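/- **Setting.** Let $n\ge 2$, $T>0$, and let $\mathbb T=\mathbb R^n/\mathbb Z^n$ be the flat torus. Repeated indices are summed from $1$ to $n$. For a periodic distribution $g$ with Fourier coefficients $\hat g(\xi)$, $\xi\in\mathbb Z^n$, put $\varrho(\xi)=2\pi(1+|\xi|^2)^{1/2}$ and, for $s\in\mathbb R$, $$\|g\|_{H^s_\#}^2=\sum_{\xi\in\mathbb Z^n}\varrho(\xi)^{2s}|\hat g(\xi)|^2 .$$ $H^s_\#$ is the space of the real-valued periodic distributions for which this norm is finite, $\dot H^s_\#$ is its subspace given by $\hat g(0)=0$, $\dot{\mathbf H}^s_\#=(\dot H^s_\#)^n$, and $\dot{\mathbf H}^s_{\#\sigma}$ is the subspace of the divergence-free elements of $\dot{\mathbf H}^s_\#$. The dual product is $\langle g,w\rangle_{\mathbb T}=\sum_\xi \hat g(\xi)\cdot\hat w(-\xi)$, $\mathbb P_\sigma$ is the Leray projector, and $$(K\mathbf u^0)(x,t)=\sum_{\xi}\hat{\mathbf u}^0(\xi)\,e^{-(2\pi|\xi|)^2t+2\pi i x\cdot\xi}$$ is the solution of the heat equation with initial value $\mathbf u^0$. Let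 $E_{j\beta}(\mathbf u)=\frac12(\partial_ju_\beta+\partial_\beta u_j)$, and let $\mathbb A=\{a_{kj}^{\alpha\beta}(x,t)\}$ be a real viscosity tensor with the symmetries $a_{kj}^{\alpha\beta}=a_{\alpha j}^{k\beta}=a_{k\beta}^{\alpha j}$ that satisfies the relaxed ellipticity condition with a constant $C_{\mathbb A}>0$: for a.e. $(x,t)\in\mathbb T\times(0,T)$, $$C_{\mathbb A}\,a_{kj}^{\alpha\beta}(x,t)\,\zeta_{k\alpha}\zeta_{j\beta}\ge|\zeta|^2\quad\text{for all symmetric } \zeta\in\mathbb R^{n\times n} \text{ with zero trace.}$$ Suppose that $a_{kj}^{\alpha\beta}\in L_\infty(0,T;H_\#^{\tilde\sigma+1})$ for some $\tilde\sigma>\frac n2+\left|\frac n2-2\right|$, and let $$\|\mathbb A\|_{L_\infty(0,T;H^{\tilde\sigma+1}_\#)}=\operatorname*{ess\,sup}_{t\in(0,T)}\Big(\sum_{k,j,\alpha,\beta}\|a_{kj}^{\alpha\beta}(\cdot,t)\|^2_{H^{\tilde\sigma+1}_\#}\Big)^{1/2}.$$ Put $a_{\mathbb T}(t;\mathbf u,\mathbf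 w)=\int_{\mathbb T}a_{ij}^{\alpha\beta}(x,t)E_{j\beta}(\mathbf u)E_{i\alpha}(\mathbf w)\,dx$. Let $\mathbf f\in L_2(0,T;\dot{\mathbf H}^{n/2-2}_\#)$ and $\mathbf u^0\in\dot{\mathbf H}^{n/2-1}_{\#\sigma}$, and consider the problem $$\mathbf u'-\mathfrak L\mathbf u+\nabla p+(\mathbf u\cdot\nabla)\mathbf u=\mathbf f,\qquad \operatorname{div}\mathbf u=0,\qquad \mathbf u(\cdot,0)=\mathbf u^0,\qquad(\mathfrak L\mathbf u)_k=\partial_\alpha\big(a_{kj}^{\alpha\beta}E_{j\beta}(\mathbf u)\big).\tag{NS}$$ A *weak solution* of (NS) on $(0,T_*)$ is a function $\mathbf u\in L_\infty(0,T_*;\dot{\mathbf H}^0_{\#\sigma})\cap L_2(0,T_*;\dot{\mathbf H}^1_{\#\sigma})$ such that, for a.e. $t\in(0,T_*)$ and all $\mathbf w\in\dot{\mathbf H}^1_{\#\sigma}$, $$\langle\mathbf u'(\cdot,t)+\mathbb P_\sigma[(\mathbf u\cdot\nabla)\mathbf u](\cdot,t),\mathbf w\rangle_{\mathbb T}+a_{\mathbb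 T}(t;\mathbf u(\cdot,t),\mathbf w)=\langle\mathbf f(\cdot,t),\mathbf w\rangle_{\mathbb T},$$ where $\mathbf u'$ is the time derivative in the sense of distributions, and $\langle\mathbf u(\cdot,0),\mathbf w\rangle_{\mathbb T}=\langle\mathbf u^0,\mathbf w\rangle_{\mathbb T}$ for all $\mathbf w\in\dot{\mathbf H}^0_{\#\sigma}$. Here, and in all statements about individual times, $\mathbf u$ denotes its representative with values in $\dot{\mathbf H}^0_{\#\sigma}$ that is weakly continuous in time on $[0,T_*]$. A weak solution in $L_2(0,T_*;\dot{\mathbf H}^{n/2}_{\#\sigma})$ is called a *Serrin-type solution*. An *associated pressure* is a $p$ such that, for a.e. $t\in(0,T_*)$ and all smooth periodic vector fields $\mathbf w$, $$\langle\mathbf u'+(\mathbf u\cdot\nabla)\mathbf u+\nabla p,\mathbf w\rangle_{\mathbb T}+a_{\mathbb T}(t;\mathbf u,\mathbf w)=\langle\mathbf f,\mathbf w\rangle_{\mathbb T}.$$ **Theorem.** There are constants $A_1\ge0$, $A_2\ge0$ and $A_3>0$, independent of $\mathbf f$ and $\mathbf u^0$ and depending only on $n$, $T$, $\tilde\sigma$,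 $C_{\mathbb A}$ and an upper bound for $\|\mathbb A\|_{L_\infty(0,T;H^{\tilde\sigma+1}_\#)}$, such that the following holds. If $T_*\in(0,T]$ and $$\int_0^{T_*}\|\mathbf f(\cdot,t)\|^2_{\mathbf H_\#^{n/2-2}}dt+\big(A_1\|\mathbf u^0\|^2_{\mathbf H_\#^{n/2-1}}+A_2\big)\int_0^{T_*}\|(K\mathbf u^0)(\cdot,t)\|^2_{\mathbf H_\#^{n/2}}dt<A_3,$$ then: (i) there is a Serrin-type solution $\mathbf u$ of (NS) on $(0,T_*)$ that belongs to $L_\infty(0,T_*;\dot{\mathbf H}_{\#\sigma}^{n/2-1})\cap L_2(0,T_*;\dot{\mathbf H}_{\#\sigma}^{n/2})$; (ii) $\mathbf u'\in L_2(0,T_*;\dot{\mathbf H}_{\#\sigma}^{n/2-2})$, $\mathbf u\in\mathcal C^0([0,T_*];\dot{\mathbf H}_{\#\sigma}^{n/2-1})$, $\lim_{t\to0}\|\mathbf u(\cdot,t)-\mathbf u^0\|_{\mathbf H_\#^{n/2-1}}=0$, and there is an associated pressure $p\in L_2(0,T_*;\dot H_\#^{n/2-1})$, which is, for a.e. $t$,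 the only associated pressure with zero mean; (iii) for all $0\le t_0\le t\le T_*$, $$\tfrac12\|\mathbf u(\cdot,t)\|^2_{\mathbf L_{2\#}}+\int_{t_0}^ta_{\mathbb T}(\tau;\mathbf u,\mathbf u)\,d\tau=\tfrac12\|\mathbf u(\cdot,t_0)\|^2_{\mathbf L_{2\#}}+\int_{t_0}^t\langle\mathbf f(\cdot,\tau),\mathbf u(\cdot,\tau)\rangle_{\mathbb T}\,d\tau,$$ and for $t_0=0$ the same holds with $\mathbf u(\cdot,0)$ replaced by $\mathbf u^0$; (iv) if $\mathbf v$ is a weak solution of (NS) on $(0,T_*)$ that satisfies the energy inequality $$\tfrac12\|\mathbf v(\cdot,t)\|^2_{\mathbf L_{2\#}}+\int_0^ta_{\mathbb T}(\tau;\mathbf v,\mathbf v)\,d\tau\le\tfrac12\|\mathbf u^0\|^2_{\mathbf L_{2\#}}+\int_0^t\langle\mathbf f(\cdot,\tau),\mathbf v(\cdot,\tau)\rangle_{\mathbb T}\,d\tau\quad\text{for all } t\in[0,T_*],$$ then $\mathbf v=\mathbf u$ on $[0,T_*]$. Constant coefficients $a_{kj}^{\alpha\beta}$ are a special case. -/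

import Mathlib

open MeasureTheory Set Filter Topology
open scoped ComplexConjugate ContDiff

namespace PeriodicNS

noncomputable section

/-! ### Periodic distributions and Sobolev spaces

A periodic distribution `g` on the flat torus `𝕋 = ℝⁿ / ℤⁿ` is given by its Fourier series
`∑ ξ, ĝ(ξ) exp (2 π i x · ξ)`, that is, by the family `ĝ` of its Fourier coefficients. The families
that satisfy `∑ ξ, ϱ(ξ) ^ (2 s) |ĝ(ξ)| ^ 2 < ∞` are exactly the coefficient families of the
elements of the Sobolev space of order `s`. -/

/-- The flat torus `ℝⁿ / ℤⁿ`. -/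
abbrev Torus (n : ℕ) : Type := UnitAddTorus (Fin n)

/-- The normalised Haar (Lebesgue) measure on the torus. -/
abbrev torusMeasure (n : ℕ) : Measure (Torus n) :=
  Measure.pi fun _ => (AddCircle.haarAddCircle : Measure UnitAddCircle)

/-- A scalar periodic distribution, `ξ ↦ ĝ(ξ)`. -/
abbrev PDistr (n : ℕ) : Type := (Fin n → ℤ) → ℂ

/-- A periodic distribution with values in `n`-vectors: component `i`, frequency `ξ`. -/
abbrev VDistr (n : ℕ) : Type := Fin n → PDistr n

variable {n : ℕ}

/-- The Euclidean norm `|ξ|` of a frequency. -/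
def freqNorm (ξ : Fin n → ℤ) : ℝ := √(∑ j, (ξ j : ℝ) ^ 2)

/-- The weight `ϱ(ξ) = 2 π (1 + |ξ|²) ^ (1/2)`. -/
def rho (ξ : Fin n → ℤ) : ℝ := 2 * Real.pi * √(1 + freqNorm ξ ^ 2)

/-- The square of the norm of `g` in `H^s`. -/
def normSq (s : ℝ) (g : PDistr n) : ℝ := ∑' ξ, rho ξ ^ (2 * s) * ‖g ξ‖ ^ 2

/-- The square of the norm of a vector distribution in `(H^s)ⁿ`. For `s = 0` this is the square
of the norm in `(L₂)ⁿ`. -/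
def vNormSq (s : ℝ) (v : VDistr n) : ℝ := ∑ i, normSq s (v i)

/-- The space `H^s` of real-valued periodic distributions. -/
def Hs (n : ℕ) (s : ℝ) : Set (PDistr n) :=
  {g | (∀ ξ, g (-ξ) = conj (g ξ)) ∧ Summable fun ξ => rho ξ ^ (2 * s) * ‖g ξ‖ ^ 2}

/-- The subspace of `H^s` of the distributions with zero mean. -/
def HsDot (n : ℕ) (s : ℝ) : Set (PDistr n) := {g | g ∈ Hs n s ∧ g 0 = 0}

/-- The vector space `(H^s)ⁿ`. -/
def VHs (n : ℕ) (s : ℝ) : Set (VDistr n) := {v | ∀ i, v i ∈ Hs n s}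

/-- The vector distributions in `(H^s)ⁿ` with zero mean. -/
def VHsDot (n : ℕ) (s : ℝ) : Set (VDistr n) := {v | ∀ i, v i ∈ HsDot n s}

/-- The partial derivative `∂_j g`. -/
def pderiv (j : Fin n) (g : PDistr n) : PDistr n :=
  fun ξ => 2 * Real.pi * Complex.I * (ξ j : ℂ) * g ξ

/-- The gradient. -/
def grad (g : PDistr n) : VDistr n := fun j => pderiv j g

/-- The divergence. -/
def divergence (v : VDistr n) : PDistr n := ∑ j, pderiv j (v j)

/-- The divergence-free vector distributions in `(H^s)ⁿ` with zero mean. -/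
def VHsDotSigma (n : ℕ) (s : ℝ) : Set (VDistr n) := {v | v ∈ VHsDot n s ∧ divergence v = 0}

/-- The smooth vector fields on the torus: the intersection of all `(H^s)ⁿ`. -/
def VSmooth (n : ℕ) : Set (VDistr n) := {w | ∀ s : ℝ, w ∈ VHs n s}

/-- The dual product `⟨g, w⟩ = ∑ ξ, ĝ(ξ) · ŵ(-ξ)`. -/
def pairing (g w : VDistr n) : ℂ := ∑' ξ, ∑ i, g i ξ * w i (-ξ)

/-- The dual product of `g` and `w` is well defined (the series converges) and equals `c`. -/
def HasPairing (g w : VDistr n) (c : ℂ) : Prop :=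
  HasSum (fun ξ : Fin n → ℤ => ∑ i, g i ξ * w i (-ξ)) c

/-! ### Functions on the torus -/

/-- The Fourier coefficients of an integrable real function on the torus. -/
def coeff (h : Torus n → ℝ) : PDistr n := UnitAddTorus.mFourierCoeff fun x => (h x : ℂ)

/-- The function in `L₂(𝕋)` that a real-valued distribution `g` in `H^0 = L₂(𝕋)` is, i.e. the
function with the Fourier coefficients `ĝ` (and `0` when `g` is not in `L₂`). -/
def toFn (g : PDistr n) : Torus n → ℝ :=
  open scoped Classical in
  if h : Memℓp g 2 then
    fun x => ((UnitAddTorus.mFourierBasis (d := Fin n)).repr.symm ⟨g, h⟩ x).re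
  else 0

/-- The advection term `(u · ∇) u`, with components `∑ j, u_j ∂_j u_i`; for `u` in `(H^1)ⁿ` these
are products of functions in `L₂`, hence integrable functions. -/
def advection (u : VDistr n) : VDistr n :=
  fun i => coeff fun x => ∑ j, toFn (u j) x * toFn (pderiv j (u i)) x

/-- The Leray projector onto the divergence-free distributions with zero mean: at every frequency
`ξ ≠ 0` the orthogonal projection onto the orthogonal complement of `ξ`. -/
def leray (F : VDistr n) : VDistr n :=
  fun i ξ => if ξ = 0 then 0 else F i ξ - (ξ i : ℂ) * (∑ j, (ξ j : ℂ) * F j ξ) / (freqNorm ξ : ℂ) ^ 2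

/-- The strain `E_{jβ}(u) = (∂_j u_β + ∂_β u_j) / 2`. -/
def strain (u : VDistr n) (j β : Fin n) : PDistr n :=
  (1 / 2 : ℂ) • (pderiv j (u β) + pderiv β (u j))

/-- The heat semigroup, `(K u⁰)(·, t)`. -/
def heat (u0 : VDistr n) (t : ℝ) : VDistr n :=
  fun i ξ => u0 i ξ * (Real.exp (-(2 * Real.pi * freqNorm ξ) ^ 2 * t) : ℂ)

/-! ### The viscosity tensor -/

/-- A tensor of viscosity coefficients; `a k j α β t x` is `a_{kj}^{αβ}(x, t)`. -/
abbrev Tensor (n : ℕ) : Type := Fin n → Fin n → Fin n → Fin n → ℝ → Torus n → ℝ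

/-- The bilinear form `a_𝕋(t; u, w) = ⟨a_{ij}^{αβ}(·, t) E_{jβ}(u), E_{iα}(w)⟩`. -/
def aForm (a : Tensor n) (t : ℝ) (u w : VDistr n) : ℝ :=
  ∑ i, ∑ j, ∑ α, ∑ β,
    ∫ x, a i j α β t x * toFn (strain u j β) x * toFn (strain w i α) x ∂(torusMeasure n)

/-- The measure on `𝕋 × (0, T)` that gives a meaning to "for a.e. `x, t`". -/
def spaceTime (n : ℕ) (T : ℝ) : Measure (ℝ × Torus n) :=
  (volume.restrict (Ioo 0 T)).prod (torusMeasure n)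

/-- All `a_{kj}^{αβ}` belong to `L_∞(0, T; H^s)`, and the norm of the tensor in this space is at
most `M`, where for fixed `t` the tensor is measured by the Frobenius norm of the norms in `H^s`
of its components. -/
structure TensorMemLinfty (T s M : ℝ) (a : Tensor n) : Prop where
  measurable : ∀ k j α β,
    AEStronglyMeasurable (fun z : ℝ × Torus n => a k j α β z.1 z.2) (spaceTime n T)
  mem : ∀ᵐ t ∂(volume.restrict (Ioo 0 T)), ∀ k j α β,
    Integrable (a k j α β t) (torusMeasure n) ∧ coeff (a k j α β t) ∈ Hs n s
  bound : ∀ᵐ t ∂(volume.restrict (Ioo 0 T)),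
    √(∑ k, ∑ j, ∑ α, ∑ β, normSq s (coeff (a k j α β t))) ≤ M

/-- The symmetry conditions `a_{kj}^{αβ} = a_{αj}^{kβ} = a_{kβ}^{αj}`. -/
def TensorSymmetric (T : ℝ) (a : Tensor n) : Prop :=
  ∀ᵐ z ∂(spaceTime n T), ∀ k j α β,
    a k j α β z.1 z.2 = a α j k β z.1 z.2 ∧ a k j α β z.1 z.2 = a k β α j z.1 z.2

/-- The relaxed ellipticity condition with the constant `C`: ellipticity on the symmetric matrices
with zero trace. -/
def RelaxedElliptic (T C : ℝ) (a : Tensor n) : Prop :=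
  ∀ᵐ z ∂(spaceTime n T), ∀ ζ : Matrix (Fin n) (Fin n) ℝ, ζ.transpose = ζ → ζ.trace = 0 →
    ∑ k, ∑ α, ζ k α ^ 2 ≤ C * ∑ k, ∑ j, ∑ α, ∑ β, a k j α β z.1 z.2 * ζ k α * ζ j β

/-! ### Spaces of functions of time -/

/-- Measurability in time of a function with values in distributions. As the spaces `H^s` are
separable Hilbert spaces in which the exponentials are total, this is strong measurability. -/
def TimeMeasurable (T : ℝ) (h : ℝ → VDistr n) : Prop :=
  ∀ i ξ, AEStronglyMeasurable (fun t => h t i ξ) (volume.restrict (Ioo 0 T))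

/-- The space `L₂(0, T; X)` for a subspace `X` of `(H^s)ⁿ` with the norm of `(H^s)ⁿ`. -/
def L2V (T s : ℝ) (X : Set (VDistr n)) : Set (ℝ → VDistr n) :=
  {h | TimeMeasurable T h ∧ (∀ᵐ t ∂(volume.restrict (Ioo 0 T)), h t ∈ X) ∧
    IntegrableOn (fun t => vNormSq s (h t)) (Ioo 0 T)}

/-- The space `L_∞(0, T; X)` for a subspace `X` of `(H^s)ⁿ` with the norm of `(H^s)ⁿ`. -/
def LinftyV (T s : ℝ) (X : Set (VDistr n)) : Set (ℝ → VDistr n) :=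
  {h | TimeMeasurable T h ∧ (∀ᵐ t ∂(volume.restrict (Ioo 0 T)), h t ∈ X) ∧
    ∃ B : ℝ, ∀ᵐ t ∂(volume.restrict (Ioo 0 T)), vNormSq s (h t) ≤ B}

/-- The space `C⁰([0, T]; X)` for a subspace `X` of `(H^s)ⁿ` with the norm of `(H^s)ⁿ`. -/
def C0V (T s : ℝ) (X : Set (VDistr n)) : Set (ℝ → VDistr n) :=
  {h | (∀ t ∈ Icc 0 T, h t ∈ X) ∧
    ∀ t₀ ∈ Icc 0 T, Tendsto (fun t => vNormSq s (h t - h t₀)) (𝓝[Icc 0 T] t₀) (𝓝 0)}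

/-- The space `L₂(0, T; Ḣ^s)` of scalar distributions with zero mean. -/
def L2Dot (n : ℕ) (T s : ℝ) : Set (ℝ → PDistr n) :=
  {p | (∀ ξ, AEStronglyMeasurable (fun t => p t ξ) (volume.restrict (Ioo 0 T))) ∧
    (∀ᵐ t ∂(volume.restrict (Ioo 0 T)), p t ∈ HsDot n s) ∧
    IntegrableOn (fun t => normSq s (p t)) (Ioo 0 T)}

/-- `du` is the time derivative of `u` on `(0, T)` in the sense of distributions. -/
def IsTimeDeriv (T : ℝ) (u du : ℝ → VDistr n) : Prop :=
  ∀ i ξ, LocallyIntegrableOn (fun t => du t i ξ) (Ioo 0 T) ∧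
    ∀ ψ : ℝ → ℝ, ContDiff ℝ ∞ ψ → HasCompactSupport ψ → tsupport ψ ⊆ Ioo 0 T →
      ∫ t in Ioo 0 T, ((deriv ψ t : ℝ) : ℂ) * u t i ξ = -∫ t in Ioo 0 T, (ψ t : ℂ) * du t i ξ

/-! ### Solutions of the Navier-Stokes problem -/

/-- Weak solutions on `(0, T)` of the anisotropic Navier-Stokes initial value problem
`u' - 𝔏 u + ∇ p + (u · ∇) u = f`, `div u = 0`, `u(0) = u⁰`. A weak solution is almost everywhere
equal to a unique function that is weakly continuous on `[0, T]`; here `u` is that function, which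
is the one that the initial condition refers to. -/
structure IsWeakSolution (a : Tensor n) (f : ℝ → VDistr n) (u0 : VDistr n) (T : ℝ)
    (u : ℝ → VDistr n) : Prop where
  mem_Linfty : u ∈ LinftyV T 0 (VHsDotSigma n 0)
  mem_L2 : u ∈ L2V T 1 (VHsDotSigma n 1)
  mem : ∀ t ∈ Icc 0 T, u t ∈ VHsDotSigma n 0
  weak_continuous : ∀ w ∈ VHs n 0, ContinuousOn (fun t => pairing (u t) w) (Icc 0 T)
  equation : ∃ du, IsTimeDeriv T u du ∧
    ∀ᵐ t ∂(volume.restrict (Ioo 0 T)), ∀ w ∈ VHsDotSigma n 1,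
      HasPairing (du t + leray (advection (u t))) w
        (pairing (f t) w - (aForm a t (u t) w : ℂ))
  initial : ∀ w ∈ VHsDotSigma n 0, pairing (u 0) w = pairing u0 w

/-- Serrin-type solutions: weak solutions in `L₂(0, T; H^{n/2})`. -/
def IsSerrinTypeSolution (a : Tensor n) (f : ℝ → VDistr n) (u0 : VDistr n) (T : ℝ)
    (u : ℝ → VDistr n) : Prop :=
  IsWeakSolution a f u0 T u ∧ u ∈ L2V T ((n : ℝ) / 2) (VHsDotSigma n ((n : ℝ) / 2))

/-- `p` is a pressure associated with `u`: the momentum equation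
`u' - 𝔏 u + ∇ p + (u · ∇) u = f` holds in the sense of distributions. -/
def IsAssociatedPressure (a : Tensor n) (f : ℝ → VDistr n) (T : ℝ) (u : ℝ → VDistr n)
    (p : ℝ → PDistr n) : Prop :=
  ∃ du, IsTimeDeriv T u du ∧
    ∀ᵐ t ∂(volume.restrict (Ioo 0 T)), ∀ w ∈ VSmooth n,
      HasPairing (du t + advection (u t) + grad (p t)) w
        (pairing (f t) w - (aForm a t (u t) w : ℂ))

/-- The energy equality on `[t₀, t]`. -/
def EnergyEquality (a : Tensor n) (f u : ℝ → VDistr n) (t₀ t : ℝ) : Prop :=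
  1 / 2 * vNormSq 0 (u t) + ∫ τ in t₀..t, aForm a τ (u τ) (u τ) =
    1 / 2 * vNormSq 0 (u t₀) + ∫ τ in t₀..t, (pairing (f τ) (u τ)).re

/-- The standard energy equality at the time `t`, with the initial value `u⁰`. -/
def StandardEnergyEquality (a : Tensor n) (f : ℝ → VDistr n) (u0 : VDistr n)
    (u : ℝ → VDistr n) (t : ℝ) : Prop :=
  1 / 2 * vNormSq 0 (u t) + ∫ τ in (0 : ℝ)..t, aForm a τ (u τ) (u τ) =
    1 / 2 * vNormSq 0 u0 + ∫ τ in (0 : ℝ)..t, (pairing (f τ) (u τ)).re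

/-- The standard energy inequality at the time `t`, with the initial value `u⁰`. -/
def StandardEnergyInequality (a : Tensor n) (f : ℝ → VDistr n) (u0 : VDistr n)
    (u : ℝ → VDistr n) (t : ℝ) : Prop :=
  1 / 2 * vNormSq 0 (u t) + ∫ τ in (0 : ℝ)..t, aForm a τ (u τ) (u τ) ≤
    1 / 2 * vNormSq 0 u0 + ∫ τ in (0 : ℝ)..t, (pairing (f τ) (u τ)).re

end

end PeriodicNS

/-! Put s = n/2 - 1 and let Λ be the multiplier ϱ. A solution in the critical class has u in L₂(0,
T; H^{s+1}) and u' in L₂(0, T; H^{s-1}), and the whole argument is carried out on Fourier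
coefficients in this scale.

Existence. The unknown is a divergence-free g in L₂(0, T; H^{s-1}); the velocity is u = K u⁰ + w,
where w' + m Λ² w = g and w(0) = 0. The equations say that the residual u' + ℙ(-𝔏 u + (u·∇)u - f)
vanishes, and g is obtained as a fixed point of g ↦ g - τ · residual. The linear part L g = w' +
ℙ(-𝔏)w is strongly monotone in L₂(0, T; H^{s-1}) with the time weight exp(-2Bt): pairing L g with g
= w' + m Λ² w gives the square of w', a mixed term which is absorbed by taking m large, the time
derivative of the H^s norm of w, and Gårding's inequality for -𝔏 (`exists_linear_coercive`). The
weight compensates the lower-order term of Gårding's inequality (`weighted_energy_nonneg`). A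
bounded strongly monotone L makes 1 - τ L a contraction for suitable τ (`den_sub_linOp_le`). The
quadratic term is bounded in L₄(0, T; H^{s+1/2}) with a constant that does not depend on the length
of the interval (`exists_bop_L4`), so on a small ball it is a small perturbation; smallness of the
data makes the iteration start close enough to its limit (`exists_small_solution`).

The analytic inputs are the product estimate H^α · H^β ⊂ H^{-γ} for α + β + γ = n/2 with all
exponents below n/2 (`trilinear_le`), and coercivity on divergence-free fields. The latter is first
proved in H¹: the strain of a divergence-free field is symmetric and trace-free, so relaxed
ellipticity applies pointwise, and Korn's identity holds frequency by frequency (`aForm_coercive`).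
It is carried to order s by the commutator of ϱ^s with the coefficients, which gains one order
because the coefficients lie in a weighted ℓ¹ space (`lop_commutator`, `lop_garding`).

Regularity and energy. Each Fourier coefficient of u is a primitive of that of u'; integrating
products and summing over the frequencies gives continuity in H^s and the evolution of scalar
products. The energy equality follows because the convection does no work, and the pressure is the
potential of the gradient part of the forces.

Uniqueness. A weak solution v is compared with u by expanding the square of v - u: the energy
inequality for v, the energy equality for u and the evolution of the scalar product of v and u leave
only the convection of v - u by itself tested with u. The dissipation absorbs it up to a multiple of
the squared H^{n/2} norm of u, which is integrable in time, and Gronwall's lemma concludes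
(`IsRegular.unique`). -/

namespace PeriodicNS

open scoped ENNReal

variable {n : ℕ}

section

/-! ### The weights -/

lemma freqNorm_eq (ξ : Fin n → ℤ) :
    freqNorm ξ = ‖(WithLp.toLp 2 (fun j => (ξ j : ℝ)) : EuclideanSpace ℝ (Fin n))‖ := by
  simp [freqNorm, EuclideanSpace.norm_eq]

lemma freqNorm_nonneg (ξ : Fin n → ℤ) : 0 ≤ freqNorm ξ := Real.sqrt_nonneg _

lemma freqNorm_add_le (ξ η : Fin n → ℤ) : freqNorm (ξ + η) ≤ freqNorm ξ + freqNorm η := by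
  simp only [freqNorm_eq]
  refine le_trans (le_of_eq ?_) (norm_add_le _ _)
  congr 1
  ext j
  simp

lemma freqNorm_neg (ξ : Fin n → ℤ) : freqNorm (-ξ) = freqNorm ξ := by simp [freqNorm]

lemma freqNorm_sq (ξ : Fin n → ℤ) : freqNorm ξ ^ 2 = ∑ j, (ξ j : ℝ) ^ 2 :=
  Real.sq_sqrt (Finset.sum_nonneg fun _ _ => sq_nonneg _)

lemma abs_le_freqNorm (ξ : Fin n → ℤ) (j : Fin n) : |(ξ j : ℝ)| ≤ freqNorm ξ := by
  rw [← Real.sqrt_sq_eq_abs]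
  exact Real.sqrt_le_sqrt
    (Finset.single_le_sum (f := fun j => (ξ j : ℝ) ^ 2) (fun _ _ => sq_nonneg _)
      (Finset.mem_univ j))

lemma one_le_freqNorm {ξ : Fin n → ℤ} (h : ξ ≠ 0) : 1 ≤ freqNorm ξ := by
  obtain ⟨j, hj⟩ := Function.ne_iff.mp h
  refine le_trans ?_ (abs_le_freqNorm ξ j)
  exact_mod_cast Int.one_le_abs hj

lemma rho_neg (ξ : Fin n → ℤ) : rho (-ξ) = rho ξ := by simp [rho, freqNorm_neg]

lemma rho_sq (ξ : Fin n → ℤ) : rho ξ ^ 2 = (2 * Real.pi) ^ 2 * (1 + freqNorm ξ ^ 2) := by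
  rw [rho, mul_pow, Real.sq_sqrt (by positivity)]

lemma four_le_rho (ξ : Fin n → ℤ) : 4 ≤ rho ξ := by
  have h : 1 ≤ √(1 + freqNorm ξ ^ 2) := by
    rw [Real.one_le_sqrt]
    nlinarith [sq_nonneg (freqNorm ξ)]
  rw [rho]
  nlinarith [Real.two_le_pi]

lemma rho_pos (ξ : Fin n → ℤ) : 0 < rho ξ := by linarith [four_le_rho ξ]

lemma one_le_rho (ξ : Fin n → ℤ) : 1 ≤ rho ξ := by linarith [four_le_rho ξ]

lemma two_pi_freqNorm_le (ξ : Fin n → ℤ) : 2 * Real.pi * freqNorm ξ ≤ rho ξ := by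
  refine mul_le_mul_of_nonneg_left ?_ (by positivity)
  exact Real.le_sqrt_of_sq_le (by linarith)

lemma two_pi_abs_le (ξ : Fin n → ℤ) (j : Fin n) : 2 * Real.pi * |(ξ j : ℝ)| ≤ rho ξ :=
  le_trans (mul_le_mul_of_nonneg_left (abs_le_freqNorm ξ j) (by positivity)) (two_pi_freqNorm_le ξ)

/-- The function x ↦ √(1 + x²) is 1-Lipschitz. Both the subadditivity of ϱ and the difference bound
`abs_rho_sub_le`, from which commutators gain an order, come from here. -/
lemma rho_sub_le_two_pi (ξ η : Fin n → ℤ) : rho (ξ + η) - rho ξ ≤ 2 * Real.pi * freqNorm η := by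
  have h1 := freqNorm_add_le ξ η
  have h0 := freqNorm_nonneg ξ
  have h2 := freqNorm_nonneg η
  have h3 := freqNorm_nonneg (ξ + η)
  have h : √(1 + freqNorm (ξ + η) ^ 2) ≤ √(1 + freqNorm ξ ^ 2) + freqNorm η := by
    have h4 : freqNorm ξ ≤ √(1 + freqNorm ξ ^ 2) := Real.le_sqrt_of_sq_le (by linarith)
    have h5 := Real.sq_sqrt (show 0 ≤ 1 + freqNorm ξ ^ 2 by positivity)
    refine Real.sqrt_le_iff.mpr ⟨by positivity, ?_⟩
    nlinarith
  simp only [rho]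
  nlinarith [Real.two_le_pi]

lemma rho_add_le (ξ η : Fin n → ℤ) : rho (ξ + η) ≤ rho ξ + rho η := by
  linarith [rho_sub_le_two_pi ξ η, two_pi_freqNorm_le η]

/-- Two numbers that are at least 2 have a sum below their product; the factor 2π in ϱ provides this
without a constant. -/
lemma rho_add_le_mul (ξ η : Fin n → ℤ) : rho (ξ + η) ≤ rho ξ * rho η := by
  nlinarith [rho_add_le ξ η, four_le_rho ξ, four_le_rho η]

lemma abs_rho_sub_le (ξ η : Fin n → ℤ) : |rho ξ - rho η| ≤ rho (ξ - η) := by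
  have h1 := rho_sub_le_two_pi η (ξ - η)
  have h2 := rho_sub_le_two_pi ξ (η - ξ)
  have h3 := two_pi_freqNorm_le (ξ - η)
  have h4 := freqNorm_neg (ξ - η)
  rw [neg_sub] at h4
  rw [add_sub_cancel] at h1 h2
  rw [h4] at h2
  rw [abs_le]
  constructor <;> linarith

/-- A nonzero lattice point has |ξ| ≥ 1, so 1 + |ξ|² ≤ 2|ξ|². For fields with zero mean the
homogeneous and inhomogeneous weights are therefore equivalent. -/
lemma rho_sq_le {ξ : Fin n → ℤ} (h : ξ ≠ 0) : rho ξ ^ 2 ≤ 2 * (2 * Real.pi * freqNorm ξ) ^ 2 := by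
  have h1 := one_le_freqNorm h
  rw [rho_sq, mul_pow]
  nlinarith [sq_nonneg (2 * Real.pi), mul_nonneg (sq_nonneg (2 * Real.pi)) (show (0:ℝ) ≤ freqNorm ξ ^ 2 - 1 by nlinarith)]

/-- Peetre's inequality. -/
lemma rho_rpow_le (r : ℝ) (ξ η : Fin n → ℤ) :
    rho ξ ^ r ≤ rho (ξ - η) ^ |r| * rho η ^ r := by
  have p1 := rho_pos ξ
  have p2 := rho_pos η
  have p3 := rho_pos (ξ - η)
  rcases le_total 0 r with h | h
  · rw [abs_of_nonneg h, ← Real.mul_rpow p3.le p2.le]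
    refine Real.rpow_le_rpow p1.le ?_ h
    simpa using rho_add_le_mul (ξ - η) η
  · rw [abs_of_nonpos h]
    -- For a negative exponent the inequality for -r is used with ξ and η exchanged, and then
    -- inverted.
    have h1 : rho η ^ (-r) ≤ rho (ξ - η) ^ (-r) * rho ξ ^ (-r) := by
      rw [← Real.mul_rpow p3.le p1.le]
      refine Real.rpow_le_rpow p2.le ?_ (by linarith)
      have := rho_add_le_mul (-(ξ - η)) ξ
      rw [rho_neg] at this
      simpa using this
    rw [Real.rpow_neg p2.le, Real.rpow_neg p1.le] at h1
    have q1 := Real.rpow_pos_of_pos p1 r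
    have q2 := Real.rpow_pos_of_pos p2 r
    rw [← div_eq_mul_inv, inv_eq_one_div, div_le_div_iff₀ q2 q1] at h1
    linarith

lemma one_add_abs_le_rho (ξ : Fin n → ℤ) (j : Fin n) : 1 + |(ξ j : ℝ)| ≤ rho ξ := by
  have h1 := abs_le_freqNorm ξ j
  have h2 := four_le_rho ξ
  have h3 := two_pi_freqNorm_le ξ
  nlinarith [Real.two_le_pi, freqNorm_nonneg ξ]

/-- Mean value theorem. The power s - 1 at the intermediate point is at most the larger of its
values at the end points; their sum covers both signs of s - 1. -/
lemma abs_rpow_sub_rpow_le (s : ℝ) {x y : ℝ} (hx : 0 < x) (hy : 0 < y) :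
    |x ^ s - y ^ s| ≤ |s| * |x - y| * (x ^ (s - 1) + y ^ (s - 1)) := by
  wlog h : x < y generalizing x y
  · rcases eq_or_lt_of_le (not_lt.mp h) with h | h
    · simp [h]
    · rw [abs_sub_comm, abs_sub_comm x y, add_comm]
      exact this hy hx h
  obtain ⟨c, hc, hd⟩ := exists_hasDerivAt_eq_slope (fun z : ℝ => z ^ s) (fun z => s * z ^ (s - 1)) h
    (fun z hz => (Real.continuousAt_rpow_const _ _
      (Or.inl (by linarith [hz.1]))).continuousWithinAt)
    (fun z hz => Real.hasDerivAt_rpow_const (Or.inl (by linarith [hz.1])))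
  have hc0 : 0 < c := hx.trans hc.1
  rw [eq_div_iff (by linarith)] at hd
  rw [abs_sub_comm, ← hd, abs_mul, abs_mul, abs_sub_comm y x, mul_right_comm]
  refine mul_le_mul_of_nonneg_left ?_ (by positivity)
  rw [abs_of_pos (Real.rpow_pos_of_pos hc0 _)]
  have q1 := Real.rpow_pos_of_pos hx (s - 1)
  have q2 := Real.rpow_pos_of_pos hy (s - 1)
  rcases le_total 0 (s - 1) with h1 | h1
  · linarith [Real.rpow_le_rpow hc0.le hc.2.le h1]
  · linarith [Real.rpow_le_rpow_of_nonpos hx hc.1.le h1]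

/-- The commutator of a weight with a multiplication operator. -/
lemma abs_rho_rpow_sub_le (s : ℝ) (ξ η : Fin n → ℤ) :
    |rho ξ ^ s - rho η ^ s| ≤ 2 * |s| * (rho (ξ - η) ^ (1 + |s - 1|) * rho η ^ (s - 1)) := by
  have p2 := Real.rpow_pos_of_pos (rho_pos η) (s - 1)
  have p3 := rho_pos (ξ - η)
  have p4 := Real.one_le_rpow (one_le_rho (ξ - η)) (abs_nonneg (s - 1))
  have h1 := abs_rpow_sub_rpow_le s (rho_pos ξ) (rho_pos η)
  have h2 := rho_rpow_le (s - 1) ξ η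
  have h3 := abs_rho_sub_le ξ η
  rw [Real.rpow_add p3, Real.rpow_one]
  -- Peetre's inequality moves the power at ξ to η; the power already at η is absorbed because
  -- ϱ(ξ-η)^|s-1| ≥ 1, whence the factor 2.
  calc _ ≤ _ := h1
    _ ≤ |s| * rho (ξ - η) * (2 * (rho (ξ - η) ^ |s - 1| * rho η ^ (s - 1))) := by
        have p1 := Real.rpow_pos_of_pos (rho_pos ξ) (s - 1)
        gcongr
        nlinarith
    _ = _ := by ring

/-! ### Lattice sums -/

/-- A discrete comparison with the integral of x^{-δ}: Bernoulli's inequality with the exponent 1 -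
δ bounds each term by the increment of m^{1-δ}/(1-δ). -/
lemma sum_rpow_le {δ : ℝ} (h0 : 0 ≤ δ) (h1 : δ < 1) (m : ℕ) :
    ∑ k ∈ Finset.range m, (1 + (k : ℝ)) ^ (-δ) ≤ (m : ℝ) ^ (1 - δ) / (1 - δ) := by
  have hd : 0 < 1 - δ := by linarith
  induction m with
  | zero => simp [Real.zero_rpow hd.ne']
  | succ m ih =>
    rw [Finset.sum_range_succ]
    have hm : (0 : ℝ) < m + 1 := by positivity
    have key : (m : ℝ) ^ (1 - δ) ≤ (m + 1 : ℝ) ^ (1 - δ) - (1 - δ) * (m + 1 : ℝ) ^ (-δ) := by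
      have hb := rpow_one_add_le_one_add_mul_self (s := -1 / (m + 1 : ℝ)) (p := 1 - δ)
        (by rw [le_div_iff₀ hm]; linarith [(Nat.cast_nonneg m : (0:ℝ) ≤ m)]) hd.le (by linarith)
      have e1 : (1 + -1 / (m + 1 : ℝ)) = m / (m + 1) := by field_simp; ring
      rw [e1, Real.div_rpow (by positivity) hm.le,
        div_le_iff₀ (Real.rpow_pos_of_pos hm _)] at hb
      refine hb.trans (le_of_eq ?_)
      have e2 : (m + 1 : ℝ) ^ (1 - δ) = (m + 1) * (m + 1 : ℝ) ^ (-δ) := by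
        rw [sub_eq_add_neg, Real.rpow_add hm, Real.rpow_one]
      rw [e2]
      field_simp
      ring
    push_cast
    rw [le_div_iff₀ hd] at ih ⊢
    rw [add_comm (1 : ℝ)]
    linarith

lemma sum_abs_rpow_le {δ : ℝ} (h0 : 0 ≤ δ) (h1 : δ < 1) (N : ℕ) :
    ∑ k ∈ Finset.Icc (-(N : ℤ)) N, (1 + |(k : ℝ)|) ^ (-δ) ≤
      2 * ((N + 1 : ℝ) ^ (1 - δ) / (1 - δ)) := by
  have h := sum_rpow_le h0 h1 (N + 1)
  have hs : Finset.Icc (-(N : ℤ)) N ⊆ (Finset.range (N + 1)).image (fun k : ℕ => (k : ℤ)) ∪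
      (Finset.range (N + 1)).image (fun k : ℕ => -(k : ℤ)) := by
    intro k hk
    rw [Finset.mem_Icc] at hk
    simp only [Finset.mem_union, Finset.mem_image, Finset.mem_range]
    rcases le_total 0 k with h | h
    · left; exact ⟨k.toNat, by omega, by omega⟩
    · right; exact ⟨(-k).toNat, by omega, by omega⟩
  have hn : ∀ k : ℤ, 0 ≤ (1 + |(k : ℝ)|) ^ (-δ) := fun k => by positivity
  calc _ ≤ ∑ k ∈ (Finset.range (N + 1)).image (fun k : ℕ => (k : ℤ)) ∪
        (Finset.range (N + 1)).image (fun k : ℕ => -(k : ℤ)), (1 + |(k : ℝ)|) ^ (-δ) :=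
        Finset.sum_le_sum_of_subset_of_nonneg hs fun _ _ _ => hn _
    _ ≤ _ := Finset.sum_union_inter (f := fun k : ℤ => (1 + |(k : ℝ)|) ^ (-δ)) ▸
        le_add_of_nonneg_right (Finset.sum_nonneg fun _ _ => hn _)
    _ = 2 * ∑ k ∈ Finset.range (N + 1), (1 + (k : ℝ)) ^ (-δ) := by
        rw [Finset.sum_image (by intro a _ b _ h; simpa using h),
          Finset.sum_image (by intro a _ b _ h; simpa using h)]
        simp [two_mul]
    _ ≤ _ := by push_cast at h; linarith

/-- The decay is shared equally by the n coordinates, so that lattice sums factor into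
one-dimensional ones; the comparison of γ with n becomes that of γ/n with 1. -/
lemma rho_rpow_neg_le_prod (hn : 0 < n) {γ : ℝ} (h0 : 0 ≤ γ) (ξ : Fin n → ℤ) :
    rho ξ ^ (-γ) ≤ ∏ i, (1 + |(ξ i : ℝ)|) ^ (-(γ / n)) := by
  have hn' : (n : ℝ) ≠ 0 := by positivity
  have : rho ξ ^ (-γ) = ∏ _i : Fin n, rho ξ ^ (-(γ / n)) := by
    rw [Finset.prod_const, Finset.card_univ, Fintype.card_fin, ← Real.rpow_natCast,
      ← Real.rpow_mul (rho_pos ξ).le]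
    congr 1
    field_simp
  rw [this]
  refine Finset.prod_le_prod (fun i _ => (Real.rpow_pos_of_pos (rho_pos ξ) _).le) fun i _ => ?_
  exact Real.rpow_le_rpow_of_nonpos (by positivity) (one_add_abs_le_rho ξ i)
    (neg_nonpos.mpr (by positivity))

lemma sum_rho_le_aux (hn : 0 < n) {γ : ℝ} (h0 : 0 ≤ γ) (h1 : γ < n) :
    ∃ C : ℝ, 0 < C ∧ ∀ R : ℝ, 1 ≤ R → ∀ S : Finset (Fin n → ℤ), (∀ ξ ∈ S, rho ξ ≤ R) →
      ∑ ξ ∈ S, rho ξ ^ (-γ) ≤ C * R ^ (n - γ) := by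
  have hn' : (0 : ℝ) < n := by positivity
  set δ := γ / n with hδ
  have d0 : 0 ≤ δ := by positivity
  have d1 : δ < 1 := by rw [hδ, div_lt_one hn']; exact h1
  have d2 : 0 < 1 - δ := by linarith
  have hp : (0 : ℝ) < 2 * (2 ^ (1 - δ) / (1 - δ)) := by positivity
  refine ⟨(2 * (2 ^ (1 - δ) / (1 - δ))) ^ n, by positivity, fun R hR S hS => ?_⟩
  have hR0 : 0 ≤ R := by linarith
  set N := ⌊R⌋₊
  have hsub : S ⊆ Fintype.piFinset fun _ => Finset.Icc (-(N : ℤ)) N := by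
    intro ξ hξ
    rw [Fintype.mem_piFinset]
    intro i
    have := one_add_abs_le_rho ξ i
    have h2 : |(ξ i : ℝ)| ≤ R := by linarith [hS ξ hξ]
    have h3 : (ξ i).natAbs ≤ N := by
      refine Nat.le_floor ?_
      rwa [Nat.cast_natAbs, Int.cast_abs]
    rw [Finset.mem_Icc]
    omega
  calc ∑ ξ ∈ S, rho ξ ^ (-γ) ≤ ∑ ξ ∈ S, ∏ i, (1 + |(ξ i : ℝ)|) ^ (-δ) :=
        Finset.sum_le_sum fun ξ _ => rho_rpow_neg_le_prod hn h0 ξ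
    _ ≤ ∑ ξ ∈ Fintype.piFinset fun _ => Finset.Icc (-(N : ℤ)) N,
          ∏ i, (1 + |(ξ i : ℝ)|) ^ (-δ) :=
        Finset.sum_le_sum_of_subset_of_nonneg hsub fun ξ _ _ =>
          Finset.prod_nonneg fun i _ => by positivity
    _ = (∑ k ∈ Finset.Icc (-(N : ℤ)) N, (1 + |(k : ℝ)|) ^ (-δ)) ^ n := by
        rw [← Finset.prod_univ_sum (fun _ => Finset.Icc (-(N : ℤ)) N)
          (fun _ k => (1 + |(k : ℝ)|) ^ (-δ))]
        simp
    _ ≤ (2 * (2 ^ (1 - δ) / (1 - δ)) * R ^ (1 - δ)) ^ n := by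
        refine pow_le_pow_left₀ (Finset.sum_nonneg fun k _ => by positivity) ?_ n
        refine (sum_abs_rpow_le d0 d1 N).trans ?_
        have : (N + 1 : ℝ) ^ (1 - δ) ≤ (2 * R) ^ (1 - δ) :=
          Real.rpow_le_rpow (by positivity) (by linarith [Nat.floor_le hR0]) d2.le
        rw [Real.mul_rpow (by norm_num) hR0] at this
        calc _ ≤ 2 * ((2 ^ (1 - δ) * R ^ (1 - δ)) / (1 - δ)) := by gcongr
          _ = _ := by ring
    _ = _ := by
        rw [mul_pow, ← Real.rpow_natCast (R ^ (1 - δ)), ← Real.rpow_mul hR0]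
        congr 2
        rw [hδ]
        field_simp

lemma sum_rho_le (hn : 0 < n) {γ : ℝ} (h1 : γ < n) :
    ∃ C : ℝ, 0 < C ∧ ∀ R : ℝ, 1 ≤ R → ∀ S : Finset (Fin n → ℤ), (∀ ξ ∈ S, rho ξ ≤ R) →
      ∑ ξ ∈ S, rho ξ ^ (-γ) ≤ C * R ^ (n - γ) := by
  rcases le_total 0 γ with h0 | h0
  · exact sum_rho_le_aux hn h0 h1
  -- For γ ≤ 0 the summand is at most R^{-γ}, and what remains is the number of lattice points, that
  -- is, the case γ = 0.
  · obtain ⟨C, hC, h⟩ := sum_rho_le_aux (γ := 0) hn le_rfl (by positivity)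
    refine ⟨C, hC, fun R hR S hS => ?_⟩
    calc ∑ ξ ∈ S, rho ξ ^ (-γ) ≤ ∑ ξ ∈ S, rho ξ ^ (-(0 : ℝ)) * R ^ (-γ) :=
          Finset.sum_le_sum fun ξ hξ => by
            simpa using Real.rpow_le_rpow (rho_pos ξ).le (hS ξ hξ) (by linarith)
      _ ≤ C * R ^ (n - (0 : ℝ)) * R ^ (-γ) := by
          rw [← Finset.sum_mul]
          exact mul_le_mul_of_nonneg_right (h R hR S hS) (by positivity)
      _ = C * R ^ (n - γ) := by
          rw [mul_assoc, ← Real.rpow_add (by linarith)]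
          congr 2
          ring

lemma summable_rho_rpow_neg (hn : 0 < n) {γ : ℝ} (h1 : n < γ) :
    Summable fun ξ : Fin n → ℤ => rho ξ ^ (-γ) := by
  have hn' : (0 : ℝ) < n := by positivity
  set δ := γ / n with hδ
  have d1 : 1 < δ := by rw [hδ, one_lt_div hn']; exact h1
  have hs : Summable fun k : ℤ => (1 + |(k : ℝ)|) ^ (-δ) := by
    have h2 : Summable fun k : ℕ => (1 + (k : ℝ)) ^ (-δ) := by
      have := (summable_nat_add_iff 1).mpr (Real.summable_nat_rpow.mpr (by linarith : -δ < -1))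
      refine this.congr fun k => ?_
      push_cast
      rw [add_comm]
    refine Summable.of_nat_of_neg ?_ ?_ <;> simpa using h2
  refine summable_of_sum_le (c := (∑' k : ℤ, (1 + |(k : ℝ)|) ^ (-δ)) ^ n)
    (fun ξ => (Real.rpow_pos_of_pos (rho_pos ξ) _).le) fun S => ?_
  classical
  -- The finite set is enlarged to the product of its coordinate projections, over which the sum of
  -- products factors.
  set I : Fin n → Finset ℤ := fun i => S.image fun ξ => ξ i
  calc ∑ ξ ∈ S, rho ξ ^ (-γ) ≤ ∑ ξ ∈ S, ∏ i, (1 + |(ξ i : ℝ)|) ^ (-δ) :=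
        Finset.sum_le_sum fun ξ _ => rho_rpow_neg_le_prod hn (by linarith) ξ
    _ ≤ ∑ ξ ∈ Fintype.piFinset I, ∏ i, (1 + |(ξ i : ℝ)|) ^ (-δ) := by
        refine Finset.sum_le_sum_of_subset_of_nonneg (fun ξ hξ => ?_) fun ξ _ _ =>
          Finset.prod_nonneg fun i _ => by positivity
        rw [Fintype.mem_piFinset]
        exact fun i => Finset.mem_image_of_mem _ hξ
    _ = ∏ i, ∑ k ∈ I i, (1 + |(k : ℝ)|) ^ (-δ) :=
        (Finset.prod_univ_sum I (fun _ k => (1 + |(k : ℝ)|) ^ (-δ))).symm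
    _ ≤ ∏ _i : Fin n, ∑' k : ℤ, (1 + |(k : ℝ)|) ^ (-δ) :=
        Finset.prod_le_prod (fun i _ => Finset.sum_nonneg fun k _ => by positivity) fun i _ =>
          hs.sum_le_tsum _ fun k _ => by positivity
    _ = _ := by simp

/-! ### Inequalities for sums of extended nonnegative reals -/

lemma tsum_mul_sq_le {ι : Type*} (f g : ι → ℝ≥0∞) :
    (∑' i, f i * g i) ^ 2 ≤ (∑' i, f i ^ 2) * ∑' i, g i ^ 2 := by
  rw [ENNReal.tsum_eq_iSup_sum (f := fun i => f i * g i), ENNReal.iSup_pow_of_ne_zero two_ne_zero]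
  refine iSup_le fun S => ?_
  have h := ENNReal.inner_le_Lp_mul_Lq S f g Real.HolderConjugate.two_two
  calc (∑ i ∈ S, f i * g i) ^ 2 ≤ ((∑ i ∈ S, f i ^ (2 : ℝ)) ^ (1 / 2 : ℝ) *
        (∑ i ∈ S, g i ^ (2 : ℝ)) ^ (1 / 2 : ℝ)) ^ 2 := by gcongr
    _ = (∑ i ∈ S, f i ^ 2) * ∑ i ∈ S, g i ^ 2 := by
        rw [mul_pow, ← ENNReal.rpow_natCast, ← ENNReal.rpow_natCast, ← ENNReal.rpow_mul,
          ← ENNReal.rpow_mul]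
        norm_num
    _ ≤ _ := mul_le_mul' (ENNReal.sum_le_tsum S) (ENNReal.sum_le_tsum S)

/-- Cauchy–Schwarz for the weighted counting measure k, with the splitting k f = √k · √k f. -/
lemma tsum_mul_sq_le' {ι : Type*} (k f : ι → ℝ≥0∞) :
    (∑' i, k i * f i) ^ 2 ≤ (∑' i, k i) * ∑' i, k i * f i ^ 2 := by
  have hk : ∀ i, (k i ^ (1 / 2 : ℝ)) ^ 2 = k i := fun i => by
    rw [← ENNReal.rpow_natCast, ← ENNReal.rpow_mul]; norm_num
  have := tsum_mul_sq_le (fun i => k i ^ (1 / 2 : ℝ)) fun i => k i ^ (1 / 2 : ℝ) * f i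
  simp only [mul_pow, hk] at this
  refine le_trans (le_of_eq ?_) this
  congr 2
  ext i
  rw [← mul_assoc, ← sq, hk]

/-- Young's inequality `ℓ¹ * ℓ² → ℓ²`. -/
lemma tsum_conv_sq_le {G : Type*} [AddCommGroup G] (k f : G → ℝ≥0∞) :
    ∑' ξ, (∑' η, k (ξ - η) * f η) ^ 2 ≤ (∑' ζ, k ζ) ^ 2 * ∑' η, f η ^ 2 := by
  have e : ∀ ξ, ∑' η, k (ξ - η) = ∑' ζ, k ζ := fun ξ => (Equiv.subLeft ξ).tsum_eq k
  calc _ ≤ ∑' ξ, (∑' ζ, k ζ) * ∑' η, k (ξ - η) * f η ^ 2 :=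
        ENNReal.tsum_le_tsum fun ξ => by
          have := tsum_mul_sq_le' (fun η => k (ξ - η)) f
          rwa [e] at this
    _ = (∑' ζ, k ζ) * ∑' η, (∑' ζ, k ζ) * f η ^ 2 := by
        rw [ENNReal.tsum_mul_left, ENNReal.tsum_comm]
        congr 2
        ext η
        rw [ENNReal.tsum_mul_right]
        congr 1
        exact (Equiv.subRight η).tsum_eq k
    _ = _ := by rw [ENNReal.tsum_mul_left]; ring

/-- The converse of Cauchy–Schwarz: the test sequence is c cut off to a finite set, and one factor
of the finite sum cancels. It turns a trilinear bound into a bound for the norm of a product. -/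
lemma tsum_sq_le_of_forall {ι : Type*} (c : ι → ℝ≥0∞) (K : ℝ≥0∞)
    (h : ∀ H : ι → ℝ≥0∞, (∑' i, c i * H i) ^ 2 ≤ K * ∑' i, H i ^ 2) : ∑' i, c i ^ 2 ≤ K := by
  classical
  rcases eq_or_ne K ⊤ with rfl | hK
  · exact le_top
  -- Testing with a unit coordinate shows that every c i is finite, without which the cancellation
  -- at the end would be illegitimate.
  have hc : ∀ i, c i ^ 2 ≤ K := fun i => by
    have := h (fun j => if j = i then 1 else 0)
    simpa using this
  have hc' : ∀ i, c i ≠ ⊤ := fun i hi => by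
    have := hc i
    rw [hi] at this
    simp at this
    exact hK this
  rw [ENNReal.tsum_eq_iSup_sum]
  refine iSup_le fun S => ?_
  have h1 := h (fun j => if j ∈ S then c j else 0)
  have e1 : ∑' i, c i * (if i ∈ S then c i else 0) = ∑ i ∈ S, c i ^ 2 := by
    rw [tsum_eq_sum (s := S) (by intro b hb; simp [hb])]
    exact Finset.sum_congr rfl fun i hi => by simp [hi, sq]
  have e2 : ∑' i, (if i ∈ S then c i else 0) ^ 2 = ∑ i ∈ S, c i ^ 2 := by
    rw [tsum_eq_sum (s := S) (by intro b hb; simp [hb])]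
    exact Finset.sum_congr rfl fun i hi => by simp [hi]
  rw [e1, e2, sq] at h1
  set X := ∑ i ∈ S, c i ^ 2
  have hX : X ≠ ⊤ := by
    refine ENNReal.sum_ne_top.mpr fun i _ => ENNReal.pow_ne_top (hc' i)
  rcases eq_or_ne X 0 with h0 | h0
  · rw [h0]; exact zero_le
  · exact (ENNReal.mul_le_mul_iff_left h0 hX).mp h1

/-! ### The trilinear estimate -/

/-- The weight `ϱ(ξ) ^ s` as an extended nonnegative real. -/
noncomputable def wt (s : ℝ) (ξ : Fin n → ℤ) : ℝ≥0∞ := ENNReal.ofReal (rho ξ ^ s)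

lemma wt_add (s t : ℝ) (ξ : Fin n → ℤ) : wt (s + t) ξ = wt s ξ * wt t ξ := by
  rw [wt, Real.rpow_add (rho_pos ξ), ENNReal.ofReal_mul (Real.rpow_pos_of_pos (rho_pos ξ) _).le]
  rfl

lemma wt_zero (ξ : Fin n → ℤ) : wt 0 ξ = 1 := by simp [wt]

lemma wt_neg (s : ℝ) (ξ : Fin n → ℤ) : wt s (-ξ) = wt s ξ := by simp [wt, rho_neg]

lemma wt_mul_neg (s : ℝ) (ξ : Fin n → ℤ) : wt s ξ * wt (-s) ξ = 1 := by
  rw [← wt_add, add_neg_cancel, wt_zero]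

lemma wt_sq (s : ℝ) (ξ : Fin n → ℤ) : wt s ξ ^ 2 = wt (2 * s) ξ := by
  rw [two_mul, wt_add, sq]

/-- Where η is the smallest of the three frequencies, ϱ(ξ) and ϱ(ξ+η) are comparable, so the squared
kernel is of size ϱ(ξ)^{-2α-2γ} ϱ(η)^{-2β}. As 2β < n, the sum over ϱ(η) ≤ ϱ(ξ) contributes
ϱ(ξ)^{n-2β}, and the powers cancel exactly because α + β + γ = n/2. -/
lemma kernel_sum_le (hn : 0 < n) {α β γ : ℝ} (hβ : β < (n : ℝ) / 2)
    (h : α + β + γ = (n : ℝ) / 2) :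
    ∃ C : ℝ≥0∞, C ≠ ⊤ ∧ ∀ ξ : Fin n → ℤ,
      ∑' η, (if rho η ≤ rho ξ ∧ rho η ≤ rho (ξ + η) then
        wt (-α) ξ * wt (-β) η * wt (-γ) (ξ + η) else 0) ^ 2 ≤ C := by
  obtain ⟨C, hC, hsum⟩ := sum_rho_le (n := n) hn (γ := 2 * β) (by linarith)
  refine ⟨ENNReal.ofReal (4 ^ |γ| * C), ENNReal.ofReal_ne_top, fun ξ => ?_⟩
  rw [ENNReal.tsum_eq_iSup_sum]
  refine iSup_le fun S => ?_
  have hξ := rho_pos ξ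
  set A : ℝ := 4 ^ |γ| * rho ξ ^ (-(2 * α + 2 * γ)) with hA
  have hA0 : 0 ≤ A := by positivity
  have hterm : ∀ η, (if rho η ≤ rho ξ ∧ rho η ≤ rho (ξ + η) then
        wt (-α) ξ * wt (-β) η * wt (-γ) (ξ + η) else 0) ^ 2 ≤
      ENNReal.ofReal (if rho η ≤ rho ξ then A * rho η ^ (-(2 * β)) else 0) := by
    intro η
    by_cases h1 : rho η ≤ rho ξ ∧ rho η ≤ rho (ξ + η)
    · rw [if_pos h1, if_pos h1.1, mul_pow, mul_pow, wt_sq, wt_sq, wt_sq, wt, wt, wt,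
        ← ENNReal.ofReal_mul (by have := rho_pos ξ; positivity), ← ENNReal.ofReal_mul (by
          have := rho_pos ξ; have := rho_pos η; positivity)]
      refine ENNReal.ofReal_le_ofReal ?_
      have hη := rho_pos η
      have hs := rho_pos (ξ + η)
      have h2 : rho (ξ + η) ≤ 2 * rho ξ := by linarith [rho_add_le ξ η]
      have h3 : rho ξ ≤ 2 * rho (ξ + η) := by
        have := rho_add_le (ξ + η) (-η)
        rw [rho_neg, add_neg_cancel_right] at this
        linarith
      have h4 : rho (ξ + η) ^ (2 * -γ) ≤ 4 ^ |γ| * rho ξ ^ (2 * -γ) := by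
        have e4 : (4 : ℝ) ^ |γ| = 2 ^ (2 * |γ|) := by
          rw [Real.rpow_mul (by norm_num)]; norm_num
        rcases le_total 0 γ with hg | hg
        · rw [abs_of_nonneg hg] at e4 ⊢
          have : (rho ξ / 2) ^ (2 * -γ) = 4 ^ γ * rho ξ ^ (2 * -γ) := by
            rw [Real.div_rpow hξ.le (by norm_num), e4, div_eq_mul_inv,
              ← Real.rpow_neg (by norm_num)]
            rw [mul_comm]; congr 2; ring
          rw [← this]
          exact Real.rpow_le_rpow_of_nonpos (by linarith) (by linarith) (by linarith)
        · rw [abs_of_nonpos hg] at e4 ⊢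
          rw [e4, ← Real.mul_rpow (by norm_num) hξ.le]
          exact Real.rpow_le_rpow hs.le h2 (by linarith)
      calc _ ≤ rho ξ ^ (2 * -α) * rho η ^ (2 * -β) * (4 ^ |γ| * rho ξ ^ (2 * -γ)) := by gcongr
        _ = 4 ^ |γ| * (rho ξ ^ (2 * -α) * rho ξ ^ (2 * -γ)) * rho η ^ (2 * -β) := by ring
        _ = _ := by
          rw [← Real.rpow_add hξ, hA]
          congr 3 <;> ring
    · rw [if_neg h1]; simp
  calc _ ≤ ∑ η ∈ S, ENNReal.ofReal (if rho η ≤ rho ξ then A * rho η ^ (-(2 * β)) else 0) :=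
        Finset.sum_le_sum fun η _ => hterm η
    _ = ENNReal.ofReal (∑ η ∈ S, if rho η ≤ rho ξ then A * rho η ^ (-(2 * β)) else 0) := by
        rw [ENNReal.ofReal_sum_of_nonneg]
        intro η _
        have hη := rho_pos η
        split_ifs <;> positivity
    _ ≤ _ := by
        refine ENNReal.ofReal_le_ofReal ?_
        rw [← Finset.sum_filter, ← Finset.mul_sum]
        have h5 := hsum (rho ξ) (one_le_rho ξ) (S.filter fun η => rho η ≤ rho ξ)
          (fun η hη => (Finset.mem_filter.mp hη).2)
        calc _ ≤ A * (C * rho ξ ^ (n - 2 * β)) := by gcongr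
          _ = 4 ^ |γ| * C * (rho ξ ^ (-(2 * α + 2 * γ)) * rho ξ ^ (n - 2 * β)) := by
              rw [hA]; ring
          _ = _ := by
              rw [← Real.rpow_add hξ]
              have : -(2 * α + 2 * γ) + (n - 2 * β) = 0 := by linarith
              rw [this, Real.rpow_zero, mul_one]

/-- Cauchy–Schwarz in ξ against F and then in η against K; the remaining double sum of A(η)² B(ξ+η)²
factors by translation. -/
lemma tsum_kernel_sq_le {G : Type*} [AddCommGroup G] (F A B : G → ℝ≥0∞) (K : G → G → ℝ≥0∞)
    {C : ℝ≥0∞} (hK : ∀ ξ, ∑' η, K ξ η ^ 2 ≤ C) :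
    (∑' ξ, ∑' η, F ξ * A η * B (ξ + η) * K ξ η) ^ 2 ≤
      C * ((∑' ξ, F ξ ^ 2) * (∑' ξ, A ξ ^ 2) * ∑' ξ, B ξ ^ 2) := by
  have e : ∀ ξ, ∑' η, F ξ * A η * B (ξ + η) * K ξ η =
      F ξ * ∑' η, (A η * B (ξ + η)) * K ξ η := fun ξ => by
    rw [← ENNReal.tsum_mul_left]
    congr 1; ext η; ring
  simp only [e]
  calc _ ≤ (∑' ξ, F ξ ^ 2) * ∑' ξ, (∑' η, (A η * B (ξ + η)) * K ξ η) ^ 2 := tsum_mul_sq_le _ _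
    _ ≤ (∑' ξ, F ξ ^ 2) * ∑' ξ, (∑' η, (A η * B (ξ + η)) ^ 2) * C := by
        gcongr with ξ
        exact (tsum_mul_sq_le _ _).trans (mul_le_mul' le_rfl (hK ξ))
    _ = _ := by
        rw [ENNReal.tsum_mul_right, ENNReal.tsum_comm]
        have : ∀ η, ∑' ξ, (A η * B (ξ + η)) ^ 2 = A η ^ 2 * ∑' ξ, B ξ ^ 2 := fun η => by
          simp only [mul_pow]
          rw [ENNReal.tsum_mul_left]
          congr 1
          exact (Equiv.addRight η).tsum_eq fun ξ => B ξ ^ 2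
        simp only [this]
        rw [ENNReal.tsum_mul_right]
        ring

lemma sq_add_three_le {a b c X : ℝ≥0∞} (ha : a ^ 2 ≤ X) (hb : b ^ 2 ≤ X) (hc : c ^ 2 ≤ X) :
    (a + b + c) ^ 2 ≤ 9 * X := by
  have h : max a (max b c) ^ 2 ≤ X := by
    rcases max_choice a (max b c) with h | h <;> rw [h]
    · exact ha
    · rcases max_choice b c with h | h <;> rw [h] <;> assumption
  calc (a + b + c) ^ 2 ≤ (max a (max b c) + max a (max b c) + max a (max b c)) ^ 2 := by
        gcongr <;> simp
    _ = 9 * max a (max b c) ^ 2 := by ring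
    _ ≤ _ := by gcongr

/-- The trilinear estimate for Sobolev weights with the total exponent `n / 2`. -/
theorem trilinear_le (hn : 0 < n) {α β γ : ℝ} (hα : α < (n : ℝ) / 2) (hβ : β < (n : ℝ) / 2)
    (hγ : γ < (n : ℝ) / 2) (h : α + β + γ = (n : ℝ) / 2) :
    ∃ C : ℝ≥0∞, C ≠ ⊤ ∧ ∀ F A B : (Fin n → ℤ) → ℝ≥0∞,
      (∑' ξ, ∑' η, (wt (-α) ξ * F ξ) * (wt (-β) η * A η) * (wt (-γ) (ξ + η) * B (ξ + η))) ^ 2 ≤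
        C * ((∑' ξ, F ξ ^ 2) * (∑' ξ, A ξ ^ 2) * ∑' ξ, B ξ ^ 2) := by
  obtain ⟨C₁, h1, k1⟩ := kernel_sum_le (n := n) hn hβ h
  obtain ⟨C₂, h2, k2⟩ := kernel_sum_le (n := n) hn (α := β) (β := α) (γ := γ) hα (by linarith)
  obtain ⟨C₃, h3, k3⟩ := kernel_sum_le (n := n) hn (α := α) (β := γ) (γ := β) hγ (by linarith)
  refine ⟨9 * (C₁ + C₂ + C₃), by finiteness, fun F A B => ?_⟩
  set X := (∑' ξ, F ξ ^ 2) * (∑' ξ, A ξ ^ 2) * ∑' ξ, B ξ ^ 2 with hX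
  set κ : (ℝ) → ℝ → ℝ → (Fin n → ℤ) → (Fin n → ℤ) → ℝ≥0∞ := fun α β γ ξ η =>
    if rho η ≤ rho ξ ∧ rho η ≤ rho (ξ + η) then
        wt (-α) ξ * wt (-β) η * wt (-γ) (ξ + η) else 0 with hκ
  -- One of ξ, η and ξ+η is the smallest, and in each region it takes the role of η in
  -- `kernel_sum_le`. For ξ this is an exchange of the variables, for ξ+η the substitution η ↦
  -- -(ξ+η), which explains the reflected sequences in `t3`.
  have t1 := tsum_kernel_sq_le F A B (κ α β γ) k1
  have t2 := tsum_kernel_sq_le A F B (κ β α γ) k2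
  have t3 := tsum_kernel_sq_le F (fun η => B (-η)) (fun η => A (-η)) (κ α γ β) k3
  have eN : ∀ D : (Fin n → ℤ) → ℝ≥0∞, ∑' ξ, D (-ξ) ^ 2 = ∑' ξ, D ξ ^ 2 := fun D =>
    (Equiv.neg (Fin n → ℤ)).tsum_eq fun ξ => D ξ ^ 2
  rw [eN, eN] at t3
  set T1 := ∑' ξ, ∑' η, F ξ * A η * B (ξ + η) * κ α β γ ξ η
  set T2 := ∑' ξ, ∑' η, A ξ * F η * B (ξ + η) * κ β α γ ξ η with hT2
  set T3 := ∑' ξ, ∑' η, F ξ * B (-η) * A (-(ξ + η)) * κ α γ β ξ η with hT3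
  have e2 : T2 = ∑' ξ, ∑' η, F ξ * A η * B (ξ + η) * κ β α γ η ξ := by
    rw [hT2, ENNReal.tsum_comm]
    congr 1; ext ξ; congr 1; ext η
    rw [mul_comm (A η), add_comm η]
  have e3 : T3 = ∑' ξ, ∑' η, F ξ * A η * B (ξ + η) * κ α γ β ξ (-(ξ + η)) := by
    rw [hT3]
    congr 1; ext ξ
    rw [← ((Equiv.neg (Fin n → ℤ)).trans (Equiv.subRight ξ)).tsum_eq]
    congr 1; ext η
    simp only [Equiv.trans_apply, Equiv.neg_apply, Equiv.subRight_apply]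
    have a1 : -(-η - ξ) = ξ + η := by abel
    have a2 : -(ξ + (-η - ξ)) = η := by abel
    have a3 : -η - ξ = -(ξ + η) := by abel
    rw [a2, a3, neg_neg]
    ring
  have hle : ∑' ξ, ∑' η, (wt (-α) ξ * F ξ) * (wt (-β) η * A η) * (wt (-γ) (ξ + η) * B (ξ + η)) ≤
      T1 + T2 + T3 := by
    rw [e2, e3, ← ENNReal.tsum_add, ← ENNReal.tsum_add]
    refine ENNReal.tsum_le_tsum fun ξ => ?_
    rw [← ENNReal.tsum_add, ← ENNReal.tsum_add]
    refine ENNReal.tsum_le_tsum fun η => ?_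
    set Q := wt (-α) ξ * wt (-β) η * wt (-γ) (ξ + η)
    have q1 : (wt (-α) ξ * F ξ) * (wt (-β) η * A η) * (wt (-γ) (ξ + η) * B (ξ + η)) =
      F ξ * A η * B (ξ + η) * Q := by ring
    have a1 : ξ + -(ξ + η) = -η := by abel
    have a2 : η + ξ = ξ + η := add_comm _ _
    rw [q1, ← mul_add, ← mul_add]
    refine mul_le_mul' le_rfl ?_
    simp only [hκ, a1, a2, rho_neg, wt_neg]
    by_cases c1 : rho η ≤ rho ξ ∧ rho η ≤ rho (ξ + η)
    · rw [if_pos c1]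
      exact le_add_right le_self_add
    · by_cases c2 : rho ξ ≤ rho η ∧ rho ξ ≤ rho (ξ + η)
      · rw [if_neg c1, if_pos c2, zero_add]
        refine le_trans (le_of_eq ?_) le_self_add
        ring
      · have c3 : rho (ξ + η) ≤ rho ξ ∧ rho (ξ + η) ≤ rho η := by
          rw [not_and_or, not_le, not_le] at c1 c2
          rcases c1 with c1 | c1 <;> rcases c2 with c2 | c2 <;> constructor <;> linarith
        rw [if_neg c1, if_neg c2, if_pos c3, zero_add, zero_add]
        refine le_of_eq ?_
        ring
  calc _ ≤ (T1 + T2 + T3) ^ 2 := by gcongr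
    _ ≤ 9 * ((C₁ + C₂ + C₃) * X) := by
        refine sq_add_three_le (t1.trans ?_) (t2.trans ?_) (t3.trans ?_)
        · rw [← hX]; gcongr; exact le_add_right le_self_add
        · rw [mul_comm (∑' ξ, A ξ ^ 2), ← hX]; gcongr; exact le_add_right le_add_self
        · rw [mul_right_comm, ← hX]; gcongr; exact le_add_self
    _ = _ := by ring

end

section

/-! ### Sobolev norms of scalar distributions -/

/-- Finiteness of the norm in `H^s`. -/
def SobMem (s : ℝ) (g : PDistr n) : Prop := Summable fun ξ => rho ξ ^ (2 * s) * ‖g ξ‖ ^ 2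

lemma wt_neg_cancel (s : ℝ) (ξ : Fin n → ℤ) (x : ℝ≥0∞) : wt (-s) ξ * (wt s ξ * x) = x := by
  rw [← mul_assoc, mul_comm (wt (-s) ξ), wt_mul_neg, one_mul]

/-- The square of the norm in `H^s` as an extended nonnegative real. -/
noncomputable def sob (s : ℝ) (g : PDistr n) : ℝ≥0∞ := ∑' ξ, (wt s ξ * ‖g ξ‖ₑ) ^ 2

lemma sob_term (s : ℝ) (g : PDistr n) (ξ : Fin n → ℤ) :
    (wt s ξ * ‖g ξ‖ₑ) ^ 2 = ENNReal.ofReal (rho ξ ^ (2 * s) * ‖g ξ‖ ^ 2) := by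
  have := rho_pos ξ
  rw [mul_pow, wt_sq, wt, ENNReal.ofReal_mul (by positivity), ENNReal.ofReal_pow (norm_nonneg _),
    ofReal_norm]

lemma weight_nonneg (s : ℝ) (g : PDistr n) (ξ : Fin n → ℤ) :
    0 ≤ rho ξ ^ (2 * s) * ‖g ξ‖ ^ 2 := by
  have := rho_pos ξ
  positivity

lemma normSq_nonneg (s : ℝ) (g : PDistr n) : 0 ≤ normSq s g := tsum_nonneg (weight_nonneg s g)

lemma SobMem.sob_eq {s : ℝ} {g : PDistr n} (h : SobMem s g) :
    sob s g = ENNReal.ofReal (normSq s g) := by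
  rw [sob, normSq, ENNReal.ofReal_tsum_of_nonneg (weight_nonneg s g) h]
  exact tsum_congr (sob_term s g)

lemma sobMem_iff {s : ℝ} {g : PDistr n} : SobMem s g ↔ sob s g ≠ ⊤ := by
  refine ⟨fun h => by rw [h.sob_eq]; exact ENNReal.ofReal_ne_top, fun h => ?_⟩
  refine (ENNReal.summable_toReal h).congr fun ξ => ?_
  rw [sob_term, ENNReal.toReal_ofReal (weight_nonneg s g ξ)]

/-- Estimates are proved for `sob`, where every series has a value; membership and the bound for the
real-valued norm are then recovered together. -/
lemma SobMem.normSq_le {s : ℝ} {g : PDistr n} {B : ℝ} (hB : 0 ≤ B) (h : sob s g ≤ ENNReal.ofReal B) :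
    SobMem s g ∧ normSq s g ≤ B := by
  have h1 : SobMem s g := sobMem_iff.mpr (ne_top_of_le_ne_top ENNReal.ofReal_ne_top h)
  refine ⟨h1, ?_⟩
  rw [h1.sob_eq] at h
  exact (ENNReal.ofReal_le_ofReal_iff hB).mp h

lemma rho_rpow_mono {s t : ℝ} (h : s ≤ t) (ξ : Fin n → ℤ) : rho ξ ^ (2 * s) ≤ rho ξ ^ (2 * t) :=
  Real.rpow_le_rpow_of_exponent_le (one_le_rho ξ) (by linarith)

lemma SobMem.mono {s t : ℝ} {g : PDistr n} (h : SobMem t g) (hst : s ≤ t) : SobMem s g :=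
  Summable.of_nonneg_of_le (weight_nonneg s g)
    (fun ξ => mul_le_mul_of_nonneg_right (rho_rpow_mono hst ξ) (sq_nonneg _)) h

lemma SobMem.normSq_mono {s t : ℝ} {g : PDistr n} (h : SobMem t g) (hst : s ≤ t) :
    normSq s g ≤ normSq t g :=
  (h.mono hst).tsum_le_tsum
    (fun ξ => mul_le_mul_of_nonneg_right (rho_rpow_mono hst ξ) (sq_nonneg _)) h

lemma SobMem.of_norm_le {s t : ℝ} {c : ℝ} {f g : PDistr n} (hg : SobMem t g)
    (h : ∀ ξ, rho ξ ^ (2 * s) * ‖f ξ‖ ^ 2 ≤ c * (rho ξ ^ (2 * t) * ‖g ξ‖ ^ 2)) :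
    SobMem s f ∧ normSq s f ≤ c * normSq t g := by
  have h1 : SobMem s f := Summable.of_nonneg_of_le (weight_nonneg s f) h (hg.mul_left c)
  refine ⟨h1, ?_⟩
  rw [normSq, normSq, ← tsum_mul_left]
  exact h1.tsum_le_tsum h (hg.mul_left c)

lemma SobMem.zero (s : ℝ) : SobMem s (0 : PDistr n) := by
  simp [SobMem, summable_zero]

lemma normSq_zero (s : ℝ) : normSq s (0 : PDistr n) = 0 := by simp [normSq]

lemma SobMem.const_mul {s : ℝ} {g : PDistr n} (h : SobMem s g) (c : ℂ) :
    SobMem s fun ξ => c * g ξ := by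
  refine (h.of_norm_le (s := s) (c := ‖c‖ ^ 2) fun ξ => le_of_eq ?_).1
  rw [norm_mul, mul_pow]; ring

lemma normSq_const_mul (s : ℝ) (g : PDistr n) (c : ℂ) :
    normSq s (fun ξ => c * g ξ) = ‖c‖ ^ 2 * normSq s g := by
  rw [normSq, normSq, ← tsum_mul_left]
  congr 1; ext ξ
  rw [norm_mul, mul_pow]; ring

lemma SobMem.add {s : ℝ} {f g : PDistr n} (hf : SobMem s f) (hg : SobMem s g) :
    SobMem s (f + g) := by
  refine Summable.of_nonneg_of_le (weight_nonneg s _) (fun ξ => ?_)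
    ((Summable.add hf hg).mul_left 2)
  have h1 := norm_add_le (f ξ) (g ξ)
  have h2 := Real.rpow_pos_of_pos (rho_pos ξ) (2 * s)
  rw [← mul_add, mul_left_comm]
  refine mul_le_mul_of_nonneg_left ?_ h2.le
  rw [Pi.add_apply]
  nlinarith [sq_nonneg (‖f ξ‖ - ‖g ξ‖), norm_nonneg (f ξ + g ξ)]

lemma SobMem.neg {s : ℝ} {f : PDistr n} (hf : SobMem s f) : SobMem s (-f) := by
  simpa [SobMem] using hf

lemma SobMem.sub {s : ℝ} {f g : PDistr n} (hf : SobMem s f) (hg : SobMem s g) :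
    SobMem s (f - g) := by
  rw [sub_eq_add_neg]; exact hf.add hg.neg

lemma SobMem.sum {s : ℝ} {ι : Type*} {S : Finset ι} {f : ι → PDistr n}
    (hf : ∀ i ∈ S, SobMem s (f i)) : SobMem s (∑ i ∈ S, f i) := by
  classical
  induction S using Finset.induction_on with
  | empty => simpa using SobMem.zero s
  | insert a S ha ih =>
    rw [Finset.sum_insert ha]
    exact (hf a (by simp)).add (ih fun i hi => hf i (by simp [hi]))

lemma normSq_sum_le {s : ℝ} {ι : Type*} {S : Finset ι} {f : ι → PDistr n}
    (hf : ∀ i ∈ S, SobMem s (f i)) :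
    normSq s (∑ i ∈ S, f i) ≤ S.card * ∑ i ∈ S, normSq s (f i) := by
  simp only [normSq]
  rw [← Summable.tsum_finsetSum hf, ← tsum_mul_left]
  refine (SobMem.sum hf).tsum_le_tsum (fun ξ => ?_) ((summable_sum hf).mul_left _)
  have h2 := Real.rpow_pos_of_pos (rho_pos ξ) (2 * s)
  rw [← Finset.mul_sum, mul_left_comm]
  refine mul_le_mul_of_nonneg_left ?_ h2.le
  rw [Finset.sum_apply]
  calc ‖∑ i ∈ S, f i ξ‖ ^ 2 ≤ (∑ i ∈ S, ‖f i ξ‖) ^ 2 := by gcongr; exact norm_sum_le _ _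
    _ ≤ _ := sq_sum_le_card_mul_sum_sq

lemma rho_rpow_split {a b c : ℝ} (h : a + b = 2 * c) (ξ : Fin n → ℤ) :
    rho ξ ^ (2 * c) = rho ξ ^ a * rho ξ ^ b := by
  rw [← Real.rpow_add (rho_pos ξ), h]

lemma rho_rpow_sq (a : ℝ) (ξ : Fin n → ℤ) : (rho ξ ^ a) ^ 2 = rho ξ ^ (2 * a) := by
  rw [two_mul, Real.rpow_add (rho_pos ξ), sq]

lemma rho_mul_sq (a : ℝ) (g : PDistr n) (ξ : Fin n → ℤ) :
    (rho ξ ^ a * ‖g ξ‖) ^ 2 = rho ξ ^ (2 * a) * ‖g ξ‖ ^ 2 := by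
  rw [mul_pow, rho_rpow_sq]

/-- The Cauchy–Schwarz inequality for the duality of `H^a` and `H^b` over `H^{(a + b) / 2}`. -/
lemma SobMem.cauchySchwarz {a b c : ℝ} (h : a + b = 2 * c) {f g : PDistr n} (hf : SobMem a f)
    (hg : SobMem b g) :
    (Summable fun ξ => rho ξ ^ (2 * c) * (‖f ξ‖ * ‖g ξ‖)) ∧
      ∑' ξ, rho ξ ^ (2 * c) * (‖f ξ‖ * ‖g ξ‖) ≤ √(normSq a f) * √(normSq b g) := by
  have e : ∀ ξ, rho ξ ^ (2 * c) * (‖f ξ‖ * ‖g ξ‖) = (rho ξ ^ a * ‖f ξ‖) * (rho ξ ^ b * ‖g ξ‖) :=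
    fun ξ => by rw [rho_rpow_split h]; ring
  have n1 : ∀ (a : ℝ) (f : PDistr n) ξ, 0 ≤ rho ξ ^ a * ‖f ξ‖ := fun a f ξ => by
    have := rho_pos ξ; positivity
  have e2 : ∀ (a : ℝ) (f : PDistr n) (ξ : Fin n → ℤ),
      (rho ξ ^ a * ‖f ξ‖) ^ (2 : ℝ) = rho ξ ^ (2 * a) * ‖f ξ‖ ^ 2 := fun a f ξ => by
    rw [← rho_mul_sq, ← Real.rpow_natCast]; norm_num
  have := Real.summable_and_inner_le_Lp_mul_Lq_tsum_of_nonneg Real.HolderConjugate.two_two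
    (n1 a f) (n1 b g) (by simp only [e2]; exact hf) (by simp only [e2]; exact hg)
  simp only [e2, ← e] at this
  refine ⟨this.1, this.2.trans (le_of_eq ?_)⟩
  rw [Real.sqrt_eq_rpow, Real.sqrt_eq_rpow]
  rfl

/-! ### Real distributions and convolutions -/

/-- The reality condition for a family of Fourier coefficients. -/
def IsReal (g : PDistr n) : Prop := ∀ ξ, g (-ξ) = conj (g ξ)

lemma mem_Hs_iff {s : ℝ} {g : PDistr n} : g ∈ Hs n s ↔ IsReal g ∧ SobMem s g := Iff.rfl

/-- The convolution of two families of Fourier coefficients, that is, the family of the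
coefficients of the product. -/
noncomputable def conv (k g : PDistr n) : PDistr n := fun ξ => ∑' η, k (ξ - η) * g η

lemma IsReal.conv {k g : PDistr n} (hk : IsReal k) (hg : IsReal g) : IsReal (conv k g) := by
  intro ξ
  rw [PeriodicNS.conv, PeriodicNS.conv, Complex.conj_tsum, ← (Equiv.neg (Fin n → ℤ)).tsum_eq]
  congr 1; ext η
  rw [map_mul, ← hk, ← hg, Equiv.neg_apply]
  congr 2
  abel

lemma enorm_conv_le (k g : PDistr n) (ξ : Fin n → ℤ) :
    ‖conv k g ξ‖ₑ ≤ ∑' η, ‖k (ξ - η)‖ₑ * ‖g η‖ₑ := by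
  refine enorm_tsum_le_tsum_enorm.trans (le_of_eq ?_)
  simp [enorm_mul]

lemma SobMem.summable_sq {g : PDistr n} (h : SobMem 0 g) : Summable fun ξ => ‖g ξ‖ ^ 2 := by
  simpa [SobMem] using h

lemma normSq_zero_eq (g : PDistr n) : normSq 0 g = ∑' ξ, ‖g ξ‖ ^ 2 := by simp [normSq]

lemma SobMem.summable_conv {k g : PDistr n} (hk : SobMem 0 k) (hg : SobMem 0 g)
    (ξ : Fin n → ℤ) : Summable fun η => k (ξ - η) * g η := by
  refine Summable.of_norm ?_
  have h1 : Summable fun η => ‖k (ξ - η)‖ ^ 2 :=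
    (Equiv.subLeft ξ).summable_iff.mpr hk.summable_sq
  refine Summable.of_nonneg_of_le (fun _ => norm_nonneg _) (fun η => ?_) (h1.add hg.summable_sq)
  rw [norm_mul]
  nlinarith [sq_nonneg (‖k (ξ - η)‖ - ‖g η‖), sq_nonneg (‖k (ξ - η)‖ + ‖g η‖)]

lemma conv_sub_left {k l g : PDistr n} (hk : SobMem 0 k) (hl : SobMem 0 l) (hg : SobMem 0 g) :
    conv (k - l) g = conv k g - conv l g := by
  ext ξ
  simp only [conv, Pi.sub_apply, sub_mul]
  exact (hk.summable_conv hg ξ).tsum_sub (hl.summable_conv hg ξ)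

lemma conv_sub_right {k g h : PDistr n} (hk : SobMem 0 k) (hg : SobMem 0 g) (hh : SobMem 0 h) :
    conv k (g - h) = conv k g - conv k h := by
  ext ξ
  simp only [conv, Pi.sub_apply, mul_sub]
  exact (hk.summable_conv hg ξ).tsum_sub (hk.summable_conv hh ξ)

/-- The substitution ζ = ξ - η brings the pairing of a convolution into the form of `trilinear_le`.
-/
lemma tsum_conv_mul_eq (f g H : (Fin n → ℤ) → ℝ≥0∞) :
    ∑' ξ, (∑' η, f (ξ - η) * g η) * H ξ = ∑' ζ, ∑' η, f ζ * g η * H (ζ + η) := by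
  simp only [← ENNReal.tsum_mul_right]
  rw [ENNReal.tsum_comm, ENNReal.tsum_comm (f := fun ζ η => f ζ * g η * H (ζ + η))]
  congr 1; ext η
  rw [← (Equiv.addRight η).tsum_eq]
  simp

/-- The product of an element of `H^α` and an element of `H^β` belongs to `H^{-γ}`. -/
theorem sob_conv_le (hn : 0 < n) {α β γ : ℝ} (hα : α < (n : ℝ) / 2) (hβ : β < (n : ℝ) / 2)
    (hγ : γ < (n : ℝ) / 2) (h : α + β + γ = (n : ℝ) / 2) :
    ∃ C : ℝ, 0 < C ∧ ∀ f g : PDistr n, SobMem α f → SobMem β g →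
      SobMem (-γ) (conv f g) ∧ normSq (-γ) (conv f g) ≤ C * (normSq α f * normSq β g) := by
  obtain ⟨C, hC, hT⟩ := trilinear_le hn hα hβ hγ h
  refine ⟨C.toReal + 1, by positivity, fun f g hf hg => ?_⟩
  have p1 := normSq_nonneg α f
  have p2 := normSq_nonneg β g
  refine SobMem.normSq_le (by positivity) ?_
  calc sob (-γ) (conv f g) ≤ C * (sob α f * sob β g) := by
        -- By duality it suffices to pair with an arbitrary square summable H, which carries the
        -- weight of order -γ as the third factor of the trilinear form.
        refine tsum_sq_le_of_forall _ _ fun H => ?_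
        calc _ ≤ (∑' ξ, (∑' η, ‖f (ξ - η)‖ₑ * ‖g η‖ₑ) * (wt (-γ) ξ * H ξ)) ^ 2 := by
              refine pow_le_pow_left' (ENNReal.tsum_le_tsum fun ξ => ?_) 2
              rw [mul_comm (wt (-γ) ξ), mul_assoc]
              exact mul_le_mul' (enorm_conv_le f g ξ) le_rfl
          _ = (∑' ξ, ∑' η, (wt (-α) ξ * (wt α ξ * ‖f ξ‖ₑ)) * (wt (-β) η * (wt β η * ‖g η‖ₑ)) *
                (wt (-γ) (ξ + η) * H (ξ + η))) ^ 2 := by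
              rw [tsum_conv_mul_eq (fun ξ => ‖f ξ‖ₑ) (fun ξ => ‖g ξ‖ₑ)]
              congr 3; ext ξ; congr 1; ext η
              rw [wt_neg_cancel, wt_neg_cancel]
          _ ≤ _ := (hT (fun ξ => wt α ξ * ‖f ξ‖ₑ) (fun ξ => wt β ξ * ‖g ξ‖ₑ) H).trans
              (le_of_eq (by rw [sob, sob]; ring))
    _ = ENNReal.ofReal (C.toReal * (normSq α f * normSq β g)) := by
        rw [hf.sob_eq, hg.sob_eq, ENNReal.ofReal_mul (by positivity), ENNReal.ofReal_toReal hC,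
          ENNReal.ofReal_mul p1]
    _ ≤ _ := ENNReal.ofReal_le_ofReal (by gcongr; linarith)

/-- Absolute convergence of the trilinear form of the advection. -/
theorem summable_trilinear (hn : 0 < n) {α β γ : ℝ} (hα : α < (n : ℝ) / 2) (hβ : β < (n : ℝ) / 2)
    (hγ : γ < (n : ℝ) / 2) (h : α + β + γ = (n : ℝ) / 2) {f g k : PDistr n} (hf : SobMem α f)
    (hg : SobMem β g) (hk : SobMem (γ + 1) k) :
    Summable fun p : (Fin n → ℤ) × (Fin n → ℤ) =>
      rho p.1 * (‖f (p.1 - p.2)‖ * ‖g p.2‖ * ‖k (-p.1)‖) := by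
  obtain ⟨C, hC, hT⟩ := trilinear_le hn hα hβ hγ h
  -- The extra order of k pays for the derivative: the weights ϱ^{-γ} and ϱ^{γ+1} multiply to the
  -- factor ϱ of the summand.
  have h1 := hT (fun ξ => wt α ξ * ‖f ξ‖ₑ) (fun ξ => wt β ξ * ‖g ξ‖ₑ)
    (fun ξ => wt (γ + 1) ξ * ‖k (-ξ)‖ₑ)
  have e1 : ∑' ξ, (wt (γ + 1) ξ * ‖k (-ξ)‖ₑ) ^ 2 = sob (γ + 1) k := by
    rw [sob, ← (Equiv.neg (Fin n → ℤ)).tsum_eq]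
    simp [wt_neg]
  rw [e1] at h1
  have hfin : C * (sob α f * sob β g * sob (γ + 1) k) < ⊤ := by
    have := sobMem_iff.mp hf
    have := sobMem_iff.mp hg
    have := sobMem_iff.mp hk
    finiteness
  have e2 : ∑' p : (Fin n → ℤ) × (Fin n → ℤ), ENNReal.ofReal
      (rho p.1 * (‖f (p.1 - p.2)‖ * ‖g p.2‖ * ‖k (-p.1)‖)) ≠ ⊤ := by
    have : ∑' p : (Fin n → ℤ) × (Fin n → ℤ), ENNReal.ofReal
      (rho p.1 * (‖f (p.1 - p.2)‖ * ‖g p.2‖ * ‖k (-p.1)‖)) =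
      ∑' ξ, ∑' η, (wt (-α) ξ * (wt α ξ * ‖f ξ‖ₑ)) * (wt (-β) η * (wt β η * ‖g η‖ₑ)) *
                (wt (-γ) (ξ + η) * (wt (γ + 1) (ξ + η) * ‖k (-(ξ + η))‖ₑ)) := by
      rw [ENNReal.tsum_prod (f := fun p q => ENNReal.ofReal (rho p * (‖f (p - q)‖ * ‖g q‖ * ‖k (-p)‖)))]
      have := tsum_conv_mul_eq (fun ξ => ‖f ξ‖ₑ) (fun ξ => ‖g ξ‖ₑ) (fun ξ => wt 1 ξ * ‖k (-ξ)‖ₑ)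
      simp only [← ENNReal.tsum_mul_right] at this
      convert this using 1
      · congr 1; ext ξ; congr 1; ext η
        rw [ENNReal.ofReal_mul (rho_pos ξ).le, ENNReal.ofReal_mul (by positivity),
          ENNReal.ofReal_mul (by positivity), ofReal_norm, ofReal_norm, ofReal_norm, wt,
          Real.rpow_one]
        ring
      · congr 1; ext ξ; congr 1; ext η
        rw [wt_neg_cancel, wt_neg_cancel, ← mul_assoc (wt (-γ) _), ← wt_add]
        congr 3
        ring_nf
    rw [this]
    intro htop
    simp only [htop] at h1
    have := h1.trans_lt hfin
    simp at this
  refine (ENNReal.summable_toReal e2).congr fun p => ?_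
  rw [ENNReal.toReal_ofReal]
  have := rho_pos p.1
  positivity

/-! ### Weighted ℓ¹ spaces, multiplication operators and commutators. -/

/-- The norm of `k` in the space of the sequences that are summable with the weight `ϱ ^ r`. -/
noncomputable def wsum (r : ℝ) (k : PDistr n) : ℝ := ∑' ξ, rho ξ ^ r * ‖k ξ‖

/-- Summability with the weight `ϱ ^ r`. -/
def WSummable (r : ℝ) (k : PDistr n) : Prop := Summable fun ξ => rho ξ ^ r * ‖k ξ‖

lemma wsum_nonneg (r : ℝ) (k : PDistr n) : 0 ≤ wsum r k :=
  tsum_nonneg fun ξ => mul_nonneg (Real.rpow_pos_of_pos (rho_pos ξ) _).le (norm_nonneg _)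

lemma WSummable.mono {r t : ℝ} {k : PDistr n} (h : WSummable t k) (hrt : r ≤ t) :
    WSummable r k ∧ wsum r k ≤ wsum t k := by
  have hle : ∀ ξ, rho ξ ^ r * ‖k ξ‖ ≤ rho ξ ^ t * ‖k ξ‖ := fun ξ =>
    mul_le_mul_of_nonneg_right (Real.rpow_le_rpow_of_exponent_le (one_le_rho ξ) hrt)
      (norm_nonneg _)
  have h1 : WSummable r k := Summable.of_nonneg_of_le
    (fun ξ => mul_nonneg (Real.rpow_pos_of_pos (rho_pos ξ) _).le (norm_nonneg _)) hle h
  exact ⟨h1, h1.tsum_le_tsum hle h⟩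

lemma WSummable.summable {r : ℝ} {k : PDistr n} (h : WSummable r k) (hr : 0 ≤ r) :
    Summable fun ξ => ‖k ξ‖ := by
  simpa [WSummable] using (h.mono hr).1

lemma WSummable.tsum_enorm {r : ℝ} {k : PDistr n} (h : WSummable r k) :
    ∑' ξ, wt r ξ * ‖k ξ‖ₑ = ENNReal.ofReal (wsum r k) := by
  rw [wsum, ENNReal.ofReal_tsum_of_nonneg
    (fun ξ => mul_nonneg (Real.rpow_pos_of_pos (rho_pos ξ) _).le (norm_nonneg _)) h]
  congr 1; ext ξ
  rw [ENNReal.ofReal_mul (Real.rpow_pos_of_pos (rho_pos ξ) _).le, ofReal_norm, wt]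

/-- A Sobolev space of high order is embedded into a weighted `ℓ¹` space. -/
lemma wsum_le_of_sobMem (hn : 0 < n) {r t : ℝ} (h : r + (n : ℝ) / 2 < t) :
    ∃ C : ℝ, 0 < C ∧ ∀ k : PDistr n, SobMem t k → WSummable r k ∧ wsum r k ≤ C * √(normSq t k) := by
  -- The constant sequence 1 has finite norm of order -(t-r) precisely because 2(t-r) > n; the
  -- embedding is Cauchy–Schwarz against it.
  have hs : SobMem (-(t - r)) (fun _ : Fin n → ℤ => (1 : ℂ)) := by
    have := summable_rho_rpow_neg (n := n) hn (γ := 2 * (t - r)) (by linarith)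
    refine this.congr fun ξ => ?_
    rw [norm_one, one_pow, mul_one]
    congr 1; ring
  refine ⟨√(normSq (-(t - r)) (fun _ : Fin n → ℤ => (1 : ℂ))) + 1, by positivity, fun k hk => ?_⟩
  have := SobMem.cauchySchwarz (c := r / 2) (by ring) hk hs
  have e : 2 * (r / 2) = r := by ring
  simp only [norm_one, mul_one, e] at this
  refine ⟨this.1, this.2.trans ?_⟩
  rw [mul_comm]
  gcongr
  linarith

/-- Multiplication by a function with coefficients in a weighted `ℓ¹` space is bounded. -/
lemma normSq_conv_le (s : ℝ) {k g : PDistr n} (hk : WSummable |s| k) (hg : SobMem s g) :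
    SobMem s (conv k g) ∧ normSq s (conv k g) ≤ wsum |s| k ^ 2 * normSq s g := by
  have p1 := normSq_nonneg s g
  have p2 := wsum_nonneg |s| k
  refine SobMem.normSq_le (by positivity) ?_
  calc sob s (conv k g) ≤ ∑' ξ, (∑' η, (wt |s| (ξ - η) * ‖k (ξ - η)‖ₑ) * (wt s η * ‖g η‖ₑ)) ^ 2 := by
        refine ENNReal.tsum_le_tsum fun ξ => ?_
        gcongr
        refine (mul_le_mul' le_rfl (enorm_conv_le k g ξ)).trans ?_
        rw [← ENNReal.tsum_mul_left]
        refine ENNReal.tsum_le_tsum fun η => ?_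
        -- Peetre's inequality distributes the weight over the two factors, after which the
        -- convolution is one of ℓ¹ with ℓ².
        have : wt s ξ ≤ wt |s| (ξ - η) * wt s η := by
          rw [wt, wt, wt, ← ENNReal.ofReal_mul (Real.rpow_pos_of_pos (rho_pos _) _).le]
          exact ENNReal.ofReal_le_ofReal (rho_rpow_le s ξ η)
        calc _ ≤ (wt |s| (ξ - η) * wt s η) * (‖k (ξ - η)‖ₑ * ‖g η‖ₑ) := by gcongr
          _ = _ := by ring
    _ ≤ _ := tsum_conv_sq_le (fun ξ => wt |s| ξ * ‖k ξ‖ₑ) fun ξ => wt s ξ * ‖g ξ‖ₑ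
    _ = _ := by
        rw [hk.tsum_enorm, ENNReal.ofReal_mul (by positivity), ENNReal.ofReal_pow p2, ← hg.sob_eq,
          sob]

/-- The weight `ϱ ^ s` as an operator. -/
noncomputable def lam (s : ℝ) (g : PDistr n) : PDistr n := fun ξ => ((rho ξ ^ s : ℝ) : ℂ) * g ξ

lemma norm_lam (s : ℝ) (g : PDistr n) (ξ : Fin n → ℤ) : ‖lam s g ξ‖ = rho ξ ^ s * ‖g ξ‖ := by
  rw [lam, norm_mul, Complex.norm_real, Real.norm_of_nonneg (Real.rpow_pos_of_pos (rho_pos ξ) _).le]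

lemma lam_weight (s t : ℝ) (g : PDistr n) (ξ : Fin n → ℤ) :
    rho ξ ^ (2 * t) * ‖lam s g ξ‖ ^ 2 = rho ξ ^ (2 * (s + t)) * ‖g ξ‖ ^ 2 := by
  rw [norm_lam, mul_pow, rho_rpow_sq, ← mul_assoc, ← Real.rpow_add (rho_pos ξ)]
  congr 2
  ring

lemma sobMem_lam {s t : ℝ} {g : PDistr n} : SobMem t (lam s g) ↔ SobMem (s + t) g := by
  simp only [SobMem, lam_weight]

lemma normSq_lam (s t : ℝ) (g : PDistr n) : normSq t (lam s g) = normSq (s + t) g := by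
  simp only [normSq, lam_weight]

/-- The commutator of the weight `ϱ ^ s` and a multiplication operator has the order `s - 1`. -/
lemma normSq_commutator_le (s : ℝ) {k g : PDistr n} (hk : WSummable (1 + |s - 1|) k)
    (hk0 : SobMem 0 k) (hg0 : SobMem 0 g) (hgs : SobMem s g) :
    SobMem 0 (lam s (conv k g) - conv k (lam s g)) ∧
      normSq 0 (lam s (conv k g) - conv k (lam s g)) ≤
        (2 * |s| * wsum (1 + |s - 1|) k) ^ 2 * normSq (s - 1) g := by
  have hg : SobMem (s - 1) g := hgs.mono (by linarith)
  have p1 := normSq_nonneg (s - 1) g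
  have p2 := wsum_nonneg (1 + |s - 1|) k
  have hls : SobMem 0 (lam s g) := sobMem_lam.mpr (by simpa using hgs)
  refine SobMem.normSq_le (by positivity) ?_
  calc _ ≤ ∑' ξ, (∑' η, (ENNReal.ofReal (2 * |s|) * (wt (1 + |s - 1|) (ξ - η) * ‖k (ξ - η)‖ₑ)) *
        (wt (s - 1) η * ‖g η‖ₑ)) ^ 2 := by
        refine ENNReal.tsum_le_tsum fun ξ => ?_
        rw [wt_zero, one_mul]
        gcongr
        -- The commutator has the kernel (ϱ(ξ)^s - ϱ(η)^s) k(ξ-η). The difference of the weights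
        -- costs powers of ϱ(ξ-η), paid by k, and leaves only ϱ(η)^{s-1} on g.
        have e : (lam s (conv k g) - conv k (lam s g)) ξ =
            ∑' η, ((rho ξ ^ s - rho η ^ s : ℝ) : ℂ) * (k (ξ - η) * g η) := by
          rw [Pi.sub_apply, lam, conv, conv, ← tsum_mul_left,
            ← ((hk0.summable_conv hg0 ξ).mul_left _).tsum_sub (hk0.summable_conv hls ξ)]
          congr 1; ext η
          rw [lam]; push_cast; ring
        rw [e]
        refine enorm_tsum_le_tsum_enorm.trans (ENNReal.tsum_le_tsum fun η => ?_)
        have : ‖((rho ξ ^ s - rho η ^ s : ℝ) : ℂ)‖ₑ ≤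
            ENNReal.ofReal (2 * |s|) * (wt (1 + |s - 1|) (ξ - η) * wt (s - 1) η) := by
          rw [wt, wt, ← ENNReal.ofReal_mul (Real.rpow_pos_of_pos (rho_pos _) _).le,
            ← ENNReal.ofReal_mul (by positivity), ← ofReal_norm, Complex.norm_real]
          exact ENNReal.ofReal_le_ofReal (abs_rho_rpow_sub_le s ξ η)
        rw [enorm_mul, enorm_mul]
        calc _ ≤ (ENNReal.ofReal (2 * |s|) * (wt (1 + |s - 1|) (ξ - η) * wt (s - 1) η)) *
              (‖k (ξ - η)‖ₑ * ‖g η‖ₑ) := by gcongr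
          _ = _ := by ring
    _ ≤ _ := tsum_conv_sq_le (fun ξ => ENNReal.ofReal (2 * |s|) * (wt (1 + |s - 1|) ξ * ‖k ξ‖ₑ))
        fun ξ => wt (s - 1) ξ * ‖g ξ‖ₑ
    _ = _ := by
        rw [ENNReal.tsum_mul_left, hk.tsum_enorm,
          ENNReal.ofReal_mul (p := (2 * |s| * wsum (1 + |s - 1|) k) ^ 2) (by positivity),
          ENNReal.ofReal_pow (by positivity), ← hg.sob_eq, sob,
          ENNReal.ofReal_mul (p := 2 * |s|) (by positivity)]

end

section

/-! ### Fourier coefficients of functions on the torus -/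

lemma coeff_apply (h : Torus n → ℝ) (ξ : Fin n → ℤ) :
    coeff h ξ = ∫ x, UnitAddTorus.mFourier (-ξ) x * (h x : ℂ) ∂(torusMeasure n) := rfl

lemma isReal_coeff (h : Torus n → ℝ) : IsReal (coeff h) := by
  intro ξ
  rw [coeff_apply, coeff_apply, ← integral_conj]
  congr 1; ext x
  rw [map_mul, Complex.conj_ofReal, ← UnitAddTorus.mFourier_neg]

lemma norm_mFourier_apply (ξ : Fin n → ℤ) (x : Torus n) : ‖UnitAddTorus.mFourier ξ x‖ = 1 := by
  simp [UnitAddTorus.mFourier, Circle.norm_coe]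

lemma integrable_ofReal {f : Torus n → ℝ} (hf : Integrable f (torusMeasure n)) :
    Integrable (fun x => (f x : ℂ)) (torusMeasure n) := hf.ofReal

lemma memLp_ofReal {f : Torus n → ℝ} (hf : MemLp f 2 (torusMeasure n)) :
    MemLp (fun x => (f x : ℂ)) 2 (torusMeasure n) := hf.ofReal

lemma integrable_mFourier_mul {f : Torus n → ℂ} (hf : Integrable f (torusMeasure n))
    (ξ : Fin n → ℤ) : Integrable (fun x => UnitAddTorus.mFourier ξ x * f x) (torusMeasure n) :=
  hf.bdd_mul (c := 1) (UnitAddTorus.mFourier ξ).continuous.aestronglyMeasurable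
    (ae_of_all _ fun x => (norm_mFourier_apply ξ x).le)

lemma coeff_add {f g : Torus n → ℝ} (hf : Integrable f (torusMeasure n))
    (hg : Integrable g (torusMeasure n)) : coeff (fun x => f x + g x) = coeff f + coeff g := by
  ext ξ
  rw [Pi.add_apply, coeff_apply, coeff_apply, coeff_apply,
    ← integral_add (integrable_mFourier_mul (integrable_ofReal hf) _)
      (integrable_mFourier_mul (integrable_ofReal hg) _)]
  congr 1; ext x
  push_cast
  ring

lemma coeff_sum {ι : Type*} (S : Finset ι) {f : ι → Torus n → ℝ}
    (hf : ∀ i ∈ S, Integrable (f i) (torusMeasure n)) :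
    coeff (fun x => ∑ i ∈ S, f i x) = ∑ i ∈ S, coeff (f i) := by
  ext ξ
  rw [Finset.sum_apply, coeff_apply]
  simp only [coeff_apply]
  rw [← integral_finsetSum _ fun i hi => (integrable_mFourier_mul (integrable_ofReal (hf i hi)) _)]
  congr 1; ext x
  push_cast
  rw [Finset.mul_sum]

/-- An integrable function all of whose Fourier coefficients vanish is zero. -/
lemma ae_eq_zero_of_coeff_eq_zero {f : Torus n → ℝ} (hf : Integrable f (torusMeasure n))
    (h : coeff f = 0) : f =ᵐ[torusMeasure n] 0 := by
  have hint : ∀ g : C(Torus n, ℂ), Integrable (fun x => g x * (f x : ℂ)) (torusMeasure n) :=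
    fun g => (integrable_ofReal hf).bdd_mul (c := ‖g‖) g.continuous.aestronglyMeasurable
      (ae_of_all _ fun x => g.norm_coe_le_norm x)
  let Φ₀ : C(Torus n, ℂ) →ₗ[ℂ] ℂ :=
    { toFun := fun g => ∫ x, g x * (f x : ℂ) ∂(torusMeasure n)
      map_add' := fun g g' => by
        rw [← integral_add (hint g) (hint g')]
        congr 1; ext x; simp [add_mul]
      map_smul' := fun c g => by
        rw [RingHom.id_apply, smul_eq_mul, ← integral_const_mul]
        congr 1; ext x; simp [mul_assoc] }
  let Φ : C(Torus n, ℂ) →L[ℂ] ℂ := Φ₀.mkContinuous (∫ x, ‖f x‖ ∂(torusMeasure n)) fun g => by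
    rw [mul_comm, ← integral_const_mul]
    refine (norm_integral_le_integral_norm _).trans ?_
    refine integral_mono (hint g).norm (hf.norm.const_mul _) fun x => ?_
    simp only [norm_mul, Complex.norm_real]
    exact mul_le_mul_of_nonneg_right (g.norm_coe_le_norm x) (norm_nonneg _)
  -- Integration against f vanishes on all characters, whose span is dense in the continuous
  -- functions.
  have hΦ : Φ = 0 := by
    refine ContinuousLinearMap.ext_on (s := range (UnitAddTorus.mFourier (d := Fin n))) ?_ ?_
    · rw [dense_iff_closure_eq, ← Submodule.topologicalClosure_coe,
        UnitAddTorus.span_mFourier_closure_eq_top]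
      rfl
    · rintro _ ⟨ξ, rfl⟩
      have := congrFun h (-ξ)
      rw [coeff_apply, neg_neg] at this
      exact this
  have hreal : ∀ g : Torus n → ℝ, Continuous g → ∫ x, f x * g x ∂(torusMeasure n) = 0 := by
    intro g hg
    have h1 : Φ ⟨fun x => (g x : ℂ), Complex.continuous_ofReal.comp hg⟩ = 0 := by
      rw [hΦ]; rfl
    change ∫ x, (g x : ℂ) * (f x : ℂ) ∂(torusMeasure n) = 0 at h1
    have h2 : ∫ x, ((g x * f x : ℝ) : ℂ) ∂(torusMeasure n) = 0 := by
      rw [← h1]; congr 1; ext x; push_cast; rfl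
    rw [integral_complex_ofReal] at h2
    rw [← Complex.ofReal_eq_zero.mp h2]
    congr 1; ext x; ring
  have hfm : AEMeasurable f (torusMeasure n) := hf.aestronglyMeasurable.aemeasurable
  have hp : ∫⁻ x, ENNReal.ofReal (f x) ∂(torusMeasure n) ≠ ⊤ := hf.lintegral_lt_top.ne
  have hm : ∫⁻ x, ENNReal.ofReal (-f x) ∂(torusMeasure n) ≠ ⊤ := hf.neg.lintegral_lt_top.ne
  -- The positive and negative parts of f are densities of finite measures with equal integrals of
  -- continuous functions, hence of the same measure.
  have hmeas : (torusMeasure n).withDensity (fun x => ENNReal.ofReal (f x)) =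
      (torusMeasure n).withDensity (fun x => ENNReal.ofReal (-f x)) := by
    have : IsFiniteMeasure ((torusMeasure n).withDensity (fun x => ENNReal.ofReal (f x))) :=
      isFiniteMeasure_withDensity hp
    have : IsFiniteMeasure ((torusMeasure n).withDensity (fun x => ENNReal.ofReal (-f x))) :=
      isFiniteMeasure_withDensity hm
    refine ext_of_forall_integral_eq_of_IsFiniteMeasure fun g => ?_
    have hb : ∀ x, ‖g x‖ ≤ ‖g‖ := g.norm_coe_le_norm
    rw [integral_withDensity_eq_integral_toReal_smul₀ hfm.ennreal_ofReal
      (ae_of_all _ fun x => ENNReal.ofReal_lt_top),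
      integral_withDensity_eq_integral_toReal_smul₀ (f := fun x => ENNReal.ofReal (-f x))
      hfm.neg.ennreal_ofReal (ae_of_all _ fun x => ENNReal.ofReal_lt_top), ← sub_eq_zero, ← integral_sub]
    · rw [← hreal g g.continuous]
      congr 1; ext x
      rw [smul_eq_mul, smul_eq_mul, ← sub_mul]
      congr 1
      rcases le_total 0 (f x) with h0 | h0
      · rw [ENNReal.toReal_ofReal h0, ENNReal.ofReal_of_nonpos (by linarith)]
        simp
      · rw [ENNReal.ofReal_of_nonpos h0, ENNReal.toReal_ofReal (by linarith)]
        simp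
    · simp only [smul_eq_mul]
      exact (integrable_toReal_of_lintegral_ne_top hfm.ennreal_ofReal hp).mul_bdd (c := ‖g‖)
        g.continuous.aestronglyMeasurable (ae_of_all _ hb)
    · simp only [smul_eq_mul]
      exact (integrable_toReal_of_lintegral_ne_top hfm.neg.ennreal_ofReal hm).mul_bdd (c := ‖g‖)
        g.continuous.aestronglyMeasurable (ae_of_all _ hb)
  have hfm' : AEMeasurable (fun x => -f x) (torusMeasure n) := hfm.neg
  rw [withDensity_eq_iff hfm.ennreal_ofReal hfm'.ennreal_ofReal hp] at hmeas
  filter_upwards [hmeas] with x hx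
  rcases le_total 0 (f x) with h0 | h0
  · rw [ENNReal.ofReal_of_nonpos (by linarith : -f x ≤ 0), ENNReal.ofReal_eq_zero] at hx
    exact le_antisymm hx h0
  · rw [ENNReal.ofReal_of_nonpos h0, eq_comm, ENNReal.ofReal_eq_zero] at hx
    exact le_antisymm h0 (by simpa using hx)

lemma integrable_of_memLp {f : Torus n → ℝ} (hf : MemLp f 2 (torusMeasure n)) :
    Integrable f (torusMeasure n) := hf.integrable (by norm_num)

lemma MemLp.integrable_mul_two {f g : Torus n → ℝ} (hf : MemLp f 2 (torusMeasure n))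
    (hg : MemLp g 2 (torusMeasure n)) : Integrable (fun x => f x * g x) (torusMeasure n) :=
  hf.integrable_mul hg

/-- Parseval's identity for functions. -/
lemma hasSum_mFourierCoeff_mul {f g : Torus n → ℂ} (hf : MemLp f 2 (torusMeasure n))
    (hg : MemLp g 2 (torusMeasure n)) :
    HasSum (fun ξ => conj (∫ x, UnitAddTorus.mFourier (-ξ) x * f x ∂(torusMeasure n)) *
      ∫ x, UnitAddTorus.mFourier (-ξ) x * g x ∂(torusMeasure n))
      (∫ x, conj (f x) * g x ∂(torusMeasure n)) := by
  have h := UnitAddTorus.hasSum_prod_mFourierCoeff (d := Fin n) (hf.toLp f) (hg.toLp g)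
  have e : ∀ (f : Torus n → ℂ) (hf : MemLp f 2 (torusMeasure n)) (ξ : Fin n → ℤ),
      UnitAddTorus.mFourierCoeff (hf.toLp f) ξ =
        ∫ x, UnitAddTorus.mFourier (-ξ) x * f x ∂(torusMeasure n) := by
    intro f hf ξ
    refine integral_congr_ae ?_
    filter_upwards [hf.coeFn_toLp] with x hx
    rw [hx, smul_eq_mul]
  simp only [e] at h
  convert h using 1
  refine integral_congr_ae ?_
  filter_upwards [hf.coeFn_toLp, hg.coeFn_toLp] with x hx hx'
  rw [hx, hx']

/-- For real functions, conjugating the coefficients is the reflection ξ ↦ -ξ; Parseval's identity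
then takes the shape of the dual product. -/
lemma hasSum_coeff_mul {f g : Torus n → ℝ} (hf : MemLp f 2 (torusMeasure n))
    (hg : MemLp g 2 (torusMeasure n)) :
    HasSum (fun ξ => coeff f ξ * coeff g (-ξ)) ((∫ x, f x * g x ∂(torusMeasure n) : ℝ) : ℂ) := by
  have h := hasSum_mFourierCoeff_mul (memLp_ofReal hf) (memLp_ofReal hg)
  have h2 := (Equiv.neg (Fin n → ℤ)).hasSum_iff.mpr h
  convert h2 using 1
  · ext ξ
    have := isReal_coeff f ξ
    rw [coeff_apply, coeff_apply] at this
    simp only [Function.comp_apply, Equiv.neg_apply]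
    rw [coeff_apply, coeff_apply]
    have e2 := congrArg conj this
    rw [Complex.conj_conj] at e2
    rw [← e2]
  · rw [← integral_complex_ofReal]
    simp

/-- The coefficients of the product of two functions in `L₂`. -/
lemma coeff_mul {f g : Torus n → ℝ} (hf : MemLp f 2 (torusMeasure n))
    (hg : MemLp g 2 (torusMeasure n)) :
    coeff (fun x => f x * g x) = conv (coeff f) (coeff g) := by
  ext ξ
  have hF : MemLp (fun x => UnitAddTorus.mFourier ξ x * (f x : ℂ)) 2 (torusMeasure n) := by
    refine (memLp_ofReal hf).of_le (((UnitAddTorus.mFourier ξ).continuous.aestronglyMeasurable).mul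
      (memLp_ofReal hf).aestronglyMeasurable) (ae_of_all _ fun x => ?_)
    rw [norm_mul, norm_mFourier_apply, one_mul]
  -- Parseval for the character e_ξ times f, paired with g: the character shifts the coefficients of
  -- f by ξ and the conjugation reverses them, which produces the convolution.
  have h := hasSum_mFourierCoeff_mul hF (memLp_ofReal hg)
  rw [conv, coeff_apply]
  have e : ∫ x, conj (UnitAddTorus.mFourier ξ x * (f x : ℂ)) * ((g x : ℝ) : ℂ) ∂(torusMeasure n) =
      ∫ x, UnitAddTorus.mFourier (-ξ) x * ((f x * g x : ℝ) : ℂ) ∂(torusMeasure n) := by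
    congr 1; ext x
    rw [map_mul, ← UnitAddTorus.mFourier_neg, Complex.conj_ofReal]
    push_cast; ring
  rw [← e, ← h.tsum_eq]
  congr 1; ext η
  rw [coeff_apply, coeff_apply, ← integral_conj]
  congr 2; ext x
  rw [← mul_assoc, ← UnitAddTorus.mFourier_add, map_mul, Complex.conj_ofReal,
    ← UnitAddTorus.mFourier_neg]
  congr 3
  abel

lemma memlp_two_iff {g : PDistr n} : Memℓp g 2 ↔ SobMem 0 g := by
  rw [memℓp_gen_iff (by norm_num)]
  simp [SobMem]

/-- The function in `L₂` with the given coefficients. -/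
lemma toFn_spec {g : PDistr n} (hr : IsReal g) (hg : SobMem 0 g) :
    MemLp (toFn g) 2 (torusMeasure n) ∧ coeff (toFn g) = g := by
  have hm : Memℓp g 2 := memlp_two_iff.mpr hg
  set F : Lp ℂ 2 (torusMeasure n) :=
    (UnitAddTorus.mFourierBasis (d := Fin n)).repr.symm ⟨g, hm⟩ with hF
  have ht : toFn g = fun x => (F x).re := by
    rw [toFn, dif_pos hm]
  have hFm : MemLp F 2 (torusMeasure n) := Lp.memLp F
  have hcF : ∀ ξ, ∫ x, UnitAddTorus.mFourier (-ξ) x * F x ∂(torusMeasure n) = g ξ := by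
    intro ξ
    have h1 : (UnitAddTorus.mFourierBasis (d := Fin n)).repr F = ⟨g, hm⟩ := by
      rw [hF]; exact LinearIsometryEquiv.apply_symm_apply _ _
    have h2 := UnitAddTorus.mFourierBasis_repr F ξ
    rw [h1] at h2
    exact h2.symm
  have hint : Integrable F (torusMeasure n) := hFm.integrable (by norm_num)
  -- By the reality condition F and its conjugate have the same coefficients, so the real part taken
  -- in `toFn` loses nothing.
  have hcC : ∀ ξ, ∫ x, UnitAddTorus.mFourier (-ξ) x * conj (F x) ∂(torusMeasure n) = g ξ := by
    intro ξ
    have h1 := congrArg conj (hcF (-ξ))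
    rw [← integral_conj, hr, Complex.conj_conj] at h1
    rw [← h1]
    congr 1; ext x
    rw [map_mul, ← UnitAddTorus.mFourier_neg, neg_neg]
  rw [ht]
  refine ⟨hFm.re, ?_⟩
  ext ξ
  rw [coeff_apply]
  have hc : Integrable (fun x => conj (F x)) (torusMeasure n) :=
    (LinearIsometryEquiv.integrable_comp_iff Complex.conjLIE).mpr hint
  have e : ∀ x, UnitAddTorus.mFourier (-ξ) x * (((F x).re : ℝ) : ℂ) =
      (1 / 2 : ℂ) * (UnitAddTorus.mFourier (-ξ) x * F x +
        UnitAddTorus.mFourier (-ξ) x * conj (F x)) := by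
    intro x
    rw [Complex.re_eq_add_conj]; ring
  simp only [e]
  rw [integral_const_mul, integral_add (integrable_mFourier_mul hint _) (integrable_mFourier_mul hc _), hcF, hcC]
  ring

lemma toFn_memLp {g : PDistr n} (hr : IsReal g) (hg : SobMem 0 g) :
    MemLp (toFn g) 2 (torusMeasure n) := (toFn_spec hr hg).1

lemma coeff_toFn {g : PDistr n} (hr : IsReal g) (hg : SobMem 0 g) : coeff (toFn g) = g :=
  (toFn_spec hr hg).2

lemma integral_toFn_sq {g : PDistr n} (hr : IsReal g) (hg : SobMem 0 g) :
    ∫ x, toFn g x ^ 2 ∂(torusMeasure n) = normSq 0 g := by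
  have h := hasSum_coeff_mul (toFn_memLp hr hg) (toFn_memLp hr hg)
  rw [coeff_toFn hr hg] at h
  have e : ∀ ξ, g ξ * g (-ξ) = ((‖g ξ‖ ^ 2 : ℝ) : ℂ) := fun ξ => by
    rw [hr, Complex.mul_conj, Complex.normSq_eq_norm_sq]
  simp only [e] at h
  rw [normSq_zero_eq, ((Complex.hasSum_ofReal).mp h).tsum_eq]
  congr 1; ext x; ring

/-- A linear relation between distributions becomes one between functions almost everywhere. It
makes the strain of a divergence-free field pointwise trace-free. -/
lemma sum_toFn_eq_zero {ι : Type*} (S : Finset ι) {f : ι → PDistr n}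
    (hr : ∀ i ∈ S, IsReal (f i)) (hf : ∀ i ∈ S, SobMem 0 (f i)) (h : ∑ i ∈ S, f i = 0) :
    ∀ᵐ x ∂(torusMeasure n), ∑ i ∈ S, toFn (f i) x = 0 := by
  have hi : ∀ i ∈ S, Integrable (toFn (f i)) (torusMeasure n) := fun i hi =>
    integrable_of_memLp (toFn_memLp (hr i hi) (hf i hi))
  refine ae_eq_zero_of_coeff_eq_zero (integrable_finsetSum _ hi) ?_
  rw [coeff_sum S hi, ← h]
  exact Finset.sum_congr rfl fun i hi => coeff_toFn (hr i hi) (hf i hi)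

/-- An integrable function with summable coefficients is essentially bounded. -/
lemma ae_norm_le_of_summable_coeff {a : Torus n → ℝ} (ha : Integrable a (torusMeasure n))
    (hs : Summable fun ξ => ‖coeff a ξ‖) :
    ∀ᵐ x ∂(torusMeasure n), ‖a x‖ ≤ ∑' ξ, ‖coeff a ξ‖ := by
  have hs0 : SobMem 0 (coeff a) := by
    have h1 : Memℓp (coeff a) 1 := by
      rw [memℓp_gen_iff (by norm_num)]
      simpa using hs
    exact memlp_two_iff.mp (h1.of_exponent_ge (by norm_num))
  have ht := toFn_spec (isReal_coeff a) hs0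
  have hsum : Summable fun ξ => coeff a ξ • (UnitAddTorus.mFourier ξ : C(Torus n, ℂ)) := by
    refine Summable.of_norm ?_
    simpa only [norm_smul, UnitAddTorus.mFourier_norm, mul_one] using hs
  -- The Fourier series converges uniformly to a continuous function G bounded by the ℓ¹ norm; a
  -- agrees with its real part almost everywhere because the coefficients coincide.
  set G : C(Torus n, ℂ) := ∑' ξ, coeff a ξ • (UnitAddTorus.mFourier ξ : C(Torus n, ℂ)) with hG
  have hGx : ∀ x, HasSum (fun ξ => coeff a ξ * UnitAddTorus.mFourier ξ x) (G x) := fun x => by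
    have := (ContinuousMap.evalCLM ℂ x).hasSum hsum.hasSum
    simpa using this
  have hGb : ∀ x, ‖G x‖ ≤ ∑' ξ, ‖coeff a ξ‖ := fun x => by
    rw [← (hGx x).tsum_eq]
    refine (norm_tsum_le_tsum_norm ?_).trans (le_of_eq ?_)
    · simpa [norm_mul, norm_mFourier_apply] using hs
    · simp [norm_mFourier_apply]
  have hGi : ∀ ξ, ∫ x, UnitAddTorus.mFourier (-ξ) x * G x ∂(torusMeasure n) = coeff a ξ := by
    intro ξ
    have h1 : HasSum (fun η => ∫ x, UnitAddTorus.mFourier (-ξ) x *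
        (coeff a η * UnitAddTorus.mFourier η x) ∂(torusMeasure n))
        (∫ x, UnitAddTorus.mFourier (-ξ) x * G x ∂(torusMeasure n)) := by
      have := hasSum_integral_of_summable_integral_norm (μ := torusMeasure n)
        (F := fun η x => UnitAddTorus.mFourier (-ξ) x * (coeff a η * UnitAddTorus.mFourier η x))
        (fun η => by
          refine integrable_mFourier_mul (Integrable.const_mul ?_ _) _
          exact (UnitAddTorus.mFourier η).continuous.integrable_of_hasCompactSupport
            (HasCompactSupport.of_compactSpace _))
        (by simpa [norm_mul, norm_mFourier_apply] using hs)
      have e : ∀ x, UnitAddTorus.mFourier (-ξ) x * G x = ∑' η, UnitAddTorus.mFourier (-ξ) x *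
          (coeff a η * UnitAddTorus.mFourier η x) := fun x => by
        rw [tsum_mul_left, (hGx x).tsum_eq]
      simp only [e]
      exact this
    refine h1.unique ?_
    convert hasSum_ite_eq ξ (coeff a ξ) using 1
    ext η
    have e : ∀ x, UnitAddTorus.mFourier (-ξ) x * (coeff a η * UnitAddTorus.mFourier η x) =
        coeff a η * UnitAddTorus.mFourier (-ξ + η) x := fun x => by
      rw [UnitAddTorus.mFourier_add]; ring
    simp only [e, integral_const_mul]
    have ho := UnitAddTorus.orthonormal_mFourier (d := Fin n)
    rw [orthonormal_iff_ite] at ho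
    have h2 := ho ξ η
    rw [L2.inner_def] at h2
    have h3 : ∫ x, UnitAddTorus.mFourier (-ξ + η) x ∂(torusMeasure n) = if ξ = η then 1 else 0 := by
      rw [← h2]
      refine integral_congr_ae ?_
      filter_upwards [UnitAddTorus.coeFn_mFourierLp 2 ξ, UnitAddTorus.coeFn_mFourierLp 2 η]
        with x h4 h5
      rw [h4, h5, UnitAddTorus.mFourier_add, UnitAddTorus.mFourier_neg]
      simp [RCLike.inner_apply, mul_comm]
    rw [h3]
    split_ifs with h6 h7 h7
    · rw [h7, mul_one]
    · exact absurd h6.symm h7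
    · exact absurd h7.symm h6
    · rw [mul_zero]
  have hGint : Integrable G (torusMeasure n) := G.continuous.integrable_of_hasCompactSupport
            (HasCompactSupport.of_compactSpace _)
  have hcre : coeff (fun x => (G x).re) = coeff a := by
    ext ξ
    rw [coeff_apply]
    have hc : Integrable (fun x => conj (G x)) (torusMeasure n) :=
      (LinearIsometryEquiv.integrable_comp_iff Complex.conjLIE).mpr hGint
    have e : ∀ x, UnitAddTorus.mFourier (-ξ) x * (((G x).re : ℝ) : ℂ) =
        (1 / 2 : ℂ) * (UnitAddTorus.mFourier (-ξ) x * G x +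
          UnitAddTorus.mFourier (-ξ) x * conj (G x)) := by
      intro x
      rw [Complex.re_eq_add_conj]; ring
    have hcC : ∫ x, UnitAddTorus.mFourier (-ξ) x * conj (G x) ∂(torusMeasure n) = coeff a ξ := by
      have h1 := congrArg conj (hGi (-ξ))
      rw [← integral_conj, isReal_coeff, Complex.conj_conj] at h1
      rw [← h1]
      congr 1; ext x
      rw [map_mul, ← UnitAddTorus.mFourier_neg, neg_neg]
    simp only [e]
    rw [integral_const_mul, integral_add (integrable_mFourier_mul hGint _) (integrable_mFourier_mul hc _), hGi, hcC]
    ring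
  have hz : (fun x => a x + -(G x).re) =ᵐ[torusMeasure n] 0 := by
    refine ae_eq_zero_of_coeff_eq_zero (ha.add hGint.re.neg) ?_
    have h1 : coeff (fun x => -(G x).re) = -coeff a := by
      rw [← hcre]
      ext ξ
      rw [Pi.neg_apply, coeff_apply, coeff_apply, ← integral_neg]
      congr 1; ext x; push_cast; ring
    rw [coeff_add ha (by exact hGint.re.neg), h1, add_neg_cancel]
  filter_upwards [hz] with x hx
  have : a x = (G x).re := by
    simp only [Pi.zero_apply] at hx; linarith
  rw [this]
  exact (Complex.abs_re_le_norm _).trans (hGb x)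

lemma memLp_bdd_mul {a e : Torus n → ℝ} (ha : Integrable a (torusMeasure n))
    (hs : Summable fun ξ => ‖coeff a ξ‖) (he : MemLp e 2 (torusMeasure n)) :
    MemLp a 2 (torusMeasure n) ∧ MemLp (fun x => a x * e x) 2 (torusMeasure n) := by
  have hb := ae_norm_le_of_summable_coeff ha hs
  refine ⟨MemLp.of_bound ha.aestronglyMeasurable _ hb, ?_⟩
  refine (he.const_mul (∑' ξ, ‖coeff a ξ‖)).of_le
    (ha.aestronglyMeasurable.mul he.aestronglyMeasurable) ?_
  filter_upwards [hb] with x hx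
  rw [norm_mul, norm_mul, Real.norm_of_nonneg (r := ∑' ξ, ‖coeff a ξ‖) (by positivity)]
  gcongr

/-- The integral `∫ a e e'` in terms of the Fourier coefficients. -/
lemma hasSum_integral_mul_toFn {a : Torus n → ℝ} (ha : Integrable a (torusMeasure n))
    (hs : Summable fun ξ => ‖coeff a ξ‖) {g h : PDistr n} (hgr : IsReal g) (hg : SobMem 0 g)
    (hhr : IsReal h) (hh : SobMem 0 h) :
    HasSum (fun ξ => conv (coeff a) g ξ * h (-ξ))
      ((∫ x, a x * toFn g x * toFn h x ∂(torusMeasure n) : ℝ) : ℂ) := by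
  have h1 := memLp_bdd_mul ha hs (toFn_memLp hgr hg)
  have h2 := hasSum_coeff_mul h1.2 (toFn_memLp hhr hh)
  rwa [coeff_mul h1.1 (toFn_memLp hgr hg), coeff_toFn hgr hg, coeff_toFn hhr hh] at h2

/-- The advection term in terms of the Fourier coefficients. -/
lemma advection_eq {u : VDistr n} (hr : ∀ i, IsReal (u i)) (h0 : ∀ i, SobMem 0 (u i))
    (hdr : ∀ i j, IsReal (pderiv j (u i))) (hd : ∀ i j, SobMem 0 (pderiv j (u i))) (i : Fin n) :
    advection u i = ∑ j, conv (u j) (pderiv j (u i)) := by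
  rw [advection, coeff_sum Finset.univ fun j _ =>
    MemLp.integrable_mul_two (toFn_memLp (hr j) (h0 j)) (toFn_memLp (hdr i j) (hd i j))]
  refine Finset.sum_congr rfl fun j _ => ?_
  rw [coeff_mul (toFn_memLp (hr j) (h0 j)) (toFn_memLp (hdr i j) (hd i j)),
    coeff_toFn (hr j) (h0 j), coeff_toFn (hdr i j) (hd i j)]

end

section

/-! ### Vector distributions -/

/-- All components are in `H^s`, without the reality condition. -/
def VSob (s : ℝ) (u : VDistr n) : Prop := ∀ i, SobMem s (u i)

/-- Real-valued divergence-free vector distributions with zero mean. -/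
structure Solenoidal (u : VDistr n) : Prop where
  real : ∀ i, IsReal (u i)
  mean : ∀ i, u i 0 = 0
  div : ∀ ξ : Fin n → ℤ, ∑ j, (ξ j : ℂ) * u j ξ = 0

lemma divergence_eq_zero_iff {u : VDistr n} :
    divergence u = 0 ↔ ∀ ξ : Fin n → ℤ, ∑ j, (ξ j : ℂ) * u j ξ = 0 := by
  have h2 : (2 * Real.pi * Complex.I : ℂ) ≠ 0 := by
    simp [Real.pi_ne_zero]
  have e : ∀ ξ, divergence u ξ = 2 * Real.pi * Complex.I * ∑ j, (ξ j : ℂ) * u j ξ := fun ξ => by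
    rw [divergence, Finset.sum_apply, Finset.mul_sum]
    exact Finset.sum_congr rfl fun j _ => by rw [pderiv]; ring
  constructor
  · intro h ξ
    have := congrFun h ξ
    rw [e] at this
    exact (mul_eq_zero.mp this).resolve_left h2
  · intro h
    ext ξ
    rw [e, h, mul_zero]
    rfl

lemma mem_VHsDotSigma_iff {s : ℝ} {u : VDistr n} :
    u ∈ VHsDotSigma n s ↔ Solenoidal u ∧ VSob s u := by
  constructor
  · rintro ⟨h1, h2⟩
    exact ⟨⟨fun i => (h1 i).1.1, fun i => (h1 i).2, divergence_eq_zero_iff.mp h2⟩,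
      fun i => (h1 i).1.2⟩
  · rintro ⟨h1, h2⟩
    exact ⟨fun i => ⟨⟨h1.real i, h2 i⟩, h1.mean i⟩, divergence_eq_zero_iff.mpr h1.div⟩

lemma IsReal.add {f g : PDistr n} (hf : IsReal f) (hg : IsReal g) : IsReal (f + g) := fun ξ => by
  rw [Pi.add_apply, Pi.add_apply, hf, hg, map_add]

lemma IsReal.sub {f g : PDistr n} (hf : IsReal f) (hg : IsReal g) : IsReal (f - g) := fun ξ => by
  rw [Pi.sub_apply, Pi.sub_apply, hf, hg, map_sub]

lemma IsReal.sum {ι : Type*} {S : Finset ι} {f : ι → PDistr n} (hf : ∀ i ∈ S, IsReal (f i)) :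
    IsReal (∑ i ∈ S, f i) := fun ξ => by
  rw [Finset.sum_apply, Finset.sum_apply, map_sum]
  exact Finset.sum_congr rfl fun i hi => hf i hi ξ

lemma IsReal.real_mul {g : PDistr n} (hg : IsReal g) {c : (Fin n → ℤ) → ℝ}
    (hc : ∀ ξ, c (-ξ) = c ξ) : IsReal fun ξ => (c ξ : ℂ) * g ξ := fun ξ => by
  change (c (-ξ) : ℂ) * g (-ξ) = _
  rw [map_mul, Complex.conj_ofReal, hc, hg]

lemma IsReal.pderiv {g : PDistr n} (hg : IsReal g) (j : Fin n) : IsReal (pderiv j g) := fun ξ => by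
  rw [PeriodicNS.pderiv, PeriodicNS.pderiv, hg]
  simp only [map_mul, Complex.conj_ofReal, Complex.conj_I, map_intCast, map_ofNat, Pi.neg_apply,
    Int.cast_neg]
  ring

/-- Multiplication of a vector distribution by a family of real numbers. -/
noncomputable def rmul (c : (Fin n → ℤ) → ℝ) (u : VDistr n) : VDistr n := fun i ξ => (c ξ : ℂ) * u i ξ

lemma Solenoidal.rmul {u : VDistr n} (hu : Solenoidal u) {c : (Fin n → ℤ) → ℝ}
    (hc : ∀ ξ, c (-ξ) = c ξ) : Solenoidal (rmul c u) where
  real i := (hu.real i).real_mul hc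
  mean i := by rw [PeriodicNS.rmul, hu.mean, mul_zero]
  div ξ := by
    have := hu.div ξ
    simp only [PeriodicNS.rmul]
    rw [← mul_zero ((c ξ : ℂ)), ← this, Finset.mul_sum]
    exact Finset.sum_congr rfl fun j _ => by ring

lemma Solenoidal.add {u w : VDistr n} (hu : Solenoidal u) (hw : Solenoidal w) :
    Solenoidal (u + w) where
  real i := (hu.real i).add (hw.real i)
  mean i := by rw [Pi.add_apply, Pi.add_apply, hu.mean, hw.mean, add_zero]
  div ξ := by
    simp only [Pi.add_apply, mul_add, Finset.sum_add_distrib]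
    rw [hu.div, hw.div, add_zero]

lemma Solenoidal.sub {u w : VDistr n} (hu : Solenoidal u) (hw : Solenoidal w) :
    Solenoidal (u - w) where
  real i := (hu.real i).sub (hw.real i)
  mean i := by rw [Pi.sub_apply, Pi.sub_apply, hu.mean, hw.mean, sub_zero]
  div ξ := by
    simp only [Pi.sub_apply, mul_sub, Finset.sum_sub_distrib]
    rw [hu.div, hw.div, sub_zero]

lemma VSob.add {s : ℝ} {u w : VDistr n} (hu : VSob s u) (hw : VSob s w) : VSob s (u + w) :=
  fun i => (hu i).add (hw i)

lemma VSob.sub {s : ℝ} {u w : VDistr n} (hu : VSob s u) (hw : VSob s w) : VSob s (u - w) :=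
  fun i => (hu i).sub (hw i)

lemma VSob.mono {s t : ℝ} {u : VDistr n} (hu : VSob t u) (h : s ≤ t) : VSob s u :=
  fun i => (hu i).mono h

lemma vNormSq_nonneg (s : ℝ) (u : VDistr n) : 0 ≤ vNormSq s u :=
  Finset.sum_nonneg fun i _ => normSq_nonneg s (u i)

lemma VSob.vNormSq_mono {s t : ℝ} {u : VDistr n} (hu : VSob t u) (h : s ≤ t) :
    vNormSq s u ≤ vNormSq t u :=
  Finset.sum_le_sum fun i _ => (hu i).normSq_mono h

lemma normSq_le_vNormSq (s : ℝ) (u : VDistr n) (i : Fin n) : normSq s (u i) ≤ vNormSq s u :=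
  Finset.single_le_sum (f := fun i => normSq s (u i)) (fun i _ => normSq_nonneg s (u i))
    (Finset.mem_univ i)

lemma VSob.hasSum {s : ℝ} {u : VDistr n} (hu : VSob s u) :
    HasSum (fun ξ => rho ξ ^ (2 * s) * ∑ i, ‖u i ξ‖ ^ 2) (vNormSq s u) := by
  have := hasSum_sum (s := Finset.univ) fun i _ => (hu i).hasSum
  simp only [Finset.mul_sum]
  exact this

lemma vSob_of_le {s t c : ℝ} {u w : VDistr n} (hw : VSob t w)
    (h : ∀ ξ, rho ξ ^ (2 * s) * ∑ i, ‖u i ξ‖ ^ 2 ≤ c * (rho ξ ^ (2 * t) * ∑ i, ‖w i ξ‖ ^ 2)) :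
    VSob s u ∧ vNormSq s u ≤ c * vNormSq t w := by
  have hs := hw.hasSum.mul_left c
  have h1 : VSob s u := fun i => Summable.of_nonneg_of_le (weight_nonneg s (u i))
    (fun ξ => le_trans (mul_le_mul_of_nonneg_left
      (Finset.single_le_sum (f := fun i => ‖u i ξ‖ ^ 2) (fun _ _ => sq_nonneg _)
        (Finset.mem_univ i)) (Real.rpow_pos_of_pos (rho_pos ξ) _).le) (h ξ)) hs.summable
  exact ⟨h1, hasSum_le h h1.hasSum hs⟩

/-- The real inner product of `H^s`. -/
noncomputable def vin (s : ℝ) (u w : VDistr n) : ℝ :=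
  ∑ i, ∑' ξ, rho ξ ^ (2 * s) * (u i ξ * conj (w i ξ)).re

lemma SobMem.summable_inner {a b s : ℝ} (h : a + b = 2 * s) {f g : PDistr n} (hf : SobMem a f)
    (hg : SobMem b g) : Summable fun ξ => rho ξ ^ (2 * s) * (f ξ * conj (g ξ)).re := by
  refine Summable.of_norm_bounded (hf.cauchySchwarz h hg).1 fun ξ => ?_
  rw [norm_mul, Real.norm_of_nonneg (Real.rpow_pos_of_pos (rho_pos ξ) _).le]
  refine mul_le_mul_of_nonneg_left ?_ (Real.rpow_pos_of_pos (rho_pos ξ) _).le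
  refine (Complex.abs_re_le_norm _).trans (le_of_eq ?_)
  rw [norm_mul, RCLike.norm_conj]

/-- The inner product of H^s extends to a duality of H^a and H^b whenever a + b = 2s; the typical
use pairs H^{s-1} with H^{s+1}. -/
lemma abs_vin_le {a b s : ℝ} (h : a + b = 2 * s) {u w : VDistr n} (hu : VSob a u) (hw : VSob b w) :
    |vin s u w| ≤ √(vNormSq a u) * √(vNormSq b w) := by
  have h1 : ∀ i, |∑' ξ, rho ξ ^ (2 * s) * (u i ξ * conj (w i ξ)).re| ≤
      √(normSq a (u i)) * √(normSq b (w i)) := fun i => by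
    have hc := (hu i).cauchySchwarz h (hw i)
    refine le_trans ?_ hc.2
    refine tsum_of_norm_bounded (f := fun ξ => rho ξ ^ (2 * s) * (u i ξ * conj (w i ξ)).re)
      hc.1.hasSum fun ξ => ?_
    rw [norm_mul, Real.norm_of_nonneg (Real.rpow_pos_of_pos (rho_pos ξ) _).le]
    refine mul_le_mul_of_nonneg_left ?_ (Real.rpow_pos_of_pos (rho_pos ξ) _).le
    refine (Complex.abs_re_le_norm _).trans (le_of_eq ?_)
    rw [norm_mul, RCLike.norm_conj]
  calc _ ≤ ∑ i, √(normSq a (u i)) * √(normSq b (w i)) :=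
        (Finset.abs_sum_le_sum_abs _ _).trans (Finset.sum_le_sum fun i _ => h1 i)
    _ ≤ _ := Real.sum_sqrt_mul_sqrt_le _ (fun i => normSq_nonneg a (u i))
        fun i => normSq_nonneg b (w i)

lemma vin_self (s : ℝ) (u : VDistr n) : vin s u u = vNormSq s u := by
  refine Finset.sum_congr rfl fun i _ => ?_
  rw [normSq]
  congr 1; ext ξ
  rw [Complex.mul_conj, Complex.ofReal_re, Complex.normSq_eq_norm_sq]

lemma vin_comm (s : ℝ) (u w : VDistr n) : vin s u w = vin s w u := by
  refine Finset.sum_congr rfl fun i _ => ?_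
  congr 1; ext ξ
  rw [← Complex.conj_re, map_mul, Complex.conj_conj, mul_comm (conj _)]

lemma vin_add_left {a b s : ℝ} (h : a + b = 2 * s) {u u' w : VDistr n} (hu : VSob a u)
    (hu' : VSob a u') (hw : VSob b w) : vin s (u + u') w = vin s u w + vin s u' w := by
  rw [vin, vin, vin, ← Finset.sum_add_distrib]
  refine Finset.sum_congr rfl fun i _ => ?_
  rw [← ((hu i).summable_inner h (hw i)).tsum_add ((hu' i).summable_inner h (hw i))]
  congr 1; ext ξ
  rw [Pi.add_apply, Pi.add_apply, add_mul, Complex.add_re, mul_add]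

lemma vin_smul_left (s c : ℝ) (u w : VDistr n) : vin s (rmul (fun _ => c) u) w = c * vin s u w := by
  rw [vin, vin, Finset.mul_sum]
  refine Finset.sum_congr rfl fun i _ => ?_
  rw [← tsum_mul_left]
  congr 1; ext ξ
  rw [rmul, mul_assoc, Complex.re_ofReal_mul]
  ring

lemma VSob.smul {s : ℝ} {u : VDistr n} (hu : VSob s u) (c : ℝ) : VSob s (rmul (fun _ => c) u) :=
  fun i => (hu i).const_mul c

lemma vNormSq_smul (s c : ℝ) (u : VDistr n) :
    vNormSq s (rmul (fun _ => c) u) = c ^ 2 * vNormSq s u := by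
  rw [vNormSq, vNormSq, Finset.mul_sum]
  refine Finset.sum_congr rfl fun i _ => ?_
  have := normSq_const_mul s (u i) c
  rw [Complex.norm_real, Real.norm_eq_abs, sq_abs] at this
  exact this

lemma vNormSq_add_eq {s : ℝ} {u w : VDistr n} (hu : VSob s u) (hw : VSob s w) :
    vNormSq s (u + w) = vNormSq s u + 2 * vin s u w + vNormSq s w := by
  have h : s + s = 2 * s := by ring
  rw [← vin_self, vin_add_left h hu hw (hu.add hw), vin_comm s u, vin_comm s w,
    vin_add_left h hu hw hu, vin_add_left h hu hw hw, vin_self, vin_self, vin_comm s w u]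
  ring

/-- The parallelogram law with the norm of the difference dropped. -/
lemma vNormSq_add_le {s : ℝ} {u w : VDistr n} (hu : VSob s u) (hw : VSob s w) :
    vNormSq s (u + w) ≤ 2 * (vNormSq s u + vNormSq s w) := by
  have h1 := vNormSq_add_eq hu hw
  have h2 := vNormSq_add_eq hu (hw.smul (-1))
  have h3 := vNormSq_nonneg s (u + rmul (fun _ => -1) w)
  rw [vin_comm, vin_smul_left, vin_comm, vNormSq_smul] at h2
  linarith

lemma sub_eq_add_rmul (u w : VDistr n) : u - w = u + rmul (fun _ => -1) w := by
  ext i ξ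
  simp [rmul, sub_eq_add_neg]

lemma vNormSq_sub_le {s : ℝ} {u w : VDistr n} (hu : VSob s u) (hw : VSob s w) :
    vNormSq s (u - w) ≤ 2 * (vNormSq s u + vNormSq s w) := by
  have := vNormSq_add_le hu (hw.smul (-1))
  rwa [vNormSq_smul, ← sub_eq_add_rmul, neg_one_sq, one_mul] at this

/-- The weight `ϱ ^ s` on vector distributions. -/
noncomputable def vlam (s : ℝ) (u : VDistr n) : VDistr n := fun i => lam s (u i)

lemma vSob_vlam {s t : ℝ} {u : VDistr n} : VSob t (vlam s u) ↔ VSob (s + t) u :=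
  forall_congr' fun _ => sobMem_lam

lemma vNormSq_vlam (s t : ℝ) (u : VDistr n) : vNormSq t (vlam s u) = vNormSq (s + t) u :=
  Finset.sum_congr rfl fun i _ => normSq_lam s t (u i)

lemma Solenoidal.vlam {u : VDistr n} (hu : Solenoidal u) (s : ℝ) : Solenoidal (vlam s u) :=
  hu.rmul (c := fun ξ => rho ξ ^ s) fun ξ => by rw [rho_neg]

/-- Powers of the weight move between the argument and the order of the product; for r = 1 the
pairing of Λ²w in H^{s-1} is that of w in H^s. -/
lemma vin_vlam (r s : ℝ) (u w : VDistr n) : vin s (vlam (2 * r) u) w = vin (r + s) u w := by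
  refine Finset.sum_congr rfl fun i _ => ?_
  congr 1; ext ξ
  rw [vlam, lam, mul_assoc, Complex.re_ofReal_mul, ← mul_assoc, ← Real.rpow_add (rho_pos ξ)]
  congr 2
  ring

/-! ### The Leray projector -/

lemma leray_zero (F : VDistr n) (i : Fin n) : leray F i 0 = 0 := by simp [leray]

lemma freqNorm_sq_cast (ξ : Fin n → ℤ) : (freqNorm ξ : ℂ) ^ 2 = ∑ j, (ξ j : ℂ) * ξ j := by
  have := freqNorm_sq ξ
  rw [← Complex.ofReal_pow, this]
  push_cast
  exact Finset.sum_congr rfl fun j _ => by ring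

lemma freqNorm_sq_ne_zero {ξ : Fin n → ℤ} (h : ξ ≠ 0) : (freqNorm ξ : ℂ) ^ 2 ≠ 0 := by
  have := one_le_freqNorm h
  exact pow_ne_zero 2 (Complex.ofReal_ne_zero.mpr (by linarith))

lemma leray_div (F : VDistr n) (ξ : Fin n → ℤ) : ∑ j, (ξ j : ℂ) * leray F j ξ = 0 := by
  by_cases h : ξ = 0
  · simp [h]
  · have h1 := freqNorm_sq_ne_zero h
    simp only [leray, if_neg h, mul_sub, Finset.sum_sub_distrib]
    rw [sub_eq_zero]
    have : ∀ j, (ξ j : ℂ) * ((ξ j : ℂ) * (∑ j, (ξ j : ℂ) * F j ξ) / (freqNorm ξ : ℂ) ^ 2) =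
        ((ξ j : ℂ) * ξ j) * ((∑ j, (ξ j : ℂ) * F j ξ) / (freqNorm ξ : ℂ) ^ 2) := fun j => by ring
    simp only [this]
    rw [← Finset.sum_mul, ← freqNorm_sq_cast, mul_div_cancel₀ _ h1]

lemma leray_real {F : VDistr n} (hF : ∀ i, IsReal (F i)) (i : Fin n) : IsReal (leray F i) := by
  intro ξ
  by_cases h : ξ = 0
  · simp [leray, h]
  · simp only [leray, neg_eq_zero, if_neg h, map_sub, map_div₀, map_mul, map_sum, map_pow,
      Complex.conj_ofReal, freqNorm_neg, hF _ ξ, Pi.neg_apply, Int.cast_neg, map_intCast]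
    congr 2
    rw [neg_mul, ← mul_neg, ← Finset.sum_neg_distrib]
    simp

lemma solenoidal_leray {F : VDistr n} (hF : ∀ i, IsReal (F i)) : Solenoidal (leray F) :=
  ⟨leray_real hF, leray_zero F, leray_div F⟩

lemma leray_of_solenoidal {F : VDistr n} (hF : Solenoidal F) : leray F = F := by
  ext i ξ
  by_cases h : ξ = 0
  · rw [h, leray_zero, hF.mean]
  · rw [leray, if_neg h, hF.div]
    simp

lemma leray_add (F G : VDistr n) : leray (F + G) = leray F + leray G := by
  ext i ξ
  by_cases h : ξ = 0
  · simp [leray, h]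
  · simp only [leray, if_neg h, Pi.add_apply, mul_add, Finset.sum_add_distrib]
    ring

lemma leray_sub (F G : VDistr n) : leray (F - G) = leray F - leray G := by
  ext i ξ
  by_cases h : ξ = 0
  · simp [leray, h]
  · simp only [leray, if_neg h, Pi.sub_apply, mul_sub, Finset.sum_sub_distrib]
    ring

/-- The Leray projector does not change the product with a divergence-free vector. -/
lemma leray_mul_eq (F : VDistr n) {ξ : Fin n → ℤ} {w : Fin n → ℂ} (h0 : ξ = 0 → w = 0)
    (hw : ∑ j, (ξ j : ℂ) * w j = 0) : ∑ i, leray F i ξ * w i = ∑ i, F i ξ * w i := by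
  by_cases h : ξ = 0
  · simp [h0 h]
  · simp only [leray, if_neg h, sub_mul, Finset.sum_sub_distrib]
    have : ∀ j, (ξ j : ℂ) * (∑ j, (ξ j : ℂ) * F j ξ) / (freqNorm ξ : ℂ) ^ 2 * w j =
        ((ξ j : ℂ) * w j) * ((∑ j, (ξ j : ℂ) * F j ξ) / (freqNorm ξ : ℂ) ^ 2) := fun j => by ring
    simp only [this]
    rw [← Finset.sum_mul, hw, zero_mul, sub_zero]

lemma Solenoidal.div_neg {w : VDistr n} (hw : Solenoidal w) (ξ : Fin n → ℤ) :
    ∑ j, (ξ j : ℂ) * w j (-ξ) = 0 := by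
  have := hw.div (-ξ)
  simp only [Pi.neg_apply, Int.cast_neg, neg_mul, Finset.sum_neg_distrib, neg_eq_zero] at this
  exact this

lemma leray_pair (F : VDistr n) {w : VDistr n} (hw : Solenoidal w) (ξ : Fin n → ℤ) :
    ∑ i, leray F i ξ * w i (-ξ) = ∑ i, F i ξ * w i (-ξ) :=
  leray_mul_eq F (w := fun i => w i (-ξ)) (fun h => by ext i; simp [h, hw.mean]) (hw.div_neg ξ)

lemma leray_pair_conj (F : VDistr n) {w : VDistr n} (hw : Solenoidal w) (ξ : Fin n → ℤ) :
    ∑ i, leray F i ξ * conj (w i ξ) = ∑ i, F i ξ * conj (w i ξ) := by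
  have := leray_pair F hw ξ
  simpa only [hw.real _ ξ] using this

/-- Pythagoras at each frequency: the part removed by the projector is parallel to ξ and orthogonal
to the rest. -/
lemma leray_norm_le (F : VDistr n) (ξ : Fin n → ℤ) :
    ∑ i, ‖leray F i ξ‖ ^ 2 ≤ ∑ i, ‖F i ξ‖ ^ 2 := by
  by_cases h : ξ = 0
  · rw [h]
    simp only [leray_zero]
    simpa using Finset.sum_nonneg fun i _ => sq_nonneg ‖F i 0‖
  · set c := (∑ j, (ξ j : ℂ) * F j ξ) / (freqNorm ξ : ℂ) ^ 2
    have e : ∀ i, F i ξ = leray F i ξ + (ξ i : ℂ) * c := fun i => by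
      rw [leray, if_neg h]; ring
    have e2 : ∀ i, ‖F i ξ‖ ^ 2 = ‖leray F i ξ‖ ^ 2 + ‖(ξ i : ℂ) * c‖ ^ 2 +
        2 * ((ξ i * leray F i ξ) * conj c).re := fun i => by
      rw [e i, ← Complex.normSq_eq_norm_sq, Complex.normSq_add, Complex.normSq_eq_norm_sq,
        Complex.normSq_eq_norm_sq, map_mul]
      congr 3
      simp
      ring
    have e3 : ∑ i, ((ξ i * leray F i ξ) * conj c).re = 0 := by
      rw [← Complex.re_sum, ← Finset.sum_mul, leray_div, zero_mul, Complex.zero_re]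
    rw [Finset.sum_congr rfl fun i _ => e2 i, Finset.sum_add_distrib, ← Finset.mul_sum, e3,
      mul_zero, add_zero, Finset.sum_add_distrib]
    exact le_add_of_nonneg_right (Finset.sum_nonneg fun i _ => sq_nonneg _)

lemma VSob.leray {s : ℝ} {F : VDistr n} (hF : VSob s F) :
    VSob s (leray F) ∧ vNormSq s (leray F) ≤ vNormSq s F := by
  have := vSob_of_le (s := s) (t := s) (c := 1) (u := PeriodicNS.leray F) hF fun ξ => by
    rw [one_mul]
    exact mul_le_mul_of_nonneg_left (leray_norm_le F ξ) (Real.rpow_pos_of_pos (rho_pos ξ) _).le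
  rwa [one_mul] at this

lemma vin_leray {a b s : ℝ} (h : a + b = 2 * s) {F w : VDistr n} (hF : VSob a F) (hw : VSob b w)
    (hw' : Solenoidal w) : vin s (leray F) w = vin s F w := by
  have key : ∀ G : VDistr n, VSob a G → vin s G w =
      ∑' ξ, rho ξ ^ (2 * s) * (∑ i, G i ξ * conj (w i ξ)).re := fun G hG => by
    rw [vin, ← Summable.tsum_finsetSum fun i _ => (hG i).summable_inner h (hw i)]
    congr 1; ext ξ
    rw [Complex.re_sum, Finset.mul_sum]
  rw [key _ hF.leray.1, key F hF]
  congr 1; ext ξ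
  rw [leray_pair_conj F hw']

/-! ### The advection operator in divergence form -/

/-- The operator `(u, w) ↦ ∂_j (u_j w)`. -/
noncomputable def bop (u w : VDistr n) : VDistr n := fun i => ∑ j, pderiv j (conv (u j) (w i))

lemma norm_pderiv_le (j : Fin n) (g : PDistr n) (ξ : Fin n → ℤ) :
    ‖pderiv j g ξ‖ ≤ rho ξ * ‖g ξ‖ := by
  rw [pderiv, norm_mul]
  refine mul_le_mul_of_nonneg_right ?_ (norm_nonneg _)
  have := two_pi_abs_le ξ j
  simpa [abs_of_pos Real.pi_pos] using this

lemma pderiv_weight (s : ℝ) (j : Fin n) (g : PDistr n) (ξ : Fin n → ℤ) :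
    rho ξ ^ (2 * s) * ‖pderiv j g ξ‖ ^ 2 ≤ rho ξ ^ (2 * (s + 1)) * ‖g ξ‖ ^ 2 := by
  have h1 := norm_pderiv_le j g ξ
  have h2 := Real.rpow_pos_of_pos (rho_pos ξ) (2 * s)
  have e : rho ξ ^ (2 * (s + 1)) = rho ξ ^ (2 * s) * rho ξ ^ 2 := by
    rw [← Real.rpow_natCast, ← Real.rpow_add (rho_pos ξ)]; congr 1; push_cast; ring
  rw [e, mul_assoc, ← mul_pow]
  gcongr

lemma SobMem.pderiv {s : ℝ} {g : PDistr n} (hg : SobMem (s + 1) g) (j : Fin n) :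
    SobMem s (pderiv j g) ∧ normSq s (pderiv j g) ≤ normSq (s + 1) g := by
  have := SobMem.of_norm_le (s := s) (c := 1) (f := PeriodicNS.pderiv j g) hg fun ξ => by
    rw [one_mul]; exact pderiv_weight s j g ξ
  rwa [one_mul] at this

lemma bop_real {u w : VDistr n} (hu : ∀ i, IsReal (u i)) (hw : ∀ i, IsReal (w i)) (i : Fin n) :
    IsReal (bop u w i) :=
  IsReal.sum fun j _ => ((hu j).conv (hw i)).pderiv j

/-- The estimate of the advection operator by products. -/
lemma bop_bound {s : ℝ} {u w : VDistr n} {B : ℝ}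
    (h : ∀ i j, SobMem (s + 1) (conv (u j) (w i)) ∧ normSq (s + 1) (conv (u j) (w i)) ≤ B) :
    VSob s (bop u w) ∧ vNormSq s (bop u w) ≤ n ^ 3 * B := by
  refine ⟨fun i => SobMem.sum fun j _ => ((h i j).1.pderiv j).1, ?_⟩
  calc vNormSq s (bop u w) ≤ ∑ _i : Fin n, (n : ℝ) * ∑ _j : Fin n, B := by
        refine Finset.sum_le_sum fun i _ => ?_
        have := normSq_sum_le (S := Finset.univ) fun j _ => ((h i j).1.pderiv j).1
        rw [Finset.card_univ, Fintype.card_fin] at this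
        refine this.trans ?_
        gcongr with j
        exact ((h i j).1.pderiv j).2.trans (h i j).2
    _ = _ := by simp; ring

/-- In divergence form all factors are undifferentiated, so the product estimate applies to the
fields themselves and one order is lost at the very end. -/
lemma bop_le_of_conv (hn : 0 < n) {α β γ : ℝ} (hα : α < (n : ℝ) / 2) (hβ : β < (n : ℝ) / 2)
    (hγ : γ < (n : ℝ) / 2) (h : α + β + γ = (n : ℝ) / 2) :
    ∃ C : ℝ, 0 < C ∧ ∀ u w : VDistr n, VSob α u → VSob β w →
      VSob (-γ - 1) (bop u w) ∧ vNormSq (-γ - 1) (bop u w) ≤ C * (vNormSq α u * vNormSq β w) := by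
  obtain ⟨C, hC, hc⟩ := sob_conv_le hn hα hβ hγ h
  refine ⟨n ^ 3 * C, by positivity, fun u w hu hw => ?_⟩
  rw [mul_assoc]
  refine bop_bound fun i j => ?_
  rw [sub_add_cancel]
  refine ⟨(hc _ _ (hu j) (hw i)).1, (hc _ _ (hu j) (hw i)).2.trans ?_⟩
  have := normSq_nonneg α (u j)
  have := normSq_nonneg β (w i)
  have := vNormSq_nonneg α u
  gcongr
  · exact normSq_le_vNormSq α u j
  · exact normSq_le_vNormSq β w i

lemma bop_sub_left {u u' w : VDistr n} (hu : VSob 0 u) (hu' : VSob 0 u') (hw : VSob 0 w) :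
    bop (u - u') w = bop u w - bop u' w := by
  ext i ξ
  simp only [bop, Pi.sub_apply, Finset.sum_apply, ← Finset.sum_sub_distrib]
  refine Finset.sum_congr rfl fun j _ => ?_
  rw [conv_sub_left (hu j) (hu' j) (hw i), pderiv, pderiv, pderiv, Pi.sub_apply]
  ring

lemma bop_sub_right {u w w' : VDistr n} (hu : VSob 0 u) (hw : VSob 0 w) (hw' : VSob 0 w') :
    bop u (w - w') = bop u w - bop u w' := by
  ext i ξ
  simp only [bop, Pi.sub_apply, Finset.sum_apply, ← Finset.sum_sub_distrib]
  refine Finset.sum_congr rfl fun j _ => ?_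
  rw [conv_sub_right (hu j) (hw i) (hw' i), pderiv, pderiv, pderiv, Pi.sub_apply]
  ring

/-- For divergence-free fields the advection term is `∂_j (u_j u)`. -/
lemma advection_eq_bop {u : VDistr n} (hu : Solenoidal u) (h1 : VSob 1 u) :
    advection u = bop u u := by
  have h0 : VSob 0 u := h1.mono zero_le_one
  have hd : ∀ i j, SobMem 0 (pderiv j (u i)) := fun i j =>
    (SobMem.pderiv (s := 0) (by simpa using h1 i) j).1
  ext i ξ
  rw [advection_eq hu.real h0 (fun i j => (hu.real i).pderiv j) hd, bop, Finset.sum_apply,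
    Finset.sum_apply]
  rw [← sub_eq_zero, ← Finset.sum_sub_distrib]
  -- The frequency ξ_j - η_j belongs to the factor u_j; summed over j, the difference of the two
  -- forms is the convolution of div u with u_i.
  have e : ∀ j, conv (u j) (pderiv j (u i)) ξ - pderiv j (conv (u j) (u i)) ξ =
      ∑' η, -(2 * Real.pi * Complex.I) * ((((ξ - η) j : ℤ) : ℂ) * u j (ξ - η)) * u i η := fun j => by
    rw [pderiv, conv, conv, ← tsum_mul_left, ← ((h0 j).summable_conv (hd i j) ξ).tsum_sub
      (((h0 j).summable_conv (h0 i) ξ).mul_left _)]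
    congr 1; ext η
    rw [pderiv, Pi.sub_apply]
    push_cast; ring
  have hs : ∀ j, Summable fun η => -(2 * Real.pi * Complex.I) *
      ((((ξ - η) j : ℤ) : ℂ) * u j (ξ - η)) * u i η := fun j => by
    refine (((h0 j).summable_conv (hd i j) ξ).sub
      (((h0 j).summable_conv (h0 i) ξ).mul_left (2 * Real.pi * Complex.I * (ξ j : ℂ)))).congr
      fun η => ?_
    rw [pderiv, Pi.sub_apply]
    push_cast; ring
  rw [Finset.sum_congr rfl fun j _ => e j, ← Summable.tsum_finsetSum fun j _ => hs j]
  have : ∀ η, ∑ j, -(2 * Real.pi * Complex.I) * ((((ξ - η) j : ℤ) : ℂ) * u j (ξ - η)) * u i η = 0 :=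
    fun η => by rw [← Finset.sum_mul, ← Finset.mul_sum, hu.div, mul_zero, zero_mul]
  simp only [this, tsum_zero]

/-- The advection of a divergence-free field has zero mean. -/
lemma bop_zero (u w : VDistr n) (i : Fin n) : bop u w i 0 = 0 := by
  simp [bop, pderiv]

end

section

/-! ### The viscosity operator at a fixed time -/

/-- The Fourier coefficients of a viscosity tensor at a fixed time. -/
abbrev CTensor (n : ℕ) : Type := Fin n → Fin n → Fin n → Fin n → PDistr n

/-- Bounds for the coefficients of a viscosity tensor. -/
structure CTensor.Bounded (A : CTensor n) (r K : ℝ) : Prop where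
  real : ∀ k j α β, IsReal (A k j α β)
  mem : ∀ k j α β, SobMem 0 (A k j α β)
  summable : ∀ k j α β, WSummable r (A k j α β)
  le : ∀ k j α β, wsum r (A k j α β) ≤ K

/-- The stress `a_{ij}^{αβ} E_{jβ}(u)`. -/
noncomputable def flux (A : CTensor n) (u : VDistr n) (i α : Fin n) : PDistr n :=
  ∑ p : Fin n × Fin n, conv (A i p.1 α p.2) (strain u p.1 p.2)

/-- The operator `-𝔏`. -/
noncomputable def lop (A : CTensor n) (u : VDistr n) : VDistr n := fun i =>
  ∑ α, (-(1 / 2) : ℂ) • pderiv α (flux A u i α + flux A u α i)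

lemma strain_comm (u : VDistr n) (j β : Fin n) : strain u j β = strain u β j := by
  rw [strain, strain, add_comm]

lemma strain_apply (u : VDistr n) (j β : Fin n) (ξ : Fin n → ℤ) :
    strain u j β ξ = Real.pi * Complex.I * ((ξ j : ℂ) * u β ξ + (ξ β : ℂ) * u j ξ) := by
  simp only [strain, pderiv, Pi.smul_apply, Pi.add_apply, smul_eq_mul]
  ring

lemma strain_real {u : VDistr n} (hu : ∀ i, IsReal (u i)) (j β : Fin n) :
    IsReal (strain u j β) := by
  have h := ((hu β).pderiv j).add ((hu j).pderiv β)
  have := h.real_mul (c := fun _ => 1 / 2) fun _ => rfl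
  convert this using 1
  ext ξ
  simp [strain]

lemma strain_vlam (s : ℝ) (u : VDistr n) (j β : Fin n) :
    strain (vlam s u) j β = lam s (strain u j β) := by
  ext ξ
  simp only [strain_apply, vlam, lam]
  ring

lemma strain_sub (u w : VDistr n) (j β : Fin n) :
    strain (u - w) j β = strain u j β - strain w j β := by
  ext ξ
  simp only [strain_apply, Pi.sub_apply]
  ring

lemma norm_half_smul_add_le (f g : PDistr n) (ξ : Fin n → ℤ) (c : ℂ) (hc : ‖c‖ = 1 / 2) :
    ‖(c • (f + g)) ξ‖ ^ 2 ≤ (1 / 2) * (‖f ξ‖ ^ 2 + ‖g ξ‖ ^ 2) := by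
  rw [Pi.smul_apply, Pi.add_apply, norm_smul, hc, mul_pow]
  have := norm_add_le (f ξ) (g ξ)
  have : ‖f ξ + g ξ‖ ^ 2 ≤ (‖f ξ‖ + ‖g ξ‖) ^ 2 := by gcongr
  nlinarith [sq_nonneg (‖f ξ‖ - ‖g ξ‖)]

lemma half_smul_add_bound {s : ℝ} {f g : PDistr n} (hf : SobMem s f) (hg : SobMem s g) {c : ℂ}
    (hc : ‖c‖ = 1 / 2) : SobMem s (c • (f + g)) ∧
      normSq s (c • (f + g)) ≤ (1 / 2) * (normSq s f + normSq s g) := by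
  have hsum := (Summable.add hf hg).mul_left (1 / 2)
  have hle : ∀ ξ, rho ξ ^ (2 * s) * ‖(c • (f + g)) ξ‖ ^ 2 ≤
      (1 / 2) * (rho ξ ^ (2 * s) * ‖f ξ‖ ^ 2 + rho ξ ^ (2 * s) * ‖g ξ‖ ^ 2) := fun ξ => by
    have h2 := Real.rpow_pos_of_pos (rho_pos ξ) (2 * s)
    rw [← mul_add, mul_left_comm]
    exact mul_le_mul_of_nonneg_left (norm_half_smul_add_le f g ξ c hc) h2.le
  have h1 : SobMem s (c • (f + g)) := Summable.of_nonneg_of_le (weight_nonneg s _) hle hsum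
  refine ⟨h1, ?_⟩
  rw [normSq, normSq, normSq, ← Summable.tsum_add hf hg, ← tsum_mul_left]
  exact h1.tsum_le_tsum hle hsum

lemma strain_bound {s : ℝ} {u : VDistr n} (hu : VSob (s + 1) u) (j β : Fin n) :
    SobMem s (strain u j β) ∧ normSq s (strain u j β) ≤ vNormSq (s + 1) u := by
  have h1 := (hu β).pderiv j
  have h2 := (hu j).pderiv β
  have h3 := half_smul_add_bound h1.1 h2.1 (c := 1 / 2) (by simp)
  refine ⟨h3.1, h3.2.trans ?_⟩
  have := normSq_le_vNormSq (s + 1) u j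
  have := normSq_le_vNormSq (s + 1) u β
  linarith [h1.2, h2.2]

lemma flux_bound {A : CTensor n} {r K s : ℝ} (hA : A.Bounded r K) (hs : |s| ≤ r) {u : VDistr n}
    (hu : VSob (s + 1) u) (i α : Fin n) :
    SobMem s (flux A u i α) ∧ normSq s (flux A u i α) ≤ n ^ 4 * K ^ 2 * vNormSq (s + 1) u := by
  have h1 : ∀ p : Fin n × Fin n, SobMem s (conv (A i p.1 α p.2) (strain u p.1 p.2)) ∧
      normSq s (conv (A i p.1 α p.2) (strain u p.1 p.2)) ≤ K ^ 2 * vNormSq (s + 1) u := fun p => by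
    have hw := (hA.summable i p.1 α p.2).mono hs
    have h2 := normSq_conv_le s hw.1 (strain_bound hu p.1 p.2).1
    refine ⟨h2.1, h2.2.trans ?_⟩
    have h3 := wsum_nonneg |s| (A i p.1 α p.2)
    have h4 := (hw.2).trans (hA.le i p.1 α p.2)
    have h5 := normSq_nonneg s (strain u p.1 p.2)
    have h6 := (strain_bound hu p.1 p.2).2
    gcongr
  refine ⟨SobMem.sum fun p _ => (h1 p).1, ?_⟩
  refine (normSq_sum_le fun p _ => (h1 p).1).trans ?_
  calc _ ≤ ((Finset.univ : Finset (Fin n × Fin n)).card : ℝ) *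
        ∑ _p : Fin n × Fin n, K ^ 2 * vNormSq (s + 1) u := by
        gcongr with p
        exact (h1 p).2
    _ = _ := by simp; ring

lemma lop_real {A : CTensor n} {r K : ℝ} (hA : A.Bounded r K) {u : VDistr n}
    (hu : ∀ i, IsReal (u i)) (i : Fin n) : IsReal (lop A u i) := by
  have hf : ∀ i α, IsReal (flux A u i α) := fun i α =>
    IsReal.sum fun p _ => (hA.real _ _ _ _).conv (strain_real hu _ _)
  refine IsReal.sum fun α _ => ?_
  have h := (((hf i α).add (hf α i)).pderiv α).real_mul (c := fun _ => -(1 / 2)) fun _ => rfl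
  convert h using 1
  ext ξ
  simp

lemma lop_zero (A : CTensor n) (u : VDistr n) (i : Fin n) : lop A u i 0 = 0 := by
  simp [lop, pderiv]

lemma pderiv_smul_add (c : ℂ) (α : Fin n) (f g : PDistr n) :
    c • pderiv α (f + g) = c • (pderiv α f + pderiv α g) := by
  ext ξ
  simp only [pderiv, Pi.smul_apply, Pi.add_apply]
  congr 1
  ring

lemma lop_bound {A : CTensor n} {r K s : ℝ} (hA : A.Bounded r K) (hs : |s + 1| ≤ r) {u : VDistr n}
    (hu : VSob (s + 2) u) :
    VSob s (lop A u) ∧ vNormSq s (lop A u) ≤ n ^ 7 * K ^ 2 * vNormSq (s + 2) u := by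
  have e : s + 2 = s + 1 + 1 := by ring
  have hf := fun i α => flux_bound hA hs (e ▸ hu) i α
  rw [← e] at hf
  have h1 : ∀ i α, SobMem s ((-(1 / 2) : ℂ) • pderiv α (flux A u i α + flux A u α i)) ∧
      normSq s ((-(1 / 2) : ℂ) • pderiv α (flux A u i α + flux A u α i)) ≤
        n ^ 4 * K ^ 2 * vNormSq (s + 2) u := fun i α => by
    have p1 := (hf i α).1.pderiv α
    have p2 := (hf α i).1.pderiv α
    rw [pderiv_smul_add]
    have p3 := half_smul_add_bound p1.1 p2.1 (c := -(1 / 2)) (by simp)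
    refine ⟨p3.1, p3.2.trans ?_⟩
    linarith [p1.2, p2.2, (hf i α).2, (hf α i).2]
  refine ⟨fun i => SobMem.sum fun α _ => (h1 i α).1, ?_⟩
  calc vNormSq s (lop A u) ≤ ∑ _i : Fin n, (n : ℝ) * ∑ _α : Fin n,
        n ^ 4 * K ^ 2 * vNormSq (s + 2) u := by
        refine Finset.sum_le_sum fun i _ => ?_
        have := normSq_sum_le (S := Finset.univ) fun α _ => (h1 i α).1
        rw [Finset.card_univ, Fintype.card_fin] at this
        refine this.trans ?_
        gcongr with α
        exact (h1 i α).2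
    _ = _ := by simp; ring

/-- Integration by parts, frequency by frequency. -/
lemma lop_pair (A : CTensor n) (u w : VDistr n) (ξ : Fin n → ℤ) :
    ∑ i, lop A u i ξ * w i (-ξ) = ∑ i, ∑ α, flux A u i α ξ * strain w i α (-ξ) := by
  -- The stress is symmetrised in `lop` because it is paired with the symmetric gradient of w. Each
  -- side splits into two double sums, which agree after renaming i and α in one of them.
  have e1 : ∀ i, lop A u i ξ * w i (-ξ) = ∑ α, -(Real.pi * Complex.I) *
      ((ξ α : ℂ) * flux A u i α ξ * w i (-ξ) + (ξ α : ℂ) * flux A u α i ξ * w i (-ξ)) := fun i => by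
    rw [lop, Finset.sum_apply, Finset.sum_mul]
    refine Finset.sum_congr rfl fun α _ => ?_
    simp only [pderiv, Pi.smul_apply, Pi.add_apply, smul_eq_mul]
    ring
  have e2 : ∀ i α, flux A u i α ξ * strain w i α (-ξ) = -(Real.pi * Complex.I) *
      ((ξ i : ℂ) * flux A u i α ξ * w α (-ξ) + (ξ α : ℂ) * flux A u i α ξ * w i (-ξ)) :=
    fun i α => by
    rw [strain_apply, Pi.neg_apply, Pi.neg_apply]
    push_cast; ring
  simp only [e1, e2, mul_add, Finset.sum_add_distrib]
  rw [add_comm]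
  congr 1
  exact Finset.sum_comm

lemma lop_sub {A : CTensor n} {r K : ℝ} (hA : A.Bounded r K) {u w : VDistr n}
    (hu : VSob 1 u) (hw : VSob 1 w) : lop A (u - w) = lop A u - lop A w := by
  have h1 : ∀ i α, flux A (u - w) i α = flux A u i α - flux A w i α := fun i α => by
    rw [flux, flux, flux, ← Finset.sum_sub_distrib]
    refine Finset.sum_congr rfl fun p _ => ?_
    rw [strain_sub, conv_sub_right (hA.mem _ _ _ _)
      (strain_bound (s := 0) (by simpa using hu) _ _).1
      (strain_bound (s := 0) (by simpa using hw) _ _).1]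
  ext i ξ
  simp only [lop, h1, Pi.sub_apply, Finset.sum_apply, ← Finset.sum_sub_distrib]
  refine Finset.sum_congr rfl fun α _ => ?_
  simp only [pderiv, Pi.smul_apply, Pi.add_apply, Pi.sub_apply, smul_eq_mul]
  ring

lemma hasSum_vin {a b c : ℝ} (h : a + b = 2 * c) {G w : VDistr n} (hG : VSob a G)
    (hw : ∀ i, IsReal (w i)) (hwb : VSob b w) :
    HasSum (fun ξ => rho ξ ^ (2 * c) * (∑ i, G i ξ * w i (-ξ)).re) (vin c G w) := by
  have := hasSum_sum (s := Finset.univ) fun i _ => ((hG i).summable_inner h (hwb i)).hasSum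
  convert this using 1
  · ext ξ
    rw [← Finset.mul_sum, Complex.re_sum]
    simp only [hw _ ξ]
  · rfl

/-- The commutator of `-𝔏` with the weight `ϱ ^ s` is of lower order. -/
lemma lop_commutator {A : CTensor n} {r K s : ℝ} (hA : A.Bounded r K) (hr : 1 + |s - 1| ≤ r)
    (hs : 0 ≤ s) {u : VDistr n} (hr' : Solenoidal u) (hu : VSob (s + 1) u) :
    |vin s (lop A u) u - vin 0 (lop A (vlam s u)) (vlam s u)| ≤
      n ^ 4 * (2 * s * K) * (√(vNormSq s u) * √(vNormSq (s + 1) u)) := by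
  have hz : VSob 1 (vlam s u) := vSob_vlam.mpr hu
  have hzr : Solenoidal (vlam s u) := hr'.vlam s
  have hu1 : VSob 1 u := hu.mono (by linarith)
  have hst : ∀ j β, SobMem s (strain u j β) := fun j β => (strain_bound hu j β).1
  have hst0 : ∀ j β, SobMem 0 (strain u j β) := fun j β => (hst j β).mono hs
  -- D collects the commutators of ϱ^s with the coefficients. Having order s-1 on the strain, they
  -- are controlled in L₂ by the H^s norm of u.
  set D : Fin n → Fin n → Fin n × Fin n → PDistr n := fun i α p =>
    lam s (conv (A i p.1 α p.2) (strain u p.1 p.2)) -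
      conv (A i p.1 α p.2) (lam s (strain u p.1 p.2)) with hD
  have hDb : ∀ i α p, SobMem 0 (D i α p) ∧
      normSq 0 (D i α p) ≤ (2 * s * K) ^ 2 * vNormSq s u := fun i α p => by
    have hw := (hA.summable i p.1 α p.2).mono hr
    have h := normSq_commutator_le s hw.1 (hA.mem i p.1 α p.2) (hst0 p.1 p.2) (hst p.1 p.2)
    refine ⟨h.1, h.2.trans ?_⟩
    have h3 := wsum_nonneg (1 + |s - 1|) (A i p.1 α p.2)
    have h4 := (hw.2).trans (hA.le i p.1 α p.2)
    have h5 := normSq_nonneg (s - 1) (strain u p.1 p.2)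
    have h6 := (strain_bound (s := s - 1) (by simpa using hu.mono (by linarith)) p.1 p.2).2
    rw [sub_add_cancel] at h6
    rw [abs_of_nonneg hs]
    gcongr
  have hl1 := lop_bound (s := s - 1) hA (by
    rw [sub_add_cancel, abs_of_nonneg hs]
    have := neg_abs_le (s - 1); have := le_abs_self (s - 1); linarith) (u := u)
    (by convert hu using 1; ring)
  have hl2 := lop_bound (s := -1) hA (by
    rw [neg_add_cancel, abs_zero]; have := abs_nonneg (s - 1); linarith) (u := vlam s u)
    (by convert hz using 1; norm_num)
  have s1 := hasSum_vin (c := s) (by ring) hl1.1 hr'.real hu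
  have s2 := hasSum_vin (c := 0) (by ring) hl2.1 hzr.real hz
  have hsub := s1.sub s2
  -- Of the weight ϱ^{2s}, one factor ϱ^s goes to the stress and one to the strain. Commuting the
  -- former with the coefficients leaves D paired with the strain of Λ^s u, for each of the n⁴ index
  -- quadruples.
  have key : ∀ ξ, rho ξ ^ (2 * s) * (∑ i, lop A u i ξ * u i (-ξ)).re -
      rho ξ ^ (2 * (0 : ℝ)) * (∑ i, lop A (vlam s u) i ξ * vlam s u i (-ξ)).re =
      ∑ q : (Fin n × Fin n) × (Fin n × Fin n),
        (D q.1.1 q.1.2 q.2 ξ * conj (strain (vlam s u) q.1.1 q.1.2 ξ)).re := fun ξ => by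
    rw [lop_pair, lop_pair, mul_zero, Real.rpow_zero, one_mul, two_mul,
      Real.rpow_add (rho_pos ξ), ← Complex.re_ofReal_mul, ← Complex.sub_re, ← Complex.re_sum]
    congr 1
    rw [Fintype.sum_prod_type, Fintype.sum_prod_type, Finset.mul_sum, ← Finset.sum_sub_distrib]
    refine Finset.sum_congr rfl fun i _ => ?_
    rw [Finset.mul_sum, ← Finset.sum_sub_distrib]
    refine Finset.sum_congr rfl fun α _ => ?_
    simp only [strain_vlam, hD, flux, Pi.sub_apply, Finset.sum_apply]
    rw [← Finset.sum_mul, Finset.sum_sub_distrib, sub_mul]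
    simp only [lam]
    rw [← Finset.mul_sum, map_mul, Complex.conj_ofReal, rho_neg, strain_real hr'.real]
    push_cast
    ring
  have hS : ∀ j β, SobMem 0 (strain (vlam s u) j β) ∧
      normSq 0 (strain (vlam s u) j β) ≤ vNormSq (s + 1) u := fun j β => by
    have := strain_bound (s := 0) (by simpa using hz) j β
    rwa [zero_add, vNormSq_vlam] at this
  have hb : ∀ q : (Fin n × Fin n) × (Fin n × Fin n),
      |∑' ξ, (D q.1.1 q.1.2 q.2 ξ * conj (strain (vlam s u) q.1.1 q.1.2 ξ)).re| ≤
        2 * s * K * (√(vNormSq s u) * √(vNormSq (s + 1) u)) := fun q => by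
    have hc := (hDb q.1.1 q.1.2 q.2).1.cauchySchwarz (c := 0) (by ring) (hS q.1.1 q.1.2).1
    simp only [mul_zero, Real.rpow_zero, one_mul] at hc
    have hK : 0 ≤ K := (wsum_nonneg _ _).trans (hA.le q.1.1 q.1.1 q.1.1 q.1.1)
    calc _ ≤ ∑' ξ, ‖D q.1.1 q.1.2 q.2 ξ‖ * ‖strain (vlam s u) q.1.1 q.1.2 ξ‖ := by
          refine tsum_of_norm_bounded (f := fun ξ =>
            (D q.1.1 q.1.2 q.2 ξ * conj (strain (vlam s u) q.1.1 q.1.2 ξ)).re)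
            hc.1.hasSum fun ξ => ?_
          refine (Complex.abs_re_le_norm _).trans (le_of_eq ?_)
          rw [norm_mul, RCLike.norm_conj]
      _ ≤ √((2 * s * K) ^ 2 * vNormSq s u) * √(vNormSq (s + 1) u) := by
          refine hc.2.trans ?_
          gcongr
          · exact (hDb q.1.1 q.1.2 q.2).2
          · exact (hS q.1.1 q.1.2).2
      _ = _ := by
          rw [Real.sqrt_mul (sq_nonneg _), Real.sqrt_sq (by positivity)]
          ring
  rw [← hsub.tsum_eq]
  simp only [key]
  have hsm : ∀ q ∈ (Finset.univ : Finset ((Fin n × Fin n) × (Fin n × Fin n))), Summable fun ξ =>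
      (D q.1.1 q.1.2 q.2 ξ * conj (strain (vlam s u) q.1.1 q.1.2 ξ)).re := fun q _ => by
    have := (hDb q.1.1 q.1.2 q.2).1.summable_inner (s := 0) (by ring) (hS q.1.1 q.1.2).1
    simpa using this
  rw [Summable.tsum_finsetSum hsm]
  calc _ ≤ ∑ _q : (Fin n × Fin n) × (Fin n × Fin n),
        2 * s * K * (√(vNormSq s u) * √(vNormSq (s + 1) u)) :=
        (Finset.abs_sum_le_sum_abs _ _).trans (Finset.sum_le_sum fun q _ => hb q)
    _ = _ := by simp; ring

/-! ### The bilinear form -/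

/-- The conditions on the viscosity tensor at a fixed time. -/
structure GoodTensor (C r K : ℝ) (b : Fin n → Fin n → Fin n → Fin n → Torus n → ℝ) : Prop where
  integrable : ∀ k j α β, Integrable (b k j α β) (torusMeasure n)
  bounded : CTensor.Bounded (fun k j α β => coeff (b k j α β)) r K
  elliptic : ∀ᵐ x ∂(torusMeasure n), ∀ ζ : Matrix (Fin n) (Fin n) ℝ, ζ.transpose = ζ →
    ζ.trace = 0 → ∑ k, ∑ α, ζ k α ^ 2 ≤ C * ∑ k, ∑ j, ∑ α, ∑ β, b k j α β x * ζ k α * ζ j β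

/-- The coefficients of the tensor at the time `t`. -/
noncomputable def tcoeff (a : Tensor n) (t : ℝ) : CTensor n := fun k j α β => coeff (a k j α β t)

variable {C r K : ℝ} {a : Tensor n} {t : ℝ}

lemma strain_zero_bound {u : VDistr n} (hu : VSob 1 u) (j β : Fin n) : SobMem 0 (strain u j β) :=
  (strain_bound (s := 0) (by simpa using hu) j β).1

/-- This links the form defined by integrals of L₂ functions with the operator `lop` on
coefficients; bounded coefficients make all the products integrable. -/
lemma hasSum_aForm (ha : GoodTensor C r K fun k j α β => a k j α β t) (hr : 0 ≤ r)
    {u w : VDistr n} (hur : ∀ i, IsReal (u i)) (hu : VSob 1 u) (hwr : ∀ i, IsReal (w i))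
    (hw : VSob 1 w) :
    HasSum (fun ξ => ∑ i, lop (tcoeff a t) u i ξ * w i (-ξ)) (aForm a t u w : ℂ) := by
  have h1 : ∀ i j α β, HasSum (fun ξ => conv (tcoeff a t i j α β) (strain u j β) ξ *
      strain w i α (-ξ)) ((∫ x, a i j α β t x * toFn (strain u j β) x * toFn (strain w i α) x
        ∂(torusMeasure n) : ℝ) : ℂ) := fun i j α β =>
    hasSum_integral_mul_toFn (ha.integrable i j α β) ((ha.bounded.summable i j α β).summable hr)
      (strain_real hur j β) (strain_zero_bound hu j β) (strain_real hwr i α)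
      (strain_zero_bound hw i α)
  have h2 := hasSum_sum (s := Finset.univ) fun i _ => hasSum_sum (s := Finset.univ) fun j _ =>
    hasSum_sum (s := Finset.univ) fun α _ => hasSum_sum (s := Finset.univ) fun β _ => h1 i j α β
  convert h2 using 1
  · ext ξ
    rw [lop_pair]
    refine Finset.sum_congr rfl fun i _ => ?_
    rw [Finset.sum_comm]
    refine Finset.sum_congr rfl fun α _ => ?_
    rw [flux, Finset.sum_apply, Fintype.sum_prod_type, Finset.sum_mul]
    exact Finset.sum_congr rfl fun j _ => by rw [Finset.sum_mul]
  · rw [aForm]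
    push_cast
    rfl

/-- Expanding the squares, the mixed terms add up to |ξ · ŵ(ξ)|², which vanishes for divergence-free
w. This is Korn's identity, with the exact constant 1/2. -/
lemma korn_identity {w : VDistr n} (hw : Solenoidal w) (ξ : Fin n → ℤ) :
    ∑ i, ∑ α, ‖strain w i α ξ‖ ^ 2 = (1 / 2) * ((2 * Real.pi * freqNorm ξ) ^ 2 * ∑ i, ‖w i ξ‖ ^ 2) := by
  have e : ∀ i α, ‖strain w i α ξ‖ ^ 2 = Real.pi ^ 2 * ((ξ i : ℝ) ^ 2 * ‖w α ξ‖ ^ 2 +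
      (ξ α : ℝ) ^ 2 * ‖w i ξ‖ ^ 2 +
      2 * (((ξ α : ℂ) * w α ξ) * conj ((ξ i : ℂ) * w i ξ)).re) := fun i α => by
    rw [strain_apply, norm_mul, mul_pow, ← Complex.normSq_eq_norm_sq ((ξ i : ℂ) * w α ξ + _),
      Complex.normSq_add, Complex.normSq_eq_norm_sq, Complex.normSq_eq_norm_sq]
    have e1 : ‖(Real.pi * Complex.I : ℂ)‖ ^ 2 = Real.pi ^ 2 := by simp
    have e2 : ∀ (k : ℤ) (z : ℂ), ‖(k : ℂ) * z‖ ^ 2 = (k : ℝ) ^ 2 * ‖z‖ ^ 2 := fun k z => by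
      rw [norm_mul, mul_pow, Complex.norm_intCast, sq_abs]
    rw [e1, e2, e2]
    congr 4
    simp only [map_mul, map_intCast]
    ring
  simp only [e, ← Finset.mul_sum, Finset.sum_add_distrib]
  have e3 : ∑ i, ∑ α, (((ξ α : ℂ) * w α ξ) * conj ((ξ i : ℂ) * w i ξ)).re = 0 := by
    simp only [← Complex.re_sum, ← Finset.sum_mul]
    rw [hw.div ξ]
    simp
  rw [e3]
  simp only [← Finset.mul_sum, ← Finset.sum_mul, mul_pow]
  rw [freqNorm_sq]
  ring

lemma hasIntegral_sum_four {X : Type*} [MeasurableSpace X] {μ : Measure X}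
    {g : Fin n → Fin n → Fin n → Fin n → X → ℝ} (hg : ∀ i j α β, Integrable (g i j α β) μ) :
    Integrable (fun x => ∑ i, ∑ j, ∑ α, ∑ β, g i j α β x) μ ∧
      ∫ x, ∑ i, ∑ j, ∑ α, ∑ β, g i j α β x ∂μ = ∑ i, ∑ j, ∑ α, ∑ β, ∫ x, g i j α β x ∂μ := by
  have h3 : ∀ i j α, Integrable (fun x => ∑ β, g i j α β x) μ := fun i j α =>
    integrable_finsetSum _ fun β _ => hg i j α β
  have h2 : ∀ i j, Integrable (fun x => ∑ α, ∑ β, g i j α β x) μ := fun i j =>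
    integrable_finsetSum _ fun α _ => h3 i j α
  have h1 : ∀ i, Integrable (fun x => ∑ j, ∑ α, ∑ β, g i j α β x) μ := fun i =>
    integrable_finsetSum _ fun j _ => h2 i j
  refine ⟨integrable_finsetSum _ fun i _ => h1 i, ?_⟩
  rw [integral_finsetSum _ fun i _ => h1 i]
  refine Finset.sum_congr rfl fun i _ => ?_
  rw [integral_finsetSum _ fun j _ => h2 i j]
  refine Finset.sum_congr rfl fun j _ => ?_
  rw [integral_finsetSum _ fun α _ => h3 i j α]
  refine Finset.sum_congr rfl fun α _ => ?_
  rw [integral_finsetSum _ fun β _ => hg i j α β]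

/-- At almost every x the ellipticity condition is applied to the matrix S(x), which is admissible
because it is symmetric and trace-free, and the result is integrated. -/
lemma elliptic_integral {X : Type*} [MeasurableSpace X] {μ : Measure X} {C : ℝ}
    {b : Fin n → Fin n → Fin n → Fin n → X → ℝ} {S : Fin n → Fin n → X → ℝ}
    (hI : ∀ i j α β, Integrable (fun x => b i j α β x * S j β x * S i α x) μ)
    (hI2 : ∀ i α, Integrable (fun x => S i α x ^ 2) μ)
    (hsym : ∀ i α, S i α = S α i) (htr : ∀ᵐ x ∂μ, ∑ i, S i i x = 0)
    (hell : ∀ᵐ x ∂μ, ∀ ζ : Matrix (Fin n) (Fin n) ℝ, ζ.transpose = ζ → ζ.trace = 0 →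
      ∑ k, ∑ α, ζ k α ^ 2 ≤ C * ∑ k, ∑ j, ∑ α, ∑ β, b k j α β x * ζ k α * ζ j β) :
    ∑ i, ∑ α, ∫ x, S i α x ^ 2 ∂μ ≤
      C * ∑ i, ∑ j, ∑ α, ∑ β, ∫ x, b i j α β x * S j β x * S i α x ∂μ := by
  have e1 : ∑ i, ∑ α, ∫ x, S i α x ^ 2 ∂μ = ∫ x, ∑ i, ∑ α, S i α x ^ 2 ∂μ := by
    rw [integral_finsetSum _ fun i _ => integrable_finsetSum _ fun α _ => hI2 i α]
    refine Finset.sum_congr rfl fun i _ => ?_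
    rw [integral_finsetSum _ fun α _ => hI2 i α]
  have e2 := hasIntegral_sum_four hI
  rw [e1, ← e2.2, ← integral_const_mul]
  refine integral_mono_ae (integrable_finsetSum _ fun i _ => integrable_finsetSum _ fun α _ =>
    hI2 i α) (e2.1.const_mul C) ?_
  filter_upwards [hell, htr] with x hx hx'
  have := hx (Matrix.of fun i α => S i α x) (by
    ext i α; simp [Matrix.transpose_apply, hsym α i]) (by simpa [Matrix.trace] using hx')
  simp only [Matrix.of_apply] at this
  refine this.trans (le_of_eq ?_)
  congr 1
  refine Finset.sum_congr rfl fun i _ => Finset.sum_congr rfl fun j _ =>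
    Finset.sum_congr rfl fun α _ => Finset.sum_congr rfl fun β _ => by ring

/-- Ellipticity of the bilinear form on the divergence-free fields. -/
lemma aForm_coercive (ha : GoodTensor C r K fun k j α β => a k j α β t) (hr : 0 ≤ r)
    {w : VDistr n} (hwr : Solenoidal w) (hw : VSob 1 w) : vNormSq 1 w ≤ 4 * C * aForm a t w w := by
  have hS := fun i α => strain_zero_bound hw i α
  have hR := fun i α => strain_real hwr.real i α
  have hL := fun i α => toFn_memLp (hR i α) (hS i α)
  have htr : ∀ᵐ x ∂(torusMeasure n), ∑ i, toFn (strain w i i) x = 0 := by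
    refine sum_toFn_eq_zero Finset.univ (fun i _ => hR i i) (fun i _ => hS i i) ?_
    ext ξ
    rw [Finset.sum_apply]
    have : ∀ i, strain w i i ξ = 2 * Real.pi * Complex.I * ((ξ i : ℂ) * w i ξ) := fun i => by
      rw [strain_apply]; ring
    simp only [this]
    rw [← Finset.mul_sum, hwr.div, mul_zero]
    rfl
  have hI : ∀ i j α β, Integrable (fun x => a i j α β t x * toFn (strain w j β) x *
      toFn (strain w i α) x) (torusMeasure n) := fun i j α β =>
    MemLp.integrable_mul_two (memLp_bdd_mul (ha.integrable i j α β)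
      ((ha.bounded.summable i j α β).summable hr) (hL j β)).2 (hL i α)
  have hI2 : ∀ i α, Integrable (fun x => toFn (strain w i α) x ^ 2) (torusMeasure n) := fun i α =>
    (hL i α).integrable_sq
  have h1 : ∑ i, ∑ α, normSq 0 (strain w i α) ≤ C * aForm a t w w := by
    have e := elliptic_integral (S := fun i α => toFn (strain w i α)) hI hI2
      (fun i α => by rw [strain_comm]) htr ha.elliptic
    refine le_trans (le_of_eq ?_) e
    exact Finset.sum_congr rfl fun i _ => Finset.sum_congr rfl fun α _ =>
      (integral_toFn_sq (hR i α) (hS i α)).symm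
  -- One factor 2 comes from Korn's identity, the other from ϱ² ≤ 2(2π|ξ|)² at nonzero frequencies;
  -- the zero frequency does not contribute since w has zero mean.
  have h2 : vNormSq 1 w ≤ 4 * ∑ i, ∑ α, normSq 0 (strain w i α) := by
    have hs := hasSum_sum (s := Finset.univ) fun i _ => hasSum_sum (s := Finset.univ)
      fun α _ => Summable.hasSum (hS i α)
    have hs' := hs.mul_left 4
    refine hasSum_le (fun ξ => ?_) hw.hasSum hs'
    simp only [mul_zero, Real.rpow_zero, one_mul, mul_one]
    rw [korn_identity hwr, Real.rpow_two]
    by_cases h : ξ = 0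
    · simp [h, hwr.mean]
    · have h3 := rho_sq_le h
      have h4 : 0 ≤ ∑ i, ‖w i ξ‖ ^ 2 := Finset.sum_nonneg fun i _ => sq_nonneg _
      nlinarith
  linarith

end

section

/-! ### Coercivity at a fixed time -/

variable {C r K : ℝ} {a : Tensor n} {t : ℝ}

lemma vin_lop_eq_aForm (ha : GoodTensor C r K fun k j α β => a k j α β t) (hr : 0 ≤ r)
    {u w : VDistr n} (hur : ∀ i, IsReal (u i)) (hu : VSob 1 u) (hwr : ∀ i, IsReal (w i))
    (hw : VSob 1 w) : vin 0 (lop (tcoeff a t) u) w = aForm a t u w := by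
  have hl := lop_bound (s := -1) ha.bounded (by simpa using hr) (u := u) (by
    convert hu using 1; norm_num)
  have h1 := hasSum_vin (c := 0) (by ring) hl.1 hwr hw
  have h2 := Complex.hasSum_re (hasSum_aForm ha hr hur hu hwr hw)
  simp only [mul_zero, Real.rpow_zero, one_mul] at h1
  exact h1.unique h2

/-- Gårding's inequality. -/
lemma lop_garding (ha : GoodTensor C r K fun k j α β => a k j α β t) (hC : 0 < C) {s : ℝ}
    (hs : 0 ≤ s) (hr : 1 + |s - 1| ≤ r) {w : VDistr n} (hwr : Solenoidal w)
    (hw : VSob (s + 1) w) :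
    1 / (8 * C) * vNormSq (s + 1) w - 2 * C * (n ^ 4 * (2 * s * K)) ^ 2 * vNormSq s w ≤
      vin s (lop (tcoeff a t) w) w := by
  have hr0 : 0 ≤ r := by have := abs_nonneg (s - 1); linarith
  have hz : VSob 1 (vlam s w) := vSob_vlam.mpr hw
  have h1 := lop_commutator ha.bounded hr hs hwr hw
  have h2 := aForm_coercive ha hr0 (hwr.vlam s) hz
  rw [← vin_lop_eq_aForm ha hr0 (hwr.vlam s).real hz (hwr.vlam s).real hz, vNormSq_vlam] at h2
  have h3 := (abs_le.mp h1).1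
  change -_ ≤ vin s (lop (tcoeff a t) w) w - vin 0 (lop (tcoeff a t) (vlam s w)) (vlam s w) at h3
  set B := (n : ℝ) ^ 4 * (2 * s * K)
  have h4 := Real.mul_self_sqrt (vNormSq_nonneg s w)
  have h5 := Real.mul_self_sqrt (vNormSq_nonneg (s + 1) w)
  set x := √(vNormSq s w)
  set y := √(vNormSq (s + 1) w)
  rw [← h4, ← h5]
  rw [← h5] at h2
  have h6 : 1 / (4 * C) * (y * y) ≤ vin 0 (lop (tcoeff a t) (vlam s w)) (vlam s w) := by
    rw [div_mul_eq_mul_div, one_mul, div_le_iff₀ (by positivity)]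
    linarith
  -- Young's inequality gives half of the coercivity constant 1/(4C) to the commutator; the rest is
  -- of lower order.
  have h7 : B * (x * y) ≤ 1 / (8 * C) * (y * y) + 2 * C * B ^ 2 * (x * x) := by
    have : 0 ≤ 1 / (8 * C) * (y - 4 * C * B * x) ^ 2 := by positivity
    have e : 1 / (8 * C) * (y - 4 * C * B * x) ^ 2 =
        1 / (8 * C) * (y * y) - B * (x * y) + 2 * C * B ^ 2 * (x * x) := by
      field_simp
      ring
    linarith
  have e : 1 / (4 * C) * (y * y) = 1 / (8 * C) * (y * y) + 1 / (8 * C) * (y * y) := by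
    field_simp
    ring
  linarith

/-- Coercivity of the linear operator `δ ↦ w' + ℙ (-𝔏) w`, where `w' = δ - m Λ² w`. -/
lemma exists_linear_coercive (n : ℕ) {C r K s : ℝ} (hC : 0 < C) (hs : 0 ≤ s)
    (hr : 1 + |s - 1| ≤ r) :
    ∃ c m B E : ℝ, 0 < c ∧ 0 < m ∧ 0 ≤ B ∧ 0 < E ∧
      ∀ (a : Tensor n) (t : ℝ), (GoodTensor C r K fun k j α β => a k j α β t) →
      ∀ δ w p : VDistr n, Solenoidal w → VSob (s - 1) δ → VSob (s + 1) w →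
        p = δ - rmul (fun _ => m) (vlam 2 w) →
        VSob (s - 1) (p + leray (lop (tcoeff a t) w)) ∧
        c * vNormSq (s - 1) δ + m * (vin s w p - B * vNormSq s w) ≤
          vin (s - 1) δ (p + leray (lop (tcoeff a t) w)) ∧
        vNormSq (s - 1) (p + leray (lop (tcoeff a t) w)) ≤
          E * (vNormSq (s - 1) δ + vNormSq (s + 1) w) := by
  -- The constants c₁ and B are those of Gårding's inequality; L is the squared bound of -𝔏 from
  -- H^{s+1} to H^{s-1}.
  set c₁ := 1 / (8 * C) with hc₁
  set B := 2 * C * (n ^ 4 * (2 * s * K)) ^ 2 with hB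
  set L := (n : ℝ) ^ 7 * K ^ 2 with hL
  have hL0 : 0 ≤ L := by positivity
  have hc0 : 0 < c₁ := by positivity
  -- With m c₁ = L + c₁ the gain m c₁ from Gårding's inequality exceeds what is needed to absorb the
  -- mixed term of p with ℙ(-𝔏)w.
  set m := L / c₁ + 1 with hm
  have hm0 : 0 < m := by positivity
  have hmc : L + c₁ = m * c₁ := by rw [hm]; field_simp
  refine ⟨min (1 / 4) (c₁ / (4 * m)), m, B, 4 + 4 * m ^ 2 + 2 * L, by positivity, hm0,
    by positivity, by positivity, fun a t ha δ w p hw hδ hwb hp => ?_⟩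
  have e1 : s + 1 = (s - 1) + 2 := by ring
  have hW : VSob (s - 1) (rmul (fun _ => m) (vlam 2 w)) :=
    (vSob_vlam.mpr (by convert hwb using 1; ring)).smul m
  have hWn : vNormSq (s - 1) (rmul (fun _ => m) (vlam 2 w)) = m ^ 2 * vNormSq (s + 1) w := by
    rw [vNormSq_smul, vNormSq_vlam]; congr 2; ring
  have hpb : VSob (s - 1) p := hp ▸ hδ.sub hW
  have hl := lop_bound (s := s - 1) ha.bounded (by
    rw [sub_add_cancel, abs_of_nonneg hs]
    have := neg_abs_le (s - 1); have := le_abs_self (s - 1); linarith) (u := w) (e1 ▸ hwb)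
  rw [← e1] at hl
  change VSob (s - 1) (lop (tcoeff a t) w) ∧ vNormSq (s - 1) (lop (tcoeff a t) w) ≤ _ at hl
  have hl' := hl.1.leray
  have hG : VSob (s - 1) (p + leray (lop (tcoeff a t) w)) := hpb.add hl'.1
  have hδe : δ = p + rmul (fun _ => m) (vlam 2 w) := by rw [hp, sub_add_cancel]
  set G := lop (tcoeff a t) w with hGdef
  have hn1 := vNormSq_nonneg (s - 1) p
  have hn2 := vNormSq_nonneg (s + 1) w
  have hδn : vNormSq (s - 1) δ ≤ 2 * (vNormSq (s - 1) p + m ^ 2 * vNormSq (s + 1) w) := by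
    rw [hδe, ← hWn]; exact vNormSq_add_le hpb hW
  have hpn : vNormSq (s - 1) p ≤ 2 * (vNormSq (s - 1) δ + m ^ 2 * vNormSq (s + 1) w) := by
    rw [hp, ← hWn]; exact vNormSq_sub_le hδ hW
  refine ⟨hG, ?_, ?_⟩
  · have e2 : vin (s - 1) δ (p + leray G) = vNormSq (s - 1) p + vin (s - 1) p (leray G) +
        m * (vin s w p + vin s G w) := by
      have a1 : vin (s - 1) (rmul (fun _ => m) (vlam 2 w)) p = m * vin s w p := by
        rw [vin_smul_left, ← mul_one (2 : ℝ), vin_vlam]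
        congr 2; ring
      have a2 : vin (s - 1) (rmul (fun _ => m) (vlam 2 w)) (leray G) = m * vin s G w := by
        rw [vin_smul_left, ← mul_one (2 : ℝ), vin_vlam, vin_comm,
          vin_leray (a := s - 1) (b := s + 1) (by ring) hl.1 hwb hw]
        congr 2; ring
      have a3 : ∀ z, VSob (s - 1) z → vin (s - 1) δ z =
          vin (s - 1) p z + vin (s - 1) (rmul (fun _ => m) (vlam 2 w)) z := fun z hz => by
        rw [hδe, vin_add_left (a := s - 1) (b := s - 1) (by ring) hpb hW hz]
      rw [vin_comm, vin_add_left (a := s - 1) (b := s - 1) (by ring) hpb hl'.1 hδ, vin_comm,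
        vin_comm (s - 1) (leray G), a3 p hpb, a3 _ hl'.1, a1, a2, vin_self]
      ring
    have h1 := lop_garding ha hC hs hr hw hwb
    have h2 := abs_vin_le (a := s - 1) (b := s - 1) (s := s - 1) (by ring) hpb hl'.1
    have h3 : √(vNormSq (s - 1) p) * √(vNormSq (s - 1) (leray G)) ≤
        1 / 2 * vNormSq (s - 1) p + 1 / 2 * (L * vNormSq (s + 1) w) := by
      have b1 := Real.mul_self_sqrt hn1
      have b2 := Real.mul_self_sqrt (vNormSq_nonneg (s - 1) (leray G))
      have := hl'.2.trans hl.2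
      nlinarith [sq_nonneg (√(vNormSq (s - 1) p) - √(vNormSq (s - 1) (leray G)))]
    have h4 := (abs_le.mp h2).1
    -- The minimum is the coercivity constant c: since ‖δ‖² ≤ 2(‖p‖² + m²‖w‖²), it spends at most
    -- half of ‖p‖² and half of m c₁‖w‖².
    have h5 : min (1 / 4) (c₁ / (4 * m)) * vNormSq (s - 1) δ ≤
        1 / 2 * vNormSq (s - 1) p + 1 / 2 * (m * c₁ * vNormSq (s + 1) w) := by
      calc _ ≤ min (1 / 4) (c₁ / (4 * m)) *
            (2 * (vNormSq (s - 1) p + m ^ 2 * vNormSq (s + 1) w)) := by gcongr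
        _ = min (1 / 4) (c₁ / (4 * m)) * (2 * vNormSq (s - 1) p) +
            min (1 / 4) (c₁ / (4 * m)) * (2 * (m ^ 2 * vNormSq (s + 1) w)) := by ring
        _ ≤ 1 / 4 * (2 * vNormSq (s - 1) p) +
            c₁ / (4 * m) * (2 * (m ^ 2 * vNormSq (s + 1) w)) := by
              gcongr
              · exact min_le_left _ _
              · exact min_le_right _ _
        _ = _ := by field_simp; ring
    have h6 := mul_le_mul_of_nonneg_left h1 hm0.le
    rw [e2]
    have h7 : m * c₁ * vNormSq (s + 1) w = L * vNormSq (s + 1) w + c₁ * vNormSq (s + 1) w := by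
      rw [← hmc]; ring
    have h8 : 0 ≤ c₁ * vNormSq (s + 1) w := by positivity
    change m * (c₁ * vNormSq (s + 1) w - B * vNormSq s w) ≤ m * vin s G w at h6
    nlinarith
  · have h1 := vNormSq_add_le hpb hl'.1
    have h2 := hl'.2.trans hl.2
    have h3 := vNormSq_nonneg (s - 1) δ
    have h4 : 0 ≤ m ^ 2 * vNormSq (s - 1) δ := by positivity
    have h5 : 0 ≤ L * vNormSq (s - 1) δ := by positivity
    nlinarith

/-! ### The viscosity tensor at almost every time. -/

lemma sqrt_normSq_le_of_tensor (s : ℝ) (A : CTensor n) (k j α β : Fin n) :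
    √(normSq s (A k j α β)) ≤ √(∑ k, ∑ j, ∑ α, ∑ β, normSq s (A k j α β)) := by
  refine Real.sqrt_le_sqrt ?_
  have h := normSq_nonneg (n := n) s
  have h4 : ∀ k j α, 0 ≤ ∑ β, normSq s (A k j α β) := fun k j α =>
    Finset.sum_nonneg fun β _ => h _
  have h3 : ∀ k j, 0 ≤ ∑ α, ∑ β, normSq s (A k j α β) := fun k j =>
    Finset.sum_nonneg fun α _ => h4 _ _ _
  have h2 : ∀ k, 0 ≤ ∑ j, ∑ α, ∑ β, normSq s (A k j α β) := fun k =>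
    Finset.sum_nonneg fun j _ => h3 _ _
  calc _ ≤ ∑ β, normSq s (A k j α β) :=
        Finset.single_le_sum (f := fun β => normSq s (A k j α β)) (fun _ _ => h _)
          (Finset.mem_univ β)
    _ ≤ ∑ α, ∑ β, normSq s (A k j α β) := Finset.single_le_sum
          (f := fun α => ∑ β, normSq s (A k j α β)) (fun _ _ => h4 _ _ _) (Finset.mem_univ α)
    _ ≤ ∑ j, ∑ α, ∑ β, normSq s (A k j α β) := Finset.single_le_sum
          (f := fun j => ∑ α, ∑ β, normSq s (A k j α β)) (fun _ _ => h3 _ _) (Finset.mem_univ j)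
    _ ≤ _ := Finset.single_le_sum
          (f := fun k => ∑ j, ∑ α, ∑ β, normSq s (A k j α β)) (fun _ _ => h2 _) (Finset.mem_univ k)

/-- At almost every time the tensor is bounded and elliptic. -/
lemma exists_goodTensor (hn : 0 < n) {r σ : ℝ} (hr : 0 ≤ r) (h : r + (n : ℝ) / 2 < σ) :
    ∃ B : ℝ, 0 < B ∧ ∀ (T M C : ℝ) (a : Tensor n), TensorMemLinfty T σ M a →
      RelaxedElliptic T C a → ∀ᵐ t ∂(volume.restrict (Ioo 0 T)),
        GoodTensor C r (B * M) fun k j α β => a k j α β t := by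
  obtain ⟨B, hB, hBk⟩ := wsum_le_of_sobMem hn h
  refine ⟨B, hB, fun T M C a ha hell => ?_⟩
  have h0 : (0 : ℝ) ≤ σ := by
    have : (0 : ℝ) ≤ (n : ℝ) / 2 := by positivity
    linarith
  filter_upwards [ha.mem, ha.bound, Measure.ae_ae_of_ae_prod hell] with t h1 h2 h3
  refine ⟨fun k j α β => (h1 k j α β).1, ⟨fun k j α β => isReal_coeff _,
    fun k j α β => SobMem.mono (t := σ) (h1 k j α β).2.2 h0,
    fun k j α β => (hBk _ (h1 k j α β).2.2).1, fun k j α β => ?_⟩, h3⟩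
  refine (hBk _ (h1 k j α β).2.2).2.trans (mul_le_mul_of_nonneg_left ?_ hB.le)
  exact (sqrt_normSq_le_of_tensor σ (tcoeff a t) k j α β).trans h2

lemma measurable_tcoeff {T σ M : ℝ} {a : Tensor n} (ha : TensorMemLinfty T σ M a)
    (k j α β : Fin n) (ξ : Fin n → ℤ) :
    AEStronglyMeasurable (fun t => tcoeff a t k j α β ξ) (volume.restrict (Ioo 0 T)) := by
  have h1 : AEStronglyMeasurable (fun z : ℝ × Torus n => ((a k j α β z.1 z.2 : ℝ) : ℂ))
      ((volume.restrict (Ioo 0 T)).prod (torusMeasure n)) :=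
    Complex.continuous_ofReal.comp_aestronglyMeasurable (ha.measurable k j α β)
  have h2 : AEStronglyMeasurable (fun z : ℝ × Torus n => UnitAddTorus.mFourier (-ξ) z.2)
      ((volume.restrict (Ioo 0 T)).prod (torusMeasure n)) :=
    ((UnitAddTorus.mFourier (-ξ)).continuous.comp continuous_snd).aestronglyMeasurable
  exact (h2.mul h1).integral_prod_right'

end

section

/-! ### Square integrable functions of time -/

/-- Finite partial sums are measurable, and finite subsets of a countable set form a countably
generated filter, along which measurability passes to the limit. -/
lemma aestronglyMeasurable_tsum {ι α E : Type*} [Countable ι] [MeasurableSpace α] {μ : Measure α}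
    [NormedAddCommGroup E] {F : ι → α → E} (hF : ∀ i, AEStronglyMeasurable (F i) μ)
    (hs : ∀ᵐ x ∂μ, Summable fun i => F i x) :
    AEStronglyMeasurable (fun x => ∑' i, F i x) μ := by
  refine aestronglyMeasurable_of_tendsto_ae (u := (atTop : Filter (Finset ι)))
    (f := fun S x => ∑ i ∈ S, F i x) (fun S => ?_) ?_
  · exact Finset.aestronglyMeasurable_fun_sum S fun i _ => hF i
  · filter_upwards [hs] with x hx using hx.hasSum

/-- When the series diverges both sides have the default value 0. The identity yields measurability
of the norm in time without any hypothesis of finiteness. -/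
lemma normSq_eq_toReal (s : ℝ) (g : PDistr n) : normSq s g = (sob s g).toReal := by
  by_cases h : SobMem s g
  · rw [h.sob_eq, ENNReal.toReal_ofReal (normSq_nonneg s g)]
  · rw [normSq, tsum_eq_zero_of_not_summable h]
    have : sob s g = ⊤ := by
      by_contra h'
      exact h (sobMem_iff.mpr h')
    rw [this, ENNReal.toReal_top]

/-- The space `L₂(0, T; H^s)` of scalar complex-valued distributions. -/
structure L2P (T s : ℝ) (g : ℝ → PDistr n) : Prop where
  meas : ∀ ξ, AEStronglyMeasurable (fun t => g t ξ) (volume.restrict (Ioo 0 T))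
  mem : ∀ᵐ t ∂(volume.restrict (Ioo 0 T)), SobMem s (g t)
  int : IntegrableOn (fun t => normSq s (g t)) (Ioo 0 T)

variable {T s : ℝ}

lemma aemeasurable_sob {g : ℝ → PDistr n} {μ : Measure ℝ}
    (hg : ∀ ξ, AEStronglyMeasurable (fun t => g t ξ) μ) (s : ℝ) :
    AEMeasurable (fun t => sob s (g t)) μ :=
  AEMeasurable.tsum fun ξ => ((hg ξ).enorm.const_mul _).pow_const 2

lemma aestronglyMeasurable_normSq {g : ℝ → PDistr n} {μ : Measure ℝ}
    (hg : ∀ ξ, AEStronglyMeasurable (fun t => g t ξ) μ) (s : ℝ) :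
    AEStronglyMeasurable (fun t => normSq s (g t)) μ := by
  simp only [normSq_eq_toReal]
  exact (aemeasurable_sob hg s).ennreal_toReal.aestronglyMeasurable

lemma L2P.of_le {g : ℝ → PDistr n}
    (hm : ∀ ξ, AEStronglyMeasurable (fun t => g t ξ) (volume.restrict (Ioo 0 T))) {F : ℝ → ℝ}
    (hF : IntegrableOn F (Ioo 0 T))
    (h : ∀ᵐ t ∂(volume.restrict (Ioo 0 T)), SobMem s (g t) ∧ normSq s (g t) ≤ F t) :
    L2P T s g where
  meas := hm
  mem := h.mono fun t ht => ht.1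
  int := by
    refine Integrable.mono' hF (aestronglyMeasurable_normSq hm s) (h.mono fun t ht => ?_)
    rw [Real.norm_of_nonneg (normSq_nonneg _ _)]
    exact ht.2

lemma L2P.mono_time {g : ℝ → PDistr n} (hg : L2P T s g) {T' : ℝ} (h : T' ≤ T) : L2P T' s g :=
  have hs : Ioo (0 : ℝ) T' ⊆ Ioo 0 T := Ioo_subset_Ioo_right h
  ⟨fun ξ => (hg.meas ξ).mono_measure (Measure.restrict_mono hs le_rfl),
    ae_mono (Measure.restrict_mono hs le_rfl) hg.mem, hg.int.mono_set hs⟩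

lemma L2P.mono {g : ℝ → PDistr n} (hg : L2P T s g) {r : ℝ} (h : r ≤ s) : L2P T r g :=
  L2P.of_le hg.meas hg.int (hg.mem.mono fun _ ht => ⟨ht.mono h, ht.normSq_mono h⟩)

lemma L2P.integrable_weight {g : ℝ → PDistr n} (hg : L2P T s g) (ξ : Fin n → ℤ) :
    IntegrableOn (fun t => rho ξ ^ (2 * s) * ‖g t ξ‖ ^ 2) (Ioo 0 T) := by
  refine Integrable.mono' hg.int (((hg.meas ξ).norm.pow 2).const_mul _) (hg.mem.mono fun t ht => ?_)
  rw [Real.norm_of_nonneg (weight_nonneg s (g t) ξ)]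
  exact ht.le_tsum ξ fun η _ => weight_nonneg s (g t) η

lemma L2P.integrable_sq {g : ℝ → PDistr n} (hg : L2P T s g) (ξ : Fin n → ℤ) :
    IntegrableOn (fun t => ‖g t ξ‖ ^ 2) (Ioo 0 T) := by
  have h := (hg.integrable_weight ξ).const_mul (rho ξ ^ (2 * s))⁻¹
  refine h.congr (.of_forall fun t => ?_)
  simp only
  rw [inv_mul_cancel_left₀ (Real.rpow_pos_of_pos (rho_pos ξ) _).ne']

lemma L2P.integrable {g : ℝ → PDistr n} (hg : L2P T s g) (ξ : Fin n → ℤ) :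
    IntegrableOn (fun t => g t ξ) (Ioo 0 T) := by
  have h := ((hg.integrable_sq ξ).add (integrableOn_const (C := (1 : ℝ)) (by simp)))
  refine Integrable.mono' h (hg.meas ξ) (.of_forall fun t => ?_)
  simp only [Pi.add_apply]
  nlinarith [sq_nonneg (‖g t ξ‖ - 1), norm_nonneg (g t ξ)]

/-- The norm of L₂(0, T; H^s) may be computed frequency by frequency, which reduces estimates of
diagonal operators to scalar ones. -/
lemma L2P.hasSum {g : ℝ → PDistr n} (hg : L2P T s g) :
    HasSum (fun ξ => rho ξ ^ (2 * s) * ∫ t in Ioo 0 T, ‖g t ξ‖ ^ 2)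
      (∫ t in Ioo 0 T, normSq s (g t)) := by
  simp only [← integral_const_mul]
  refine hasSum_integral_of_summable_integral_norm hg.integrable_weight ?_
  have h0 : ∀ ξ, 0 ≤ ∫ t in Ioo 0 T, ‖rho ξ ^ (2 * s) * ‖g t ξ‖ ^ 2‖ := fun ξ =>
    integral_nonneg fun t => norm_nonneg _
  refine summable_of_sum_le (c := ∫ t in Ioo 0 T, normSq s (g t)) h0 fun S => ?_
  rw [← integral_finsetSum _ fun ξ _ => (hg.integrable_weight ξ).norm]
  refine integral_mono_ae (integrable_finsetSum _ fun ξ _ => (hg.integrable_weight ξ).norm)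
    hg.int (hg.mem.mono fun t ht => ?_)
  simp only [Real.norm_of_nonneg (weight_nonneg s (g t) _)]
  exact ht.sum_le_tsum S fun ξ _ => weight_nonneg s (g t) ξ

/-- By Tonelli the integral of the norm is finite, hence the norm itself is finite at almost every
time. -/
lemma L2P.of_summable {g : ℝ → PDistr n}
    (hm : ∀ ξ, AEStronglyMeasurable (fun t => g t ξ) (volume.restrict (Ioo 0 T)))
    (hi : ∀ ξ, IntegrableOn (fun t => ‖g t ξ‖ ^ 2) (Ioo 0 T))
    (hs : Summable fun ξ => rho ξ ^ (2 * s) * ∫ t in Ioo 0 T, ‖g t ξ‖ ^ 2) : L2P T s g := by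
  have h0 : ∀ ξ, 0 ≤ rho ξ ^ (2 * s) * ∫ t in Ioo 0 T, ‖g t ξ‖ ^ 2 := fun ξ =>
    mul_nonneg (Real.rpow_nonneg (rho_pos ξ).le _) (integral_nonneg fun t => sq_nonneg _)
  have hfin : ∫⁻ t in Ioo 0 T, sob s (g t) ≠ ⊤ := by
    have : ∀ t, sob s (g t) = ∑' ξ, ENNReal.ofReal (rho ξ ^ (2 * s) * ‖g t ξ‖ ^ 2) := fun t =>
      tsum_congr fun ξ => sob_term s (g t) ξ
    simp only [this]
    have hme : ∀ ξ, AEMeasurable (fun t => ENNReal.ofReal (rho ξ ^ (2 * s) * ‖g t ξ‖ ^ 2))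
        (volume.restrict (Ioo 0 T)) := fun ξ =>
      (((hm ξ).norm.pow 2).const_mul _).aemeasurable.ennreal_ofReal
    rw [lintegral_tsum hme]
    have e : ∀ ξ, ∫⁻ t in Ioo 0 T, ENNReal.ofReal (rho ξ ^ (2 * s) * ‖g t ξ‖ ^ 2) =
        ENNReal.ofReal (rho ξ ^ (2 * s) * ∫ t in Ioo 0 T, ‖g t ξ‖ ^ 2) := fun ξ => by
      rw [← integral_const_mul, ofReal_integral_eq_lintegral_ofReal ((hi ξ).const_mul _)
        (.of_forall fun t => weight_nonneg s (g t) ξ)]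
    simp only [e]
    rw [← ENNReal.ofReal_tsum_of_nonneg h0 hs]
    exact ENNReal.ofReal_ne_top
  refine ⟨hm, ?_, ?_⟩
  · filter_upwards [ae_lt_top' (aemeasurable_sob hm s) hfin] with t ht using sobMem_iff.mpr ht.ne
  · simp only [normSq_eq_toReal]
    exact integrable_toReal_of_lintegral_ne_top (aemeasurable_sob hm s) hfin

/-- This form serves operators that act on each frequency separately but mix the times, such as the
solution operator `duh`. -/
lemma L2P.of_coeff_le {g h : ℝ → PDistr n} {r c : ℝ} (hh : L2P T r h)
    (hm : ∀ ξ, AEStronglyMeasurable (fun t => g t ξ) (volume.restrict (Ioo 0 T)))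
    (hle : ∀ ξ, IntegrableOn (fun t => ‖g t ξ‖ ^ 2) (Ioo 0 T) ∧
      rho ξ ^ (2 * s) * ∫ t in Ioo 0 T, ‖g t ξ‖ ^ 2 ≤
        c * (rho ξ ^ (2 * r) * ∫ t in Ioo 0 T, ‖h t ξ‖ ^ 2)) :
    L2P T s g ∧ ∫ t in Ioo 0 T, normSq s (g t) ≤ c * ∫ t in Ioo 0 T, normSq r (h t) := by
  have h1 : L2P T s g := L2P.of_summable hm (fun ξ => (hle ξ).1)
    (Summable.of_nonneg_of_le (fun ξ => mul_nonneg (Real.rpow_nonneg (rho_pos ξ).le _)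
      (integral_nonneg fun t => sq_nonneg _)) (fun ξ => (hle ξ).2) (hh.hasSum.summable.mul_left c))
  exact ⟨h1, hasSum_le (fun ξ => (hle ξ).2) h1.hasSum (hh.hasSum.mul_left c)⟩

lemma abs_weight_re_mul_le {a b c : ℝ} (h : a + b = 2 * c) (f k : PDistr n) (ξ : Fin n → ℤ) :
    |rho ξ ^ (2 * c) * (f ξ * conj (k ξ)).re| ≤
      1 / 2 * (rho ξ ^ (2 * a) * ‖f ξ‖ ^ 2 + rho ξ ^ (2 * b) * ‖k ξ‖ ^ 2) := by
  have h0 := Real.rpow_nonneg (rho_pos ξ).le (2 * c)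
  rw [abs_mul, abs_of_nonneg h0]
  have h1 : |(f ξ * conj (k ξ)).re| ≤ ‖f ξ‖ * ‖k ξ‖ := by
    refine (Complex.abs_re_le_norm _).trans (le_of_eq ?_)
    rw [norm_mul, RCLike.norm_conj]
  refine (mul_le_mul_of_nonneg_left h1 h0).trans ?_
  rw [rho_rpow_split h, ← rho_mul_sq, ← rho_mul_sq]
  nlinarith [sq_nonneg (rho ξ ^ a * ‖f ξ‖ - rho ξ ^ b * ‖k ξ‖)]

lemma L2P.inner {a b c : ℝ} (h : a + b = 2 * c) {f k : ℝ → PDistr n} (hf : L2P T a f)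
    (hk : L2P T b k) :
    IntegrableOn (fun t => ∑' ξ, rho ξ ^ (2 * c) * (f t ξ * conj (k t ξ)).re) (Ioo 0 T) ∧
      HasSum (fun ξ => ∫ t in Ioo 0 T, rho ξ ^ (2 * c) * (f t ξ * conj (k t ξ)).re)
        (∫ t in Ioo 0 T, ∑' ξ, rho ξ ^ (2 * c) * (f t ξ * conj (k t ξ)).re) := by
  have hm : ∀ ξ, AEStronglyMeasurable (fun t => rho ξ ^ (2 * c) * (f t ξ * conj (k t ξ)).re)
      (volume.restrict (Ioo 0 T)) := fun ξ =>
    (Complex.continuous_re.comp_aestronglyMeasurable ((hf.meas ξ).mul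
      (Complex.continuous_conj.comp_aestronglyMeasurable (hk.meas ξ)))).const_mul _
  have hw := fun ξ => ((hf.integrable_weight ξ).add (hk.integrable_weight ξ)).const_mul (1 / 2)
  have hle : ∀ ξ t, ‖rho ξ ^ (2 * c) * (f t ξ * conj (k t ξ)).re‖ ≤ 1 / 2 *
      (rho ξ ^ (2 * a) * ‖f t ξ‖ ^ 2 + rho ξ ^ (2 * b) * ‖k t ξ‖ ^ 2) := fun ξ t =>
    abs_weight_re_mul_le h (f t) (k t) ξ
  have hi : ∀ ξ, IntegrableOn (fun t => rho ξ ^ (2 * c) * (f t ξ * conj (k t ξ)).re) (Ioo 0 T) :=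
    fun ξ => Integrable.mono' (hw ξ) (hm ξ) (.of_forall (hle ξ))
  constructor
  · have hsum : ∀ᵐ t ∂(volume.restrict (Ioo 0 T)), (Summable fun ξ => 1 / 2 *
        (rho ξ ^ (2 * a) * ‖f t ξ‖ ^ 2 + rho ξ ^ (2 * b) * ‖k t ξ‖ ^ 2)) ∧
        ∑' ξ, 1 / 2 * (rho ξ ^ (2 * a) * ‖f t ξ‖ ^ 2 + rho ξ ^ (2 * b) * ‖k t ξ‖ ^ 2) =
          1 / 2 * (normSq a (f t) + normSq b (k t)) := by
      filter_upwards [hf.mem, hk.mem] with t h1 h2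
      have := ((h1.hasSum.add h2.hasSum).mul_left (1 / 2))
      exact ⟨this.summable, this.tsum_eq⟩
    refine Integrable.mono' ((hf.int.add hk.int).const_mul (1 / 2))
      (aestronglyMeasurable_tsum hm ?_) ?_
    · exact hsum.mono fun t ht => Summable.of_norm_bounded ht.1 fun ξ => hle ξ t
    · filter_upwards [hsum] with t ht
      rw [Pi.add_apply, ← ht.2]
      exact tsum_of_norm_bounded ht.1.hasSum fun ξ => hle ξ t
  · refine hasSum_integral_of_summable_integral_norm hi ?_
    have hs := (hf.hasSum.add hk.hasSum).summable.mul_left (1 / 2)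
    refine Summable.of_nonneg_of_le (fun ξ => integral_nonneg fun t => norm_nonneg _)
      (fun ξ => ?_) hs
    refine (integral_mono (hi ξ).norm (hw ξ) (hle ξ)).trans (le_of_eq ?_)
    simp only [Pi.add_apply]
    rw [integral_const_mul, integral_add (hf.integrable_weight ξ) (hk.integrable_weight ξ),
      integral_const_mul, integral_const_mul]

/-- The space `L₂(0, T; (H^s)ⁿ)` of complex-valued distributions. -/
def L2S (T s : ℝ) (h : ℝ → VDistr n) : Prop := ∀ i, L2P T s fun t => h t i

/-- The square of the norm in `L₂(0, T; (H^s)ⁿ)`. -/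
noncomputable def en (T s : ℝ) (h : ℝ → VDistr n) : ℝ := ∫ t in Ioo 0 T, vNormSq s (h t)

lemma en_nonneg (T s : ℝ) (h : ℝ → VDistr n) : 0 ≤ en T s h :=
  integral_nonneg fun t => vNormSq_nonneg s (h t)

lemma L2S.meas {h : ℝ → VDistr n} (hh : L2S T s h) : TimeMeasurable T h := fun i => (hh i).meas

lemma L2S.mem {h : ℝ → VDistr n} (hh : L2S T s h) :
    ∀ᵐ t ∂(volume.restrict (Ioo 0 T)), VSob s (h t) := ae_all_iff.mpr fun i => (hh i).mem

lemma L2S.int {h : ℝ → VDistr n} (hh : L2S T s h) :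
    IntegrableOn (fun t => vNormSq s (h t)) (Ioo 0 T) :=
  integrable_finsetSum _ fun i _ => (hh i).int

lemma L2S.en_eq {h : ℝ → VDistr n} (hh : L2S T s h) :
    en T s h = ∑ i, ∫ t in Ioo 0 T, normSq s (h t i) :=
  integral_finsetSum _ fun i _ => (hh i).int

lemma L2S.of_le {h : ℝ → VDistr n} (hm : TimeMeasurable T h) {F : ℝ → ℝ}
    (hF : IntegrableOn F (Ioo 0 T))
    (hle : ∀ᵐ t ∂(volume.restrict (Ioo 0 T)), VSob s (h t) ∧ vNormSq s (h t) ≤ F t) :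
    L2S T s h ∧ en T s h ≤ ∫ t in Ioo 0 T, F t := by
  have h1 : L2S T s h := fun i => L2P.of_le (hm i) hF
    (hle.mono fun t ht => ⟨ht.1 i, (normSq_le_vNormSq s (h t) i).trans ht.2⟩)
  exact ⟨h1, integral_mono_ae h1.int hF (hle.mono fun t ht => ht.2)⟩

lemma aestronglyMeasurable_vNormSq {h : ℝ → VDistr n} (hm : TimeMeasurable T h) (s : ℝ) :
    AEStronglyMeasurable (fun t => vNormSq s (h t)) (volume.restrict (Ioo 0 T)) :=
  Finset.aestronglyMeasurable_fun_sum _ fun i _ => aestronglyMeasurable_normSq (hm i) s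

lemma l2S_iff {h : ℝ → VDistr n} : L2S T s h ↔ TimeMeasurable T h ∧
    (∀ᵐ t ∂(volume.restrict (Ioo 0 T)), VSob s (h t)) ∧
    IntegrableOn (fun t => vNormSq s (h t)) (Ioo 0 T) :=
  ⟨fun h => ⟨h.meas, h.mem, h.int⟩, fun h => (L2S.of_le h.1 h.2.2 (h.2.1.mono fun _ ht =>
    ⟨ht, le_rfl⟩)).1⟩

lemma mem_L2V_iff {X : Set (VDistr n)} (hX : ∀ u ∈ X, VSob s u) {h : ℝ → VDistr n} :
    h ∈ L2V T s X ↔ L2S T s h ∧ ∀ᵐ t ∂(volume.restrict (Ioo 0 T)), h t ∈ X :=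
  ⟨fun h => ⟨l2S_iff.mpr ⟨h.1, h.2.1.mono fun t ht => hX _ ht, h.2.2⟩, h.2.1⟩,
    fun h => ⟨h.1.meas, h.2, h.1.int⟩⟩

lemma L2S.mono_time {h : ℝ → VDistr n} (hh : L2S T s h) {T' : ℝ} (hT : T' ≤ T) : L2S T' s h :=
  fun i => (hh i).mono_time hT

lemma L2S.mono {h : ℝ → VDistr n} (hh : L2S T s h) {r : ℝ} (hr : r ≤ s) : L2S T r h :=
  fun i => (hh i).mono hr

lemma TimeMeasurable.add {h k : ℝ → VDistr n} (hh : TimeMeasurable T h) (hk : TimeMeasurable T k) :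
    TimeMeasurable T (h + k) := fun i ξ => (hh i ξ).add (hk i ξ)

lemma TimeMeasurable.sub {h k : ℝ → VDistr n} (hh : TimeMeasurable T h) (hk : TimeMeasurable T k) :
    TimeMeasurable T (h - k) := fun i ξ => (hh i ξ).sub (hk i ξ)

lemma L2S.add {h k : ℝ → VDistr n} (hh : L2S T s h) (hk : L2S T s k) :
    L2S T s (h + k) ∧ en T s (h + k) ≤ 2 * (en T s h + en T s k) := by
  have := L2S.of_le (s := s) (hh.meas.add hk.meas) ((hh.int.add hk.int).const_mul 2) (by
    filter_upwards [hh.mem, hk.mem] with t h1 h2 using ⟨h1.add h2, vNormSq_add_le h1 h2⟩)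
  refine ⟨this.1, this.2.trans (le_of_eq ?_)⟩
  simp only [Pi.add_apply]
  rw [integral_const_mul, integral_add hh.int hk.int]
  rfl

lemma L2S.sub {h k : ℝ → VDistr n} (hh : L2S T s h) (hk : L2S T s k) :
    L2S T s (h - k) ∧ en T s (h - k) ≤ 2 * (en T s h + en T s k) := by
  have := L2S.of_le (s := s) (hh.meas.sub hk.meas) ((hh.int.add hk.int).const_mul 2) (by
    filter_upwards [hh.mem, hk.mem] with t h1 h2 using ⟨h1.sub h2, vNormSq_sub_le h1 h2⟩)
  refine ⟨this.1, this.2.trans (le_of_eq ?_)⟩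
  simp only [Pi.add_apply]
  rw [integral_const_mul, integral_add hh.int hk.int]
  rfl

/-- Multiplication by a bounded real multiplier that may depend on the time. -/
lemma L2S.rmul {h : ℝ → VDistr n} {r B : ℝ} (hh : L2S T r h) {c : ℝ → (Fin n → ℤ) → ℝ}
    (hc : ∀ ξ, AEStronglyMeasurable (fun t => c t ξ) (volume.restrict (Ioo 0 T)))
    (hb : ∀ t ∈ Ioo 0 T, ∀ ξ, rho ξ ^ (2 * s) * c t ξ ^ 2 ≤ B * rho ξ ^ (2 * r)) :
    L2S T s (fun t => rmul (c t) (h t)) ∧ en T s (fun t => rmul (c t) (h t)) ≤ B * en T r h := by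
  have := L2S.of_le (h := fun t => PeriodicNS.rmul (c t) (h t)) (s := s)
    (fun i ξ => (Complex.continuous_ofReal.comp_aestronglyMeasurable (hc ξ)).mul (hh.meas i ξ))
    (hh.int.const_mul B) (by
      filter_upwards [hh.mem, ae_restrict_mem measurableSet_Ioo] with t h1 ht
      refine vSob_of_le h1 fun ξ => ?_
      have e : ∑ i, ‖PeriodicNS.rmul (c t) (h t) i ξ‖ ^ 2 = c t ξ ^ 2 * ∑ i, ‖h t i ξ‖ ^ 2 := by
        simp only [PeriodicNS.rmul, norm_mul, Complex.norm_real, mul_pow, Real.norm_eq_abs, sq_abs,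
          Finset.mul_sum]
      rw [e, ← mul_assoc, ← mul_assoc]
      exact mul_le_mul_of_nonneg_right (hb t ht ξ) (Finset.sum_nonneg fun i _ => sq_nonneg _))
  exact ⟨this.1, this.2.trans (le_of_eq (integral_const_mul _ _))⟩

lemma L2S.const_rmul {h : ℝ → VDistr n} (hh : L2S T s h) (c : ℝ) :
    L2S T s (fun t => PeriodicNS.rmul (fun _ => c) (h t)) ∧
      en T s (fun t => PeriodicNS.rmul (fun _ => c) (h t)) ≤ c ^ 2 * en T s h :=
  hh.rmul (fun _ => aestronglyMeasurable_const) fun _ _ _ => (mul_comm _ _).le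

lemma L2S.leray {h : ℝ → VDistr n} (hh : L2S T s h) :
    L2S T s (fun t => leray (h t)) ∧ en T s (fun t => leray (h t)) ≤ en T s h := by
  refine L2S.of_le (fun i ξ => ?_) hh.int (hh.mem.mono fun t ht => ht.leray)
  by_cases h0 : ξ = 0
  · simp only [PeriodicNS.leray, h0, if_true]
    exact aestronglyMeasurable_const
  · simp only [PeriodicNS.leray, h0, if_false]
    refine (hh.meas i ξ).sub ?_
    simp only [div_eq_mul_inv]
    exact ((Finset.aestronglyMeasurable_fun_sum _ fun j _ =>
      (hh.meas j ξ).const_mul _).const_mul _).mul_const _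

lemma L2S.vin {a b c : ℝ} (h : a + b = 2 * c) {f k : ℝ → VDistr n} (hf : L2S T a f)
    (hk : L2S T b k) : IntegrableOn (fun t => vin c (f t) (k t)) (Ioo 0 T) ∧
      ∀ i, HasSum (fun ξ => ∫ t in Ioo 0 T, rho ξ ^ (2 * c) * (f t i ξ * conj (k t i ξ)).re)
        (∫ t in Ioo 0 T, ∑' ξ, rho ξ ^ (2 * c) * (f t i ξ * conj (k t i ξ)).re) :=
  ⟨integrable_finsetSum _ fun i _ => ((hf i).inner h (hk i)).1, fun i => ((hf i).inner h (hk i)).2⟩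

lemma L2S.integral_vin {a b c : ℝ} (h : a + b = 2 * c) {f k : ℝ → VDistr n} (hf : L2S T a f)
    (hk : L2S T b k) : ∫ t in Ioo 0 T, PeriodicNS.vin c (f t) (k t) =
      ∑ i, ∫ t in Ioo 0 T, ∑' ξ, rho ξ ^ (2 * c) * (f t i ξ * conj (k t i ξ)).re :=
  integral_finsetSum _ fun i _ => ((hf i).inner h (hk i)).1

end

section

/-! ### Primitives of integrable functions -/

/-- `y` is a primitive of the integrable function `z` on `[0, T]`. -/
def IsPrim {E : Type*} [NormedAddCommGroup E] [NormedSpace ℝ E] (T : ℝ) (y z : ℝ → E) : Prop :=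
  IntegrableOn z (Ioo 0 T) ∧ ∀ t ∈ Icc 0 T, y t = y 0 + ∫ τ in (0 : ℝ)..t, z τ

lemma intervalIntegrable_of_Ioo {E : Type*} [NormedAddCommGroup E] {T : ℝ} {z : ℝ → E} (hz : IntegrableOn z (Ioo 0 T)) {a b : ℝ}
    (ha : a ∈ Icc 0 T) (hb : b ∈ Icc 0 T) : IntervalIntegrable z volume a b := by
  rw [intervalIntegrable_iff]
  have h : IntegrableOn z (Ioc 0 T) := (integrableOn_Ioc_iff_integrableOn_Ioo (by simp)).mpr hz
  exact h.mono_set fun x hx => ⟨(le_min ha.1 hb.1).trans_lt hx.1, hx.2.trans (max_le ha.2 hb.2)⟩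

section

variable {E F : Type*} [NormedAddCommGroup E] [NormedSpace ℝ E] [NormedAddCommGroup F]
  [NormedSpace ℝ F] {T : ℝ}

lemma integral_Ioo_eq (z : ℝ → E) {t : ℝ} (ht : 0 ≤ t) :
    ∫ τ in Ioo 0 t, z τ = ∫ τ in (0 : ℝ)..t, z τ := by
  rw [intervalIntegral.integral_of_le ht, integral_Ioc_eq_integral_Ioo]

lemma IsPrim.mono_time {y z : ℝ → E} (h : IsPrim T y z) {T' : ℝ} (hT : T' ≤ T) : IsPrim T' y z :=
  ⟨h.1.mono_set (Ioo_subset_Ioo_right hT), fun t ht => h.2 t ⟨ht.1, ht.2.trans hT⟩⟩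

lemma IsPrim.congr {y z y' z' : ℝ → E} (h : IsPrim T y z) (hT : 0 ≤ T)
    (hy : ∀ t ∈ Icc 0 T, y' t = y t) (hz : z' =ᵐ[volume.restrict (Ioo 0 T)] z) :
    IsPrim T y' z' := by
  refine ⟨h.1.congr hz.symm, fun t ht => ?_⟩
  rw [hy t ht, hy 0 ⟨le_rfl, hT⟩, h.2 t ht, ← integral_Ioo_eq z ht.1, ← integral_Ioo_eq z' ht.1]
  congr 1
  exact (setIntegral_congr_ae₀ nullMeasurableSet_Ioo ((ae_restrict_iff' measurableSet_Ioo).mp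
    (ae_mono (Measure.restrict_mono (Ioo_subset_Ioo_right ht.2) le_rfl) hz))).symm

lemma IsPrim.clm_comp {y z : ℝ → E} (h : IsPrim T y z) (L : E →L[ℝ] F) [CompleteSpace E]
    [CompleteSpace F] : IsPrim T (fun t => L (y t)) (fun t => L (z t)) := by
  refine ⟨L.integrable_comp h.1, fun t ht => ?_⟩
  have hi := intervalIntegrable_of_Ioo h.1 ⟨le_rfl, ht.1.trans ht.2⟩ ht
  beta_reduce
  rw [h.2 t ht, map_add, L.intervalIntegral_comp_comm hi]

lemma IsPrim.add {y z y' z' : ℝ → E} (h : IsPrim T y z) (h' : IsPrim T y' z') :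
    IsPrim T (fun t => y t + y' t) (fun t => z t + z' t) := by
  refine ⟨h.1.add h'.1, fun t ht => ?_⟩
  have h0 : (0 : ℝ) ∈ Icc 0 T := ⟨le_rfl, ht.1.trans ht.2⟩
  beta_reduce
  rw [intervalIntegral.integral_add (intervalIntegrable_of_Ioo h.1 h0 ht)
    (intervalIntegrable_of_Ioo h'.1 h0 ht), h.2 t ht, h'.2 t ht]
  abel

lemma IsPrim.sub_eq {y z : ℝ → E} (h : IsPrim T y z) {a b : ℝ} (ha : a ∈ Icc 0 T)
    (hb : b ∈ Icc 0 T) : y b - y a = ∫ τ in a..b, z τ := by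
  have h0 : (0 : ℝ) ∈ Icc 0 T := ⟨le_rfl, ha.1.trans ha.2⟩
  rw [h.2 b hb, h.2 a ha, ← intervalIntegral.integral_interval_sub_left
    (intervalIntegrable_of_Ioo h.1 h0 hb) (intervalIntegrable_of_Ioo h.1 h0 ha)]
  abel

lemma IsPrim.continuousOn {y z : ℝ → E} (h : IsPrim T y z) : ContinuousOn y (Icc 0 T) := by
  rcases lt_or_ge T 0 with hT | hT
  · simp [Icc_eq_empty_of_lt hT]
  have h0 : (0 : ℝ) ∈ Icc 0 T := ⟨le_rfl, hT⟩
  have := intervalIntegral.continuousOn_primitive_interval (μ := volume) (f := z) (a := 0) (b := T)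
    (by
      rw [uIcc_of_le hT]
      exact (integrableOn_Icc_iff_integrableOn_Ioo (by simp) (by simp)).mpr h.1)
  rw [uIcc_of_le hT] at this
  exact (continuousOn_const.add this).congr fun t ht => h.2 t ht

lemma isPrim_of_hasDerivAt [CompleteSpace E] {y z : ℝ → E} (h : ∀ t, HasDerivAt y (z t) t)
    (hz : Continuous z) : IsPrim T y z := by
  refine ⟨(hz.integrableOn_Icc (a := 0) (b := T)).mono_set Ioo_subset_Icc_self, fun t _ => ?_⟩
  rw [intervalIntegral.integral_eq_sub_of_hasDerivAt (fun x _ => h x) (hz.intervalIntegrable _ _)]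
  abel

/-- The product rule for real functions. -/
lemma IsPrim.mul_real {y z y' z' : ℝ → ℝ} (h : IsPrim T y z) (h' : IsPrim T y' z') :
    IsPrim T (fun t => y t * y' t) (fun t => z t * y' t + y t * z' t) := by
  rcases lt_or_ge T 0 with hT | hT
  · exact ⟨by simp [Ioo_eq_empty_of_le hT.le], by simp [Icc_eq_empty_of_lt hT]⟩
  have h0 : (0 : ℝ) ∈ Icc 0 T := ⟨le_rfl, hT⟩
  have hTm : T ∈ Icc 0 T := ⟨hT, le_rfl⟩
  -- The primitive extends to an absolutely continuous function whose derivative is the integrand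
  -- almost everywhere, so integration by parts for absolutely continuous functions applies.
  have key : ∀ {y z : ℝ → ℝ}, IsPrim T y z → ∃ Y : ℝ → ℝ, AbsolutelyContinuousOnInterval Y 0 T ∧
      (∀ t ∈ Icc 0 T, y t = Y t) ∧ ∀ᵐ x, x ∈ Icc 0 T → deriv Y x = z x := fun {y z} h => by
    have hi := intervalIntegrable_of_Ioo h.1 h0 hTm
    refine ⟨fun t => y 0 + ∫ τ in (0 : ℝ)..t, z τ, ?_, h.2, ?_⟩
    · exact AbsolutelyContinuousOnInterval.add (LipschitzOnWith.absolutelyContinuousOnInterval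
        (LipschitzWith.const (y 0)).lipschitzOnWith)
        (hi.absolutelyContinuousOnInterval_intervalIntegral (by simp))
    · filter_upwards [hi.ae_hasDerivAt_integral] with x hx hx'
      rw [uIcc_of_le hT] at hx
      exact ((hx hx' 0 h0).const_add _).deriv
  obtain ⟨Y, hY, hYe, hYd⟩ := key h
  obtain ⟨Y', hY', hYe', hYd'⟩ := key h'
  have hcont := h.continuousOn
  have hcont' := h'.continuousOn
  have hi := intervalIntegrable_of_Ioo h.1 h0 hTm
  have hi' := intervalIntegrable_of_Ioo h'.1 h0 hTm
  refine ⟨?_, fun t ht => ?_⟩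
  · have := (hi.mul_continuousOn (g := y') (by rwa [uIcc_of_le hT])).add
      (hi'.continuousOn_mul (g := y) (by rwa [uIcc_of_le hT]))
    rw [intervalIntegrable_iff_integrableOn_Ioo_of_le hT] at this
    exact this
  · have hsub : uIcc 0 t ⊆ uIcc 0 T := by
      rw [uIcc_of_le ht.1, uIcc_of_le hT]; exact Icc_subset_Icc_right ht.2
    have e := AbsolutelyContinuousOnInterval.integral_deriv_mul_eq_sub (hY.mono hsub)
      (hY'.mono hsub)
    have e2 : ∫ x in (0 : ℝ)..t, deriv Y x * Y' x + Y x * deriv Y' x =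
        ∫ x in (0 : ℝ)..t, z x * y' x + y x * z' x := by
      refine intervalIntegral.integral_congr_ae ?_
      filter_upwards [hYd, hYd'] with x h1 h2 hx
      rw [uIoc_of_le ht.1] at hx
      have hx' : x ∈ Icc 0 T := ⟨hx.1.le, hx.2.trans ht.2⟩
      rw [h1 hx', h2 hx', hYe x hx', hYe' x hx']
    beta_reduce
    rw [← e2, e, hYe t ht, hYe' t ht, hYe 0 h0, hYe' 0 h0]
    ring

end

variable {T : ℝ}

lemma IsPrim.re {y z : ℝ → ℂ} (h : IsPrim T y z) : IsPrim T (fun t => (y t).re) (fun t => (z t).re) :=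
  h.clm_comp Complex.reCLM

lemma IsPrim.im {y z : ℝ → ℂ} (h : IsPrim T y z) : IsPrim T (fun t => (y t).im) (fun t => (z t).im) :=
  h.clm_comp Complex.imCLM

lemma isPrim_of_re_im {y z : ℝ → ℂ} (h : IsPrim T (fun t => (y t).re) (fun t => (z t).re))
    (h' : IsPrim T (fun t => (y t).im) (fun t => (z t).im)) : IsPrim T y z := by
  have h1 := (h.clm_comp Complex.ofRealCLM).add
    ((h'.clm_comp Complex.ofRealCLM).clm_comp (ContinuousLinearMap.mul ℝ ℂ Complex.I))
  have e : ∀ w : ℂ, Complex.ofRealCLM w.re +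
      (ContinuousLinearMap.mul ℝ ℂ Complex.I) (Complex.ofRealCLM w.im) = w := fun w => by
    simp only [Complex.ofRealCLM_apply, ContinuousLinearMap.mul_apply']
    rw [mul_comm, Complex.re_add_im]
  simpa only [e] using h1

/-- The product rule for a real and a complex function. -/
lemma IsPrim.ofReal_mul {φ dφ : ℝ → ℝ} {y z : ℝ → ℂ} (hφ : IsPrim T φ dφ) (h : IsPrim T y z) :
    IsPrim T (fun t => (φ t : ℂ) * y t) (fun t => (dφ t : ℂ) * y t + (φ t : ℂ) * z t) := by
  have h1 := hφ.mul_real h.re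
  have h2 := hφ.mul_real h.im
  refine isPrim_of_re_im ?_ ?_
  · simpa using h1
  · simpa using h2

/-- The product rule for the real scalar product of complex functions. -/
lemma IsPrim.re_mul_conj {y z y' z' : ℝ → ℂ} (h : IsPrim T y z) (h' : IsPrim T y' z') :
    IsPrim T (fun t => (y t * conj (y' t)).re)
      (fun t => (z t * conj (y' t)).re + (y t * conj (z' t)).re) := by
  have h1 := (h.re.mul_real h'.re).add (h.im.mul_real h'.im)
  convert h1 using 2
  · simp
  · simp; ring

/-! ### Time derivatives of the Fourier coefficients. -/

/-- The coefficients of `u` are primitives of those of `du`. -/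
def HasPrim (T : ℝ) (u du : ℝ → VDistr n) : Prop :=
  ∀ i ξ, IsPrim T (fun t => u t i ξ) fun t => du t i ξ

lemma HasPrim.mono_time {u du : ℝ → VDistr n} (h : HasPrim T u du) {T' : ℝ} (hT : T' ≤ T) :
    HasPrim T' u du := fun i ξ => (h i ξ).mono_time hT

lemma HasPrim.add {u du v dv : ℝ → VDistr n} (h : HasPrim T u du) (h' : HasPrim T v dv) :
    HasPrim T (u + v) (du + dv) := fun i ξ => (h i ξ).add (h' i ξ)

/-- A primitive has the distributional derivative that it should have. -/
lemma HasPrim.isTimeDeriv {u du : ℝ → VDistr n} (h : HasPrim T u du) : IsTimeDeriv T u du := by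
  intro i ξ
  refine ⟨(h i ξ).1.locallyIntegrableOn, fun ψ hψ _ hs => ?_⟩
  rcases le_or_gt T 0 with hT | hT
  · simp [Ioo_eq_empty_of_le hT]
  have h0 : (0 : ℝ) ∈ Icc 0 T := ⟨le_rfl, hT.le⟩
  have hTm : T ∈ Icc 0 T := ⟨hT.le, le_rfl⟩
  have hd : Differentiable ℝ ψ := hψ.differentiable (by simp)
  have hdc : Continuous (deriv ψ) := hψ.continuous_deriv (by simp)
  have hp : IsPrim T ψ (deriv ψ) := isPrim_of_hasDerivAt (fun t => (hd t).hasDerivAt) hdc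
  have e := (hp.ofReal_mul (h i ξ)).2 T hTm
  have z0 : ψ 0 = 0 := image_eq_zero_of_notMem_tsupport fun h => (hs h).1.false
  have zT : ψ T = 0 := image_eq_zero_of_notMem_tsupport fun h => (hs h).2.false
  beta_reduce at e
  rw [z0, zT, Complex.ofReal_zero, zero_mul, zero_mul, zero_add] at e
  have hi := intervalIntegrable_of_Ioo (h i ξ).1 h0 hTm
  have c1 : IntervalIntegrable (fun t => ((deriv ψ t : ℝ) : ℂ) * u t i ξ) volume 0 T := by
    refine ContinuousOn.intervalIntegrable ?_
    rw [uIcc_of_le hT.le]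
    exact (Complex.continuous_ofReal.comp hdc).continuousOn.mul (h i ξ).continuousOn
  have c2 : IntervalIntegrable (fun t => (ψ t : ℂ) * du t i ξ) volume 0 T :=
    hi.continuousOn_mul (Complex.continuous_ofReal.comp hψ.continuous).continuousOn
  rw [intervalIntegral.integral_add c1 c2] at e
  rw [integral_Ioo_eq _ hT.le, integral_Ioo_eq _ hT.le]
  exact eq_neg_of_add_eq_zero_left e.symm

/-- The distributional derivative is unique. -/
lemma IsTimeDeriv.unique {u du du' : ℝ → VDistr n} (h : IsTimeDeriv T u du)
    (h' : IsTimeDeriv T u du') : ∀ᵐ t ∂(volume.restrict (Ioo 0 T)), du t = du' t := by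
  have key : ∀ i ξ, ∀ᵐ t ∂(volume.restrict (Ioo 0 T)), du t i ξ = du' t i ξ := fun i ξ => by
    rw [ae_restrict_iff' measurableSet_Ioo]
    have hl := (h i ξ).1.sub (h' i ξ).1
    have := isOpen_Ioo.ae_eq_zero_of_integral_contDiff_smul_eq_zero hl fun ψ hψ hc hs => by
      have e1 := (h i ξ).2 ψ hψ hc hs
      have e2 := (h' i ξ).2 ψ hψ hc hs
      have hint : ∀ {g : ℝ → ℂ}, LocallyIntegrableOn g (Ioo 0 T) →
          Integrable (fun t => (ψ t : ℂ) * g t) := fun {g} hg => by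
        have hK := hg.integrableOn_compact_subset hs hc
        have : IntegrableOn (fun t => (ψ t : ℂ) * g t) (tsupport ψ) :=
          hK.continuousOn_mul (Complex.continuous_ofReal.comp hψ.continuous).continuousOn hc
        refine (integrableOn_iff_integrable_of_support_subset fun t ht => ?_).mp this
        by_contra hts
        exact ht (by simp [image_eq_zero_of_notMem_tsupport hts])
      have hset : ∀ g : ℝ → ℂ, ∫ t in Ioo 0 T, (ψ t : ℂ) * g t = ∫ t, (ψ t : ℂ) * g t := fun g =>
        setIntegral_eq_integral_of_forall_compl_eq_zero fun t ht => by
          rw [image_eq_zero_of_notMem_tsupport fun h => ht (hs h)]; simp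
      rw [hset] at e1 e2
      have e3 : ∀ t, ψ t • ((fun t => du t i ξ) - fun t => du' t i ξ) t =
          (ψ t : ℂ) * du t i ξ - (ψ t : ℂ) * du' t i ξ := fun t => by
        simp [mul_sub]
      simp only [e3]
      rw [integral_sub (hint (h i ξ).1) (hint (h' i ξ).1), sub_eq_zero]
      exact neg_injective (e1.symm.trans e2)
    filter_upwards [this] with t ht hm using sub_eq_zero.mp (ht hm)
  filter_upwards [ae_all_iff.mpr fun i => ae_all_iff.mpr fun ξ => key i ξ] with t ht
  ext i ξ
  exact ht i ξ

/-- The lemma of du Bois-Reymond. -/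
lemma constant_of_integral_deriv_mul_eq_zero (hT : 0 < T) {y : ℝ → ℂ}
    (hy : ContinuousOn y (Icc 0 T))
    (h : ∀ ψ : ℝ → ℝ, ContDiff ℝ ∞ ψ → HasCompactSupport ψ → tsupport ψ ⊆ Ioo 0 T →
      ∫ t in Ioo 0 T, ((deriv ψ t : ℝ) : ℂ) * y t = 0) : ∀ t ∈ Icc 0 T, y t = y 0 := by
  obtain ⟨f, hfs, hfc, hfd, hfr, hf1⟩ := exists_contDiff_tsupport_subset (E := ℝ) (n := ⊤)
    (isOpen_Ioo.mem_nhds (show T / 2 ∈ Ioo 0 T from ⟨by linarith, by linarith⟩))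
  have hJ : 0 < ∫ t, f t := hfd.continuous.integral_pos_of_hasCompactSupport_nonneg_nonzero hfc
    (fun t => (hfr ⟨t, rfl⟩).1) (x := T / 2) (by rw [hf1]; exact one_ne_zero)
  set J := ∫ t, f t
  have hyi : IntegrableOn y (Ioo 0 T) := (hy.integrableOn_Icc).mono_set Ioo_subset_Icc_self
  have hmul : ∀ {φ : ℝ → ℝ}, Continuous φ → IntegrableOn (fun t => (φ t : ℂ) * y t) (Ioo 0 T) :=
    fun {φ} hφ => (((Complex.continuous_ofReal.comp hφ).continuousOn.mul hy).integrableOn_Icc).mono_set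
      Ioo_subset_Icc_self
  -- The average of y against the normalised bump f: the only value that y can take if it is
  -- constant.
  set c : ℂ := (∫ t in Ioo 0 T, (f t : ℂ) * y t) / J with hc
  have hcJ : c * J = ∫ t in Ioo 0 T, (f t : ℂ) * y t :=
    div_mul_cancel₀ _ (Complex.ofReal_ne_zero.mpr hJ.ne')
  have hzero : ∀ᵐ t, t ∈ Ioo 0 T → y t - c = 0 := by
    refine isOpen_Ioo.ae_eq_zero_of_integral_contDiff_smul_eq_zero
      (hyi.sub (integrableOn_const (by simp))).locallyIntegrableOn fun φ hφ hφc hφs => ?_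
    -- Subtracting k f makes the integral of φ vanish, so that the primitive of the difference again
    -- has compact support in (0, T) and is an admissible test function.
    set k := (∫ t, φ t) / J with hk
    set θ : ℝ → ℝ := fun t => φ t - k * f t with hθ
    have hθd : ContDiff ℝ ∞ θ := hφ.sub (contDiff_const.mul hfd)
    have hφi : Integrable φ := hφ.continuous.integrable_of_hasCompactSupport hφc
    have hfi : Integrable f := hfd.continuous.integrable_of_hasCompactSupport hfc
    have hθi : Integrable θ := hφi.sub (hfi.const_mul k)
    have hθ0 : ∫ t, θ t = 0 := by
      rw [integral_sub hφi (hfi.const_mul k), integral_const_mul, hk, div_mul_cancel₀ _ hJ.ne',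
        sub_self]
    set K := tsupport φ ∪ tsupport f with hK
    have hKc : IsCompact K := hφc.union hfc
    have hKn : K.Nonempty := ⟨T / 2, Or.inr (subset_tsupport f (by
      rw [Function.mem_support, hf1]; exact one_ne_zero))⟩
    have hKs : K ⊆ Ioo 0 T := union_subset hφs hfs
    have hθK : ∀ t, t ∉ K → θ t = 0 := fun t ht => by
      rw [hK, mem_union, not_or] at ht
      simp [hθ, image_eq_zero_of_notMem_tsupport ht.1, image_eq_zero_of_notMem_tsupport ht.2]
    have ha := hKs (hKc.sInf_mem hKn)
    have hb := hKs (hKc.sSup_mem hKn)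
    set a := sInf K
    set b := sSup K
    have hKab : ∀ t ∈ K, t ∈ Icc a b := fun t ht =>
      ⟨csInf_le hKc.bddBelow ht, le_csSup hKc.bddAbove ht⟩
    set ψ : ℝ → ℝ := fun t => ∫ τ in (0 : ℝ)..t, θ τ with hψ
    have hψd : ∀ t, HasDerivAt ψ (θ t) t := fun t =>
      intervalIntegral.integral_hasDerivAt_right (hθd.continuous.intervalIntegrable _ _)
        (hθd.continuous.stronglyMeasurableAtFilter _ _) hθd.continuous.continuousAt
    have hder : deriv ψ = θ := funext fun t => (hψd t).deriv
    have hψc : ContDiff ℝ ∞ ψ := contDiff_infty_iff_deriv.mpr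
      ⟨fun t => (hψd t).differentiableAt, hder ▸ hθd⟩
    have hsupp : Function.support ψ ⊆ Icc a b := by
      intro t ht
      by_contra hn
      apply ht
      rw [mem_Icc, not_and_or, not_le, not_le] at hn
      rcases hn with hn | hn
      · refine intervalIntegral.integral_zero_ae (.of_forall fun x hx => hθK x fun hxK => ?_)
        have := (hKab x hxK).1
        have h2 := hx.2
        rcases le_total t 0 with h3 | h3
        · rw [max_eq_left h3] at h2; linarith [ha.1]
        · rw [max_eq_right h3] at h2; linarith
      · have ht0 : 0 ≤ t := by linarith [hb.1]
        change ∫ τ in (0 : ℝ)..t, θ τ = 0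
        rw [intervalIntegral.integral_of_le ht0,
          setIntegral_eq_integral_of_forall_compl_eq_zero fun x hx => hθK x fun hxK => ?_, hθ0]
        exact hx ⟨(hKs hxK).1, ((hKab x hxK).2).trans hn.le⟩
    have hts : tsupport ψ ⊆ Icc a b := closure_minimal hsupp isClosed_Icc
    have e := h ψ hψc (HasCompactSupport.of_support_subset_isCompact isCompact_Icc hsupp)
      (hts.trans fun t ht => ⟨ha.1.trans_le ht.1, ht.2.trans_lt hb.2⟩)
    rw [hder] at e
    have e1 : ∫ t in Ioo 0 T, (φ t : ℂ) * y t = k * (c * J) := by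
      rw [hcJ, ← integral_const_mul, ← sub_eq_zero, ← integral_sub (hmul hφ.continuous)
        ((hmul hfd.continuous).const_mul _), ← e]
      refine integral_congr_ae (.of_forall fun t => ?_)
      simp only [hθ]
      push_cast; ring
    have e2 : ∫ t, φ t • (y t - c) = ∫ t in Ioo 0 T, ((φ t : ℂ) * y t - c * (φ t : ℂ)) := by
      rw [← setIntegral_eq_integral_of_forall_compl_eq_zero (s := Ioo 0 T) fun t ht => by
        rw [image_eq_zero_of_notMem_tsupport fun h => ht (hφs h), zero_smul]]
      refine integral_congr_ae (.of_forall fun t => ?_)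
      simp only [Complex.real_smul]
      ring
    have e3 : ∫ t in Ioo 0 T, (φ t : ℂ) = k * J := by
      rw [setIntegral_eq_integral_of_forall_compl_eq_zero fun t ht => by
        rw [image_eq_zero_of_notMem_tsupport fun h => ht (hφs h), Complex.ofReal_zero],
        integral_complex_ofReal, ← Complex.ofReal_mul, hk, div_mul_cancel₀ _ hJ.ne']
    have hφC : IntegrableOn (fun t => (φ t : ℂ)) (Ioo 0 T) := hφi.ofReal.integrableOn
    rw [e2, integral_sub (hmul hφ.continuous) (hφC.const_mul c), e1,
      integral_const_mul, e3]
    ring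
  have hIoo : ∀ t ∈ Ioo 0 T, y t = c := by
    have hae : y =ᵐ[volume.restrict (Ioo 0 T)] fun _ => c := by
      rw [EventuallyEq, ae_restrict_iff' measurableSet_Ioo]
      filter_upwards [hzero] with t ht hm using sub_eq_zero.mp (ht hm)
    exact fun t ht => Measure.eqOn_open_of_ae_eq hae isOpen_Ioo (hy.mono Ioo_subset_Icc_self)
      continuousOn_const ht
  have hIcc : ∀ t ∈ Icc 0 T, y t = c := fun t ht => by
    have hcl : closure (Ioo 0 T) = Icc 0 T := closure_Ioo hT.ne
    have := Set.EqOn.of_subset_closure (f := y) (g := fun _ => c) hIoo hy continuousOn_const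
      Ioo_subset_Icc_self hcl.ge
    exact this ht
  intro t ht
  rw [hIcc t ht, hIcc 0 ⟨le_rfl, hT.le⟩]

/-- The difference of u and the primitive of du has zero weak derivative and is continuous on the
closed interval, hence is constant there at every time. -/
lemma IsTimeDeriv.hasPrim (hT : 0 < T) {u du : ℝ → VDistr n} (h : IsTimeDeriv T u du)
    (hi : ∀ i ξ, IntegrableOn (fun t => du t i ξ) (Ioo 0 T))
    (hc : ∀ i ξ, ContinuousOn (fun t => u t i ξ) (Icc 0 T)) : HasPrim T u du := by
  intro i ξ
  have hP : HasPrim T (fun t (_ : Fin n) (_ : Fin n → ℤ) => ∫ τ in (0 : ℝ)..t, du τ i ξ)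
      fun t _ _ => du t i ξ := fun _ _ => ⟨hi i ξ, fun t _ => by simp⟩
  have hPt := hP.isTimeDeriv i ξ
  have hPc := (hP i ξ).continuousOn
  have := constant_of_integral_deriv_mul_eq_zero hT ((hc i ξ).sub hPc) fun ψ hψ hψc hs => by
    have e1 := (h i ξ).2 ψ hψ hψc hs
    have e2 := hPt.2 ψ hψ hψc hs
    have hd : Continuous (deriv ψ) := hψ.continuous_deriv (by simp)
    have hint : ∀ {g : ℝ → ℂ}, ContinuousOn g (Icc 0 T) →
        IntegrableOn (fun t => ((deriv ψ t : ℝ) : ℂ) * g t) (Ioo 0 T) := fun {g} hg =>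
      (((Complex.continuous_ofReal.comp hd).continuousOn.mul hg).integrableOn_Icc).mono_set
        Ioo_subset_Icc_self
    simp only [Pi.sub_apply, mul_sub]
    rw [integral_sub (hint (hc i ξ)) (hint hPc), e1, e2, sub_self]
  refine ⟨hi i ξ, fun t ht => ?_⟩
  have e := this t ht
  simp only [Pi.sub_apply, intervalIntegral.integral_same, sub_zero] at e
  beta_reduce
  rw [← e]
  ring

end

section

/-! ### Evolution of scalar products and norms -/

variable {T s : ℝ}

lemma re_mul_conj_self (z : ℂ) : (z * conj z).re = ‖z‖ ^ 2 := by
  rw [Complex.mul_conj, Complex.ofReal_re, Complex.normSq_eq_norm_sq]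

lemma abs_re_mul_conj_le (z w : ℂ) : |(z * conj w).re| ≤ ‖z‖ * ‖w‖ := by
  refine (Complex.abs_re_le_norm _).trans (le_of_eq ?_)
  rw [norm_mul, RCLike.norm_conj]

lemma integrable_re_mul_conj {y z : ℝ → ℂ} {A : Set ℝ}
    (hy : AEStronglyMeasurable y (volume.restrict A))
    (hz : AEStronglyMeasurable z (volume.restrict A)) (hy2 : IntegrableOn (fun t => ‖y t‖ ^ 2) A)
    (hz2 : IntegrableOn (fun t => ‖z t‖ ^ 2) A) :
    IntegrableOn (fun t => (y t * conj (z t)).re) A := by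
  refine Integrable.mono' (hy2.add hz2) (Complex.continuous_re.comp_aestronglyMeasurable
    (hy.mul (Complex.continuous_conj.comp_aestronglyMeasurable hz))) (.of_forall fun t => ?_)
  refine (abs_re_mul_conj_le _ _).trans ?_
  simp only [Pi.add_apply]
  nlinarith [sq_nonneg (‖y t‖ - ‖z t‖), sq_nonneg (‖y t‖), sq_nonneg (‖z t‖)]

/-- The product rule holds for each coefficient and is summed over the frequencies. Two separate
pairs of dual orders are allowed, since a weak solution and a regular one are paired in different
spaces. -/
lemma vin_evolution (hT : 0 ≤ T) {a a' b b' c : ℝ} (h : a + a' = 2 * c) (h' : b + b' = 2 * c)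
    {y dy z dz : ℝ → VDistr n} (hy : HasPrim T y dy) (hz : HasPrim T z dz) (hya : L2S T a y)
    (hdz : L2S T a' dz) (hdy : L2S T b dy) (hzb : L2S T b' z) (hy0 : VSob c (y 0))
    (hz0 : VSob c (z 0)) :
    vin c (y T) (z T) = vin c (y 0) (z 0) +
      ∫ t in Ioo 0 T, (vin c (dy t) (z t) + vin c (y t) (dz t)) := by
  have e1 := hdy.vin h' hzb
  have e2 := hya.vin h hdz
  rw [integral_add e1.1 e2.1, hdy.integral_vin h' hzb, hya.integral_vin h hdz]
  simp only [vin]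
  rw [← Finset.sum_add_distrib, ← Finset.sum_add_distrib]
  refine Finset.sum_congr rfl fun i _ => ?_
  have h0 := ((hy0 i).summable_inner (s := c) (by ring) (hz0 i)).hasSum
  have hs := h0.add ((e1.2 i).add (e2.2 i))
  rw [← hs.tsum_eq]
  refine tsum_congr fun ξ => ?_
  rw [integral_const_mul, integral_const_mul, ← mul_add, ← mul_add]
  congr 1
  rw [← integral_add (integrable_re_mul_conj (hdy.meas i ξ) (hzb.meas i ξ)
    ((hdy i).integrable_sq ξ) ((hzb i).integrable_sq ξ)) (integrable_re_mul_conj (hya.meas i ξ)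
    (hdz.meas i ξ) ((hya i).integrable_sq ξ) ((hdz i).integrable_sq ξ)), integral_Ioo_eq _ hT]
  exact ((hy i ξ).re_mul_conj (hz i ξ)).2 T ⟨hT, le_rfl⟩

/-- |û|² grows by the integral of 2 Re(û' û*), which Young's inequality splits into the weights of
order s+1 and s-1. The bound does not depend on t and is summable in ξ. -/
lemma coeff_trace_le {u du : ℝ → VDistr n} (hu : HasPrim T u du) (h1 : L2S T (s + 1) u)
    (h2 : L2S T (s - 1) du) {t : ℝ} (ht : t ∈ Icc 0 T) (i : Fin n) (ξ : Fin n → ℤ) :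
    rho ξ ^ (2 * s) * ‖u t i ξ‖ ^ 2 ≤ rho ξ ^ (2 * s) * ‖u 0 i ξ‖ ^ 2 +
      (rho ξ ^ (2 * (s + 1)) * ∫ τ in Ioo 0 T, ‖u τ i ξ‖ ^ 2) +
      rho ξ ^ (2 * (s - 1)) * ∫ τ in Ioo 0 T, ‖du τ i ξ‖ ^ 2 := by
  have e := ((hu i ξ).re_mul_conj (hu i ξ)).2 t ht
  simp only [re_mul_conj_self] at e
  have hi := ((h1 i).integrable_weight ξ).add ((h2 i).integrable_weight ξ)
  have hle : ∀ τ, rho ξ ^ (2 * s) *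
      ((du τ i ξ * conj (u τ i ξ)).re + (u τ i ξ * conj (du τ i ξ)).re) ≤
      rho ξ ^ (2 * (s + 1)) * ‖u τ i ξ‖ ^ 2 + rho ξ ^ (2 * (s - 1)) * ‖du τ i ξ‖ ^ 2 := fun τ => by
    have a1 := (abs_le.mp (abs_weight_re_mul_le (a := s - 1) (b := s + 1) (c := s) (by ring)
      (du τ i) (u τ i) ξ)).2
    have a2 := (abs_le.mp (abs_weight_re_mul_le (a := s + 1) (b := s - 1) (c := s) (by ring)
      (u τ i) (du τ i) ξ)).2
    rw [mul_add]
    linarith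
  have hI : IntegrableOn (fun τ => (du τ i ξ * conj (u τ i ξ)).re +
      (u τ i ξ * conj (du τ i ξ)).re) (Ioo 0 T) :=
    (integrable_re_mul_conj (h2.meas i ξ) (h1.meas i ξ) ((h2 i).integrable_sq ξ)
      ((h1 i).integrable_sq ξ)).add (integrable_re_mul_conj (h1.meas i ξ) (h2.meas i ξ)
      ((h1 i).integrable_sq ξ) ((h2 i).integrable_sq ξ))
  rw [e, mul_add, add_assoc]
  gcongr
  rw [← integral_Ioo_eq _ ht.1, ← integral_const_mul, ← integral_const_mul, ← integral_const_mul,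
    ← integral_add ((h1 i).integrable_weight ξ) ((h2 i).integrable_weight ξ)]
  have hsub : Ioo 0 t ⊆ Ioo 0 T := Ioo_subset_Ioo_right ht.2
  refine (setIntegral_mono ((hI.mono_set hsub).const_mul _) (hi.mono_set hsub) hle).trans ?_
  exact setIntegral_mono_set hi (.of_forall fun τ => add_nonneg (weight_nonneg (s + 1) (u τ i) ξ)
    (weight_nonneg (s - 1) (du τ i) ξ)) hsub.eventuallyLE

lemma trace_bound {u du : ℝ → VDistr n} (hu : HasPrim T u du) (h1 : L2S T (s + 1) u)
    (h2 : L2S T (s - 1) du) (h0 : VSob s (u 0)) {t : ℝ} (ht : t ∈ Icc 0 T) :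
    VSob s (u t) ∧ vNormSq s (u t) ≤ vNormSq s (u 0) + en T (s + 1) u + en T (s - 1) du := by
  have hs : ∀ i, HasSum (fun ξ => rho ξ ^ (2 * s) * ‖u 0 i ξ‖ ^ 2 +
      (rho ξ ^ (2 * (s + 1)) * ∫ τ in Ioo 0 T, ‖u τ i ξ‖ ^ 2) +
      rho ξ ^ (2 * (s - 1)) * ∫ τ in Ioo 0 T, ‖du τ i ξ‖ ^ 2) _ := fun i =>
    ((h0 i).hasSum.add (h1 i).hasSum).add (h2 i).hasSum
  have hb : VSob s (u t) := fun i => Summable.of_nonneg_of_le (weight_nonneg s (u t i))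
    (fun ξ => coeff_trace_le hu h1 h2 ht i ξ) (hs i).summable
  refine ⟨hb, ?_⟩
  rw [h1.en_eq, h2.en_eq, vNormSq, vNormSq, ← Finset.sum_add_distrib, ← Finset.sum_add_distrib]
  exact Finset.sum_le_sum fun i _ => hasSum_le (fun ξ => coeff_trace_le hu h1 h2 ht i ξ)
    (hb i).hasSum (hs i)

/-- Every coefficient is continuous, and `coeff_trace_le` supplies a summable majorant; dominated
convergence gives continuity with values in H^s. -/
lemma trace_continuous {u du : ℝ → VDistr n} (hu : HasPrim T u du) (h1 : L2S T (s + 1) u)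
    (h2 : L2S T (s - 1) du) (h0 : VSob s (u 0)) {t₀ : ℝ} (ht₀ : t₀ ∈ Icc 0 T) :
    Tendsto (fun t => vNormSq s (u t - u t₀)) (𝓝[Icc 0 T] t₀) (𝓝 0) := by
  have : Tendsto (fun t => ∑ i, normSq s ((u t - u t₀) i)) (𝓝[Icc 0 T] t₀)
      (𝓝 (∑ _i : Fin n, (0 : ℝ))) := by
    refine tendsto_finsetSum _ fun i _ => ?_
    have hs := (((h0 i).hasSum.add (h1 i).hasSum).add (h2 i).hasSum).summable
    rw [show 𝓝 (0 : ℝ) = 𝓝 (∑' _ξ : Fin n → ℤ, (0 : ℝ)) by rw [tsum_zero]]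
    refine tendsto_tsum_of_dominated_convergence (hs.mul_left 4) (fun ξ => ?_) ?_
    · have hc : ContinuousOn (fun t => rho ξ ^ (2 * s) * ‖u t i ξ - u t₀ i ξ‖ ^ 2) (Icc 0 T) :=
        continuousOn_const.mul (((hu i ξ).continuousOn.sub continuousOn_const).norm.pow 2)
      have := hc t₀ ht₀
      simpa [ContinuousWithinAt] using this
    · filter_upwards [self_mem_nhdsWithin] with t ht ξ
      have a1 := coeff_trace_le hu h1 h2 ht i ξ
      have a2 := coeff_trace_le hu h1 h2 ht₀ i ξ
      rw [Real.norm_of_nonneg (weight_nonneg s ((u t - u t₀) i) ξ)]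
      refine le_trans ?_ (show 2 * (rho ξ ^ (2 * s) * ‖u t i ξ‖ ^ 2) +
        2 * (rho ξ ^ (2 * s) * ‖u t₀ i ξ‖ ^ 2) ≤ _ by linarith)
      have hw : 0 ≤ rho ξ ^ (2 * s) := Real.rpow_nonneg (rho_pos ξ).le _
      have hn := norm_sub_le (u t i ξ) (u t₀ i ξ)
      have : ‖u t i ξ - u t₀ i ξ‖ ^ 2 ≤ 2 * ‖u t i ξ‖ ^ 2 + 2 * ‖u t₀ i ξ‖ ^ 2 := by
        nlinarith [sq_nonneg (‖u t i ξ‖ - ‖u t₀ i ξ‖), norm_nonneg (u t i ξ - u t₀ i ξ)]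
      calc _ ≤ rho ξ ^ (2 * s) * (2 * ‖u t i ξ‖ ^ 2 + 2 * ‖u t₀ i ξ‖ ^ 2) :=
            mul_le_mul_of_nonneg_left this hw
        _ = _ := by ring
  rwa [Finset.sum_const_zero] at this

/-- The weighted energy identity for a function with zero initial value. -/
lemma weighted_energy_nonneg (hT : 0 ≤ T) {w dw : ℝ → VDistr n} (hw : HasPrim T w dw)
    (h1 : L2S T (s + 1) w) (h2 : L2S T (s - 1) dw) (h0 : w 0 = 0) (B : ℝ) :
    IntegrableOn (fun t => Real.exp (-(2 * B) * t) * (vin s (w t) (dw t) - B * vNormSq s (w t)))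
      (Ioo 0 T) ∧
    0 ≤ ∫ t in Ioo 0 T,
      Real.exp (-(2 * B) * t) * (vin s (w t) (dw t) - B * vNormSq s (w t)) := by
  set e : ℝ → ℝ := fun t => Real.exp (-B * t) with he
  have hed : ∀ t, HasDerivAt e (-B * e t) t := fun t => by
    have := ((hasDerivAt_id' t).const_mul (-B)).exp
    rwa [mul_one, mul_comm] at this
  have hec : Continuous e := by fun_prop
  have hep : IsPrim T e fun t => -B * e t := isPrim_of_hasDerivAt hed (by fun_prop)
  -- The integral in question is half the squared H^s norm of z = exp(-Bt) w at the final time,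
  -- because w starts at zero.
  set z : ℝ → VDistr n := fun t => rmul (fun _ => e t) (w t) with hz
  set dz : ℝ → VDistr n := fun t => rmul (fun _ => e t) (dw t + rmul (fun _ => -B) (w t)) with hdz
  have hzp : HasPrim T z dz := fun i ξ => by
    have := hep.ofReal_mul (hw i ξ)
    have e3 : ∀ t, dz t i ξ = ((-B * e t : ℝ) : ℂ) * w t i ξ + (e t : ℂ) * dw t i ξ := fun t => by
      simp only [hdz, rmul, Pi.add_apply]
      push_cast; ring
    change IsPrim T (fun t => (e t : ℂ) * w t i ξ) fun t => dz t i ξ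
    simp only [e3]
    exact this
  obtain ⟨E, hE⟩ : ∃ E, ∀ t ∈ Icc 0 T, e t ^ 2 ≤ E :=
    isCompact_Icc.bddAbove_image (hec.pow 2).continuousOn |>.imp fun E hE t ht =>
      hE (mem_image_of_mem _ ht)
  have hem : ∀ {r : ℝ} {f : ℝ → VDistr n}, L2S T r f → L2S T r fun t => rmul (fun _ => e t) (f t) :=
    fun {r f} hf => (hf.rmul (c := fun t _ => e t) (fun _ => hec.aestronglyMeasurable)
      fun t ht ξ => by
        rw [mul_comm]
        exact mul_le_mul_of_nonneg_right (hE t ⟨ht.1.le, ht.2.le⟩)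
          (Real.rpow_nonneg (rho_pos ξ).le _)).1
  have hz1 : L2S T (s + 1) z := hem h1
  have hdz1 : L2S T (s - 1) dz := hem (h2.add ((h1.mono (by linarith)).const_rmul (-B)).1).1
  have hz0 : z 0 = 0 := by
    simp only [hz, h0]
    ext i ξ
    simp [rmul]
  have hv0 : VSob s (z 0) := by rw [hz0]; exact fun i => SobMem.zero s
  have ev := vin_evolution hT (a := s + 1) (a' := s - 1) (b := s - 1) (b' := s + 1) (c := s)
    (by ring) (by ring) hzp hzp hz1 hdz1 hdz1 hz1 hv0 hv0
  have hn0 : vNormSq s (0 : VDistr n) = 0 := Finset.sum_eq_zero fun i _ => normSq_zero s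
  rw [vin_self, vin_self, hz0, hn0, zero_add] at ev
  have hpt : ∀ᵐ t ∂(volume.restrict (Ioo 0 T)), vin s (dz t) (z t) + vin s (z t) (dz t) =
      2 * (Real.exp (-(2 * B) * t) * (vin s (w t) (dw t) - B * vNormSq s (w t))) := by
    filter_upwards [h1.mem, h2.mem] with t hm1 hm2
    have hm1' : VSob (s - 1) (rmul (fun _ => -B) (w t)) := (hm1.mono (by linarith)).smul _
    have e2 : Real.exp (-(2 * B) * t) = e t * e t := by
      rw [he, ← Real.exp_add]; congr 1; ring
    simp only [hz, hdz]
    rw [vin_comm s (rmul _ (w t)), vin_smul_left, vin_comm _ _ (rmul _ (w t)), vin_smul_left,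
      vin_comm _ (w t), vin_add_left (a := s - 1) (b := s + 1) (by ring) hm2 hm1' hm1,
      vin_smul_left, vin_self, vin_comm _ (dw t), e2]
    ring
  have hint : IntegrableOn (fun t => vin s (dz t) (z t) + vin s (z t) (dz t)) (Ioo 0 T) :=
    (hdz1.vin (by ring) hz1).1.add (hz1.vin (by ring) hdz1).1
  have hint2 := (hint.congr hpt).const_mul (1 / 2)
  simp only [← mul_assoc (1 / 2 : ℝ) 2, show (1 / 2 : ℝ) * 2 = 1 by norm_num, one_mul] at hint2
  refine ⟨hint2, ?_⟩
  rw [integral_congr_ae hpt, integral_const_mul] at ev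
  have := vNormSq_nonneg s (z T)
  linarith

end

section

/-! ### Linear evolutions, frequency by frequency -/

variable {T s : ℝ}

/-- The solution of `y' + κ y = h`, `y(0) = 0`. -/
noncomputable def duh (κ : ℝ) (h : ℝ → ℂ) (t : ℝ) : ℂ :=
  (Real.exp (-κ * t) : ℂ) * ∫ τ in (0 : ℝ)..t, (Real.exp (κ * τ) : ℂ) * h τ

lemma hasDerivAt_exp_mul (κ t : ℝ) :
    HasDerivAt (fun t => Real.exp (κ * t)) (κ * Real.exp (κ * t)) t := by
  have := ((hasDerivAt_id' t).const_mul κ).exp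
  rwa [mul_one, mul_comm] at this

lemma isPrim_exp_mul (T κ : ℝ) :
    IsPrim T (fun t => Real.exp (κ * t)) fun t => κ * Real.exp (κ * t) :=
  isPrim_of_hasDerivAt (hasDerivAt_exp_mul κ) (by fun_prop)

lemma integrable_exp_mul {h : ℝ → ℂ} (hh : IntegrableOn h (Ioo 0 T)) (κ : ℝ) :
    IntegrableOn (fun τ => (Real.exp (κ * τ) : ℂ) * h τ) (Ioo 0 T) := by
  rcases lt_or_ge T 0 with hT | hT
  · simp [Ioo_eq_empty_of_le hT.le]
  have h1 := (intervalIntegrable_of_Ioo hh ⟨le_rfl, hT⟩ ⟨hT, le_rfl⟩).continuousOn_mul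
    (g := fun τ => (Real.exp (κ * τ) : ℂ)) (by fun_prop)
  rwa [intervalIntegrable_iff_integrableOn_Ioo_of_le hT] at h1

lemma duh_zero (κ : ℝ) (h : ℝ → ℂ) : duh κ h 0 = 0 := by simp [duh]

lemma isPrim_duh {h : ℝ → ℂ} (hh : IntegrableOn h (Ioo 0 T)) (κ : ℝ) :
    IsPrim T (duh κ h) fun t => h t - κ * duh κ h t := by
  have hp : IsPrim T (fun t => ∫ τ in (0 : ℝ)..t, (Real.exp (κ * τ) : ℂ) * h τ)
      fun t => (Real.exp (κ * t) : ℂ) * h t := ⟨integrable_exp_mul hh κ, fun t _ => by simp⟩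
  have := (isPrim_exp_mul T (-κ)).ofReal_mul hp
  have e : ∀ t, h t - κ * duh κ h t = ((-κ * Real.exp (-κ * t) : ℝ) : ℂ) *
      (∫ τ in (0 : ℝ)..t, (Real.exp (κ * τ) : ℂ) * h τ) +
      (Real.exp (-κ * t) : ℂ) * ((Real.exp (κ * t) : ℂ) * h t) := fun t => by
    rw [← mul_assoc (Real.exp _ : ℂ), ← Complex.ofReal_mul, ← Real.exp_add,
      show -κ * t + κ * t = 0 by ring, Real.exp_zero, duh]
    push_cast; ring
  simp only [e]
  exact this

lemma duh_sub {h k : ℝ → ℂ} (hh : IntegrableOn h (Ioo 0 T)) (hk : IntegrableOn k (Ioo 0 T))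
    (κ : ℝ) {t : ℝ} (ht : t ∈ Icc 0 T) :
    duh κ (fun t => h t - k t) t = duh κ h t - duh κ k t := by
  have h0 : (0 : ℝ) ∈ Icc 0 T := ⟨le_rfl, ht.1.trans ht.2⟩
  rw [duh, duh, duh, ← mul_sub, ← intervalIntegral.integral_sub
    (intervalIntegrable_of_Ioo (integrable_exp_mul hh κ) h0 ht)
    (intervalIntegrable_of_Ioo (integrable_exp_mul hk κ) h0 ht)]
  simp only [mul_sub]

lemma duh_congr {h k : ℝ → ℂ} (hhk : ∀ᵐ t ∂(volume.restrict (Ioo 0 T)), h t = k t)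
    (κ : ℝ) {t : ℝ} (ht : t ∈ Icc 0 T) : duh κ h t = duh κ k t := by
  rw [duh, duh, ← integral_Ioo_eq _ ht.1, ← integral_Ioo_eq _ ht.1]
  congr 1
  refine integral_congr_ae ?_
  filter_upwards [ae_mono (Measure.restrict_mono (Ioo_subset_Ioo_right ht.2) le_rfl) hhk] with x hx
  rw [hx]

/-- The basic estimate for the scalar problem. -/
lemma duh_estimate (hT : 0 ≤ T) {κ : ℝ} (hκ : 0 < κ) {h : ℝ → ℂ}
    (hh : IntegrableOn h (Ioo 0 T)) (hh2 : IntegrableOn (fun t => ‖h t‖ ^ 2) (Ioo 0 T)) :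
    IntegrableOn (fun t => ‖duh κ h t‖ ^ 2) (Ioo 0 T) ∧
    κ ^ 2 * ∫ t in Ioo 0 T, ‖duh κ h t‖ ^ 2 ≤ ∫ t in Ioo 0 T, ‖h t‖ ^ 2 := by
  have hp := isPrim_duh hh κ
  have hc := hp.continuousOn
  have hy : IntegrableOn (fun t => ‖duh κ h t‖ ^ 2) (Ioo 0 T) :=
    ((hc.norm.pow 2).integrableOn_Icc).mono_set Ioo_subset_Icc_self
  refine ⟨hy, ?_⟩
  have e := (hp.re_mul_conj hp)
  have e2 := e.2 T ⟨hT, le_rfl⟩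
  simp only [re_mul_conj_self, duh_zero, norm_zero] at e2
  rw [← integral_Ioo_eq _ hT] at e2
  -- The derivative of |y|² is 2 Re(h y*) - 2κ|y|² ≤ |h|²/κ - κ|y|². Its integral is |y(T)|² ≥ 0.
  have hle : ∫ t in Ioo 0 T, (((h t - κ * duh κ h t) * conj (duh κ h t)).re +
      (duh κ h t * conj (h t - κ * duh κ h t)).re) ≤
      ∫ t in Ioo 0 T, (1 / κ * ‖h t‖ ^ 2 - κ * ‖duh κ h t‖ ^ 2) := by
    refine integral_mono e.1 ((hh2.const_mul _).sub (hy.const_mul _)) fun t => ?_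
    have a1 : ((h t - κ * duh κ h t) * conj (duh κ h t)).re =
        (h t * conj (duh κ h t)).re - κ * ‖duh κ h t‖ ^ 2 := by
      rw [sub_mul, Complex.sub_re, mul_assoc, Complex.re_ofReal_mul, re_mul_conj_self]
    have a2 : (duh κ h t * conj (h t - κ * duh κ h t)).re =
        (h t * conj (duh κ h t)).re - κ * ‖duh κ h t‖ ^ 2 := by
      rw [← a1, ← Complex.conj_re]
      simp only [map_mul, Complex.conj_conj]
      rw [mul_comm]
    have a3 := (abs_le.mp (abs_re_mul_conj_le (h t) (duh κ h t))).2
    have a4 : 2 * (‖h t‖ * ‖duh κ h t‖) ≤ 1 / κ * ‖h t‖ ^ 2 + κ * ‖duh κ h t‖ ^ 2 := by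
      have : 0 ≤ 1 / κ * (‖h t‖ - κ * ‖duh κ h t‖) ^ 2 := by positivity
      have e : 1 / κ * (‖h t‖ - κ * ‖duh κ h t‖) ^ 2 = 1 / κ * ‖h t‖ ^ 2 -
          2 * (‖h t‖ * ‖duh κ h t‖) + κ * ‖duh κ h t‖ ^ 2 := by
        field_simp
        ring
      linarith
    simp only [a1, a2]
    linarith
  rw [integral_sub (hh2.const_mul _) (hy.const_mul _), integral_const_mul, integral_const_mul]
    at hle
  have h0 : 0 ≤ ‖duh κ h T‖ ^ 2 := sq_nonneg _
  have h1 : κ * ∫ t in Ioo 0 T, ‖duh κ h t‖ ^ 2 ≤ 1 / κ * ∫ t in Ioo 0 T, ‖h t‖ ^ 2 := by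
    nlinarith
  calc _ = κ * (κ * ∫ t in Ioo 0 T, ‖duh κ h t‖ ^ 2) := by ring
    _ ≤ κ * (1 / κ * ∫ t in Ioo 0 T, ‖h t‖ ^ 2) := by gcongr
    _ = _ := by field_simp

/-- The solution of `w' + m Λ² w = g`, `w(0) = 0`. -/
noncomputable def duhamel (m : ℝ) (g : ℝ → VDistr n) (t : ℝ) : VDistr n :=
  fun i ξ => duh (m * rho ξ ^ 2) (fun τ => g τ i ξ) t

/-- The derivative of `duhamel m g`. -/
noncomputable def duhamelDeriv (m : ℝ) (g : ℝ → VDistr n) (t : ℝ) : VDistr n :=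
  g t - rmul (fun _ => m) (vlam 2 (duhamel m g t))

variable {g g' : ℝ → VDistr n} {m : ℝ}

lemma duhamel_zero (m : ℝ) (g : ℝ → VDistr n) : duhamel m g 0 = 0 := by
  ext i ξ
  exact duh_zero _ _

lemma hasPrim_duhamel {r : ℝ} (hg : L2S T r g) (m : ℝ) :
    HasPrim T (duhamel m g) (duhamelDeriv m g) := fun i ξ => by
  have := isPrim_duh ((hg i).integrable ξ) (m * rho ξ ^ 2)
  have e : ∀ t, duhamelDeriv m g t i ξ =
      g t i ξ - ((m * rho ξ ^ 2 : ℝ) : ℂ) * duh (m * rho ξ ^ 2) (fun τ => g τ i ξ) t := fun t => by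
    simp only [duhamelDeriv, Pi.sub_apply, rmul, vlam, lam, Real.rpow_two, ← mul_assoc]
    push_cast
    rfl
  simp only [e]
  exact this

lemma duhamel_sub {r : ℝ} (hg : L2S T r g) (hg' : L2S T r g') (m : ℝ) {t : ℝ}
    (ht : t ∈ Icc 0 T) : duhamel m (g - g') t = duhamel m g t - duhamel m g' t := by
  ext i ξ
  exact duh_sub ((hg i).integrable ξ) ((hg' i).integrable ξ) _ ht

lemma HasPrim.timeMeasurable {u du : ℝ → VDistr n} (h : HasPrim T u du) : TimeMeasurable T u :=
  fun i ξ => ((h i ξ).continuousOn.mono Ioo_subset_Icc_self).aestronglyMeasurable measurableSet_Ioo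

/-- Maximal regularity: at frequency ξ the rate is κ = m ϱ², so the scalar estimate gains the factor
(m ϱ²)^{-2}, that is, two orders. -/
lemma L2S.duhamel (hT : 0 ≤ T) (hm : 0 < m) (hg : L2S T (s - 1) g) :
    L2S T (s + 1) (duhamel m g) ∧ en T (s + 1) (duhamel m g) ≤ (m ^ 2)⁻¹ * en T (s - 1) g := by
  have key := fun i => L2P.of_coeff_le (s := s + 1) (g := fun t => PeriodicNS.duhamel m g t i)
    (c := (m ^ 2)⁻¹) (hg i) ((hasPrim_duhamel hg m).timeMeasurable i) fun ξ => by
      have h := duh_estimate hT (mul_pos hm (pow_pos (rho_pos ξ) 2)) ((hg i).integrable ξ)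
        ((hg i).integrable_sq ξ)
      refine ⟨h.1, ?_⟩
      have e : rho ξ ^ (2 * (s + 1)) = rho ξ ^ (2 * (s - 1)) * (rho ξ ^ 2) ^ 2 := by
        rw [← Real.rpow_natCast, ← Real.rpow_natCast, ← Real.rpow_mul (rho_pos ξ).le,
          ← Real.rpow_add (rho_pos ξ)]
        congr 1; push_cast; ring
      have hw : 0 ≤ rho ξ ^ (2 * (s - 1)) := Real.rpow_nonneg (rho_pos ξ).le _
      calc rho ξ ^ (2 * (s + 1)) * ∫ t in Ioo 0 T, ‖PeriodicNS.duhamel m g t i ξ‖ ^ 2 =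
          (m ^ 2)⁻¹ * (rho ξ ^ (2 * (s - 1)) * ((m * rho ξ ^ 2) ^ 2 *
            ∫ t in Ioo 0 T, ‖PeriodicNS.duhamel m g t i ξ‖ ^ 2)) := by
            rw [e]; field_simp
        _ ≤ _ := by
            gcongr
            exact h.2
  have h1 : L2S T (s + 1) (PeriodicNS.duhamel m g) := fun i => (key i).1
  refine ⟨h1, ?_⟩
  rw [h1.en_eq, hg.en_eq, Finset.mul_sum]
  exact Finset.sum_le_sum fun i _ => (key i).2

/-- The derivative is g - m Λ² w, and m² cancels the (m²)⁻¹ of `L2S.duhamel`; hence the constant 4 =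
2 · (1 + 1) is free of m. -/
lemma L2S.duhamelDeriv (hT : 0 ≤ T) (hm : 0 < m) (hg : L2S T (s - 1) g) :
    L2S T (s - 1) (duhamelDeriv m g) ∧ en T (s - 1) (duhamelDeriv m g) ≤ 4 * en T (s - 1) g := by
  have h1 := hg.duhamel hT hm
  have e0 : s - 1 + 2 = s + 1 := by ring
  have h2 := h1.1.rmul (s := s - 1) (B := m ^ 2) (c := fun _ ξ => m * rho ξ ^ (2 : ℝ))
    (fun _ => aestronglyMeasurable_const) fun t _ ξ => by
      rw [mul_pow, mul_left_comm, rho_rpow_sq, ← Real.rpow_add (rho_pos ξ)]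
      apply le_of_eq; congr 2; ring
  have e : (fun t => PeriodicNS.rmul (fun ξ => m * rho ξ ^ (2 : ℝ)) (PeriodicNS.duhamel m g t)) =
      fun t => PeriodicNS.rmul (fun _ => m) (vlam 2 (PeriodicNS.duhamel m g t)) := by
    ext t i ξ
    simp only [PeriodicNS.rmul, vlam, lam]
    push_cast; ring
  rw [e] at h2
  have h3 := hg.sub h2.1
  refine ⟨h3.1, h3.2.trans ?_⟩
  have h4 := h2.2.trans (mul_le_mul_of_nonneg_left h1.2 (sq_nonneg m))
  rw [mul_inv_cancel_left₀ (by positivity)] at h4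
  linarith

/-- The solution operator is linear, real, and even in ξ; since it integrates in time, a property of
g at almost every time holds for the solution at every time. -/
lemma Solenoidal.duhamel (hg : ∀ᵐ t ∂(volume.restrict (Ioo 0 T)), Solenoidal (g t))
    (hi : ∀ i ξ, IntegrableOn (fun t => g t i ξ) (Ioo 0 T)) {t : ℝ} (ht : t ∈ Icc 0 T) :
    Solenoidal (duhamel m g t) where
  real i ξ := by
    have h1 : PeriodicNS.duhamel m g t i (-ξ) = duh (m * rho ξ ^ 2) (fun τ => conj (g τ i ξ)) t := by
      rw [PeriodicNS.duhamel, rho_neg]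
      exact duh_congr (hg.mono fun τ hτ => hτ.real i ξ) _ ht
    rw [h1, PeriodicNS.duhamel, duh, duh, map_mul, Complex.conj_ofReal,
      intervalIntegral.integral_of_le ht.1, intervalIntegral.integral_of_le ht.1, ← integral_conj]
    simp only [map_mul, Complex.conj_ofReal]
  mean i := by
    have : PeriodicNS.duhamel m g t i 0 = duh (m * rho (0 : Fin n → ℤ) ^ 2) (fun _ => 0) t :=
      duh_congr (hg.mono fun τ hτ => hτ.mean i) _ ht
    rw [this]; simp [duh]
  div ξ := by
    have h0 : (0 : ℝ) ∈ Icc 0 T := ⟨le_rfl, ht.1.trans ht.2⟩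
    have h1 : ∑ j, (ξ j : ℂ) * PeriodicNS.duhamel m g t j ξ =
        duh (m * rho ξ ^ 2) (fun τ => ∑ j, (ξ j : ℂ) * g τ j ξ) t := by
      simp only [PeriodicNS.duhamel, duh, Finset.mul_sum]
      rw [intervalIntegral.integral_finsetSum fun j _ => by
        have := (intervalIntegrable_of_Ioo (integrable_exp_mul (hi j ξ) (m * rho ξ ^ 2)) h0 ht)
        simp only [mul_left_comm _ (ξ j : ℂ)]
        exact this.const_mul _, Finset.mul_sum]
      refine Finset.sum_congr rfl fun j _ => ?_
      simp only [mul_left_comm _ (ξ j : ℂ), intervalIntegral.integral_const_mul]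
    rw [h1, duh_congr (hg.mono fun τ hτ => hτ.div ξ) _ ht]
    simp [duh]

/-! ### The heat equation -/

/-- The time derivative of the solution of the heat equation. -/
noncomputable def heatDeriv (u0 : VDistr n) (t : ℝ) : VDistr n :=
  rmul (fun ξ => -(2 * Real.pi * freqNorm ξ) ^ 2) (heat u0 t)

lemma heat_eq_rmul (u0 : VDistr n) (t : ℝ) :
    heat u0 t = rmul (fun ξ => Real.exp (-(2 * Real.pi * freqNorm ξ) ^ 2 * t)) u0 := by
  ext i ξ
  exact mul_comm _ _

lemma hasPrim_heat (T : ℝ) (u0 : VDistr n) : HasPrim T (heat u0) (heatDeriv u0) := fun i ξ => by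
  have h1 : IsPrim T (fun _ => u0 i ξ) fun _ => (0 : ℂ) :=
    isPrim_of_hasDerivAt (fun t => hasDerivAt_const t _) continuous_const
  have := (isPrim_exp_mul T (-(2 * Real.pi * freqNorm ξ) ^ 2)).ofReal_mul h1
  have e : ∀ t, heat u0 t i ξ = (Real.exp (-(2 * Real.pi * freqNorm ξ) ^ 2 * t) : ℂ) * u0 i ξ :=
    fun t => mul_comm _ _
  have e' : ∀ t, heatDeriv u0 t i ξ = ((-(2 * Real.pi * freqNorm ξ) ^ 2 *
      Real.exp (-(2 * Real.pi * freqNorm ξ) ^ 2 * t) : ℝ) : ℂ) * u0 i ξ +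
      (Real.exp (-(2 * Real.pi * freqNorm ξ) ^ 2 * t) : ℂ) * 0 := fun t => by
    rw [heatDeriv, rmul, e]
    push_cast; ring
  simp only [e, e']
  exact this

lemma solenoidal_heat {u0 : VDistr n} (h : Solenoidal u0) (t : ℝ) : Solenoidal (heat u0 t) := by
  rw [heat_eq_rmul]
  exact h.rmul fun ξ => by rw [freqNorm_neg]

lemma heat_zero (u0 : VDistr n) : heat u0 0 = u0 := by
  ext i ξ
  simp [heat]

lemma heat_bound {u0 : VDistr n} (h : VSob s u0) {t : ℝ} (ht : 0 ≤ t) :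
    VSob s (heat u0 t) ∧ vNormSq s (heat u0 t) ≤ vNormSq s u0 := by
  have := vSob_of_le (s := s) (c := 1) (u := heat u0 t) h fun ξ => by
    rw [one_mul]
    refine mul_le_mul_of_nonneg_left (Finset.sum_le_sum fun i _ => ?_)
      (Real.rpow_nonneg (rho_pos ξ).le _)
    refine pow_le_pow_left₀ (norm_nonneg _) ?_ 2
    rw [show heat u0 t i ξ = u0 i ξ * (Real.exp (-(2 * Real.pi * freqNorm ξ) ^ 2 * t) : ℂ) from rfl,
      norm_mul, Complex.norm_real, Real.norm_of_nonneg (Real.exp_pos _).le]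
    refine mul_le_of_le_one_right (norm_nonneg _) (Real.exp_le_one_iff.mpr ?_)
    have := sq_nonneg (2 * Real.pi * freqNorm ξ)
    nlinarith
  rwa [one_mul] at this

/-- At each frequency 2κ times the integral of |û|² is at most |û(0)|², with κ = (2π|ξ|)² ≥ ϱ²/2 off
the zero frequency. Zero mean excludes the mode that does not decay. -/
lemma l2S_heat (hT : 0 ≤ T) {u0 : VDistr n} (h0 : ∀ i, u0 i 0 = 0) (h : VSob s u0) :
    L2S T (s + 1) (heat u0) := fun i => by
  have hm := (hasPrim_heat T u0).timeMeasurable i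
  have hc : ∀ ξ, ContinuousOn (fun t => heat u0 t i ξ) (Icc 0 T) := fun ξ =>
    (hasPrim_heat T u0 i ξ).continuousOn
  have hi : ∀ ξ, IntegrableOn (fun t => ‖heat u0 t i ξ‖ ^ 2) (Ioo 0 T) := fun ξ =>
    (((hc ξ).norm.pow 2).integrableOn_Icc).mono_set Ioo_subset_Icc_self
  refine L2P.of_summable hm hi (Summable.of_nonneg_of_le (fun ξ => mul_nonneg
    (Real.rpow_nonneg (rho_pos ξ).le _) (integral_nonneg fun t => sq_nonneg _)) (fun ξ => ?_) (h i))
  by_cases hξ : ξ = 0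
  · simp [hξ, heat, h0]
  set κ := (2 * Real.pi * freqNorm ξ) ^ 2 with hκ
  have hp := (hasPrim_heat T u0 i ξ).re_mul_conj (hasPrim_heat T u0 i ξ)
  have e := hp.2 T ⟨hT, le_rfl⟩
  simp only [re_mul_conj_self] at e
  rw [← integral_Ioo_eq _ hT, heat_zero] at e
  have e1 : ∀ t, (heatDeriv u0 t i ξ * conj (heat u0 t i ξ)).re +
      (heat u0 t i ξ * conj (heatDeriv u0 t i ξ)).re = -2 * κ * ‖heat u0 t i ξ‖ ^ 2 := fun t => by
    have a1 : (heatDeriv u0 t i ξ * conj (heat u0 t i ξ)).re = -κ * ‖heat u0 t i ξ‖ ^ 2 := by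
      rw [heatDeriv, rmul, mul_assoc, Complex.re_ofReal_mul, re_mul_conj_self]
    have a2 : (heat u0 t i ξ * conj (heatDeriv u0 t i ξ)).re = -κ * ‖heat u0 t i ξ‖ ^ 2 := by
      rw [← a1, ← Complex.conj_re]
      simp only [map_mul, Complex.conj_conj]
      rw [mul_comm]
    rw [a1, a2]; ring
  simp only [e1] at e
  rw [integral_const_mul] at e
  have h1 := rho_sq_le hξ
  have hI : 0 ≤ ∫ t in Ioo 0 T, ‖heat u0 t i ξ‖ ^ 2 := integral_nonneg fun t => sq_nonneg _
  have h2 : rho ξ ^ 2 * ∫ t in Ioo 0 T, ‖heat u0 t i ξ‖ ^ 2 ≤ ‖u0 i ξ‖ ^ 2 := by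
    have := sq_nonneg ‖heat u0 T i ξ‖
    have := mul_le_mul_of_nonneg_right h1 hI
    linarith
  rw [mul_add, Real.rpow_add (rho_pos ξ), mul_one, Real.rpow_two, mul_assoc]
  exact mul_le_mul_of_nonneg_left h2 (Real.rpow_nonneg (rho_pos ξ).le _)

lemma L2S.heatDeriv {u0 : VDistr n} (h : L2S T (s + 1) (heat u0)) :
    L2S T (s - 1) (heatDeriv u0) ∧ en T (s - 1) (heatDeriv u0) ≤ en T (s + 1) (heat u0) := by
  have := h.rmul (s := s - 1) (B := 1) (c := fun _ ξ => -(2 * Real.pi * freqNorm ξ) ^ 2)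
    (fun _ => aestronglyMeasurable_const) fun t _ ξ => by
      have h1 := two_pi_freqNorm_le ξ
      have h0 : 0 ≤ 2 * Real.pi * freqNorm ξ := by have := freqNorm_nonneg ξ; positivity
      have e : rho ξ ^ (2 * (s + 1)) = rho ξ ^ (2 * (s - 1)) * (rho ξ ^ 2) ^ 2 := by
        rw [← Real.rpow_natCast, ← Real.rpow_natCast, ← Real.rpow_mul (rho_pos ξ).le,
          ← Real.rpow_add (rho_pos ξ)]
        congr 1; push_cast; ring
      rw [one_mul, e, neg_sq]
      have := Real.rpow_nonneg (rho_pos ξ).le (2 * (s - 1))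
      gcongr
  rwa [one_mul] at this

lemma solenoidal_heatDeriv {u0 : VDistr n} (h : Solenoidal u0) (t : ℝ) :
    Solenoidal (heatDeriv u0 t) :=
  (solenoidal_heat h t).rmul fun ξ => by rw [freqNorm_neg]

end

section

/-! ### A contraction principle -/

variable {T s : ℝ}

/-- With squared norms this replaces the triangle inequality: for small θ the factor of the first
term stays close to 1, so a contraction factor survives. -/
lemma vNormSq_add_le_of_pos {u w : VDistr n} (hu : VSob s u) (hw : VSob s w) {θ : ℝ} (hθ : 0 < θ) :
    vNormSq s (u + w) ≤ (1 + θ) * vNormSq s u + (1 + θ⁻¹) * vNormSq s w := by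
  rw [vNormSq_add_eq hu hw]
  have h := (abs_le.mp (abs_vin_le (a := s) (b := s) (s := s) (by ring) hu hw)).2
  have h1 := Real.mul_self_sqrt (vNormSq_nonneg s u)
  have h2 := Real.mul_self_sqrt (vNormSq_nonneg s w)
  set x := √(vNormSq s u)
  set y := √(vNormSq s w)
  have h3 : 0 ≤ θ⁻¹ * (θ * x - y) ^ 2 := by positivity
  have e : θ⁻¹ * (θ * x - y) ^ 2 = θ * (x * x) - 2 * (x * y) + θ⁻¹ * (y * y) := by
    field_simp
    ring
  rw [← h1, ← h2]
  linarith

lemma vNormSq_neg_sub (s : ℝ) (u w : VDistr n) : vNormSq s (u - w) = vNormSq s (w - u) := by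
  refine Finset.sum_congr rfl fun i _ => tsum_congr fun ξ => ?_
  simp only [Pi.sub_apply, norm_sub_rev]

lemma weight_le_vNormSq {u : VDistr n} (hu : VSob s u) (i : Fin n) (ξ : Fin n → ℤ) :
    rho ξ ^ (2 * s) * ‖u i ξ‖ ^ 2 ≤ vNormSq s u :=
  ((hu i).le_tsum ξ fun η _ => weight_nonneg s (u i) η).trans (normSq_le_vNormSq s u i)

/-- Norms pass to the limit. -/
lemma vNormSq_le_of_tendsto {x : ℕ → VDistr n} {G : VDistr n} {B : ℝ}
    (hx : ∀ᶠ k in atTop, VSob s (x k) ∧ vNormSq s (x k) ≤ B)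
    (h : ∀ i ξ, Tendsto (fun k => x k i ξ) atTop (𝓝 (G i ξ))) :
    VSob s G ∧ vNormSq s G ≤ B := by
  have hfin : ∀ S : Finset (Fin n → ℤ), ∑ i, ∑ ξ ∈ S, rho ξ ^ (2 * s) * ‖G i ξ‖ ^ 2 ≤ B := by
    intro S
    have ht : Tendsto (fun k => ∑ i, ∑ ξ ∈ S, rho ξ ^ (2 * s) * ‖x k i ξ‖ ^ 2) atTop
        (𝓝 (∑ i, ∑ ξ ∈ S, rho ξ ^ (2 * s) * ‖G i ξ‖ ^ 2)) :=
      tendsto_finsetSum _ fun i _ => tendsto_finsetSum _ fun ξ _ =>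
        ((h i ξ).norm.pow 2).const_mul _
    refine le_of_tendsto ht (hx.mono fun k hk => le_trans ?_ hk.2)
    exact Finset.sum_le_sum fun i _ => (hk.1 i).sum_le_tsum S fun ξ _ => weight_nonneg s (x k i) ξ
  have hV : VSob s G := fun i => by
    refine summable_of_sum_le (weight_nonneg s (G i)) fun S => le_trans ?_ (hfin S)
    exact Finset.single_le_sum (f := fun i => ∑ ξ ∈ S, rho ξ ^ (2 * s) * ‖G i ξ‖ ^ 2)
      (fun i _ => Finset.sum_nonneg fun ξ _ => weight_nonneg s (G i) ξ) (Finset.mem_univ i)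
  refine ⟨hV, ?_⟩
  have ht : Tendsto (fun S => ∑ i, ∑ ξ ∈ S, rho ξ ^ (2 * s) * ‖G i ξ‖ ^ 2) atTop
      (𝓝 (vNormSq s G)) := tendsto_finsetSum _ fun i _ => (hV i).hasSum
  exact le_of_tendsto' ht hfin

/-- θ is chosen so that (1+θ) r = (1+r)/2 is still below 1; A solves A (1-r)/2 = 1 + 1/θ, which
closes the induction on the number of steps. -/
lemma exists_geometric_const {r : ℝ} (h0 : 0 < r) (h1 : r < 1) :
    ∃ A : ℝ, 0 < A ∧ ∀ (x : ℕ → VDistr n) (H : ℝ), (∀ k, VSob s (x k)) →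
      (∀ k, vNormSq s (x (k + 1) - x k) ≤ H * r ^ k) →
      ∀ j k, vNormSq s (x k - x (k + j)) ≤ A * (H * r ^ k) := by
  set θ := (1 - r) / (2 * r) with hθ
  have hθ0 : 0 < θ := div_pos (by linarith) (by linarith)
  have hθr : (1 + θ) * r = (1 + r) / 2 := by rw [hθ]; field_simp; ring
  refine ⟨(1 + θ⁻¹) * (2 / (1 - r)), by have : 0 < 1 - r := by linarith
                                        positivity, fun x H hx hH j => ?_⟩
  set A := (1 + θ⁻¹) * (2 / (1 - r)) with hA
  have hA0 : 0 ≤ A := by have : 0 < 1 - r := by linarith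
                         positivity
  have hAe : A * ((1 - r) / 2) = 1 + θ⁻¹ := by
    have : 1 - r ≠ 0 := by linarith
    rw [hA]; field_simp
  have hH0 : ∀ k, 0 ≤ H * r ^ k := fun k => (vNormSq_nonneg _ _).trans (hH k)
  induction j with
  | zero =>
    intro k
    have : vNormSq s (x k - x (k + 0)) = 0 := by
      rw [add_zero, sub_self]; exact Finset.sum_eq_zero fun i _ => normSq_zero s
    rw [this]
    exact mul_nonneg hA0 (hH0 k)
  | succ j ih =>
    intro k
    have e : x k - x (k + (j + 1)) = (x (k + 1) - x (k + 1 + j)) + (x k - x (k + 1)) := by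
      rw [show k + (j + 1) = k + 1 + j by ring]; abel
    rw [e]
    refine (vNormSq_add_le_of_pos ((hx _).sub (hx _)) ((hx _).sub (hx _)) hθ0).trans ?_
    have h2 := hH k
    rw [vNormSq_neg_sub] at h2
    calc _ ≤ (1 + θ) * (A * (H * r ^ (k + 1))) + (1 + θ⁻¹) * (H * r ^ k) := by
          gcongr
          exact ih (k + 1)
      _ = ((1 + θ) * r) * A * (H * r ^ k) + A * ((1 - r) / 2) * (H * r ^ k) := by
          rw [hAe]; ring
      _ = A * (H * r ^ k) := by rw [hθr]; ring

/-- A geometrically convergent sequence of Sobolev functions has a limit. -/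
lemma exists_limit {r : ℝ} (h0 : 0 < r) (h1 : r < 1) :
    ∃ A : ℝ, 0 < A ∧ ∀ (x : ℕ → VDistr n) (H : ℝ), (∀ k, VSob s (x k)) →
      (∀ k, vNormSq s (x (k + 1) - x k) ≤ H * r ^ k) →
      ∃ G : VDistr n, (∀ i ξ, Tendsto (fun k => x k i ξ) atTop (𝓝 (G i ξ))) ∧
        ∀ k, VSob s (x k - G) ∧ vNormSq s (x k - G) ≤ A * (H * r ^ k) := by
  obtain ⟨A, hA, hb⟩ := exists_geometric_const (n := n) (s := s) h0 h1
  refine ⟨A, hA, fun x H hx hH => ?_⟩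
  have hb := hb x H hx hH
  have hlim : ∀ i ξ, ∃ z, Tendsto (fun k => x k i ξ) atTop (𝓝 z) := fun i ξ => by
    refine cauchySeq_tendsto_of_complete ?_
    have hρ : 0 < rho ξ ^ (2 * s) := Real.rpow_pos_of_pos (rho_pos ξ) _
    refine cauchySeq_of_le_geometric (√r) (√((rho ξ ^ (2 * s))⁻¹ * H)) ?_ fun k => ?_
    · rw [Real.sqrt_lt' one_pos]; simpa using h1
    · have hH0 : 0 ≤ H := by simpa using (vNormSq_nonneg _ _).trans (hH 0)
      have h3 := (weight_le_vNormSq ((hx (k + 1)).sub (hx k)) i ξ).trans (hH k)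
      rw [dist_comm, dist_eq_norm, Real.sqrt_eq_rpow r, ← Real.rpow_natCast, ← Real.rpow_mul h0.le,
        mul_comm (1 / 2 : ℝ), Real.rpow_mul h0.le, ← Real.sqrt_eq_rpow, ← Real.sqrt_mul (by positivity)]
      refine Real.le_sqrt_of_sq_le ?_
      rw [Real.rpow_natCast, mul_assoc, ← div_eq_inv_mul, le_div_iff₀ hρ, mul_comm]
      exact h3
  choose G hG using hlim
  refine ⟨G, hG, fun k => ?_⟩
  refine vNormSq_le_of_tendsto (x := fun j => x k - x (k + j)) (.of_forall fun j =>
    ⟨(hx _).sub (hx _), hb j k⟩) fun i ξ => ?_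
  have : Tendsto (fun j => x (j + k) i ξ) atTop (𝓝 (G i ξ)) :=
    (hG i ξ).comp (tendsto_add_atTop_nat k)
  simp only [add_comm _ k] at this
  exact tendsto_const_nhds.sub this

/-- With r = √q the decay q^k = r^k r^k is split: one half makes the sum of r^{-k}‖g_{k+1} - g_k‖²
integrable, hence finite at almost every time, and the other half gives geometric convergence at
each such time. -/
lemma L2S.exists_limit {q C : ℝ} (h0 : 0 < q) (h1 : q < 1) {g : ℕ → ℝ → VDistr n}
    (hg : ∀ k, L2S T s (g k)) (hb : ∀ k, en T s (g (k + 1) - g k) ≤ C * q ^ k) :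
    ∃ G : ℝ → VDistr n, L2S T s G ∧ Tendsto (fun k => en T s (g k - G)) atTop (𝓝 0) ∧
      ∀ᵐ t ∂(volume.restrict (Ioo 0 T)),
        ∀ i ξ, Tendsto (fun k => g k t i ξ) atTop (𝓝 (G t i ξ)) := by
  set r := √q with hr
  have hr0 : 0 < r := Real.sqrt_pos.mpr h0
  have hr1 : r < 1 := by rw [hr, Real.sqrt_lt' one_pos]; simpa using h1
  have hrq : r * r = q := Real.mul_self_sqrt h0.le
  obtain ⟨A, hA, hlim⟩ := PeriodicNS.exists_limit (n := n) (s := s) hr0 hr1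
  have hd : ∀ k, L2S T s (g (k + 1) - g k) := fun k => ((hg _).sub (hg _)).1
  set F : ℕ → ℝ → ℝ := fun k t => (r ^ k)⁻¹ * vNormSq s ((g (k + 1) - g k) t) with hF
  have hFi : ∀ k, IntegrableOn (F k) (Ioo 0 T) := fun k => (hd k).int.const_mul _
  have hF0 : ∀ k t, 0 ≤ F k t := fun k t => mul_nonneg (by positivity) (vNormSq_nonneg _ _)
  have hFs : Summable fun k => ∫ t in Ioo 0 T, ‖F k t‖ := by
    refine Summable.of_nonneg_of_le (fun k => integral_nonneg fun t => norm_nonneg _) (fun k => ?_)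
      ((summable_geometric_of_lt_one hr0.le hr1).mul_left C)
    simp only [Real.norm_of_nonneg (hF0 k _)]
    rw [integral_const_mul]
    have := hb k
    calc _ ≤ (r ^ k)⁻¹ * (C * q ^ k) := by gcongr; exact this
      _ = C * r ^ k := by rw [← hrq, mul_pow]; field_simp
  have hsum : ∀ᵐ t ∂(volume.restrict (Ioo 0 T)), Summable fun k => F k t := by
    have hfin : ∫⁻ t in Ioo 0 T, ∑' k, ENNReal.ofReal (F k t) ≠ ⊤ := by
      rw [lintegral_tsum fun k => (hFi k).aestronglyMeasurable.aemeasurable.ennreal_ofReal]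
      have e : ∀ k, ∫⁻ t in Ioo 0 T, ENNReal.ofReal (F k t) =
          ENNReal.ofReal (∫ t in Ioo 0 T, ‖F k t‖) := fun k => by
        simp only [Real.norm_of_nonneg (hF0 k _)]
        rw [ofReal_integral_eq_lintegral_ofReal (hFi k) (.of_forall (hF0 k))]
      simp only [e]
      rw [← ENNReal.ofReal_tsum_of_nonneg (fun k => integral_nonneg fun t => norm_nonneg _) hFs]
      exact ENNReal.ofReal_ne_top
    filter_upwards [ae_lt_top' (AEMeasurable.tsum fun k =>
      (hFi k).aestronglyMeasurable.aemeasurable.ennreal_ofReal) hfin] with t ht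
    have := ENNReal.summable_toReal ht.ne
    simpa only [ENNReal.toReal_ofReal (hF0 _ t)] using this
  have hHi : IntegrableOn (fun t => ∑' k, F k t) (Ioo 0 T) := by
    have hm : AEStronglyMeasurable (fun t => ∑' k, F k t) (volume.restrict (Ioo 0 T)) :=
      aestronglyMeasurable_tsum (fun k => (hFi k).aestronglyMeasurable) hsum
    refine ⟨hm, ?_⟩
    rw [hasFiniteIntegral_iff_ofReal (.of_forall fun t => tsum_nonneg fun k => hF0 k t)]
    have e : ∀ᵐ t ∂(volume.restrict (Ioo 0 T)), ENNReal.ofReal (∑' k, F k t) =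
        ∑' k, ENNReal.ofReal (F k t) := hsum.mono fun t ht =>
      ENNReal.ofReal_tsum_of_nonneg (fun k => hF0 k t) ht
    rw [lintegral_congr_ae e,
      lintegral_tsum fun k => (hFi k).aestronglyMeasurable.aemeasurable.ennreal_ofReal]
    have e : ∀ k, ∫⁻ t in Ioo 0 T, ENNReal.ofReal (F k t) =
        ENNReal.ofReal (∫ t in Ioo 0 T, ‖F k t‖) := fun k => by
      simp only [Real.norm_of_nonneg (hF0 k _)]
      rw [ofReal_integral_eq_lintegral_ofReal (hFi k) (.of_forall (hF0 k))]
    simp only [e]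
    rw [← ENNReal.ofReal_tsum_of_nonneg (fun k => integral_nonneg fun t => norm_nonneg _) hFs]
    exact ENNReal.ofReal_lt_top
  -- At the exceptional times the value is arbitrary; everything about G is claimed almost
  -- everywhere.
  set G : ℝ → VDistr n := fun t i ξ => limUnder atTop fun k => g k t i ξ with hGd
  have hmain : ∀ᵐ t ∂(volume.restrict (Ioo 0 T)),
      (∀ i ξ, Tendsto (fun k => g k t i ξ) atTop (𝓝 (G t i ξ))) ∧
      ∀ k, VSob s ((g k - G) t) ∧ vNormSq s ((g k - G) t) ≤ A * ((∑' k, F k t) * r ^ k) := by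
    filter_upwards [hsum, ae_all_iff.mpr fun k => (hg k).mem] with t ht hm
    obtain ⟨G', hG', hG2⟩ := hlim (fun k => g k t) (∑' k, F k t) hm fun k => by
      have := ht.le_tsum k fun j _ => hF0 j t
      simp only [hF] at this
      rw [inv_mul_le_iff₀ (by positivity), mul_comm] at this
      exact this
    have e : G t = G' := by
      ext i ξ
      exact (hG' i ξ).limUnder_eq
    refine ⟨by rwa [e], ?_⟩
    simp only [Pi.sub_apply, e]
    exact hG2
  have hGm : TimeMeasurable T G := fun i ξ =>
    aestronglyMeasurable_of_tendsto_ae atTop (fun k => (hg k).meas i ξ)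
      (hmain.mono fun t ht => ht.1 i ξ)
  have hdiff := fun k => L2S.of_le (s := s) ((hg k).meas.sub hGm)
    ((hHi.mul_const (r ^ k)).const_mul A) (hmain.mono fun t ht => ht.2 k)
  refine ⟨G, ?_, ?_, hmain.mono fun t ht => ht.1⟩
  · have := ((hg 0).sub (hdiff 0).1).1
    rwa [sub_sub_cancel] at this
  · refine squeeze_zero (fun k => en_nonneg _ _ _) (fun k => (hdiff k).2) ?_
    simp only [integral_const_mul, integral_mul_const]
    have := ((tendsto_pow_atTop_nhds_zero_of_lt_one hr0.le hr1).const_mul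
      (∫ t in Ioo 0 T, ∑' k, F k t)).const_mul A
    simpa using this

/-! ### Exponentially weighted norms in time and the fixed point theorem. -/

/-- The norm of `L₂(0, T; (H^s)ⁿ)` with an exponential weight, squared. -/
noncomputable def den (T s l : ℝ) (h : ℝ → VDistr n) : ℝ :=
  ∫ t in Ioo 0 T, Real.exp (-l * t) * vNormSq s (h t)

variable {l : ℝ}

lemma L2S.integrable_den {h : ℝ → VDistr n} (hh : L2S T s h) (hl : 0 ≤ l) :
    IntegrableOn (fun t => Real.exp (-l * t) * vNormSq s (h t)) (Ioo 0 T) := by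
  refine Integrable.mono' hh.int ((by fun_prop : Continuous fun t =>
    Real.exp (-l * t)).aestronglyMeasurable.mul hh.int.aestronglyMeasurable) ?_
  filter_upwards [ae_restrict_mem measurableSet_Ioo] with t ht
  have := vNormSq_nonneg s (h t)
  rw [Real.norm_of_nonneg (by positivity)]
  refine mul_le_of_le_one_left this (Real.exp_le_one_iff.mpr ?_)
  nlinarith [ht.1]

lemma den_nonneg (T s l : ℝ) (h : ℝ → VDistr n) : 0 ≤ den T s l h :=
  integral_nonneg fun t => mul_nonneg (Real.exp_pos _).le (vNormSq_nonneg s (h t))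

lemma L2S.den_le_en {h : ℝ → VDistr n} (hh : L2S T s h) (hl : 0 ≤ l) :
    den T s l h ≤ en T s h := by
  refine setIntegral_mono_on (hh.integrable_den hl) hh.int measurableSet_Ioo fun t ht => ?_
  refine mul_le_of_le_one_left (vNormSq_nonneg s (h t)) (Real.exp_le_one_iff.mpr ?_)
  nlinarith [ht.1]

lemma L2S.en_le_den {h : ℝ → VDistr n} (hh : L2S T s h) (hl : 0 ≤ l) :
    en T s h ≤ Real.exp (l * T) * den T s l h := by
  rw [den, ← integral_const_mul]
  refine setIntegral_mono_on hh.int ((hh.integrable_den hl).const_mul _) measurableSet_Ioo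
    fun t ht => ?_
  rw [← mul_assoc, ← Real.exp_add]
  refine le_mul_of_one_le_left (vNormSq_nonneg s (h t)) (Real.one_le_exp ?_)
  nlinarith [ht.2]

lemma L2S.den_add_le {h k : ℝ → VDistr n} (hh : L2S T s h) (hk : L2S T s k) (hl : 0 ≤ l) {θ : ℝ}
    (hθ : 0 < θ) : den T s l (h + k) ≤ (1 + θ) * den T s l h + (1 + θ⁻¹) * den T s l k := by
  rw [den, den, den, ← integral_const_mul, ← integral_const_mul,
    ← integral_add ((hh.integrable_den hl).const_mul _) ((hk.integrable_den hl).const_mul _)]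
  refine integral_mono_ae ((hh.add hk).1.integrable_den hl)
    (((hh.integrable_den hl).const_mul _).add ((hk.integrable_den hl).const_mul _)) ?_
  filter_upwards [hh.mem, hk.mem] with t h1 h2
  have := vNormSq_add_le_of_pos h1 h2 hθ
  have := mul_le_mul_of_nonneg_left this (Real.exp_pos (-l * t)).le
  simp only [Pi.add_apply]
  linarith

lemma en_sub_comm (T s : ℝ) (h k : ℝ → VDistr n) : en T s (h - k) = en T s (k - h) :=
  integral_congr_ae (.of_forall fun t => vNormSq_neg_sub s (h t) (k t))

lemma vNormSq_eq_zero {u : VDistr n} (hu : VSob s u) (h : vNormSq s u = 0) : u = 0 := by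
  ext i ξ
  have h1 := weight_le_vNormSq hu i ξ
  rw [h] at h1
  have h2 := Real.rpow_pos_of_pos (rho_pos ξ) (2 * s)
  have h3 : ‖u i ξ‖ ^ 2 ≤ 0 := by
    by_contra hn
    push Not at hn
    have := mul_pos h2 hn
    linarith
  exact norm_eq_zero.mp (pow_eq_zero_iff (two_ne_zero) |>.mp (le_antisymm h3 (sq_nonneg _)))

lemma L2S.ae_eq_of_en_sub {h k : ℝ → VDistr n} (hh : L2S T s h) (hk : L2S T s k)
    (h0 : en T s (h - k) = 0) : ∀ᵐ t ∂(volume.restrict (Ioo 0 T)), h t = k t := by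
  have h1 := (hh.sub hk).1
  have h2 := (integral_eq_zero_iff_of_nonneg (fun t => vNormSq_nonneg s ((h - k) t)) h1.int).mp h0
  filter_upwards [h1.mem, h2] with t h3 h4 using sub_eq_zero.mp (vNormSq_eq_zero h3 h4)

/-- Square integrable functions with values in the divergence-free fields. -/
def Adm (T s : ℝ) (g : ℝ → VDistr n) : Prop :=
  L2S T s g ∧ ∀ᵐ t ∂(volume.restrict (Ioo 0 T)), Solenoidal (g t)

lemma solenoidal_zero : Solenoidal (0 : VDistr n) :=
  ⟨fun i ξ => by simp, fun i => rfl, fun ξ => by simp⟩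

lemma l2S_zero : L2S T s (0 : ℝ → VDistr n) :=
  l2S_iff.mpr ⟨fun i ξ => aestronglyMeasurable_const, .of_forall fun t i => SobMem.zero s, by
    have : (fun t => vNormSq s ((0 : ℝ → VDistr n) t)) = fun _ => 0 :=
      funext fun t => Finset.sum_eq_zero fun i _ => normSq_zero s
    rw [this]
    exact integrableOn_zero⟩

lemma solenoidal_of_tendsto {x : ℕ → VDistr n} {G : VDistr n} (hx : ∀ k, Solenoidal (x k))
    (h : ∀ i ξ, Tendsto (fun k => x k i ξ) atTop (𝓝 (G i ξ))) : Solenoidal G where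
  real i ξ := by
    refine tendsto_nhds_unique (h i (-ξ)) ?_
    simp only [(hx _).real i ξ]
    exact (Complex.continuous_conj.tendsto _).comp (h i ξ)
  mean i := by
    refine tendsto_nhds_unique (h i 0) ?_
    simp only [(hx _).mean i]
    exact tendsto_const_nhds
  div ξ := by
    have h1 : Tendsto (fun k => ∑ j, (ξ j : ℂ) * x k j ξ) atTop (𝓝 (∑ j, (ξ j : ℂ) * G j ξ)) :=
      tendsto_finsetSum _ fun j _ => (h j ξ).const_mul _
    refine tendsto_nhds_unique h1 ?_
    simp only [(hx _).div ξ]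
    exact tendsto_const_nhds

/-- Banach's principle for squared norms on a ball. The iterates of 0 stay below R/4, which leaves
room for the constants lost when passing to the limit, so the contraction also applies at the limit.
The weighted norm measures the contraction; completeness is that of the equivalent unweighted norm.
-/
theorem exists_fixed_point {Φ : (ℝ → VDistr n) → ℝ → VDistr n} {q R : ℝ} (hl : 0 ≤ l)
    (hq0 : 0 < q) (hq1 : q < 1) (hR : 0 ≤ R) (hΦ : ∀ g, Adm T s g → Adm T s (Φ g))
    (hc : ∀ g g', Adm T s g → Adm T s g' → den T s l g ≤ R → den T s l g' ≤ R →
      den T s l (Φ g - Φ g') ≤ q * den T s l (g - g'))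
    (h0 : den T s l (Φ 0) ≤ (1 - q) ^ 2 / 16 * R) :
    ∃ G, Adm T s G ∧ den T s l G ≤ R ∧ ∀ᵐ t ∂(volume.restrict (Ioo 0 T)), G t = Φ G t := by
  have hz : Adm T s (0 : ℝ → VDistr n) := ⟨l2S_zero, .of_forall fun t => solenoidal_zero⟩
  have hz0 : den T s l (0 : ℝ → VDistr n) = 0 := by
    have : ∀ t, vNormSq s ((0 : ℝ → VDistr n) t) = 0 := fun t =>
      Finset.sum_eq_zero fun i _ => normSq_zero s
    simp only [den, this, mul_zero, integral_zero]
  set g : ℕ → ℝ → VDistr n := fun k => Φ^[k] 0 with hg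
  have hgs : ∀ k, g (k + 1) = Φ (g k) := fun k => Function.iterate_succ_apply' Φ k 0
  have hga : ∀ k, Adm T s (g k) := fun k => by
    induction k with
    | zero => exact hz
    | succ k ih => rw [hgs]; exact hΦ _ ih
  have h1q : 0 < 1 - q := by linarith
  have hgb : ∀ k, den T s l (g k) ≤ R / 4 := fun k => by
    induction k with
    | zero =>
      change den T s l (0 : ℝ → VDistr n) ≤ R / 4
      rw [hz0]; positivity
    | succ k ih =>
      have h1 := hc _ _ (hga k) hz (by linarith) (by rw [hz0]; exact hR)
      rw [sub_zero] at h1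
      -- This θ gives (1+θ) q = (1+q)/2, while 1 + 1/θ = (1+q)/(1-q) is compensated by the factor
      -- (1-q)²/16 in the smallness of Φ 0.
      have hθ : 0 < (1 - q) / (2 * q) := by positivity
      have h2 := ((hΦ _ (hga k)).1.sub (hΦ _ hz).1).1.den_add_le (hΦ _ hz).1 hl hθ
      rw [sub_add_cancel, ← hgs] at h2
      rw [← hgs] at h1
      have e1 : (1 + (1 - q) / (2 * q)) * q = (1 + q) / 2 := by field_simp; ring
      have e2 : 1 + ((1 - q) / (2 * q))⁻¹ = (1 + q) / (1 - q) := by field_simp; ring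
      rw [e2] at h2
      calc _ ≤ _ := h2
        _ ≤ (1 + (1 - q) / (2 * q)) * (q * (R / 4)) +
            (1 + q) / (1 - q) * ((1 - q) ^ 2 / 16 * R) := by
            have := h1.trans (mul_le_mul_of_nonneg_left ih hq0.le)
            gcongr
        _ = (1 + q) / 2 * (R / 4) + (1 + q) * (1 - q) / 16 * R := by
            rw [← mul_assoc, e1]; field_simp
        _ ≤ R / 4 := by nlinarith [mul_nonneg hR h1q.le, mul_nonneg (mul_nonneg hR h1q.le) h1q.le]
  have hR4 : ∀ k, den T s l (g k) ≤ R := fun k => (hgb k).trans (by linarith)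
  have hdiff : ∀ k, den T s l (g (k + 1) - g k) ≤ den T s l (g 1 - g 0) * q ^ k := fun k => by
    induction k with
    | zero => simp
    | succ k ih =>
      have h1 := hc _ _ (hga (k + 1)) (hga k) (hR4 _) (hR4 _)
      rw [← hgs, ← hgs] at h1
      refine h1.trans ((mul_le_mul_of_nonneg_left ih hq0.le).trans (le_of_eq ?_))
      ring
  obtain ⟨G, hG, hGl, hGt⟩ := L2S.exists_limit (C := Real.exp (l * T) * den T s l (g 1 - g 0))
    hq0 hq1 (fun k => (hga k).1) fun k => by
      refine (((hga _).1.sub (hga _).1).1.en_le_den hl).trans ?_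
      rw [mul_assoc]
      exact mul_le_mul_of_nonneg_left (hdiff k) (Real.exp_pos _).le
  have hGa : Adm T s G := by
    refine ⟨hG, ?_⟩
    filter_upwards [hGt, ae_all_iff.mpr fun k => (hga k).2] with t h1 h2
      using solenoidal_of_tendsto h2 h1
  have hdG : Tendsto (fun k => den T s l (g k - G)) atTop (𝓝 0) :=
    squeeze_zero (fun k => den_nonneg _ _ _ _)
      (fun k => (((hga k).1.sub hG).1.den_le_en hl)) hGl
  have hGR : den T s l G ≤ R := by
    have hb : ∀ k, den T s l G ≤ R / 2 + 2 * en T s (g k - G) := fun k => by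
      have h1 := (hga k).1.den_add_le (hG.sub (hga k).1).1 hl one_pos
      rw [add_sub_cancel] at h1
      have h2 := (hG.sub (hga k).1).1.den_le_en hl
      rw [en_sub_comm] at h2
      have := hgb k
      norm_num at h1
      linarith
    have ht : Tendsto (fun k => R / 2 + 2 * en T s (g k - G)) atTop (𝓝 (R / 2 + 2 * 0)) :=
      (hGl.const_mul 2).const_add _
    have := ge_of_tendsto' ht hb
    linarith
  refine ⟨G, hGa, hGR, ?_⟩
  have hΦG := (hΦ _ hGa).1
  refine hG.ae_eq_of_en_sub hΦG (le_antisymm ?_ (en_nonneg _ _ _))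
  have hb : ∀ k, en T s (G - Φ G) ≤ 2 * (en T s (g (k + 1) - G) +
      Real.exp (l * T) * (q * den T s l (g k - G))) := fun k => by
    have h1 := ((hG.sub (hga (k + 1)).1).1.add ((hga (k + 1)).1.sub hΦG).1).2
    rw [sub_add_sub_cancel, en_sub_comm T s G (g (k + 1))] at h1
    have h2 := ((hga (k + 1)).1.sub hΦG).1.en_le_den hl
    have h3 := hc _ _ (hga k) hGa (hR4 k) hGR
    rw [← hgs] at h3
    have h4 := mul_le_mul_of_nonneg_left h3 (Real.exp_pos (l * T)).le
    linarith
  have ht : Tendsto (fun k => 2 * (en T s (g (k + 1) - G) +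
      Real.exp (l * T) * (q * den T s l (g k - G)))) atTop
      (𝓝 (2 * (0 + Real.exp (l * T) * (q * 0)))) :=
    (((tendsto_add_atTop_iff_nat 1).mpr hGl).add ((hdG.const_mul q).const_mul _)).const_mul 2
  have := ge_of_tendsto' ht hb
  simpa using this

end

section

/-! ### The nonlinear term as a function of time -/

variable {T : ℝ}

lemma aestronglyMeasurable_conv {μ : Measure ℝ} {k g : ℝ → PDistr n}
    (hk : ∀ ξ, AEStronglyMeasurable (fun t => k t ξ) μ)
    (hg : ∀ ξ, AEStronglyMeasurable (fun t => g t ξ) μ) (hk0 : ∀ᵐ t ∂μ, SobMem 0 (k t))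
    (hg0 : ∀ᵐ t ∂μ, SobMem 0 (g t)) (ξ : Fin n → ℤ) :
    AEStronglyMeasurable (fun t => conv (k t) (g t) ξ) μ :=
  aestronglyMeasurable_tsum (fun η => (hk (ξ - η)).mul (hg η)) (by
    filter_upwards [hk0, hg0] with t h1 h2 using h1.summable_conv h2 ξ)

lemma timeMeasurable_bop {u w : ℝ → VDistr n} (hu : TimeMeasurable T u) (hw : TimeMeasurable T w)
    (hu0 : ∀ᵐ t ∂(volume.restrict (Ioo 0 T)), VSob 0 (u t))
    (hw0 : ∀ᵐ t ∂(volume.restrict (Ioo 0 T)), VSob 0 (w t)) :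
    TimeMeasurable T fun t => bop (u t) (w t) := fun i ξ => by
  simp only [bop, Finset.sum_apply, pderiv]
  exact Finset.aestronglyMeasurable_fun_sum _ fun j _ =>
    (aestronglyMeasurable_conv (hu j) (hw i) (hu0.mono fun t h => h j)
      (hw0.mono fun t h => h i) ξ).const_mul _

lemma timeMeasurable_lop {A : ℝ → CTensor n} {r K : ℝ} {u : ℝ → VDistr n}
    (hA : ∀ k j α β ξ, AEStronglyMeasurable (fun t => A t k j α β ξ) (volume.restrict (Ioo 0 T)))
    (hAb : ∀ᵐ t ∂(volume.restrict (Ioo 0 T)), (A t).Bounded r K) (hu : TimeMeasurable T u)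
    (hu1 : ∀ᵐ t ∂(volume.restrict (Ioo 0 T)), VSob 1 (u t)) :
    TimeMeasurable T fun t => lop (A t) (u t) := by
  have hs : ∀ j β ξ, AEStronglyMeasurable (fun t => strain (u t) j β ξ)
      (volume.restrict (Ioo 0 T)) := fun j β ξ => by
    simp only [strain_apply]
    exact (((hu β ξ).const_mul _).add ((hu j ξ).const_mul _)).const_mul _
  have hf : ∀ i α ξ, AEStronglyMeasurable (fun t => flux (A t) (u t) i α ξ)
      (volume.restrict (Ioo 0 T)) := fun i α ξ => by
    simp only [flux, Finset.sum_apply]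
    exact Finset.aestronglyMeasurable_fun_sum _ fun p _ =>
      aestronglyMeasurable_conv (hA i p.1 α p.2) (hs p.1 p.2) (hAb.mono fun t h => h.mem _ _ _ _)
        (hu1.mono fun t h => strain_zero_bound h _ _) ξ
  intro i ξ
  simp only [lop, Finset.sum_apply, Pi.smul_apply, pderiv, Pi.add_apply, smul_eq_mul]
  exact Finset.aestronglyMeasurable_fun_sum _ fun α _ =>
    (((hf i α ξ).add (hf α i ξ)).const_mul _).const_mul _

/-! ### Spaces L₄ in time and the convection estimate. -/

/-- The space `L₄(0, T; (H^d)ⁿ)`. -/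
structure L4S (T d : ℝ) (u : ℝ → VDistr n) : Prop where
  meas : TimeMeasurable T u
  mem : ∀ᵐ t ∂(volume.restrict (Ioo 0 T)), VSob d (u t)
  int : IntegrableOn (fun t => vNormSq d (u t) ^ 2) (Ioo 0 T)

/-- The fourth power of the norm in `L₄(0, T; (H^d)ⁿ)`. -/
noncomputable def en4 (T d : ℝ) (u : ℝ → VDistr n) : ℝ := ∫ t in Ioo 0 T, vNormSq d (u t) ^ 2

variable {d : ℝ}

lemma en4_nonneg (T d : ℝ) (u : ℝ → VDistr n) : 0 ≤ en4 T d u :=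
  integral_nonneg fun t => sq_nonneg _

lemma L4S.add {u w : ℝ → VDistr n} (hu : L4S T d u) (hw : L4S T d w) :
    L4S T d (u + w) ∧ en4 T d (u + w) ≤ 8 * (en4 T d u + en4 T d w) := by
  have hm := hu.meas.add hw.meas
  have hle : ∀ᵐ t ∂(volume.restrict (Ioo 0 T)), vNormSq d ((u + w) t) ^ 2 ≤
      8 * (vNormSq d (u t) ^ 2 + vNormSq d (w t) ^ 2) := by
    filter_upwards [hu.mem, hw.mem] with t h1 h2
    have h3 := vNormSq_add_le h1 h2
    have h4 := vNormSq_nonneg d (u t + w t)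
    have h5 := pow_le_pow_left₀ h4 h3 2
    rw [Pi.add_apply]
    nlinarith [sq_nonneg (vNormSq d (u t) - vNormSq d (w t))]
  have hi := ((hu.int.add hw.int).const_mul 8)
  have hint : IntegrableOn (fun t => vNormSq d ((u + w) t) ^ 2) (Ioo 0 T) :=
    Integrable.mono' hi ((aestronglyMeasurable_vNormSq hm d).pow 2) (hle.mono fun t ht => by
      rw [Real.norm_of_nonneg (sq_nonneg _)]; exact ht)
  refine ⟨⟨hm, ?_, hint⟩, ?_⟩
  · filter_upwards [hu.mem, hw.mem] with t h1 h2 using h1.add h2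
  · refine (integral_mono_ae hint hi hle).trans (le_of_eq ?_)
    simp only [Pi.add_apply]
    rw [integral_const_mul, integral_add hu.int hw.int]
    rfl

/-- Interpolation at the middle order is the duality estimate for H^a and H^b with both arguments
equal. -/
lemma vNormSq_interp {a b c : ℝ} (h : a + b = 2 * c) (hab : a ≤ b) {u : VDistr n}
    (hu : VSob b u) : VSob c u ∧ vNormSq c u ^ 2 ≤ vNormSq a u * vNormSq b u := by
  have ha : VSob a u := hu.mono hab
  refine ⟨hu.mono (by linarith), ?_⟩
  have h1 := abs_vin_le h ha hu
  rw [vin_self, abs_of_nonneg (vNormSq_nonneg _ _)] at h1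
  have h2 := pow_le_pow_left₀ (vNormSq_nonneg c u) h1 2
  rwa [mul_pow, Real.sq_sqrt (vNormSq_nonneg a u), Real.sq_sqrt (vNormSq_nonneg b u)] at h2

/-- With d = s + 1/2, a function bounded in H^s and square integrable in H^{s+1} is in L₄ with
values in H^d. -/
lemma L4S.of_interp {s X : ℝ} {u : ℝ → VDistr n} (hd : 2 * d = 2 * s + 1) (hu : L2S T (s + 1) u)
    (hX : ∀ᵐ t ∂(volume.restrict (Ioo 0 T)), vNormSq s (u t) ≤ X) :
    L4S T d u ∧ en4 T d u ≤ X * en T (s + 1) u := by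
  have hle : ∀ᵐ t ∂(volume.restrict (Ioo 0 T)), VSob d (u t) ∧
      vNormSq d (u t) ^ 2 ≤ X * vNormSq (s + 1) (u t) := by
    filter_upwards [hu.mem, hX] with t h1 h2
    have h3 := vNormSq_interp (a := s) (b := s + 1) (c := d) (by linarith) (by linarith) h1
    exact ⟨h3.1, h3.2.trans (mul_le_mul_of_nonneg_right h2 (vNormSq_nonneg _ _))⟩
  have hint : IntegrableOn (fun t => vNormSq d (u t) ^ 2) (Ioo 0 T) :=
    Integrable.mono' (hu.int.const_mul X) ((aestronglyMeasurable_vNormSq hu.meas d).pow 2)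
      (hle.mono fun t ht => by rw [Real.norm_of_nonneg (sq_nonneg _)]; exact ht.2)
  refine ⟨⟨hu.meas, hle.mono fun t ht => ht.1, hint⟩, ?_⟩
  refine (integral_mono_ae hint (hu.int.const_mul X) (hle.mono fun t ht => ht.2)).trans ?_
  rw [integral_const_mul]
  rfl

/-- The integral of (f + y g)² is a non-negative quadratic polynomial in y, so its discriminant is
not positive. -/
lemma integral_mul_le_sqrt {α : Type*} [MeasurableSpace α] {μ : Measure α} {f g : α → ℝ}
    (hf : AEStronglyMeasurable f μ) (hg : AEStronglyMeasurable g μ)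
    (hf2 : Integrable (fun x => f x ^ 2) μ) (hg2 : Integrable (fun x => g x ^ 2) μ) :
    Integrable (fun x => f x * g x) μ ∧
      ∫ x, f x * g x ∂μ ≤ √(∫ x, f x ^ 2 ∂μ) * √(∫ x, g x ^ 2 ∂μ) := by
  have hfg : Integrable (fun x => f x * g x) μ := by
    refine Integrable.mono' (hf2.add hg2) (hf.mul hg) (.of_forall fun x => ?_)
    rw [Real.norm_eq_abs, abs_mul, Pi.add_apply, ← sq_abs (f x), ← sq_abs (g x)]
    nlinarith [sq_nonneg (|f x| - |g x|), sq_nonneg |f x|, sq_nonneg |g x|]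
  refine ⟨hfg, ?_⟩
  set F := ∫ x, f x ^ 2 ∂μ with hF
  set G := ∫ x, g x ^ 2 ∂μ with hG
  set P := ∫ x, f x * g x ∂μ with hP
  have hF0 : 0 ≤ F := integral_nonneg fun x => sq_nonneg _
  have key : ∀ y : ℝ, 0 ≤ G * (y * y) + 2 * P * y + F := fun y => by
    have h : 0 ≤ ∫ x, (f x ^ 2 + (2 * y) * (f x * g x) + y ^ 2 * g x ^ 2) ∂μ :=
      integral_nonneg fun x => by
        change 0 ≤ f x ^ 2 + (2 * y) * (f x * g x) + y ^ 2 * g x ^ 2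
        nlinarith [sq_nonneg (f x + y * g x)]
    have h1 : Integrable (fun x => f x ^ 2 + (2 * y) * (f x * g x)) μ := hf2.add (hfg.const_mul _)
    rw [integral_add h1 (hg2.const_mul _), integral_add hf2 (hfg.const_mul _), integral_const_mul,
      integral_const_mul] at h
    linarith
  have h := discrim_le_zero key
  rw [discrim] at h
  rw [← Real.sqrt_mul hF0]
  refine Real.le_sqrt_of_sq_le ?_
  linarith

/-- The exponents (n-1)/2, (n-1)/2 and 1 - n/2 add up to n/2, and all lie below n/2 as n ≥ 2. The
estimate is critical: Hölder in time uses up all the integrability, and no power of T appears. -/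
lemma exists_bop_L4 (hn : 2 ≤ n) :
    ∃ C : ℝ, 0 < C ∧ ∀ (T : ℝ) (u w : ℝ → VDistr n), L4S T (((n : ℝ) - 1) / 2) u →
      L4S T (((n : ℝ) - 1) / 2) w → L2S T ((n : ℝ) / 2 - 2) (fun t => bop (u t) (w t)) ∧
      en T ((n : ℝ) / 2 - 2) (fun t => bop (u t) (w t)) ≤
        C * (√(en4 T (((n : ℝ) - 1) / 2) u) * √(en4 T (((n : ℝ) - 1) / 2) w)) := by
  have hn' : (2 : ℝ) ≤ n := by exact_mod_cast hn
  obtain ⟨C, hC, hb⟩ := bop_le_of_conv (n := n) (by omega) (α := ((n : ℝ) - 1) / 2)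
    (β := ((n : ℝ) - 1) / 2) (γ := 1 - (n : ℝ) / 2) (by linarith) (by linarith) (by linarith)
    (by ring)
  rw [show -(1 - (n : ℝ) / 2) - 1 = (n : ℝ) / 2 - 2 by ring] at hb
  refine ⟨C, hC, fun T u w hu hw => ?_⟩
  have h0 : ∀ {z : VDistr n}, VSob (((n : ℝ) - 1) / 2) z → VSob 0 z := fun hz =>
    hz.mono (by linarith)
  have hcs := integral_mul_le_sqrt (aestronglyMeasurable_vNormSq hu.meas _)
    (aestronglyMeasurable_vNormSq hw.meas _) hu.int hw.int
  have := L2S.of_le (timeMeasurable_bop hu.meas hw.meas (hu.mem.mono fun t h => h0 h)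
    (hw.mem.mono fun t h => h0 h)) (hcs.1.const_mul C) (by
      filter_upwards [hu.mem, hw.mem] with t h1 h2 using hb _ _ h1 h2)
  refine ⟨this.1, this.2.trans ?_⟩
  rw [integral_const_mul]
  exact mul_le_mul_of_nonneg_left hcs.2 hC.le

lemma L2S.lop {A : ℝ → CTensor n} {r K s : ℝ} {u : ℝ → VDistr n}
    (hA : ∀ k j α β ξ, AEStronglyMeasurable (fun t => A t k j α β ξ) (volume.restrict (Ioo 0 T)))
    (hAb : ∀ᵐ t ∂(volume.restrict (Ioo 0 T)), (A t).Bounded r K) (hs : 0 ≤ s) (hr : s ≤ r)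
    (hu : L2S T (s + 1) u) (h1 : 1 ≤ s + 1) : L2S T (s - 1) (fun t => lop (A t) (u t)) ∧
      en T (s - 1) (fun t => PeriodicNS.lop (A t) (u t)) ≤ n ^ 7 * K ^ 2 * en T (s + 1) u := by
  have := L2S.of_le (s := s - 1) (timeMeasurable_lop hA hAb hu.meas
    (hu.mem.mono fun t h => h.mono h1)) (hu.int.const_mul (n ^ 7 * K ^ 2)) (by
      filter_upwards [hAb, hu.mem] with t h2 h3
      have e : s - 1 + 2 = s + 1 := by ring
      have := lop_bound (s := s - 1) h2 (by rwa [sub_add_cancel, abs_of_nonneg hs]) (u := u t)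
        (e ▸ h3)
      rwa [e] at this)
  refine ⟨this.1, this.2.trans (le_of_eq ?_)⟩
  rw [integral_const_mul]
  rfl

end

section

/-! ### Existence -/

variable {T s m τ : ℝ} {A : ℝ → CTensor n} {f g g' : ℝ → VDistr n} {u0 : VDistr n}

/-- The linear part of the fixed point problem. -/
noncomputable def linOp (A : ℝ → CTensor n) (m : ℝ) (g : ℝ → VDistr n) : ℝ → VDistr n :=
  fun t => duhamelDeriv m g t + leray (lop (A t) (duhamel m g t))

/-- The candidate for the solution that belongs to `g`. -/
noncomputable def candidate (u0 : VDistr n) (m : ℝ) (g : ℝ → VDistr n) : ℝ → VDistr n :=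
  heat u0 + duhamel m g

/-- The residual of the Navier-Stokes equations at the candidate. -/
noncomputable def residual (A : ℝ → CTensor n) (f : ℝ → VDistr n) (u0 : VDistr n) (m : ℝ)
    (g : ℝ → VDistr n) : ℝ → VDistr n :=
  fun t => heatDeriv u0 t + duhamelDeriv m g t + leray (lop (A t) (candidate u0 m g t) +
    bop (candidate u0 m g t) (candidate u0 m g t) - f t)

lemma vNormSq_sub_rmul {u w : VDistr n} (hu : VSob s u) (hw : VSob s w) (τ : ℝ) :
    vNormSq s (u - rmul (fun _ => τ) w) =
      vNormSq s u - 2 * τ * vin s u w + τ ^ 2 * vNormSq s w := by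
  have e : u - rmul (fun _ => τ) w = u + rmul (fun _ => -τ) w := by
    ext i ξ
    simp only [Pi.sub_apply, Pi.add_apply, rmul]
    push_cast; ring
  rw [e, vNormSq_add_eq hu (hw.smul _), vNormSq_smul, vin_comm, vin_smul_left, vin_comm]
  ring

lemma integral_le_combination {α : Type*} [MeasurableSpace α] {μ : Measure α} {F X Y Z : α → ℝ}
    {a b c : ℝ} (hF : Integrable F μ) (hX : Integrable X μ) (hY : Integrable Y μ)
    (hZ : Integrable Z μ) (h : ∀ᵐ t ∂μ, F t ≤ a * X t - b * Y t + c * Z t) :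
    ∫ t, F t ∂μ ≤ a * (∫ t, X t ∂μ) - b * (∫ t, Y t ∂μ) + c * ∫ t, Z t ∂μ := by
  have h1 : Integrable (fun t => a * X t - b * Y t) μ := (hX.const_mul a).sub (hY.const_mul b)
  rw [← integral_const_mul, ← integral_const_mul, ← integral_const_mul,
    ← integral_sub (hX.const_mul a) (hY.const_mul b), ← integral_add h1 (hZ.const_mul c)]
  exact integral_mono_ae hF (h1.add (hZ.const_mul c)) h

/-- The relaxed linear iteration is a contraction. -/
lemma den_sub_linOp_le (hT : 0 ≤ T) {c B E : ℝ} (hc : 0 < c) (hm : 0 < m) (hB : 0 ≤ B)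
    (hE : 0 < E) (hg : Adm T (s - 1) g)
    (hG : L2S T (s - 1) (linOp A m g))
    (hcoer : ∀ᵐ t ∂(volume.restrict (Ioo 0 T)), ∀ δ w p : VDistr n, Solenoidal w →
      VSob (s - 1) δ → VSob (s + 1) w → p = δ - rmul (fun _ => m) (vlam 2 w) →
        VSob (s - 1) (p + leray (lop (A t) w)) ∧
        c * vNormSq (s - 1) δ + m * (vin s w p - B * vNormSq s w) ≤
          vin (s - 1) δ (p + leray (lop (A t) w)) ∧
        vNormSq (s - 1) (p + leray (lop (A t) w)) ≤
          E * (vNormSq (s - 1) δ + vNormSq (s + 1) w)) {E' : ℝ} (hE' : 0 < E')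
    (hEE : E * (1 + Real.exp (2 * B * T) / m ^ 2) ≤ E') :
    den T (s - 1) (2 * B) (g - fun t => rmul (fun _ => c / E') (linOp A m g t)) ≤
      (1 - c ^ 2 / E') * den T (s - 1) (2 * B) g := by
  -- The minimiser of 1 - 2τc + τ²E', with the minimum 1 - c²/E'.
  set τ := c / E' with hτ
  have hτ0 : 0 ≤ τ := by positivity
  have hl : 0 ≤ 2 * B := by linarith
  have hw := hg.1.duhamel hT hm
  have hp := hg.1.duhamelDeriv hT hm
  have hen := weighted_energy_nonneg hT (hasPrim_duhamel hg.1 m) hw.1 hp.1 (duhamel_zero m g) B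
  have hd := hg.1.integrable_den hl
  -- The square of g - τ L g is expanded. Coercivity bounds the cross term; its part with w' has a
  -- non-negative weighted integral and can be dropped after integration.
  have hpt : ∀ᵐ t ∂(volume.restrict (Ioo 0 T)), Real.exp (-(2 * B) * t) *
      vNormSq (s - 1) ((g - fun t => rmul (fun _ => τ) (linOp A m g t)) t) ≤
      (1 - 2 * τ * c + τ ^ 2 * E) * (Real.exp (-(2 * B) * t) * vNormSq (s - 1) (g t)) -
      2 * τ * m * (Real.exp (-(2 * B) * t) * (vin s (duhamel m g t) (duhamelDeriv m g t) -
        B * vNormSq s (duhamel m g t))) + τ ^ 2 * E * vNormSq (s + 1) (duhamel m g t) := by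
    filter_upwards [hcoer, hg.1.mem, hw.1.mem, ae_restrict_mem measurableSet_Ioo]
      with t h1 h2 h3 ht
    have hsol : Solenoidal (duhamel m g t) :=
      Solenoidal.duhamel hg.2 (fun i ξ => (hg.1 i).integrable ξ) ⟨ht.1.le, ht.2.le⟩
    obtain ⟨a1, a2, a3⟩ := h1 (g t) (duhamel m g t) (duhamelDeriv m g t) hsol h2 h3 rfl
    have e := vNormSq_sub_rmul h2 a1 τ
    change Real.exp (-(2 * B) * t) * vNormSq (s - 1) (g t - rmul (fun _ => τ)
      (duhamelDeriv m g t + leray (lop (A t) (duhamel m g t)))) ≤ _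
    rw [e]
    have hx := Real.exp_pos (-(2 * B) * t)
    have hx1 : Real.exp (-(2 * B) * t) ≤ 1 := Real.exp_le_one_iff.mpr (by nlinarith [ht.1])
    have hn := vNormSq_nonneg (s + 1) (duhamel m g t)
    have b2 := mul_le_mul_of_nonneg_left a2 (by positivity : 0 ≤ 2 * τ)
    have b3 := mul_le_mul_of_nonneg_left a3 (by positivity : 0 ≤ τ ^ 2)
    have b4 := mul_le_mul_of_nonneg_left (add_le_add (neg_le_neg b2) b3) hx.le
    have b5 := mul_le_mul_of_nonneg_right hx1 (by positivity : 0 ≤ τ ^ 2 * E *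
      vNormSq (s + 1) (duhamel m g t))
    linarith
  have hsub : L2S T (s - 1) (g - fun t => rmul (fun _ => τ) (linOp A m g t)) :=
    (hg.1.sub (hG.const_rmul τ).1).1
  have hint := integral_le_combination (hsub.integrable_den hl) hd hen.1 hw.1.int hpt
  have h4 : 0 ≤ 2 * τ * m * ∫ t in Ioo 0 T, Real.exp (-(2 * B) * t) *
      (vin s (duhamel m g t) (duhamelDeriv m g t) - B * vNormSq s (duhamel m g t)) :=
    mul_nonneg (by positivity) hen.2
  -- The H^{s+1} norm of w occurs without the weight; returning to the weighted norm of g costs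
  -- exp(2BT), which is why this factor is built into E'.
  have h5 : en T (s + 1) (duhamel m g) ≤
      (m ^ 2)⁻¹ * (Real.exp (2 * B * T) * den T (s - 1) (2 * B) g) :=
    hw.2.trans (mul_le_mul_of_nonneg_left (hg.1.en_le_den hl) (by positivity))
  have h6 := mul_le_mul_of_nonneg_left h5 (by positivity : 0 ≤ τ ^ 2 * E)
  have hd0 := den_nonneg T (s - 1) (2 * B) g
  have h7 : τ ^ 2 * (E * (1 + Real.exp (2 * B * T) / m ^ 2)) * den T (s - 1) (2 * B) g ≤
      τ ^ 2 * E' * den T (s - 1) (2 * B) g := by gcongr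
  have e1 : τ ^ 2 * E' = c ^ 2 / E' := by rw [hτ]; field_simp
  have e2 : τ * c = c ^ 2 / E' := by rw [hτ]; field_simp
  have e3 : τ ^ 2 * (E * (1 + Real.exp (2 * B * T) / m ^ 2)) * den T (s - 1) (2 * B) g =
      τ ^ 2 * E * den T (s - 1) (2 * B) g +
      τ ^ 2 * E * ((m ^ 2)⁻¹ * (Real.exp (2 * B * T) * den T (s - 1) (2 * B) g)) := by
    field_simp
  rw [e1, e3] at h7
  change den T (s - 1) (2 * B) _ ≤ _ * den T (s - 1) (2 * B) g - _ +
    τ ^ 2 * E * en T (s + 1) (duhamel m g) at hint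
  have e4 : (1 - 2 * τ * c + τ ^ 2 * E) * den T (s - 1) (2 * B) g =
      den T (s - 1) (2 * B) g - 2 * (c ^ 2 / E' * den T (s - 1) (2 * B) g) +
      τ ^ 2 * E * den T (s - 1) (2 * B) g := by rw [← e2]; ring
  rw [e4] at hint
  linarith

lemma duhamel_zero_right (m t : ℝ) : duhamel m (0 : ℝ → VDistr n) t = 0 := by
  ext i ξ
  simp [duhamel, duh]

lemma bop_sub_self {u w : VDistr n} (hu : VSob 0 u) (hw : VSob 0 w) :
    bop u u - bop w w = bop u (u - w) + bop (u - w) w := by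
  rw [bop_sub_right hu hu hw, bop_sub_left hu hw hw]
  abel

end

/-! ### Estimates for the candidates and their residuals. -/

section

variable {T s m r K d : ℝ} {A : ℝ → CTensor n} {f g g' : ℝ → VDistr n} {u0 : VDistr n}

/-- As w starts at zero, its norms in L_∞(H^s) and L₂(H^{s+1}) are both controlled by g. The root of
`en4` is the square of the L₄ norm, hence the linear dependence on `en`. -/
lemma l4S_duhamel (hT : 0 ≤ T) (hm : 0 < m) (hd : 2 * d = 2 * s + 1) (hg : L2S T (s - 1) g) :
    L4S T d (duhamel m g) ∧ √(en4 T d (duhamel m g)) ≤ ((m ^ 2)⁻¹ + 4) * en T (s - 1) g := by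
  have h1 := hg.duhamel hT hm
  have h2 := hg.duhamelDeriv hT hm
  have he := en_nonneg T (s - 1) g
  have hX : ∀ᵐ t ∂(volume.restrict (Ioo 0 T)),
      vNormSq s (duhamel m g t) ≤ ((m ^ 2)⁻¹ + 4) * en T (s - 1) g := by
    filter_upwards [ae_restrict_mem measurableSet_Ioo] with t ht
    have := (trace_bound (hasPrim_duhamel hg m) h1.1 h2.1
      (by rw [duhamel_zero]; exact fun i => SobMem.zero s) ⟨ht.1.le, ht.2.le⟩).2
    have h0 : vNormSq s (duhamel m g 0) = 0 := by
      rw [duhamel_zero]; exact Finset.sum_eq_zero fun i _ => normSq_zero s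
    rw [h0] at this
    linarith [h1.2, h2.2]
  have h3 := L4S.of_interp hd h1.1 hX
  refine ⟨h3.1, Real.sqrt_le_left (by positivity) |>.mpr (h3.2.trans ?_)⟩
  rw [sq (_ * _)]
  refine mul_le_mul_of_nonneg_left (h1.2.trans ?_) (by positivity)
  exact mul_le_mul_of_nonneg_right (by linarith) he

/-- The heat flow does not increase the H^s norm, so the first factor is that of u⁰. The product of
these factors accounts for the term with A₁ in the smallness condition. -/
lemma l4S_heat (hT : 0 ≤ T) (hd : 2 * d = 2 * s + 1) (h0 : Solenoidal u0) (hu0 : VSob s u0) :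
    L4S T d (heat u0) ∧ en4 T d (heat u0) ≤ vNormSq s u0 * en T (s + 1) (heat u0) :=
  L4S.of_interp hd (l2S_heat hT h0.mean hu0) (by
    filter_upwards [ae_restrict_mem measurableSet_Ioo] with t ht using (heat_bound hu0 ht.1.le).2)

lemma l2S_candidate (hT : 0 ≤ T) (hm : 0 < m) (h0 : Solenoidal u0) (hu0 : VSob s u0)
    (hg : L2S T (s - 1) g) : L2S T (s + 1) (candidate u0 m g) :=
  ((l2S_heat hT h0.mean hu0).add (hg.duhamel hT hm).1).1

lemma L2S.linOp (hT : 0 ≤ T) (hm : 0 < m) (hs : 0 ≤ s) (hr : s ≤ r)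
    (hA : ∀ k j α β ξ, AEStronglyMeasurable (fun t => A t k j α β ξ) (volume.restrict (Ioo 0 T)))
    (hAb : ∀ᵐ t ∂(volume.restrict (Ioo 0 T)), (A t).Bounded r K) (hg : L2S T (s - 1) g) :
    L2S T (s - 1) (linOp A m g) :=
  ((hg.duhamelDeriv hT hm).1.add
    ((hg.duhamel hT hm).1.lop hA hAb hs hr (by linarith)).1.leray.1).1

/-- The problem solved by the candidates. -/
structure Setting (T s d r K Cb : ℝ) (A : ℝ → CTensor n) (f : ℝ → VDistr n) (u0 : VDistr n) :
    Prop where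
  hT : 0 ≤ T
  hs : 0 ≤ s
  hr : s ≤ r
  hd : 2 * d = 2 * s + 1
  hCb : 0 < Cb
  measA : ∀ k j α β ξ, AEStronglyMeasurable (fun t => A t k j α β ξ) (volume.restrict (Ioo 0 T))
  bddA : ∀ᵐ t ∂(volume.restrict (Ioo 0 T)), (A t).Bounded r K
  memf : L2S T (s - 1) f
  realf : ∀ᵐ t ∂(volume.restrict (Ioo 0 T)), ∀ i, IsReal (f t i)
  sol0 : Solenoidal u0
  mem0 : VSob s u0
  bopL4 : ∀ u w : ℝ → VDistr n, L4S T d u → L4S T d w →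
    L2S T (s - 1) (fun t => bop (u t) (w t)) ∧
      en T (s - 1) (fun t => bop (u t) (w t)) ≤ Cb * (√(en4 T d u) * √(en4 T d w))

variable {Cb : ℝ}

lemma Setting.l4S_candidate (S : Setting T s d r K Cb A f u0) (hm : 0 < m)
    (hg : L2S T (s - 1) g) : L4S T d (candidate u0 m g) ∧
      en4 T d (candidate u0 m g) ≤ 8 * (vNormSq s u0 * en T (s + 1) (heat u0) +
        (((m ^ 2)⁻¹ + 4) * en T (s - 1) g) ^ 2) := by
  have h1 := l4S_heat S.hT S.hd S.sol0 S.mem0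
  have h2 := l4S_duhamel S.hT hm S.hd hg
  have h3 := h1.1.add h2.1
  refine ⟨h3.1, h3.2.trans ?_⟩
  have h4 := (Real.sqrt_le_left (by have := en_nonneg T (s - 1) g; positivity)).mp h2.2
  linarith [h1.2]

lemma Setting.solenoidal_candidate (S : Setting T s d r K Cb A f u0) (hg : Adm T (s - 1) g)
    {t : ℝ} (ht : t ∈ Icc 0 T) : Solenoidal (candidate u0 m g t) :=
  (solenoidal_heat S.sol0 t).add
    (Solenoidal.duhamel hg.2 (fun i ξ => (hg.1 i).integrable ξ) ht)

lemma Setting.adm_residual (S : Setting T s d r K Cb A f u0) (hm : 0 < m)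
    (hg : Adm T (s - 1) g) : Adm T (s - 1) (residual A f u0 m g) := by
  have hc := l2S_candidate S.hT hm S.sol0 S.mem0 hg.1
  have h1 := hc.lop S.measA S.bddA S.hs S.hr (by linarith [S.hs])
  have h4 := (S.l4S_candidate hm hg.1).1
  have h2 := (S.bopL4 _ _ h4 h4).1
  have h3 := ((h1.1.add h2).1.sub S.memf).1.leray.1
  refine ⟨(((l2S_heat S.hT S.sol0.mean S.mem0).heatDeriv.1.add
    (hg.1.duhamelDeriv S.hT hm).1).1.add h3).1, ?_⟩
  filter_upwards [hg.2, S.bddA, S.realf, ae_restrict_mem measurableSet_Ioo] with t a1 a2 a3 ht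
  have hc := S.solenoidal_candidate (m := m) hg (t := t) ⟨ht.1.le, ht.2.le⟩
  have hd : Solenoidal (duhamel m g t) :=
    Solenoidal.duhamel hg.2 (fun i ξ => (hg.1 i).integrable ξ) ⟨ht.1.le, ht.2.le⟩
  refine ((solenoidal_heatDeriv S.sol0 t).add
    (a1.sub ((hd.vlam 2).rmul fun _ => rfl))).add (solenoidal_leray fun i => ?_)
  exact ((lop_real a2 hc.real i).add (bop_real hc.real hc.real i)).sub (a3 i)

/-- The residuals of two candidates. -/
lemma Setting.residual_sub (S : Setting T s d r K Cb A f u0) (hm : 0 < m)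
    (hg : Adm T (s - 1) g) (hg' : Adm T (s - 1) g') :
    ∃ N : ℝ → VDistr n, L2S T (s - 1) N ∧
      en T (s - 1) N ≤ 2 * Cb * (√(en4 T d (candidate u0 m g)) + √(en4 T d (candidate u0 m g'))) *
        (((m ^ 2)⁻¹ + 4) * en T (s - 1) (g - g')) ∧
      ∀ᵐ t ∂(volume.restrict (Ioo 0 T)), residual A f u0 m g t - residual A f u0 m g' t =
        linOp A m (g - g') t + N t := by
  set u := candidate u0 m g
  set u' := candidate u0 m g'
  -- The heat parts cancel in u - u' = w, and the convection terms differ by bop u w + bop w u',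
  -- which is linear in w with coefficients small in L₄.
  set w := duhamel m (g - g')
  have hgg := (hg.1.sub hg'.1).1
  have hw := l4S_duhamel S.hT hm S.hd hgg
  have hu := (S.l4S_candidate hm hg.1).1
  have hu' := (S.l4S_candidate hm hg'.1).1
  have b1 := S.bopL4 _ _ hu hw.1
  have b2 := S.bopL4 _ _ hw.1 hu'
  have b3 := (b1.1.add b2.1)
  have b4 := b3.1.leray
  refine ⟨_, b4.1, ?_, ?_⟩
  · refine (b4.2.trans b3.2).trans ?_
    have c1 := Real.sqrt_nonneg (en4 T d u)
    have c2 := Real.sqrt_nonneg (en4 T d u')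
    have hC := S.hCb.le
    have d1 := b1.2.trans (mul_le_mul_of_nonneg_left (mul_le_mul_of_nonneg_left hw.2 c1) hC)
    have d2 := b2.2.trans (mul_le_mul_of_nonneg_left (mul_le_mul_of_nonneg_right hw.2 c2) hC)
    linarith
  · have cu := l2S_candidate S.hT hm S.sol0 S.mem0 hg.1
    have cu' := l2S_candidate S.hT hm S.sol0 S.mem0 hg'.1
    filter_upwards [S.bddA, cu.mem, cu'.mem, ae_restrict_mem measurableSet_Ioo] with t a1 a2 a3 ht
    have hs := S.hs
    have hsub : duhamel m (g - g') t = duhamel m g t - duhamel m g' t :=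
      duhamel_sub hg.1 hg'.1 m ⟨ht.1.le, ht.2.le⟩
    have e1 : w t = u t - u' t := by
      change duhamel m (g - g') t = (heat u0 t + duhamel m g t) - (heat u0 t + duhamel m g' t)
      rw [hsub]; abel
    have e2 := lop_sub a1 (a2.mono (by linarith)) (a3.mono (by linarith) : VSob 1 (u' t))
    have e3 := bop_sub_self (a2.mono (by linarith)) (a3.mono (by linarith) : VSob 0 (u' t))
    have e4 : duhamelDeriv m (g - g') t = duhamelDeriv m g t - duhamelDeriv m g' t := by
      rw [duhamelDeriv, duhamelDeriv, duhamelDeriv, hsub]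
      ext i ξ
      simp only [Pi.sub_apply, rmul, vlam, lam]
      ring
    change heatDeriv u0 t + duhamelDeriv m g t + leray (lop (A t) (u t) + bop (u t) (u t) - f t) -
      (heatDeriv u0 t + duhamelDeriv m g' t + leray (lop (A t) (u' t) + bop (u' t) (u' t) - f t)) =
      duhamelDeriv m (g - g') t + leray (lop (A t) (w t)) +
        leray (bop (u t) (w t) + bop (w t) (u' t))
    rw [e1, e2, ← e3, e4, leray_sub, leray_sub, leray_sub, leray_sub, leray_add, leray_add]
    abel

/-- For g = 0 the candidate is K u⁰. Its time derivative and viscous term are bounded by the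
integral of its H^{s+1} norm squared, the convection has the additional factor of u⁰, and f enters
directly; one common constant then covers all of them. -/
lemma Setting.en_residual_zero_le (S : Setting T s d r K Cb A f u0) :
    en T (s - 1) (residual A f u0 m 0) ≤ (6 + 8 * (n ^ 7 * K ^ 2) + 8 * Cb) *
      (en T (s - 1) f + (vNormSq s u0 + 1) * en T (s + 1) (heat u0)) := by
  have hc := l2S_heat S.hT S.sol0.mean S.mem0
  have h1 := hc.lop S.measA S.bddA S.hs S.hr (by linarith [S.hs])
  have h4 := l4S_heat S.hT S.hd S.sol0 S.mem0
  have h2 := S.bopL4 _ _ h4.1 h4.1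
  have h3 := (h1.1.add h2.1).1.sub S.memf
  have h5 := h3.1.leray
  have h6 := hc.heatDeriv
  have h7 := (h6.1.add h5.1).2
  have e : residual A f u0 m 0 = heatDeriv u0 + fun t => leray ((((fun t => lop (A t) (heat u0 t)) +
      fun t => bop (heat u0 t) (heat u0 t)) - f) t) := by
    ext1 t
    have e1 : candidate u0 m 0 t = heat u0 t := by
      change heat u0 t + duhamel m 0 t = heat u0 t
      rw [duhamel_zero_right, add_zero]
    have e2 : duhamelDeriv m (0 : ℝ → VDistr n) t = 0 := by
      rw [duhamelDeriv, duhamel_zero_right]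
      ext i ξ
      simp [rmul, vlam, lam]
    rw [residual, e1, e2, add_zero]
    rfl
  rw [e]
  rw [Real.mul_self_sqrt (en4_nonneg _ _ _)] at h2
  have a1 := (h1.1.add h2.1).2
  have hE := en_nonneg T (s + 1) (heat u0)
  have hN := vNormSq_nonneg s u0
  have hf := en_nonneg T (s - 1) f
  have hCb := S.hCb
  have a2 := h2.2.trans (mul_le_mul_of_nonneg_left h4.2 hCb.le)
  have hL : 0 ≤ (n : ℝ) ^ 7 * K ^ 2 := by positivity
  have a3 : en T (s - 1) (heatDeriv u0 + fun t => leray ((((fun t => lop (A t) (heat u0 t)) +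
      fun t => bop (heat u0 t) (heat u0 t)) - f) t)) ≤
      2 * en T (s + 1) (heat u0) + 4 * en T (s - 1) f + 8 * (n ^ 7 * K ^ 2 * en T (s + 1) (heat u0)) +
        8 * (Cb * (vNormSq s u0 * en T (s + 1) (heat u0))) := by
    linarith [h7, h5.2, h3.2, h6.2, h1.2]
  refine a3.trans ?_
  have p1 : 0 ≤ vNormSq s u0 * en T (s + 1) (heat u0) := by positivity
  have p2 : 0 ≤ n ^ 7 * K ^ 2 * en T (s - 1) f := by positivity
  have p3 : 0 ≤ n ^ 7 * K ^ 2 * (vNormSq s u0 * en T (s + 1) (heat u0)) := by positivity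
  have p4 : 0 ≤ Cb * en T (s - 1) f := by positivity
  have p5 : 0 ≤ Cb * en T (s + 1) (heat u0) := by positivity
  linarith

end

/-! ### The relaxed fixed point map and solvability for small data. -/

section

variable {T s m r K d Cb : ℝ} {A : ℝ → CTensor n} {f g g' : ℝ → VDistr n} {u0 : VDistr n}

/-- The relaxed fixed point map. -/
noncomputable def relaxation (τ : ℝ) (A : ℝ → CTensor n) (f : ℝ → VDistr n) (u0 : VDistr n)
    (m : ℝ) (g : ℝ → VDistr n) : ℝ → VDistr n :=
  g - fun t => rmul (fun _ => τ) (residual A f u0 m g t)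

lemma Setting.adm_relaxation (S : Setting T s d r K Cb A f u0) (hm : 0 < m) (τ : ℝ)
    (hg : Adm T (s - 1) g) : Adm T (s - 1) (relaxation τ A f u0 m g) := by
  have h := S.adm_residual hm hg
  refine ⟨(hg.1.sub (h.1.const_rmul τ).1).1, ?_⟩
  filter_upwards [hg.2, h.2] with t h1 h2 using h1.sub (h2.rmul fun _ => rfl)

lemma Setting.den_relaxation_zero_le (S : Setting T s d r K Cb A f u0) (hm : 0 < m) (τ : ℝ) {l : ℝ}
    (hl : 0 ≤ l) : den T (s - 1) l (relaxation τ A f u0 m 0) ≤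
      τ ^ 2 * ((6 + 8 * (n ^ 7 * K ^ 2) + 8 * Cb) *
        (en T (s - 1) f + (vNormSq s u0 + 1) * en T (s + 1) (heat u0))) := by
  have hz : Adm T (s - 1) (0 : ℝ → VDistr n) := ⟨l2S_zero, .of_forall fun t => solenoidal_zero⟩
  have h := (S.adm_residual hm hz).1
  have e : relaxation τ A f u0 m 0 =
      fun t => rmul (fun _ => -τ) (residual A f u0 m 0 t) := by
    ext t i ξ
    simp [relaxation, rmul]
  rw [e]
  have h1 := h.const_rmul (-τ)
  rw [neg_sq] at h1
  exact (h1.1.den_le_en hl).trans (h1.2.trans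
    (mul_le_mul_of_nonneg_left S.en_residual_zero_le (sq_nonneg τ)))

lemma den_congr {l : ℝ} {h k : ℝ → VDistr n}
    (hhk : ∀ᵐ t ∂(volume.restrict (Ioo 0 T)), h t = k t) : den T s l h = den T s l k :=
  integral_congr_ae (hhk.mono fun t ht => by simp only [ht])

/-- Global constants give a threshold for the data below which the Navier-Stokes equations can be
solved. -/
theorem exists_small_solution (n : ℕ) {T₀ c m B E Cb : ℝ} (K : ℝ) (hc : 0 < c)
    (hm : 0 < m) (hB : 0 ≤ B) (hE : 0 < E) (hCb : 0 < Cb) :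
    ∃ A₃ : ℝ, 0 < A₃ ∧ ∀ (T s d r : ℝ) (A : ℝ → CTensor n) (f : ℝ → VDistr n) (u0 : VDistr n),
      T ≤ T₀ → Setting T s d r K Cb A f u0 →
      (∀ᵐ t ∂(volume.restrict (Ioo 0 T)), ∀ δ w p : VDistr n, Solenoidal w →
        VSob (s - 1) δ → VSob (s + 1) w → p = δ - rmul (fun _ => m) (vlam 2 w) →
          VSob (s - 1) (p + leray (lop (A t) w)) ∧
          c * vNormSq (s - 1) δ + m * (vin s w p - B * vNormSq s w) ≤
            vin (s - 1) δ (p + leray (lop (A t) w)) ∧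
          vNormSq (s - 1) (p + leray (lop (A t) w)) ≤
            E * (vNormSq (s - 1) δ + vNormSq (s + 1) w)) →
      en T (s - 1) f + (vNormSq s u0 + 1) * en T (s + 1) (heat u0) < A₃ →
      ∃ G, Adm T (s - 1) G ∧ ∀ᵐ t ∂(volume.restrict (Ioo 0 T)), residual A f u0 m G t = 0 := by
  -- The weight is estimated on the largest interval, so no constant depends on the actual length T
  -- ≤ T₀.
  obtain ⟨Λ, hΛ⟩ : ∃ Λ, Λ = Real.exp (2 * B * T₀) := ⟨_, rfl⟩
  have hΛ0 : 0 < Λ := hΛ ▸ Real.exp_pos _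
  obtain ⟨C₄, hC₄⟩ : ∃ C₄, C₄ = (m ^ 2)⁻¹ + 4 := ⟨_, rfl⟩
  have hC₄0 : 0 < C₄ := by rw [hC₄]; positivity
  -- The added c² guarantees that κ = c²/E' is at most 1.
  obtain ⟨E', hE'⟩ : ∃ E', E' = E * (1 + Λ / m ^ 2) + c ^ 2 := ⟨_, rfl⟩
  have hE'0 : 0 < E' := by rw [hE']; positivity
  obtain ⟨τ, hτ⟩ : ∃ τ, τ = c / E' := ⟨_, rfl⟩
  have hτ0 : 0 < τ := by rw [hτ]; positivity
  obtain ⟨κ, hκ⟩ : ∃ κ, κ = c ^ 2 / E' := ⟨_, rfl⟩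
  have hκ0 : 0 < κ := by rw [hκ]; positivity
  have hκ1 : κ ≤ 1 := by
    rw [hκ, div_le_one hE'0, hE']
    have : 0 ≤ E * (1 + Λ / m ^ 2) := by positivity
    linarith
  -- η bounds the squared L₄ norm of the candidates; its value is the one for which the nonlinear
  -- part takes exactly κ/4 of the contraction.
  obtain ⟨η, hη⟩ : ∃ η, η = κ / 4 / ((1 + (κ / 2)⁻¹) * τ ^ 2 * (4 * Cb * C₄ * Λ)) := ⟨_, rfl⟩
  have hη0 : 0 < η := by rw [hη]; positivity
  -- On the ball of radius R the contribution of `duhamel` to the squared L₄ norm is at most η/4.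
  obtain ⟨R, hR⟩ : ∃ R, R = η / (4 * C₄ * Λ) := ⟨_, rfl⟩
  have hR0 : 0 < R := by rw [hR]; positivity
  obtain ⟨W, hW⟩ : ∃ W, W = 6 + 8 * ((n : ℝ) ^ 7 * K ^ 2) + 8 * Cb := ⟨_, rfl⟩
  have hW0 : 0 < W := by rw [hW]; positivity
  -- The first threshold keeps K u⁰ small in L₄, the second makes the image of 0 small enough for
  -- `exists_fixed_point`.
  refine ⟨min (η ^ 2 / 16) ((κ / 4) ^ 2 / 16 * R / (τ ^ 2 * W)), by positivity, ?_⟩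
  intro T s d r A f u0 hT S hcoer hsmall
  obtain ⟨hs1, hs2⟩ := lt_min_iff.mp hsmall
  have hl : 0 ≤ 2 * B := by linarith
  have hexp : Real.exp (2 * B * T) ≤ Λ := by
    rw [hΛ]; exact Real.exp_le_exp.mpr (mul_le_mul_of_nonneg_left hT hl)
  have hf0 := en_nonneg T (s - 1) f
  have hU0 := en_nonneg T (s + 1) (heat u0)
  have hv0 := vNormSq_nonneg s u0
  have hen : ∀ g : ℝ → VDistr n, L2S T (s - 1) g → en T (s - 1) g ≤ Λ * den T (s - 1) (2 * B) g :=
    fun g hg => (hg.en_le_den hl).trans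
      (mul_le_mul_of_nonneg_right hexp (den_nonneg _ _ _ _))
  have hX : ∀ g : ℝ → VDistr n, Adm T (s - 1) g → den T (s - 1) (2 * B) g ≤ R →
      √(en4 T d (candidate u0 m g)) ≤ η := fun g hg hgR => by
    refine (Real.sqrt_le_left hη0.le).mpr ((S.l4S_candidate hm hg.1).2.trans ?_)
    have h1 : ((m ^ 2)⁻¹ + 4) * en T (s - 1) g ≤ η / 4 := by
      rw [← hC₄]
      have : C₄ * en T (s - 1) g ≤ C₄ * (Λ * R) := mul_le_mul_of_nonneg_left
        ((hen g hg.1).trans (mul_le_mul_of_nonneg_left hgR hΛ0.le)) hC₄0.le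
      refine this.trans (le_of_eq ?_)
      rw [hR]; field_simp
    have h2 := pow_le_pow_left₀ (mul_nonneg (by positivity) (en_nonneg T (s - 1) g)) h1 2
    nlinarith
  have hcontr : ∀ g g', Adm T (s - 1) g → Adm T (s - 1) g' → den T (s - 1) (2 * B) g ≤ R →
      den T (s - 1) (2 * B) g' ≤ R → den T (s - 1) (2 * B) (relaxation τ A f u0 m g -
        relaxation τ A f u0 m g') ≤ (1 - κ / 4) * den T (s - 1) (2 * B) (g - g') := by
    intro g g' hg hg' hgR hgR'
    obtain ⟨N, hN, hNle, hNeq⟩ := S.residual_sub hm hg hg'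
    have hgg : Adm T (s - 1) (g - g') :=
      ⟨(hg.1.sub hg'.1).1, by filter_upwards [hg.2, hg'.2] with t h1 h2 using h1.sub h2⟩
    have hL := L2S.linOp S.hT hm S.hs S.hr S.measA S.bddA hgg.1
    have h1 := den_sub_linOp_le S.hT hc hm hB hE hgg hL hcoer hE'0 (by
      rw [hE']
      have : E * (1 + Real.exp (2 * B * T) / m ^ 2) ≤ E * (1 + Λ / m ^ 2) := by gcongr
      nlinarith [sq_nonneg c])
    rw [← hτ, ← hκ] at h1
    have hN' := hN.const_rmul (-τ)
    have h2 := (hgg.1.sub (hL.const_rmul τ).1).1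
    -- With θ = κ/2 the linear part contributes (1+κ/2)(1-κ) = 1 - κ/2 - κ²/2, and the nonlinear
    -- part adds κ/4; the total is at most 1 - κ/4.
    have h3 := h2.den_add_le hN'.1 hl (half_pos hκ0)
    have h4 : den T (s - 1) (2 * B) (relaxation τ A f u0 m g - relaxation τ A f u0 m g') =
        den T (s - 1) (2 * B) (((g - g') - fun t => rmul (fun _ => τ) (linOp A m (g - g') t)) +
          fun t => rmul (fun _ => -τ) (N t)) := by
      refine den_congr (hNeq.mono fun t ht => ?_)
      ext i ξ
      have := congrFun (congrFun ht i) ξ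
      simp only [Pi.sub_apply, Pi.add_apply] at this
      simp only [relaxation, Pi.sub_apply, Pi.add_apply, rmul]
      push_cast
      linear_combination (-(τ : ℂ)) * this
    rw [h4]
    refine h3.trans ?_
    have hD := den_nonneg T (s - 1) (2 * B) (g - g')
    have b1 : en T (s - 1) N ≤ 4 * Cb * C₄ * Λ * η * den T (s - 1) (2 * B) (g - g') := by
      have x1 : √(en4 T d (candidate u0 m g)) + √(en4 T d (candidate u0 m g')) ≤ 2 * η := by
        linarith [hX g hg hgR, hX g' hg' hgR']
      have x2 := mul_le_mul_of_nonneg_left (hen _ hgg.1) hC₄0.le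
      rw [← hC₄] at hNle
      refine hNle.trans ((mul_le_mul (mul_le_mul_of_nonneg_left x1 (by positivity)) x2
        (mul_nonneg hC₄0.le (en_nonneg _ _ _)) (by positivity)).trans (le_of_eq (by ring)))
    have b2 : den T (s - 1) (2 * B) (fun t => rmul (fun _ => -τ) (N t)) ≤
        τ ^ 2 * (4 * Cb * C₄ * Λ * η * den T (s - 1) (2 * B) (g - g')) := by
      refine (hN'.1.den_le_en hl).trans (hN'.2.trans ?_)
      rw [neg_sq]
      exact mul_le_mul_of_nonneg_left b1 (sq_nonneg τ)
    have b3 := mul_le_mul_of_nonneg_left b2 (by positivity : 0 ≤ 1 + (κ / 2)⁻¹)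
    have b4 : (1 + (κ / 2)⁻¹) * (τ ^ 2 * (4 * Cb * C₄ * Λ * η *
        den T (s - 1) (2 * B) (g - g'))) = κ / 4 * den T (s - 1) (2 * B) (g - g') := by
      have : (1 + (κ / 2)⁻¹) * τ ^ 2 * (4 * Cb * C₄ * Λ) * η = κ / 4 := by
        rw [hη]; field_simp
      rw [← this]; ring
    have b5 := mul_le_mul_of_nonneg_left h1 (by positivity : 0 ≤ 1 + κ / 2)
    rw [b4] at b3
    refine (add_le_add b5 b3).trans ?_
    have b6 : 0 ≤ κ ^ 2 * den T (s - 1) (2 * B) (g - g') := by positivity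
    linarith
  have hzero : den T (s - 1) (2 * B) (relaxation τ A f u0 m 0) ≤
      (1 - (1 - κ / 4)) ^ 2 / 16 * R := by
    have h1 := S.den_relaxation_zero_le hm τ hl
    rw [← hW] at h1
    refine h1.trans ?_
    have h2 := (lt_div_iff₀ (by positivity)).mp hs2
    have e : (1 - (1 - κ / 4)) ^ 2 / 16 * R = (κ / 4) ^ 2 / 16 * R := by ring
    rw [e]
    refine le_trans (le_of_eq ?_) h2.le
    ring
  obtain ⟨G, hG, -, hfix⟩ := exists_fixed_point (Φ := relaxation τ A f u0 m) (q := 1 - κ / 4)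
    (R := R) (l := 2 * B) (T := T) (s := s - 1) hl (by linarith) (by linarith) hR0.le
    (fun g hg => S.adm_relaxation hm τ hg) hcontr hzero
  refine ⟨G, hG, hfix.mono fun t ht => ?_⟩
  ext i ξ
  have h1 := congrFun (congrFun ht i) ξ
  change G t i ξ = G t i ξ - (τ : ℂ) * residual A f u0 m G t i ξ at h1
  have h2 : (τ : ℂ) * residual A f u0 m G t i ξ = 0 := by linear_combination h1
  exact (mul_eq_zero.mp h2).resolve_left (by exact_mod_cast hτ0.ne')

/-- A solution of the Navier-Stokes equations in terms of Fourier coefficients. -/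
structure IsRegular (T s : ℝ) (A : ℝ → CTensor n) (f : ℝ → VDistr n) (u0 : VDistr n)
    (u du : ℝ → VDistr n) : Prop where
  hasPrim : HasPrim T u du
  initial : u 0 = u0
  mem : L2S T (s + 1) u
  memDeriv : L2S T (s - 1) du
  memBop : L2S T (s - 1) fun t => bop (u t) (u t)
  solenoidal : ∀ t ∈ Icc 0 T, Solenoidal (u t)
  equation : ∀ᵐ t ∂(volume.restrict (Ioo 0 T)),
    du t = leray (f t - lop (A t) (u t) - bop (u t) (u t))

lemma Setting.isRegular (S : Setting T s d r K Cb A f u0) (hm : 0 < m) (hg : Adm T (s - 1) g)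
    (hres : ∀ᵐ t ∂(volume.restrict (Ioo 0 T)), residual A f u0 m g t = 0) :
    IsRegular T s A f u0 (candidate u0 m g) (heatDeriv u0 + duhamelDeriv m g) where
  hasPrim := (hasPrim_heat T u0).add (hasPrim_duhamel hg.1 m)
  initial := by
    change heat u0 0 + duhamel m g 0 = u0
    rw [heat_zero, duhamel_zero, add_zero]
  mem := l2S_candidate S.hT hm S.sol0 S.mem0 hg.1
  memDeriv := ((l2S_heat S.hT S.sol0.mean S.mem0).heatDeriv.1.add
    (hg.1.duhamelDeriv S.hT hm).1).1
  memBop :=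
    have h := (S.l4S_candidate hm hg.1).1
    (S.bopL4 _ _ h h).1
  solenoidal t ht := S.solenoidal_candidate hg ht
  equation := by
    filter_upwards [hres] with t ht
    change heatDeriv u0 t + duhamelDeriv m g t + leray (lop (A t) (candidate u0 m g t) +
      bop (candidate u0 m g t) (candidate u0 m g t) - f t) = 0 at ht
    rw [leray_sub, leray_add] at ht
    rw [leray_sub, leray_sub]
    change heatDeriv u0 t + duhamelDeriv m g t = _
    rw [eq_neg_of_add_eq_zero_left ht]
    abel

end

section

/-! ### The dual product and test fields -/

/-- The series converges absolutely by duality. Reality of both factors makes its sum invariant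
under conjugation, so it equals its real part, the L₂ product. -/
lemma hasPairing_vin {a b : ℝ} (h : a + b = 0) {G w : VDistr n} (hG : VSob a G)
    (hGr : ∀ i, IsReal (G i)) (hw : VSob b w) (hwr : ∀ i, IsReal (w i)) :
    HasPairing G w (vin 0 G w : ℂ) := by
  have hc : a + b = 2 * (0 : ℝ) := by rw [h, mul_zero]
  have hs : Summable fun ξ => ∑ i, G i ξ * w i (-ξ) := by
    refine summable_sum fun i _ => Summable.of_norm ?_
    refine ((hG i).cauchySchwarz hc (hw i)).1.congr fun ξ => ?_
    rw [mul_zero, Real.rpow_zero, one_mul, norm_mul, hwr i ξ, Complex.norm_conj]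
  obtain ⟨S, hS⟩ := hs
  have h1 : HasSum (fun ξ => conj (∑ i, G i ξ * w i (-ξ))) S := by
    have := (Equiv.neg (Fin n → ℤ)).hasSum_iff.mpr hS
    convert this using 1
    ext ξ
    simp only [Function.comp, Equiv.neg_apply, map_sum, map_mul]
    refine Finset.sum_congr rfl fun i _ => ?_
    rw [hGr i ξ, hwr i (-ξ)]
  have h2 : conj S = S := (Complex.hasSum_conj'.mpr hS).unique h1
  have h3 : S.re = vin 0 G w := by
    have h4 := hasSum_vin hc hG hwr hw
    simp only [mul_zero, Real.rpow_zero, one_mul] at h4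
    exact (Complex.hasSum_re hS).unique h4
  have h5 : S = (vin 0 G w : ℂ) := by
    rw [← h3]; exact (Complex.conj_eq_iff_re.mp h2).symm
  exact h5 ▸ hS

lemma pairing_eq_vin {a b : ℝ} (h : a + b = 0) {G w : VDistr n} (hG : VSob a G)
    (hGr : ∀ i, IsReal (G i)) (hw : VSob b w) (hwr : ∀ i, IsReal (w i)) :
    pairing G w = (vin 0 G w : ℂ) :=
  (hasPairing_vin h hG hGr hw hwr).tsum_eq

lemma vin_sub_left {a b s : ℝ} (h : a + b = 2 * s) {u u' w : VDistr n} (hu : VSob a u)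
    (hu' : VSob a u') (hw : VSob b w) : vin s (u - u') w = vin s u w - vin s u' w := by
  rw [sub_eq_add_rmul, vin_add_left h hu (hu'.smul _) hw, vin_smul_left]
  ring

/-- The real vector field with the coefficients `c e` and `conj c e` at `ξ` and `-ξ`. -/
noncomputable def testField (ξ : Fin n → ℤ) (e : Fin n → ℝ) (c : ℂ) : VDistr n :=
  fun i η => (e i : ℂ) * ((if η = ξ then c else 0) + if η = -ξ then conj c else 0)

lemma isReal_testField (ξ : Fin n → ℤ) (e : Fin n → ℝ) (c : ℂ) (i : Fin n) :
    IsReal (testField ξ e c i) := fun η => by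
  simp only [testField, map_mul, map_add, Complex.conj_ofReal, neg_inj,
    show (-η = ξ) = (η = -ξ) from propext neg_eq_iff_eq_neg]
  rw [add_comm]
  congr 2
  · split_ifs <;> simp
  · split_ifs <;> simp

lemma vSob_testField (ξ : Fin n → ℤ) (e : Fin n → ℝ) (c : ℂ) (s : ℝ) :
    VSob s (testField ξ e c) := fun i => by
  refine summable_of_ne_finset_zero (s := {ξ, -ξ}) fun η hη => ?_
  simp only [Finset.mem_insert, Finset.mem_singleton, not_or] at hη
  simp [testField, hη.1, hη.2]

lemma solenoidal_testField {ξ : Fin n → ℤ} (hξ : ξ ≠ 0) {e : Fin n → ℝ}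
    (he : ∑ j, (ξ j : ℝ) * e j = 0) (c : ℂ) : Solenoidal (testField ξ e c) where
  real := isReal_testField ξ e c
  mean i := by
    have h1 : (0 : Fin n → ℤ) ≠ ξ := hξ.symm
    have h2 : (0 : Fin n → ℤ) ≠ -ξ := fun h => hξ (neg_eq_zero.mp h.symm)
    simp [testField, h1, h2]
  div η := by
    have he' : ∑ j, (ξ j : ℂ) * (e j : ℂ) = 0 := by exact_mod_cast he
    simp only [testField, ← mul_assoc]
    rw [← Finset.sum_mul]
    by_cases h1 : η = ξ
    · rw [h1, he', zero_mul]
    · by_cases h2 : η = -ξ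
      · have : ∑ j, ((η j : ℤ) : ℂ) * (e j : ℂ) = 0 := by
          rw [h2]
          simp only [Pi.neg_apply, Int.cast_neg, neg_mul, Finset.sum_neg_distrib, he', neg_zero]
        rw [this, zero_mul]
      · simp [h1, h2]

lemma ne_neg_self {ξ : Fin n → ℤ} (hξ : ξ ≠ 0) : ξ ≠ -ξ := fun h => hξ <| by
  ext i
  have := congrFun h i
  simp only [Pi.neg_apply] at this
  simp only [Pi.zero_apply]
  omega

lemma hasPairing_testField {ξ : Fin n → ℤ} (hξ : ξ ≠ 0) (e : Fin n → ℝ) (c : ℂ) (F : VDistr n) :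
    HasPairing F (testField ξ e c)
      (conj c * ∑ i, (e i : ℂ) * F i ξ + c * ∑ i, (e i : ℂ) * F i (-ξ)) := by
  have hne := ne_neg_self hξ
  have h : HasSum (fun η => ∑ i, F i η * testField ξ e c i (-η))
      (∑ η ∈ {ξ, -ξ}, ∑ i, F i η * testField ξ e c i (-η)) :=
    hasSum_sum_of_ne_finset_zero fun η hη => by
      simp only [Finset.mem_insert, Finset.mem_singleton, not_or] at hη
      have h1 : ¬ -η = ξ := fun h => hη.2 (by rw [← h, neg_neg])
      have h2 : ¬ -η = -ξ := fun h => hη.1 (neg_inj.mp h)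
      simp [testField, h1, h2]
  rw [Finset.sum_pair hne] at h
  have e1 : ∑ i, F i ξ * testField ξ e c i (-ξ) = conj c * ∑ i, (e i : ℂ) * F i ξ := by
    rw [Finset.mul_sum]
    refine Finset.sum_congr rfl fun i _ => ?_
    simp only [testField, hne.symm, if_false, if_true, zero_add]
    ring
  have e2 : ∑ i, F i (-ξ) * testField ξ e c i (- -ξ) = c * ∑ i, (e i : ℂ) * F i (-ξ) := by
    rw [Finset.mul_sum]
    refine Finset.sum_congr rfl fun i _ => ?_
    simp only [testField, neg_neg, hne, if_false, if_true, add_zero]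
    ring
  rwa [e1, e2] at h

/-- A real test field sees the frequencies ξ and -ξ together; combining c = 1 and c = i isolates ξ.
-/
lemma sum_eq_of_test {ξ : Fin n → ℤ} (hξ : ξ ≠ 0) (e : Fin n → ℝ) {F H : VDistr n}
    (h : ∀ c : ℂ, ∃ S, HasPairing F (testField ξ e c) S ∧ HasPairing H (testField ξ e c) S) :
    ∑ i, (e i : ℂ) * F i ξ = ∑ i, (e i : ℂ) * H i ξ := by
  have key : ∀ c : ℂ, conj c * ∑ i, (e i : ℂ) * F i ξ + c * ∑ i, (e i : ℂ) * F i (-ξ) =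
      conj c * ∑ i, (e i : ℂ) * H i ξ + c * ∑ i, (e i : ℂ) * H i (-ξ) := fun c => by
    obtain ⟨S, h1, h2⟩ := h c
    rw [(hasPairing_testField hξ e c F).unique h1, (hasPairing_testField hξ e c H).unique h2]
  have h1 := key 1
  have h2 := key Complex.I
  rw [Complex.conj_I] at h2
  rw [map_one] at h1
  linear_combination (1 / 2 : ℂ) * h1 + (Complex.I / 2) * h2 +
    ((∑ i, (e i : ℂ) * F i ξ) / 2 - (∑ i, (e i : ℂ) * H i ξ) / 2 -
    (∑ i, (e i : ℂ) * F i (-ξ)) / 2 + (∑ i, (e i : ℂ) * H i (-ξ)) / 2) * Complex.I_sq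

/-- Distributions that agree on the divergence-free trigonometric polynomials have the same Leray
projection. -/
lemma leray_eq_of_test {F H : VDistr n}
    (h : ∀ w : VDistr n, Solenoidal w → (∀ s, VSob s w) →
      ∃ S, HasPairing F w S ∧ HasPairing H w S) : leray F = leray H := by
  ext i ξ
  by_cases hξ : ξ = 0
  · simp [leray, hξ]
  have hN : (freqNorm ξ : ℂ) ^ 2 ≠ 0 := freqNorm_sq_ne_zero hξ
  have hN' : (freqNorm ξ) ^ 2 ≠ 0 := by exact_mod_cast hN
  have hsq : ∑ j, (ξ j : ℝ) * ξ j = freqNorm ξ ^ 2 := by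
    have := freqNorm_sq_cast ξ
    exact_mod_cast this.symm
  -- The i-th row of the orthogonal projection onto the complement of ξ: it is an admissible
  -- polarisation, and contracting with it reads off the i-th component of the Leray projection.
  set e : Fin n → ℝ := fun j => (if j = i then 1 else 0) - ξ i * ξ j / freqNorm ξ ^ 2 with he
  have he0 : ∑ j, (ξ j : ℝ) * e j = 0 := by
    have : ∀ j, (ξ j : ℝ) * e j = (if j = i then (ξ j : ℝ) else 0) -
        ξ i / freqNorm ξ ^ 2 * (ξ j * ξ j) := fun j => by
      simp only [he]; split_ifs <;> ring
    simp only [this, Finset.sum_sub_distrib, ← Finset.mul_sum, hsq]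
    rw [Finset.sum_ite_eq' Finset.univ i]
    simp only [Finset.mem_univ, if_true]
    rw [div_mul_cancel₀ _ hN', sub_self]
  have hsum : ∀ G : VDistr n, ∑ j, (e j : ℂ) * G j ξ = leray G i ξ := fun G => by
    have : ∀ j, (e j : ℂ) * G j ξ = (if j = i then G j ξ else 0) -
        (ξ i : ℂ) / (freqNorm ξ : ℂ) ^ 2 * ((ξ j : ℂ) * G j ξ) := fun j => by
      simp only [he]; split_ifs <;> push_cast <;> ring
    simp only [this, Finset.sum_sub_distrib, ← Finset.mul_sum]
    rw [Finset.sum_ite_eq' Finset.univ i]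
    simp only [Finset.mem_univ, if_true, leray, hξ, if_false]
    ring
  rw [← hsum F, ← hsum H]
  exact sum_eq_of_test hξ e fun c => h _ (solenoidal_testField hξ he0 c)
    fun s => vSob_testField ξ e c s

variable {C r K t : ℝ} {a : Tensor n}

/-- The right hand side of the weak formulations is the dual product with `f + 𝔏 u`. -/
lemma hasPairing_momentum (ha : GoodTensor C r K fun k j α β => a k j α β t) (hr : 0 ≤ r)
    {α β : ℝ} (hαβ : α + β = 0) {f u w : VDistr n} (hf : VSob α f) (hfr : ∀ i, IsReal (f i))
    (hur : ∀ i, IsReal (u i)) (hu : VSob 1 u) (hw : VSob β w) (hw1 : VSob 1 w)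
    (hwr : ∀ i, IsReal (w i)) :
    HasPairing (f - lop (tcoeff a t) u) w (pairing f w - (aForm a t u w : ℂ)) := by
  have h1 := hasPairing_vin hαβ hf hfr hw hwr
  have h2 := hasSum_aForm ha hr hur hu hwr hw1
  rw [pairing_eq_vin hαβ hf hfr hw hwr]
  have h3 := HasSum.sub h1 h2
  refine h3.congr_fun fun ξ => ?_
  rw [← Finset.sum_sub_distrib]
  exact Finset.sum_congr rfl fun i _ => by simp only [Pi.sub_apply]; ring

lemma hasPairing_leray_iff {F w : VDistr n} (hw : Solenoidal w) {S : ℂ} :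
    HasPairing (leray F) w S ↔ HasPairing F w S := by
  simp only [HasPairing, leray_pair F hw]

end

section

/-! ### Antisymmetry of the trilinear form -/

variable {x y z : VDistr n}

/-- The terms of the trilinear form. -/
noncomputable def triTerm (x y z : VDistr n) (p : (Fin n → ℤ) × (Fin n → ℤ)) : ℂ :=
  ∑ i, ∑ j, 2 * Real.pi * Complex.I * (p.1 j : ℂ) * (x j (p.1 - p.2) * y i p.2) * z i (-p.1)

lemma summable_triTerm
    (h : ∀ i j, Summable fun p : (Fin n → ℤ) × (Fin n → ℤ) =>
      rho p.1 * (‖x j (p.1 - p.2)‖ * ‖y i p.2‖ * ‖z i (-p.1)‖)) : Summable (triTerm x y z) := by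
  refine summable_sum fun i _ => summable_sum fun j _ => ?_
  refine Summable.of_norm_bounded (h i j) fun p => ?_
  have h1 := norm_pderiv_le j (fun _ => x j (p.1 - p.2) * y i p.2) p.1
  rw [norm_mul]
  refine (mul_le_mul_of_nonneg_right h1 (norm_nonneg _)).trans (le_of_eq ?_)
  rw [norm_mul]
  ring

lemma hasPairing_bop (hx : VSob 0 x) (hy : VSob 0 y) (h : Summable (triTerm x y z)) :
    HasPairing (bop x y) z (∑' p, triTerm x y z p) := by
  refine h.hasSum.prod_fiberwise fun ξ => ?_
  have h1 : ∀ i j, HasSum (fun η => 2 * Real.pi * Complex.I * (ξ j : ℂ) *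
      (x j (ξ - η) * y i η) * z i (-ξ)) (pderiv j (conv (x j) (y i)) ξ * z i (-ξ)) := fun i j =>
    (((hx j).summable_conv (hy i) ξ).hasSum.mul_left _).mul_right _
  have h2 := hasSum_sum (s := Finset.univ) fun i _ =>
    hasSum_sum (s := Finset.univ) fun j _ => h1 i j
  have e : ∑ i, bop x y i ξ * z i (-ξ) =
      ∑ i, ∑ j, pderiv j (conv (x j) (y i)) ξ * z i (-ξ) :=
    Finset.sum_congr rfl fun i _ => by rw [bop, Finset.sum_apply, Finset.sum_mul]
  rw [e]
  exact h2

/-- Integration by parts in frequency. The map (ξ, η) ↦ (-η, -ξ) fixes ξ - η and exchanges y and z,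
and the two terms add up to a multiple of the divergence of x at ξ - η. -/
lemma triTerm_swap (hx : Solenoidal x) (p : (Fin n → ℤ) × (Fin n → ℤ)) :
    triTerm x z y (-p.2, -p.1) = -triTerm x y z p := by
  rw [eq_neg_iff_add_eq_zero, triTerm, triTerm, ← Finset.sum_add_distrib]
  refine Finset.sum_eq_zero fun i _ => ?_
  rw [← Finset.sum_add_distrib]
  have h := hx.div (p.1 - p.2)
  have e : ∀ j, 2 * Real.pi * Complex.I * ((-p.2) j : ℂ) *
      (x j (-p.2 - -p.1) * z i (-p.1)) * y i (- -p.2) + 2 * Real.pi * Complex.I * (p.1 j : ℂ) *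
      (x j (p.1 - p.2) * y i p.2) * z i (-p.1) =
      2 * Real.pi * Complex.I * y i p.2 * z i (-p.1) * (((p.1 - p.2) j : ℂ) * x j (p.1 - p.2)) :=
    fun j => by
      rw [show -p.2 - -p.1 = p.1 - p.2 by abel, neg_neg]
      simp only [Pi.neg_apply, Pi.sub_apply]
      push_cast
      ring
  rw [Finset.sum_congr rfl fun j _ => e j, ← Finset.mul_sum, h, mul_zero]

/-- Absolute convergence of the double series permits the rearrangement by `triTerm_swap`. The two
pairings may live in different pairs of dual spaces. -/
lemma vin_bop_antisymm {a b a' b' : ℝ} (hab : a + b = 0) (hab' : a' + b' = 0) (hx : Solenoidal x)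
    (hyr : ∀ i, IsReal (y i)) (hzr : ∀ i, IsReal (z i)) (hx0 : VSob 0 x) (hy0 : VSob 0 y)
    (hz0 : VSob 0 z) (h : ∀ i j, Summable fun p : (Fin n → ℤ) × (Fin n → ℤ) =>
      rho p.1 * (‖x j (p.1 - p.2)‖ * ‖y i p.2‖ * ‖z i (-p.1)‖))
    (hb : VSob a (bop x y)) (hz : VSob b z) (hb' : VSob a' (bop x z)) (hy : VSob b' y) :
    vin 0 (bop x y) z = -vin 0 (bop x z) y := by
  have hs := summable_triTerm h
  let e : (Fin n → ℤ) × (Fin n → ℤ) ≃ (Fin n → ℤ) × (Fin n → ℤ) :=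
    ⟨fun p => (-p.2, -p.1), fun p => (-p.2, -p.1), fun p => by simp, fun p => by simp⟩
  have h1 : HasSum (triTerm x z y) (-∑' p, triTerm x y z p) := by
    rw [← e.hasSum_iff]
    exact hs.hasSum.neg.congr_fun fun p => triTerm_swap hx p
  have h2 := (hasPairing_vin hab hb (bop_real hx.real hyr) hz hzr).unique
    (hasPairing_bop hx0 hy0 hs)
  have h3 := (hasPairing_vin hab' hb' (bop_real hx.real hzr) hy hyr).unique
    (hasPairing_bop hx0 hz0 h1.summable)
  rw [h1.tsum_eq, ← h2] at h3
  have : vin 0 (bop x z) y = -vin 0 (bop x y) z := by exact_mod_cast h3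
  rw [this, neg_neg]

/-- The exponents 1/2, 1/2 and n/2 - 1 add up to n/2. The convection of a field of energy regularity
can thus be tested with fields in H^{n/2}, the space of the Serrin-type class. -/
lemma exists_bop_half (hn : 2 ≤ n) : ∃ C : ℝ, 0 < C ∧ ∀ x y : VDistr n, VSob (1 / 2) x →
    VSob (1 / 2) y → VSob (-((n : ℝ) / 2)) (bop x y) ∧
      vNormSq (-((n : ℝ) / 2)) (bop x y) ≤ C * (vNormSq (1 / 2) x * vNormSq (1 / 2) y) := by
  have hn' : (2 : ℝ) ≤ n := by exact_mod_cast hn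
  obtain ⟨C, hC, h⟩ := bop_le_of_conv (n := n) (by omega) (α := 1 / 2) (β := 1 / 2)
    (γ := (n : ℝ) / 2 - 1) (by linarith) (by linarith) (by linarith) (by ring)
  refine ⟨C, hC, fun x y hx hy => ?_⟩
  have := h x y hx hy
  rwa [show -((n : ℝ) / 2 - 1) - 1 = -((n : ℝ) / 2) by ring] at this

/-- Here the exponents are n/4, n/4 and 0: the convection of a regular field lies in the dual of H¹
and may be tested with a weak solution. -/
lemma vSob_bop_neg_one (hn : 2 ≤ n) (hx : VSob ((n : ℝ) / 4) x) (hy : VSob ((n : ℝ) / 4) y) :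
    VSob (-1) (bop x y) := by
  have hn' : (2 : ℝ) ≤ n := by exact_mod_cast hn
  obtain ⟨C, -, h⟩ := bop_le_of_conv (n := n) (by omega) (α := (n : ℝ) / 4) (β := (n : ℝ) / 4)
    (γ := 0) (by linarith) (by linarith) (by linarith) (by ring)
  have := (h x y hx hy).1
  rwa [show -(0 : ℝ) - 1 = -1 by ring] at this

/-- Antisymmetry if the second and third arguments may be exchanged. -/
lemma vin_bop_swap (hn : 2 ≤ n) (hx : Solenoidal x) (hyr : ∀ i, IsReal (y i))
    (hzr : ∀ i, IsReal (z i)) (hx1 : VSob ((n : ℝ) / 2) x) (hy1 : VSob 1 y)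
    (hz1 : VSob ((n : ℝ) / 2) z) : vin 0 (bop x y) z = -vin 0 (bop x z) y := by
  have hn' : (2 : ℝ) ≤ n := by exact_mod_cast hn
  obtain ⟨C, -, h⟩ := exists_bop_half hn
  refine vin_bop_antisymm (a := -((n : ℝ) / 2)) (b := (n : ℝ) / 2) (a' := -1) (b' := 1) (by ring)
    (by ring) hx hyr hzr (hx1.mono (by linarith)) (hy1.mono (by norm_num))
    (hz1.mono (by linarith)) (fun i j => ?_)
    (h x y (hx1.mono (by linarith)) (hy1.mono (by norm_num))).1 hz1
    (vSob_bop_neg_one hn (hx1.mono (by linarith)) (hz1.mono (by linarith))) hy1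
  refine summable_trilinear (by omega) (α := 1 / 2) (β := 1 / 2) (γ := (n : ℝ) / 2 - 1)
    (by linarith) (by linarith) (by linarith) (by ring) ((hx1 j).mono (by linarith))
    ((hy1 i).mono (by norm_num)) ((hz1 i).mono (by linarith))

/-- Antisymmetry with equal arguments. The regularity is required of the transported field y, so the
transporting field may be a mere weak solution. -/
lemma vin_bop_self (hn : 2 ≤ n) (hx : Solenoidal x) (hyr : ∀ i, IsReal (y i))
    (hx1 : VSob 1 x) (hy1 : VSob ((n : ℝ) / 2) y) : vin 0 (bop x y) y = 0 := by
  have hn' : (2 : ℝ) ≤ n := by exact_mod_cast hn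
  obtain ⟨C, -, h⟩ := exists_bop_half hn
  have hb := (h x y (hx1.mono (by norm_num)) (hy1.mono (by linarith))).1
  have := vin_bop_antisymm (x := x) (y := y) (z := y) (a := -((n : ℝ) / 2)) (b := (n : ℝ) / 2)
    (by ring) (by ring : -((n : ℝ) / 2) + (n : ℝ) / 2 = 0) hx hyr hyr (hx1.mono (by norm_num))
    (hy1.mono (by linarith)) (hy1.mono (by linarith)) (fun i j =>
      summable_trilinear (by omega) (α := 1 / 2) (β := 1 / 2) (γ := (n : ℝ) / 2 - 1)
        (by linarith) (by linarith) (by linarith) (by ring) ((hx1 j).mono (by norm_num))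
        ((hy1 i).mono (by linarith)) ((hy1 i).mono (by linarith))) hb hy1 hb hy1
  linarith

lemma vin_sub_right {a b s : ℝ} (h : a + b = 2 * s) {u w w' : VDistr n} (hu : VSob a u)
    (hw : VSob b w) (hw' : VSob b w') : vin s u (w - w') = vin s u w - vin s u w' := by
  rw [vin_comm, vin_sub_left (by rw [add_comm]; exact h) hw hw' hu, vin_comm s w, vin_comm s w']

/-- The trilinear terms in the equation for the difference of two solutions. -/
lemma vin_bop_difference (hn : 2 ≤ n) {u v : VDistr n} (hu : Solenoidal u) (hv : Solenoidal v)
    (hu1 : VSob ((n : ℝ) / 2) u) (hv1 : VSob 1 v) :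
    vin 0 (bop v v) u + vin 0 (bop u u) v = vin 0 (bop (v - u) (v - u)) u := by
  have hn' : (2 : ℝ) ≤ n := by exact_mod_cast hn
  obtain ⟨C, -, hC⟩ := exists_bop_half hn
  have hu1' : VSob 1 u := hu1.mono (by linarith)
  have hb : ∀ {p q : VDistr n}, VSob 1 p → VSob 1 q → VSob (-((n : ℝ) / 2)) (bop p q) :=
    fun hp hq => (hC _ _ (hp.mono (by norm_num)) (hq.mono (by norm_num))).1
  have h0 : ∀ {p : VDistr n}, VSob 1 p → VSob 0 p := fun hp => hp.mono (by norm_num)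
  have hz : -((n : ℝ) / 2) + (n : ℝ) / 2 = 2 * 0 := by ring
  have e1 : vin 0 (bop (v - u) (v - u)) u = vin 0 (bop v v) u - vin 0 (bop u v) u -
      (vin 0 (bop v u) u - vin 0 (bop u u) u) := by
    rw [bop_sub_right (h0 (hv1.sub hu1')) (h0 hv1) (h0 hu1'), bop_sub_left (h0 hv1) (h0 hu1') (h0 hv1),
      bop_sub_left (h0 hv1) (h0 hu1') (h0 hu1'),
      vin_sub_left hz ((hb hv1 hv1).sub (hb hu1' hv1)) ((hb hv1 hu1').sub (hb hu1' hu1')) hu1,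
      vin_sub_left hz (hb hv1 hv1) (hb hu1' hv1) hu1,
      vin_sub_left hz (hb hv1 hu1') (hb hu1' hu1') hu1]
  -- In the expansion the terms with u in both last places vanish, and the one with u, v, u is minus
  -- the one with u, u, v.
  rw [e1, vin_bop_self hn hv hu.real hv1 hu1, vin_bop_self hn hu hu.real hu1' hu1,
    vin_bop_swap hn hu hv.real hu.real hu1 hv1 hu1]
  ring

end

section

/-! ### The energy equality -/

variable {T s r C K : ℝ} {a : Tensor n} {f u du : ℝ → VDistr n} {u0 : VDistr n}

/-- The data of the Navier-Stokes problem. -/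
structure Problem (T s r C K : ℝ) (a : Tensor n) (f : ℝ → VDistr n) : Prop where
  hn : 2 ≤ n
  hT : 0 < T
  hs : s = (n : ℝ) / 2 - 1
  hsr : s ≤ r
  hr : 1 ≤ r
  hC : 0 < C
  measA : ∀ k j α β ξ,
    AEStronglyMeasurable (fun t => tcoeff a t k j α β ξ) (volume.restrict (Ioo 0 T))
  good : ∀ᵐ t ∂(volume.restrict (Ioo 0 T)), GoodTensor C r K fun k j α β => a k j α β t
  memf : L2S T (s - 1) f
  dotf : ∀ᵐ t ∂(volume.restrict (Ioo 0 T)), ∀ i, IsReal (f t i) ∧ f t i 0 = 0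

lemma Problem.hn' (P : Problem T s r C K a f) : (2 : ℝ) ≤ n := by exact_mod_cast P.hn

lemma Problem.s_nonneg (P : Problem T s r C K a f) : 0 ≤ s := by linarith [P.hs, P.hn']

lemma Problem.bdd (P : Problem T s r C K a f) :
    ∀ᵐ t ∂(volume.restrict (Ioo 0 T)), (tcoeff a t).Bounded r K := P.good.mono fun _ h => h.bounded

lemma Problem.mem_lop (P : Problem T s r C K a f) (hu : L2S T 1 u) :
    L2S T (-1) (fun t => lop (tcoeff a t) (u t)) := by
  have := (L2S.lop (s := 0) P.measA P.bdd le_rfl (by linarith [P.hr]) (by simpa using hu)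
    (by simp)).1
  simpa using this

/-- Functions `u` with the time derivative `du` that solve the Navier-Stokes equations. -/
structure IsEvolution (T : ℝ) (a : Tensor n) (f u du : ℝ → VDistr n) : Prop where
  hasPrim : HasPrim T u du
  mem : L2S T 1 u
  memDeriv : L2S T (-((n : ℝ) / 2)) du
  solenoidal : ∀ t ∈ Icc 0 T, Solenoidal (u t)
  start : VSob 0 (u 0)
  equation : ∀ᵐ t ∂(volume.restrict (Ioo 0 T)),
    du t = leray (f t - lop (tcoeff a t) (u t) - bop (u t) (u t))

lemma IsRegular.isEvolution (P : Problem T s r C K a f) (hu0 : VSob s u0)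
    (R : IsRegular T s (tcoeff a) f u0 u du) : IsEvolution T a f u du where
  hasPrim := R.hasPrim
  mem := R.mem.mono (by linarith [P.s_nonneg])
  memDeriv := R.memDeriv.mono (by linarith [P.hs, P.hn'])
  solenoidal := R.solenoidal
  start := by rw [R.initial]; exact hu0.mono P.s_nonneg
  equation := R.equation

/-- The order σ of the test field is 1 for the equation of the regular solution and n/2 for that of
a weak solution, whose convection is less regular. -/
lemma vin_momentum {t σ : ℝ} (hg : GoodTensor C r K fun k j α β => a k j α β t) (hr : 1 ≤ r)
    (hσ : 1 ≤ σ) {g v z : VDistr n} (hgs : VSob (-σ) g) (hb : VSob (-σ) (bop v v))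
    (hv : Solenoidal v) (hv1 : VSob 1 v) (hz : Solenoidal z) (hz1 : VSob σ z) :
    vin 0 (leray (g - lop (tcoeff a t) v - bop v v)) z =
      vin 0 g z - aForm a t v z - vin 0 (bop v v) z := by
  have h0 : -σ + σ = 2 * 0 := by ring
  have hl : VSob (-σ) (lop (tcoeff a t) v) := VSob.mono (t := -1)
    (lop_bound (s := -1) hg.bounded (by norm_num; linarith) (hv1.mono (by norm_num))).1
    (by linarith)
  rw [vin_leray h0 ((hgs.sub hl).sub hb) hz1 hz, vin_sub_left h0 (hgs.sub hl) hb hz1,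
    vin_sub_left h0 hgs hl hz1,
    vin_lop_eq_aForm hg (by linarith) hv.real hv1 hz.real (hz1.mono hσ)]

lemma vin_isPrim {a a' b b' c : ℝ} (h : a + a' = 2 * c) (h' : b + b' = 2 * c)
    {y dy z dz : ℝ → VDistr n} (hy : HasPrim T y dy) (hz : HasPrim T z dz) (hya : L2S T a y)
    (hdz : L2S T a' dz) (hdy : L2S T b dy) (hzb : L2S T b' z) (hy0 : VSob c (y 0))
    (hz0 : VSob c (z 0)) : IsPrim T (fun t => vin c (y t) (z t))
      (fun t => vin c (dy t) (z t) + vin c (y t) (dz t)) := by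
  refine ⟨(L2S.vin h' hdy hzb).1.add (L2S.vin h hya hdz).1, fun t ht => ?_⟩
  rw [← integral_Ioo_eq _ ht.1]
  exact vin_evolution ht.1 h h' (hy.mono_time ht.2) (hz.mono_time ht.2) (hya.mono_time ht.2)
    (hdz.mono_time ht.2) (hdy.mono_time ht.2) (hzb.mono_time ht.2) hy0 hz0

lemma intervalIntegral_congr_of_Ioo {F G : ℝ → ℝ}
    (h : ∀ᵐ t ∂(volume.restrict (Ioo 0 T)), F t = G t) {t₀ t : ℝ} (h0 : 0 ≤ t₀) (h1 : t₀ ≤ t)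
    (h2 : t ≤ T) : ∫ τ in t₀..t, F τ = ∫ τ in t₀..t, G τ := by
  rw [intervalIntegral.integral_of_le h1, intervalIntegral.integral_of_le h1,
    integral_Ioc_eq_integral_Ioo, integral_Ioc_eq_integral_Ioo]
  exact integral_congr_ae (ae_mono (Measure.restrict_mono (Ioo_subset_Ioo h0 h2) le_rfl) h)

/-- The dissipation and the power of the forces, for functions in `L₂(0, T; H¹)`. -/
lemma Problem.power (P : Problem T s r C K a f) (hu : L2S T 1 u)
    (hsol : ∀ t ∈ Icc 0 T, Solenoidal (u t)) :
    (∀ᵐ t ∂(volume.restrict (Ioo 0 T)), (pairing (f t) (u t)).re = vin 0 (f t) (u t)) ∧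
    IntegrableOn (fun t => vin 0 (f t) (u t)) (Ioo 0 T) := by
  have hf : L2S T (-1) f := P.memf.mono (by linarith [P.s_nonneg])
  refine ⟨?_, (L2S.vin (by norm_num) hf hu).1⟩
  filter_upwards [hf.mem, hu.mem, P.dotf, ae_restrict_mem measurableSet_Ioo] with t h1 h2 h3 ht
  rw [pairing_eq_vin (by norm_num) h1 (fun i => (h3 i).1) h2 (hsol t ⟨ht.1.le, ht.2.le⟩).real,
    Complex.ofReal_re]

lemma Problem.dissipation (P : Problem T s r C K a f) {v : ℝ → VDistr n} (hu : L2S T 1 u)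
    (hsol : ∀ t ∈ Icc 0 T, Solenoidal (u t)) (hv : L2S T 1 v)
    (hvsol : ∀ t ∈ Icc 0 T, Solenoidal (v t)) :
    IntegrableOn (fun t => aForm a t (u t) (v t)) (Ioo 0 T) := by
  refine ((L2S.vin (a := -1) (b := 1) (c := 0) (by norm_num) (P.mem_lop hu) hv).1).congr ?_
  filter_upwards [P.good, hu.mem, hv.mem, ae_restrict_mem measurableSet_Ioo] with t h1 h2 h3 ht
  exact vin_lop_eq_aForm h1 (by linarith [P.hr]) (hsol t ⟨ht.1.le, ht.2.le⟩).real h2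
    (hvsol t ⟨ht.1.le, ht.2.le⟩).real h3

/-- The equation is tested with u itself: the projector disappears and the convection does no work.
-/
lemma IsRegular.energy_isPrim (P : Problem T s r C K a f) (hu0 : VSob s u0)
    (R : IsRegular T s (tcoeff a) f u0 u du) : IsPrim T (fun t => vNormSq 0 (u t))
      (fun t => 2 * (vin 0 (f t) (u t) - aForm a t (u t) (u t))) := by
  have E := R.isEvolution P hu0
  have hs := P.hs
  have hn := P.hn'
  have hd : L2S T (-1) du := R.memDeriv.mono (by linarith)
  have h := vin_isPrim (a := 1) (a' := -1) (b := -1) (b' := 1) (c := 0) (by norm_num) (by norm_num)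
    E.hasPrim E.hasPrim E.mem hd hd E.mem E.start E.start
  refine h.congr P.hT.le (fun t _ => (vin_self 0 (u t)).symm) ?_
  filter_upwards [R.equation, P.good, P.memf.mem, R.mem.mem,
    ae_restrict_mem measurableSet_Ioo] with t h1 h2 h3 h4 ht
  have hsol := R.solenoidal t ⟨ht.1.le, ht.2.le⟩
  rw [vin_comm 0 (u t) (du t), h1, vin_momentum h2 P.hr le_rfl (h3.mono (by linarith))
    (vSob_bop_neg_one P.hn (h4.mono (by linarith)) (h4.mono (by linarith))) hsol
    (h4.mono (by linarith)) hsol (h4.mono (by linarith)),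
    vin_bop_self P.hn hsol hsol.real (h4.mono (by linarith)) (h4.mono (by linarith))]
  ring

lemma IsRegular.energyEquality (P : Problem T s r C K a f) (hu0 : VSob s u0)
    (R : IsRegular T s (tcoeff a) f u0 u du) {t₀ t : ℝ} (h0 : 0 ≤ t₀) (h1 : t₀ ≤ t) (h2 : t ≤ T) :
    EnergyEquality a f u t₀ t := by
  have E := R.isEvolution P hu0
  have hp := P.power E.mem E.solenoidal
  have hd := P.dissipation E.mem E.solenoidal E.mem E.solenoidal
  have i0 : t₀ ∈ Icc 0 T := ⟨h0, h1.trans h2⟩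
  have i1 : t ∈ Icc 0 T := ⟨h0.trans h1, h2⟩
  have h := (R.energy_isPrim P hu0).sub_eq i0 i1
  rw [intervalIntegral.integral_const_mul, intervalIntegral.integral_sub
    (intervalIntegrable_of_Ioo hp.2 i0 i1) (intervalIntegrable_of_Ioo hd i0 i1)] at h
  rw [EnergyEquality, intervalIntegral_congr_of_Ioo hp.1 h0 h1 h2]
  linarith

/-! ### Regular solutions are weak solutions -/

lemma IsRegular.trace (hu0 : VSob s u0)
    (R : IsRegular T s (tcoeff a) f u0 u du) {t : ℝ} (ht : t ∈ Icc 0 T) :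
    VSob s (u t) ∧ vNormSq s (u t) ≤ vNormSq s u0 + en T (s + 1) u + en T (s - 1) du := by
  have := trace_bound R.hasPrim R.mem R.memDeriv (by rw [R.initial]; exact hu0) ht
  rwa [R.initial] at this

lemma IsRegular.mem_LinftyV (hu0 : VSob s u0)
    (R : IsRegular T s (tcoeff a) f u0 u du) {σ : ℝ} (hσ : σ ≤ s) :
    u ∈ LinftyV T σ (VHsDotSigma n σ) := by
  refine ⟨R.mem.meas, ?_, vNormSq s u0 + en T (s + 1) u + en T (s - 1) du, ?_⟩
  · filter_upwards [ae_restrict_mem measurableSet_Ioo] with t ht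
    have ht' : t ∈ Icc 0 T := ⟨ht.1.le, ht.2.le⟩
    exact mem_VHsDotSigma_iff.mpr ⟨R.solenoidal t ht', (R.trace hu0 ht').1.mono hσ⟩
  · filter_upwards [ae_restrict_mem measurableSet_Ioo] with t ht
    have h := R.trace hu0 (t := t) ⟨ht.1.le, ht.2.le⟩
    exact (h.1.vNormSq_mono hσ).trans h.2

lemma IsRegular.mem_L2V (R : IsRegular T s (tcoeff a) f u0 u du) {σ : ℝ} (hσ : σ ≤ s + 1) :
    u ∈ L2V T σ (VHsDotSigma n σ) := by
  rw [mem_L2V_iff fun v hv => (mem_VHsDotSigma_iff.mp hv).2]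
  have h := R.mem.mono hσ
  refine ⟨h, ?_⟩
  filter_upwards [h.mem, ae_restrict_mem measurableSet_Ioo] with t h1 ht
  exact mem_VHsDotSigma_iff.mpr ⟨R.solenoidal t ⟨ht.1.le, ht.2.le⟩, h1⟩

lemma IsRegular.mem_C0V (hu0 : VSob s u0)
    (R : IsRegular T s (tcoeff a) f u0 u du) : u ∈ C0V T s (VHsDotSigma n s) :=
  ⟨fun t ht => mem_VHsDotSigma_iff.mpr ⟨R.solenoidal t ht, (R.trace hu0 ht).1⟩,
    fun t₀ ht₀ => trace_continuous R.hasPrim R.mem R.memDeriv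
      (by rw [R.initial]; exact hu0) ht₀⟩

lemma IsRegular.tendsto_zero (P : Problem T s r C K a f) (hu0 : VSob s u0)
    (R : IsRegular T s (tcoeff a) f u0 u du) :
    Tendsto (fun t => vNormSq s (u t - u0)) (𝓝[>] 0) (𝓝 0) := by
  have h := (R.mem_C0V hu0).2 0 ⟨le_rfl, P.hT.le⟩
  rw [R.initial] at h
  exact h.mono_left (nhdsWithin_le_of_mem (Icc_mem_nhdsGT P.hT))

lemma IsRegular.weak_continuous (P : Problem T s r C K a f) (hu0 : VSob s u0)
    (R : IsRegular T s (tcoeff a) f u0 u du) {w : VDistr n} (hw : w ∈ VHs n 0) :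
    ContinuousOn (fun t => pairing (u t) w) (Icc 0 T) := by
  intro t₀ ht₀
  have hs := P.s_nonneg
  have hws : VSob 0 w := fun i => (mem_Hs_iff.mp (hw i)).2
  have hwr : ∀ i, IsReal (w i) := fun i => (mem_Hs_iff.mp (hw i)).1
  have h := (R.mem_C0V hu0).2 t₀ ht₀
  rw [ContinuousWithinAt, tendsto_iff_norm_sub_tendsto_zero]
  have hb : Tendsto (fun t => √(vNormSq s (u t - u t₀)) * √(vNormSq 0 w)) (𝓝[Icc 0 T] t₀)
      (𝓝 0) := by
    have := (Real.continuous_sqrt.tendsto 0).comp h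
    rw [Real.sqrt_zero] at this
    simpa using this.mul_const (√(vNormSq 0 w))
  refine squeeze_zero' (.of_forall fun t => norm_nonneg _) ?_ hb
  filter_upwards [self_mem_nhdsWithin] with t ht
  have h1 : ∀ {t}, t ∈ Icc 0 T → VSob 0 (u t) := fun ht => (R.trace hu0 ht).1.mono hs
  have h2 : (0 : ℝ) + 0 = 2 * 0 := by norm_num
  rw [pairing_eq_vin (add_zero 0) (h1 ht) (R.solenoidal t ht).real hws hwr,
    pairing_eq_vin (add_zero 0) (h1 ht₀) (R.solenoidal t₀ ht₀).real hws hwr,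
    ← Complex.ofReal_sub, ← vin_sub_left h2 (h1 ht) (h1 ht₀) hws, Complex.norm_real,
    Real.norm_eq_abs]
  refine (abs_vin_le h2 ((h1 ht).sub (h1 ht₀)) hws).trans ?_
  refine mul_le_mul_of_nonneg_right (Real.sqrt_le_sqrt ?_) (Real.sqrt_nonneg _)
  exact ((R.trace hu0 ht).1.sub (R.trace hu0 ht₀).1).vNormSq_mono hs

lemma IsRegular.isWeakSolution (P : Problem T s r C K a f) (hu0 : VSob s u0)
    (R : IsRegular T s (tcoeff a) f u0 u du) : IsWeakSolution a f u0 T u where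
  mem_Linfty := R.mem_LinftyV hu0 P.s_nonneg
  mem_L2 := R.mem_L2V (by linarith [P.s_nonneg])
  mem t ht := mem_VHsDotSigma_iff.mpr ⟨R.solenoidal t ht, (R.trace hu0 ht).1.mono P.s_nonneg⟩
  weak_continuous w hw := R.weak_continuous P hu0 hw
  initial w _ := by rw [R.initial]
  equation := by
    refine ⟨du, R.hasPrim.isTimeDeriv, ?_⟩
    have hs := P.s_nonneg
    filter_upwards [R.equation, P.good, P.memf.mem, P.dotf, R.mem.mem,
      ae_restrict_mem measurableSet_Ioo] with t h1 h2 h3 h4 h5 ht w hw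
    obtain ⟨hw1, hw2⟩ := mem_VHsDotSigma_iff.mp hw
    have hsol := R.solenoidal t ⟨ht.1.le, ht.2.le⟩
    have hu1 : VSob 1 (u t) := h5.mono (by linarith)
    -- The projected convection cancels, and what remains is the projection of f + 𝔏 u, which
    -- divergence-free test fields do not distinguish from f + 𝔏 u.
    have e : du t + leray (advection (u t)) = leray (f t - lop (tcoeff a t) (u t)) := by
      rw [h1, advection_eq_bop hsol hu1, ← leray_add, sub_add_cancel]
    rw [e, hasPairing_leray_iff hw1]
    exact hasPairing_momentum h2 (by linarith [P.hr]) (α := -1) (β := 1) (by norm_num)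
      (h3.mono (by linarith)) (fun i => (h4 i).1) hsol.real hu1 hw2 hw2 hw1.real

end

section

/-! ### The pressure -/

variable {T s r C K : ℝ} {a : Tensor n} {f u du : ℝ → VDistr n} {u0 : VDistr n}

/-- The potential of the gradient part of `G`. -/
noncomputable def potential (G : VDistr n) : PDistr n :=
  fun ξ => (∑ j, (ξ j : ℂ) * G j ξ) / (2 * Real.pi * Complex.I * (freqNorm ξ : ℂ) ^ 2)

lemma potential_zero (G : VDistr n) : potential G 0 = 0 := by simp [potential]

lemma two_pi_I_ne : (2 * Real.pi * Complex.I : ℂ) ≠ 0 := by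
  simp [Real.pi_ne_zero]

/-- The Helmholtz decomposition: the part removed by the projector at ξ is parallel to ξ, hence a
gradient. At ξ = 0 zero mean is needed. -/
lemma leray_add_grad_potential {G : VDistr n} (hG : ∀ i, G i 0 = 0) :
    leray G + grad (potential G) = G := by
  ext i ξ
  by_cases hξ : ξ = 0
  · rw [hξ, Pi.add_apply, Pi.add_apply, leray_zero, grad, pderiv, potential_zero, hG i]
    simp
  · have h := freqNorm_sq_ne_zero hξ
    have h2 := two_pi_I_ne
    simp only [Pi.add_apply, leray, if_neg hξ, grad, pderiv, potential]
    rw [← mul_div_assoc, mul_assoc (2 * Real.pi * Complex.I : ℂ), mul_div_mul_left _ _ h2]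
    ring

lemma isReal_potential {G : VDistr n} (hG : ∀ i, IsReal (G i)) : IsReal (potential G) := by
  intro ξ
  simp only [potential, map_div₀, map_mul, map_sum, map_pow, Complex.conj_ofReal, freqNorm_neg,
    hG _ ξ, Pi.neg_apply, Int.cast_neg, map_intCast, Complex.conj_I, map_ofNat, neg_mul,
    Finset.sum_neg_distrib, mul_neg, div_neg, neg_div]

/-- The gradient part is G minus its projection, which costs a factor 4; replacing 2π|ξ| by ϱ at
nonzero frequencies costs 2. -/
lemma potential_weight (s : ℝ) {G : VDistr n} (hG : ∀ i, G i 0 = 0) (ξ : Fin n → ℤ) :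
    rho ξ ^ (2 * s) * ‖potential G ξ‖ ^ 2 ≤
      8 * (rho ξ ^ (2 * (s - 1)) * ∑ i, ‖G i ξ‖ ^ 2) := by
  have hs : 0 ≤ ∑ i, ‖G i ξ‖ ^ 2 := Finset.sum_nonneg fun i _ => sq_nonneg _
  have hρ := rho_pos ξ
  have hp := Real.rpow_pos_of_pos hρ (2 * (s - 1))
  by_cases hξ : ξ = 0
  · rw [hξ, potential_zero]
    rw [hξ] at hs hp
    simp only [norm_zero, ne_eq, OfNat.ofNat_ne_zero, not_false_eq_true, zero_pow, mul_zero]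
    positivity
  · have h1 : ∑ i, ‖grad (potential G) i ξ‖ ^ 2 =
        (2 * Real.pi * freqNorm ξ) ^ 2 * ‖potential G ξ‖ ^ 2 := by
      have e : ∀ i, ‖grad (potential G) i ξ‖ ^ 2 =
          (2 * Real.pi) ^ 2 * ‖potential G ξ‖ ^ 2 * (ξ i : ℝ) ^ 2 := fun i => by
        rw [grad, pderiv]
        simp only [norm_mul, Complex.norm_real, Complex.norm_I, Complex.norm_intCast, mul_one,
          Complex.norm_ofNat, Real.norm_of_nonneg Real.pi_pos.le, mul_pow, sq_abs]
        ring
      simp only [e]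
      rw [← Finset.mul_sum, ← freqNorm_sq]
      ring
    have h2 : ∑ i, ‖grad (potential G) i ξ‖ ^ 2 ≤ 4 * ∑ i, ‖G i ξ‖ ^ 2 := by
      have e : ∀ i, ‖grad (potential G) i ξ‖ ^ 2 ≤ 2 * ‖G i ξ‖ ^ 2 + 2 * ‖leray G i ξ‖ ^ 2 :=
        fun i => by
          have e1 : grad (potential G) i ξ = G i ξ - leray G i ξ := by
            have := congrFun (congrFun (leray_add_grad_potential hG) i) ξ
            simp only [Pi.add_apply] at this
            linear_combination this
          rw [e1]
          have := norm_sub_le (G i ξ) (leray G i ξ)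
          have := pow_le_pow_left₀ (norm_nonneg _) this 2
          nlinarith [sq_nonneg (‖G i ξ‖ - ‖leray G i ξ‖)]
      refine (Finset.sum_le_sum fun i _ => e i).trans ?_
      rw [Finset.sum_add_distrib, ← Finset.mul_sum, ← Finset.mul_sum]
      linarith [leray_norm_le G ξ]
    have h3 := mul_le_mul_of_nonneg_right (rho_sq_le hξ) (sq_nonneg ‖potential G ξ‖)
    have h4 : rho ξ ^ 2 * ‖potential G ξ‖ ^ 2 ≤ 8 * ∑ i, ‖G i ξ‖ ^ 2 := by
      rw [h1] at h2
      linarith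
    have e : rho ξ ^ (2 * s) = rho ξ ^ (2 * (s - 1)) * rho ξ ^ 2 := by
      rw [← Real.rpow_natCast, ← Real.rpow_add hρ]
      congr 1
      push_cast
      ring
    rw [e]
    have := mul_le_mul_of_nonneg_left h4 hp.le
    linarith

lemma sobMem_potential {s : ℝ} {G : VDistr n} (hG : ∀ i, G i 0 = 0) (h : VSob (s - 1) G) :
    SobMem s (potential G) ∧ normSq s (potential G) ≤ 8 * vNormSq (s - 1) G := by
  have h1 := h.hasSum.mul_left 8
  have h2 : SobMem s (potential G) := Summable.of_nonneg_of_le (fun ξ => weight_nonneg s _ ξ)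
    (potential_weight s hG) h1.summable
  exact ⟨h2, (h2.tsum_le_tsum (potential_weight s hG) h1.summable).trans h1.tsum_eq.le⟩

/-- The pressure of a regular solution. -/
noncomputable def pressure (a : Tensor n) (f u : ℝ → VDistr n) : ℝ → PDistr n :=
  fun t => potential (f t - lop (tcoeff a t) (u t) - bop (u t) (u t))

lemma Problem.force_zero {t : ℝ} (h : ∀ i, IsReal (f t i) ∧ f t i 0 = 0) (i : Fin n) :
    (f t - lop (tcoeff a t) (u t) - bop (u t) (u t)) i 0 = 0 := by
  simp only [Pi.sub_apply, (h i).2, lop_zero, bop_zero, sub_zero]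

lemma IsRegular.pressure_mem (P : Problem T s r C K a f)
    (R : IsRegular T s (tcoeff a) f u0 u du) : pressure a f u ∈ L2Dot n T s := by
  have hl := (L2S.lop P.measA P.bdd P.s_nonneg P.hsr R.mem (by linarith [P.s_nonneg])).1
  have hG : L2S T (s - 1) (fun t => f t - lop (tcoeff a t) (u t) - bop (u t) (u t)) :=
    ((P.memf.sub hl).1.sub R.memBop).1
  have hp : L2P T s (pressure a f u) := by
    refine L2P.of_le (fun ξ => ?_) (hG.int.const_mul 8) ?_
    · simp only [pressure, potential, div_eq_mul_inv]
      exact (Finset.aestronglyMeasurable_fun_sum _ fun j _ =>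
        (hG.meas j ξ).const_mul _).mul_const _
    · filter_upwards [hG.mem, P.dotf] with t h1 h2
      exact sobMem_potential (Problem.force_zero h2) h1
  refine ⟨hp.meas, ?_, hp.int⟩
  filter_upwards [hp.mem, P.dotf, P.bdd, ae_restrict_mem measurableSet_Ioo] with t h1 h2 h3 ht
  have hu := (R.solenoidal t ⟨ht.1.le, ht.2.le⟩).real
  exact ⟨mem_Hs_iff.mpr ⟨isReal_potential fun i => ((h2 i).1.sub (lop_real h3 hu i)).sub
    (bop_real hu hu i), h1⟩, potential_zero _⟩

/-- The projected equation differs from the momentum equation exactly by the gradient part of the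
forces, which the gradient of the pressure supplies. -/
lemma IsRegular.isAssociatedPressure (P : Problem T s r C K a f)
    (R : IsRegular T s (tcoeff a) f u0 u du) :
    IsAssociatedPressure a f T u (pressure a f u) := by
  refine ⟨du, R.hasPrim.isTimeDeriv, ?_⟩
  have hs := P.s_nonneg
  filter_upwards [R.equation, P.good, P.memf.mem, P.dotf, R.mem.mem,
    ae_restrict_mem measurableSet_Ioo] with t h1 h2 h3 h4 h5 ht w hw
  have hsol := R.solenoidal t ⟨ht.1.le, ht.2.le⟩
  have hu1 : VSob 1 (u t) := h5.mono (by linarith)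
  have e : du t + advection (u t) + grad (pressure a f u t) = f t - lop (tcoeff a t) (u t) := by
    rw [h1, advection_eq_bop hsol hu1]
    have := leray_add_grad_potential (Problem.force_zero (a := a) (u := u) h4)
    change leray _ + bop (u t) (u t) + grad (potential _) = _
    rw [add_right_comm, this, sub_add_cancel]
  rw [e]
  have hwS : ∀ s, VSob s w := fun s i => (mem_Hs_iff.mp (hw s i)).2
  exact hasPairing_momentum h2 (by linarith [P.hr]) (α := -1) (β := 1) (by norm_num)
    (h3.mono (by linarith)) (fun i => (h4 i).1) hsol.real hu1 (hwS 1) (hwS 1)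
    fun i => (mem_Hs_iff.mp (hw 0 i)).1

/-- Associated pressures with zero mean are unique. -/
lemma IsAssociatedPressure.unique {p q : ℝ → PDistr n} (hp : IsAssociatedPressure a f T u p)
    (hq : IsAssociatedPressure a f T u q)
    (hp0 : ∀ᵐ t ∂(volume.restrict (Ioo 0 T)), p t 0 = 0)
    (hq0 : ∀ᵐ t ∂(volume.restrict (Ioo 0 T)), q t 0 = 0) :
    ∀ᵐ t ∂(volume.restrict (Ioo 0 T)), q t = p t := by
  obtain ⟨dp, h1, h2⟩ := hp
  obtain ⟨dq, h3, h4⟩ := hq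
  filter_upwards [h2, h4, h1.unique h3, hp0, hq0] with t a1 a2 a3 a4 a5
  ext ξ
  by_cases hξ : ξ = 0
  · rw [hξ, a4, a5]
  obtain ⟨k, hk⟩ := Function.ne_iff.mp hξ
  -- Smooth test fields need not be divergence-free, so single coordinates are available; one with
  -- ξ_k ≠ 0 determines the coefficient of the pressure, as the two time derivatives agree almost
  -- everywhere.
  have h := sum_eq_of_test hξ (Pi.single k 1) (F := dp t + advection (u t) + grad (p t))
    (H := dq t + advection (u t) + grad (q t)) fun c =>
      ⟨_, a1 _ fun s i => mem_Hs_iff.mpr ⟨isReal_testField ξ _ c i, vSob_testField ξ _ c s i⟩,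
        a2 _ fun s i => mem_Hs_iff.mpr ⟨isReal_testField ξ _ c i, vSob_testField ξ _ c s i⟩⟩
  have hs : ∀ F : VDistr n, ∑ i, ((Pi.single k 1 : Fin n → ℝ) i : ℂ) * F i ξ = F k ξ := fun F => by
    rw [Finset.sum_eq_single k]
    · simp
    · intro i _ hi
      simp [Pi.single_eq_of_ne hi]
    · simp
  rw [hs, hs, a3] at h
  simp only [Pi.add_apply, add_right_inj, grad, pderiv] at h
  have hk' : (2 * Real.pi * Complex.I * (ξ k : ℂ) : ℂ) ≠ 0 :=
    mul_ne_zero two_pi_I_ne (by exact_mod_cast hk)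
  exact (mul_left_cancel₀ hk' h).symm

end

section

/-! ### Weak solutions as solutions for the Fourier coefficients -/

variable {T s r C K : ℝ} {a : Tensor n} {f u du v dv : ℝ → VDistr n} {u0 : VDistr n}

lemma integrable_test_mul {φ : ℝ → ℝ} (hφ : Continuous φ) {A : Set ℝ} (hA : IsCompact A)
    (hs : Function.support φ ⊆ A) (hAT : A ⊆ Ioo 0 T) {g : ℝ → ℂ}
    (hg : LocallyIntegrableOn g (Ioo 0 T)) :
    IntegrableOn (fun t => (φ t : ℂ) * g t) (Ioo 0 T) := by
  have h1 : IntegrableOn (fun t => (φ t : ℂ) * g t) A :=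
    (hg.integrableOn_compact_subset hAT hA).continuousOn_mul
      (Complex.continuous_ofReal.comp hφ).continuousOn hA
  refine ((integrableOn_iff_integrable_of_support_subset fun t ht => ?_).mp h1).integrableOn
  by_contra hts
  have : φ t = 0 := by
    by_contra h
    exact hts (hs h)
  exact ht (by simp [this])

/-- `z` is the distributional derivative of `y` on `(0, T)`. -/
def IsWeakDeriv (T : ℝ) (y z : ℝ → ℂ) : Prop :=
  LocallyIntegrableOn y (Ioo 0 T) ∧ LocallyIntegrableOn z (Ioo 0 T) ∧
    ∀ ψ : ℝ → ℝ, ContDiff ℝ ∞ ψ → HasCompactSupport ψ → tsupport ψ ⊆ Ioo 0 T →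
      ∫ t in Ioo 0 T, ((deriv ψ t : ℝ) : ℂ) * y t = -∫ t in Ioo 0 T, (ψ t : ℂ) * z t

lemma IsWeakDeriv.add {y z y' z' : ℝ → ℂ} (h : IsWeakDeriv T y z) (h' : IsWeakDeriv T y' z') :
    IsWeakDeriv T (fun t => y t + y' t) (fun t => z t + z' t) := by
  refine ⟨h.1.add h'.1, h.2.1.add h'.2.1, fun ψ hψ hc hs => ?_⟩
  have hd : Continuous (deriv ψ) := hψ.continuous_deriv (by simp)
  simp only [mul_add]
  rw [integral_add (integrable_test_mul hd hc support_deriv_subset hs h.1)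
    (integrable_test_mul hd hc support_deriv_subset hs h'.1),
    integral_add (integrable_test_mul hψ.continuous hc (subset_tsupport ψ) hs h.2.1)
    (integrable_test_mul hψ.continuous hc (subset_tsupport ψ) hs h'.2.1), h.2.2 ψ hψ hc hs,
    h'.2.2 ψ hψ hc hs, neg_add]

lemma IsWeakDeriv.const_mul {y z : ℝ → ℂ} (h : IsWeakDeriv T y z) (c : ℂ) :
    IsWeakDeriv T (fun t => c * y t) (fun t => c * z t) := by
  refine ⟨h.1.smul c, h.2.1.smul c, fun ψ hψ hc hs => ?_⟩
  simp only [mul_left_comm _ c]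
  rw [integral_const_mul, integral_const_mul, h.2.2 ψ hψ hc hs, mul_neg]

lemma IsWeakDeriv.sum {ι : Type*} (S : Finset ι) {y z : ι → ℝ → ℂ}
    (h : ∀ j ∈ S, IsWeakDeriv T (y j) (z j)) :
    IsWeakDeriv T (fun t => ∑ j ∈ S, y j t) (fun t => ∑ j ∈ S, z j t) := by
  classical
  induction S using Finset.induction_on with
  | empty =>
    simp only [Finset.sum_empty]
    exact ⟨locallyIntegrableOn_const 0, locallyIntegrableOn_const 0, fun ψ _ _ _ => by simp⟩
  | insert j S hj ih =>
    simp only [Finset.sum_insert hj]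
    exact (h j (Finset.mem_insert_self j S)).add
      (ih fun k hk => h k (Finset.mem_insert_of_mem hk))

/-- The weak formulation determines only the projection of the time derivative. Since u is
divergence-free, the projection of a distributional derivative of u is again one. -/
lemma IsTimeDeriv.of_leray {D : ℝ → VDistr n} (h : IsTimeDeriv T u du)
    (hu : ∀ i ξ, IntegrableOn (fun t => u t i ξ) (Ioo 0 T))
    (hsol : ∀ t ∈ Ioo 0 T, leray (u t) = u t)
    (hD : ∀ i ξ, IntegrableOn (fun t => D t i ξ) (Ioo 0 T))
    (hae : ∀ᵐ t ∂(volume.restrict (Ioo 0 T)), leray (du t) = D t) : IsTimeDeriv T u D := by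
  intro i ξ
  refine ⟨(hD i ξ).locallyIntegrableOn, fun ψ hψ hc hs => ?_⟩
  have h0 : ∀ j, IsWeakDeriv T (fun t => u t j ξ) (fun t => du t j ξ) := fun j =>
    ⟨(hu j ξ).locallyIntegrableOn, (h j ξ).1, (h j ξ).2⟩
  have h1 : IsWeakDeriv T (fun t => leray (u t) i ξ) (fun t => leray (du t) i ξ) := by
    by_cases hξ : ξ = 0
    · simp only [leray, if_pos hξ]
      exact ⟨locallyIntegrableOn_const 0, locallyIntegrableOn_const 0, fun ψ _ _ _ => by simp⟩
    · have e : ∀ F : VDistr n, leray F i ξ = F i ξ + (-(ξ i : ℂ) / (freqNorm ξ : ℂ) ^ 2) *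
          ∑ j, (ξ j : ℂ) * F j ξ := fun F => by
        simp only [leray, if_neg hξ]; ring
      simp only [e]
      exact (h0 i).add ((IsWeakDeriv.sum _ fun j _ => (h0 j).const_mul _).const_mul _)
  have e1 : ∫ t in Ioo 0 T, ((deriv ψ t : ℝ) : ℂ) * u t i ξ =
      ∫ t in Ioo 0 T, ((deriv ψ t : ℝ) : ℂ) * leray (u t) i ξ :=
    setIntegral_congr_fun measurableSet_Ioo fun t ht => by simp only [hsol t ht]
  have e2 : ∫ t in Ioo 0 T, (ψ t : ℂ) * D t i ξ = ∫ t in Ioo 0 T, (ψ t : ℂ) * leray (du t) i ξ :=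
    integral_congr_ae (hae.mono fun t ht => by simp only [ht])
  rw [e1, e2]
  exact h1.2.2 ψ hψ hc hs

/-- A coefficient is a combination of the pairings with the real test fields for c = 1 and c = i,
each of which is continuous. -/
lemma continuousOn_coeff_of_weak (hsol : ∀ t ∈ Icc 0 T, Solenoidal (v t))
    (hc : ∀ w ∈ VHs n 0, ContinuousOn (fun t => pairing (v t) w) (Icc 0 T)) (i : Fin n)
    (ξ : Fin n → ℤ) : ContinuousOn (fun t => v t i ξ) (Icc 0 T) := by
  by_cases hξ : ξ = 0
  · exact (continuousOn_const (c := (0 : ℂ))).congr fun t ht => by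
      simp only [hξ]; exact (hsol t ht).mean i
  have hp : ∀ c t, pairing (v t) (testField ξ (Pi.single i 1) c) =
      conj c * v t i ξ + c * v t i (-ξ) := fun c t => by
    have hs : ∀ η, ∑ k, ((Pi.single i 1 : Fin n → ℝ) k : ℂ) * v t k η = v t i η := fun η => by
      rw [Finset.sum_eq_single i]
      · simp
      · intro k _ hk
        simp [Pi.single_eq_of_ne hk]
      · simp
    rw [← hs ξ, ← hs (-ξ)]
    exact (hasPairing_testField hξ _ c (v t)).tsum_eq
  have hm : ∀ c, testField ξ (Pi.single i 1) c ∈ VHs n 0 := fun c k =>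
    mem_Hs_iff.mpr ⟨isReal_testField ξ _ c k, vSob_testField ξ _ c 0 k⟩
  have h := (continuousOn_const (c := (1 / 2 : ℂ))).mul ((hc _ (hm 1)).add
    ((continuousOn_const (c := Complex.I)).mul (hc _ (hm Complex.I))))
  refine h.congr fun t _ => ?_
  simp only [Pi.mul_apply, Pi.add_apply, hp, map_one, Complex.conj_I]
  linear_combination (v t i ξ - v t i (-ξ)) / 2 * Complex.I_sq

/-- Interpolation bounds the fourth power of the H^{1/2} norm by the squares of the L₂ and H¹ norms,
and the former is bounded in time. -/
lemma Problem.l2S_bop (P : Problem T s r C K a f) (hv : L2S T 1 v) {B : ℝ}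
    (hB : ∀ᵐ t ∂(volume.restrict (Ioo 0 T)), vNormSq 0 (v t) ≤ B) :
    L2S T (-((n : ℝ) / 2)) (fun t => bop (v t) (v t)) := by
  obtain ⟨Cb, hCb, hb⟩ := exists_bop_half P.hn
  have h0 : ∀ᵐ t ∂(volume.restrict (Ioo 0 T)), VSob 0 (v t) :=
    hv.mem.mono fun t h => h.mono zero_le_one
  refine (L2S.of_le (timeMeasurable_bop hv.meas hv.meas h0 h0)
    (hv.int.const_mul (Cb * B)) ?_).1
  filter_upwards [hv.mem, hB] with t h1 h2
  have h3 := hb (v t) (v t) (h1.mono (by norm_num)) (h1.mono (by norm_num))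
  refine ⟨h3.1, h3.2.trans ?_⟩
  have h4 := (vNormSq_interp (a := 0) (b := 1) (c := 1 / 2) (by norm_num) zero_le_one h1).2
  have h7 := vNormSq_nonneg 1 (v t)
  rw [mul_assoc, ← sq]
  exact mul_le_mul_of_nonneg_left (h4.trans (mul_le_mul_of_nonneg_right h2 h7)) hCb.le

/-- Weak solutions solve the equations for the Fourier coefficients. -/
lemma IsWeakSolution.exists_isEvolution (P : Problem T s r C K a f)
    (V : IsWeakSolution a f u0 T v) : ∃ dv, IsEvolution T a f v dv := by
  have hsol : ∀ t ∈ Icc 0 T, Solenoidal (v t) := fun t ht => (mem_VHsDotSigma_iff.mp (V.mem t ht)).1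
  have hv1 : L2S T 1 v := ((mem_L2V_iff fun w hw => (mem_VHsDotSigma_iff.mp hw).2).mp V.mem_L2).1
  obtain ⟨B, hB⟩ := V.mem_Linfty.2.2
  have hn := P.hn'
  have hs := P.hs
  have hD : L2S T (-((n : ℝ) / 2))
      (fun t => leray (f t - lop (tcoeff a t) (v t) - bop (v t) (v t))) :=
    (((P.memf.mono (by linarith)).sub ((P.mem_lop hv1).mono (by linarith))).1.sub
      (P.l2S_bop hv1 hB)).1.leray.1
  obtain ⟨dv, h1, h2⟩ := V.equation
  -- Both sides of the weak equation agree on divergence-free trigonometric polynomials, hence have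
  -- the same Leray projection.
  have hae : ∀ᵐ t ∂(volume.restrict (Ioo 0 T)),
      leray (dv t) = leray (f t - lop (tcoeff a t) (v t) - bop (v t) (v t)) := by
    filter_upwards [h2, P.good, P.memf.mem, P.dotf, hv1.mem,
      ae_restrict_mem measurableSet_Ioo] with t a2 a3 a4 a5 a6 ht
    have hvt := hsol t ⟨ht.1.le, ht.2.le⟩
    have e := leray_eq_of_test (F := dv t + leray (advection (v t)))
      (H := f t - lop (tcoeff a t) (v t)) fun w hw hws =>
        ⟨_, a2 w (mem_VHsDotSigma_iff.mpr ⟨hw, hws 1⟩),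
          hasPairing_momentum a3 (by linarith [P.hr]) (α := -1) (β := 1) (by norm_num)
            (a4.mono (by linarith)) (fun i => (a5 i).1) hvt.real a6 (hws 1) (hws 1) hw.real⟩
    rw [advection_eq_bop hvt a6, leray_add,
      leray_of_solenoidal (solenoidal_leray (bop_real hvt.real hvt.real))] at e
    rw [leray_sub _ (bop _ _), ← e, add_sub_cancel_right]
  have ht := h1.of_leray (fun i ξ => (hv1 i).integrable ξ)
    (fun t ht => leray_of_solenoidal (hsol t ⟨ht.1.le, ht.2.le⟩))
    (fun i ξ => (hD i).integrable ξ) hae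
  exact ⟨_, ht.hasPrim P.hT (fun i ξ => (hD i).integrable ξ)
    (continuousOn_coeff_of_weak hsol V.weak_continuous), hv1, hD, hsol,
    (mem_VHsDotSigma_iff.mp (V.mem 0 ⟨le_rfl, P.hT.le⟩)).2, .of_forall fun t => rfl⟩

/-- The difference v(0) - u⁰ is itself an admissible test field. -/
lemma IsWeakSolution.initial_eq (hT : 0 ≤ T) (V : IsWeakSolution a f u0 T v) (h0 : Solenoidal u0)
    (hu0 : VSob 0 u0) : v 0 = u0 := by
  obtain ⟨h1, h2⟩ := mem_VHsDotSigma_iff.mp (V.mem 0 ⟨le_rfl, hT⟩)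
  have hw : Solenoidal (v 0 - u0) := h1.sub h0
  have hw' : VSob 0 (v 0 - u0) := h2.sub hu0
  have h := V.initial _ (mem_VHsDotSigma_iff.mpr ⟨hw, hw'⟩)
  rw [pairing_eq_vin (add_zero 0) h2 h1.real hw' hw.real,
    pairing_eq_vin (add_zero 0) hu0 h0.real hw' hw.real] at h
  have h3 : vin 0 (v 0) (v 0 - u0) = vin 0 u0 (v 0 - u0) := by exact_mod_cast h
  have h4 : vNormSq 0 (v 0 - u0) = 0 := by
    rw [← vin_self, vin_sub_left (by norm_num : (0 : ℝ) + 0 = 2 * 0) h2 hu0 hw', h3, sub_self]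
  exact sub_eq_zero.mp (vNormSq_eq_zero hw' h4)

end

section

/-! ### Weak-strong uniqueness -/

variable {T s r C K : ℝ} {a : Tensor n} {f u du v dv : ℝ → VDistr n} {u0 : VDistr n}

lemma isPrim_pow {y k : ℝ → ℝ} (h : IsPrim T y k) (hT : 0 ≤ T) (m : ℕ) :
    IsPrim T (fun t => y t ^ (m + 1)) (fun t => (m + 1) * (k t * y t ^ m)) := by
  induction m with
  | zero => simpa using h
  | succ m ih =>
    refine (ih.mul_real h).congr hT (fun t _ => pow_succ _ _) (.of_forall fun t => ?_)
    simp only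
    push_cast
    ring

/-- Gronwall's lemma with an integrable kernel. -/
lemma eq_zero_of_le_integral (hT : 0 ≤ T) {k y : ℝ → ℝ} {B : ℝ} (hk : IntegrableOn k (Ioo 0 T))
    (hk0 : ∀ t, 0 ≤ k t) (hy0 : ∀ t, 0 ≤ y t)
    (hB : ∀ᵐ t ∂(volume.restrict (Ioo 0 T)), y t ≤ B)
    (h : ∀ t ∈ Icc 0 T, y t ≤ ∫ τ in Ioo 0 t, k τ * y τ) : ∀ t ∈ Icc 0 T, y t = 0 := by
  set I : ℝ → ℝ := fun t => ∫ τ in (0 : ℝ)..t, k τ with hI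
  have hI0 : I 0 = 0 := intervalIntegral.integral_same
  have hp : IsPrim T I k := ⟨hk, fun t _ => by rw [hI0, zero_add]⟩
  -- As I is a primitive of k, inserting a bound by c I^m into the integral inequality improves it
  -- to c I^{m+1}/(m+1).
  have hmono : ∀ t ∈ Icc 0 T, ∀ (m : ℕ) (c : ℝ),
      (∀ᵐ τ ∂(volume.restrict (Ioo 0 T)), y τ ≤ c * I τ ^ m) →
        y t ≤ c * I t ^ (m + 1) / (m + 1) := by
    intro t ht m c hc
    have h1 := isPrim_pow hp hT m
    have h2 := h1.2 t ht
    beta_reduce at h2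
    rw [hI0, zero_pow (Nat.succ_ne_zero m), zero_add, ← integral_Ioo_eq _ ht.1,
      integral_const_mul] at h2
    have hsub : Ioo (0 : ℝ) t ⊆ Ioo 0 T := Ioo_subset_Ioo_right ht.2
    have hint : IntegrableOn (fun τ => c * (k τ * I τ ^ m)) (Ioo 0 t) := by
      have h3 := (h1.1.mono_set hsub).const_mul (c / (m + 1))
      refine h3.congr (.of_forall fun τ => ?_)
      have : (m + 1 : ℝ) ≠ 0 := by positivity
      simp only
      field_simp
    refine (h t ht).trans ((integral_mono_of_nonneg (.of_forall fun τ =>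
      mul_nonneg (hk0 τ) (hy0 τ)) hint ?_).trans ?_)
    · filter_upwards [ae_mono (Measure.restrict_mono hsub le_rfl) hc] with τ hτ
      have := mul_le_mul_of_nonneg_left hτ (hk0 τ)
      linarith
    · rw [integral_const_mul, h2]
      have : (m + 1 : ℝ) ≠ 0 := by positivity
      apply le_of_eq
      field_simp
  have key : ∀ m : ℕ, ∀ t ∈ Icc 0 T, y t ≤ B / (m + 1).factorial * I t ^ (m + 1) := by
    intro m
    induction m with
    | zero =>
      intro t ht
      have := hmono t ht 0 B (hB.mono fun τ hτ => by simpa using hτ)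
      simpa using this
    | succ m ih =>
      intro t ht
      have := hmono t ht (m + 1) (B / (m + 1).factorial) (by
        filter_upwards [ae_restrict_mem measurableSet_Ioo] with τ hτ
        exact ih τ ⟨hτ.1.le, hτ.2.le⟩)
      refine this.trans (le_of_eq ?_)
      rw [Nat.factorial_succ (m + 1)]
      have h1 : ((m + 1).factorial : ℝ) ≠ 0 := by positivity
      have h2 : ((m + 1 : ℕ) + 1 : ℝ) ≠ 0 := by positivity
      push_cast at h2 ⊢
      field_simp
  intro t ht
  refine le_antisymm ?_ (hy0 t)
  -- Iteration produces B I^m/m!, which tends to zero.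
  have hlim : Tendsto (fun m : ℕ => B * (I t ^ (m + 1) / ((m + 1).factorial : ℝ))) atTop (𝓝 0) := by
    have := ((FloorSemiring.tendsto_pow_div_factorial_atTop (I t)).comp
      (tendsto_add_atTop_nat 1)).const_mul B
    simpa using this
  refine ge_of_tendsto' hlim fun m => (key m t ht).trans (le_of_eq ?_)
  ring

lemma aForm_sub {t : ℝ} (hg : GoodTensor C r K fun k j α β => a k j α β t) (hr : 0 ≤ r)
    {u v : VDistr n} (hu : Solenoidal u) (hv : Solenoidal v) (hu1 : VSob 1 u) (hv1 : VSob 1 v)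
    (hr1 : 1 ≤ r) : aForm a t (v - u) (v - u) =
      aForm a t v v - aForm a t v u - aForm a t u v + aForm a t u u := by
  have h0 : (-1 : ℝ) + 1 = 2 * 0 := by norm_num
  have hl : ∀ {w : VDistr n}, VSob 1 w → VSob (-1) (lop (tcoeff a t) w) := fun hw =>
    (lop_bound (s := -1) hg.bounded (by norm_num; linarith) (hw.mono (by norm_num))).1
  rw [← vin_lop_eq_aForm hg hr (hv.sub hu).real (hv1.sub hu1) (hv.sub hu).real (hv1.sub hu1),
    ← vin_lop_eq_aForm hg hr hv.real hv1 hv.real hv1,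
    ← vin_lop_eq_aForm hg hr hv.real hv1 hu.real hu1,
    ← vin_lop_eq_aForm hg hr hu.real hu1 hv.real hv1,
    ← vin_lop_eq_aForm hg hr hu.real hu1 hu.real hu1,
    lop_sub (A := tcoeff a t) hg.bounded hv1 hu1,
    vin_sub_left h0 (hl hv1) (hl hu1) (hv1.sub hu1), vin_sub_right h0 (hl hv1) hv1 hu1,
    vin_sub_right h0 (hl hu1) hv1 hu1]
  ring

lemma vNormSq_sub_eq {u w : VDistr n} (hu : VSob s u) (hw : VSob s w) :
    vNormSq s (u - w) = vNormSq s u - 2 * vin s u w + vNormSq s w := by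
  have h : s + s = 2 * s := by ring
  rw [← vin_self s (u - w), vin_sub_left h hu hw (hu.sub hw), vin_sub_right h hu hu hw,
    vin_sub_right h hw hu hw, vin_self, vin_self, vin_comm s w u]
  ring

/-- The evolution of the inner product of two solutions. -/
lemma IsRegular.cross_isPrim (P : Problem T s r C K a f) (hu0 : VSob s u0)
    (R : IsRegular T s (tcoeff a) f u0 u du) (V : IsEvolution T a f v dv) :
    IsPrim T (fun t => vin 0 (v t) (u t)) (fun t => vin 0 (f t) (u t) + vin 0 (f t) (v t) -
      aForm a t (v t) (u t) - aForm a t (u t) (v t) -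
      vin 0 (bop (v t - u t) (v t - u t)) (u t)) := by
  have E := R.isEvolution P hu0
  have hs := P.hs
  have hn := P.hn'
  obtain ⟨Cb, -, hb⟩ := exists_bop_half P.hn
  have hd : L2S T (-1) du := R.memDeriv.mono (by linarith)
  have hu : L2S T ((n : ℝ) / 2) u := R.mem.mono (by linarith)
  -- The derivative of v lies only in H^{-n/2} and is paired with u in H^{n/2}; that of u lies in
  -- H^{-1} and is paired with v in H¹.
  have h := vin_isPrim (a := 1) (a' := -1) (b := -((n : ℝ) / 2)) (b' := (n : ℝ) / 2) (c := 0)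
    (by norm_num) (by ring) V.hasPrim E.hasPrim V.mem hd V.memDeriv hu V.start E.start
  refine h.congr P.hT.le (fun t _ => rfl) ?_
  filter_upwards [R.equation, V.equation, P.good, P.memf.mem, hu.mem, V.mem.mem,
    ae_restrict_mem measurableSet_Ioo] with t h1 h2 h3 h4 h5 h6 ht
  have hus := R.solenoidal t ⟨ht.1.le, ht.2.le⟩
  have hvs := V.solenoidal t ⟨ht.1.le, ht.2.le⟩
  have hu1 : VSob 1 (u t) := h5.mono (by linarith)
  rw [vin_comm 0 (v t) (du t), h1, h2, vin_momentum h3 P.hr le_rfl (h4.mono (by linarith))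
    (vSob_bop_neg_one P.hn (h5.mono (by linarith)) (h5.mono (by linarith))) hus hu1 hvs h6,
    vin_momentum h3 P.hr (by linarith) (h4.mono (by linarith))
    (hb _ _ (h6.mono (by norm_num)) (h6.mono (by norm_num))).1 hvs h6 hus h5,
    ← vin_bop_difference P.hn hus hvs h5 h6]
  ring

/-- Let X be the convection term, D the dissipation and Y the right-hand side. Duality,
interpolation and coercivity give X² ≤ 4 D Y ≤ (D + Y)², so the dissipation absorbs X up to Y. -/
lemma neg_dissipation_add_le {t Cb : ℝ} (hg : GoodTensor C r K fun k j α β => a k j α β t)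
    (hr : 0 ≤ r) (hC : 0 < C) (hCb : 0 ≤ Cb) {u w : VDistr n} (hw : Solenoidal w)
    (hw1 : VSob 1 w) (hu : VSob ((n : ℝ) / 2) u)
    (hb : VSob (-((n : ℝ) / 2)) (bop w w) ∧ vNormSq (-((n : ℝ) / 2)) (bop w w) ≤
      Cb * (vNormSq (1 / 2) w * vNormSq (1 / 2) w)) :
    -aForm a t w w + vin 0 (bop w w) u ≤ C * Cb * vNormSq ((n : ℝ) / 2) u * vNormSq 0 w := by
  have h1 := aForm_coercive hg hr hw hw1
  have h2 := abs_vin_le (by ring : -((n : ℝ) / 2) + (n : ℝ) / 2 = 2 * 0) hb.1 hu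
  have h3 := (vNormSq_interp (a := 0) (b := 1) (c := 1 / 2) (by norm_num) zero_le_one hw1).2
  have hN0 := vNormSq_nonneg 0 w
  have hN1 := vNormSq_nonneg 1 w
  have hU := vNormSq_nonneg ((n : ℝ) / 2) u
  have h4 : vin 0 (bop w w) u ^ 2 ≤
      Cb * (vNormSq 0 w * vNormSq 1 w) * vNormSq ((n : ℝ) / 2) u := by
    rw [← sq_abs]
    refine (pow_le_pow_left₀ (abs_nonneg _) h2 2).trans ?_
    rw [mul_pow, Real.sq_sqrt (vNormSq_nonneg _ _), Real.sq_sqrt hU]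
    refine mul_le_mul_of_nonneg_right (hb.2.trans (mul_le_mul_of_nonneg_left ?_ hCb)) hU
    rwa [← sq]
  set X := vin 0 (bop w w) u
  set Y := C * Cb * vNormSq ((n : ℝ) / 2) u * vNormSq 0 w with hY
  have hY0 : 0 ≤ Y := by positivity
  have h5 : X ^ 2 ≤ 4 * (aForm a t w w) * Y := by
    have : Cb * (vNormSq 0 w * vNormSq 1 w) * vNormSq ((n : ℝ) / 2) u ≤
        Cb * (vNormSq 0 w * (4 * C * aForm a t w w)) * vNormSq ((n : ℝ) / 2) u := by
      gcongr
    refine (h4.trans this).trans (le_of_eq ?_)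
    rw [hY]; ring
  have ha : 0 ≤ aForm a t w w := by
    by_contra h
    have : 4 * C * aForm a t w w < 0 := by
      have : 0 < 4 * C := by positivity
      nlinarith
    linarith
  have h6 : X ^ 2 ≤ (aForm a t w w + Y) ^ 2 := by nlinarith [sq_nonneg (aForm a t w w - Y)]
  have h7 := abs_le_of_sq_le_sq h6 (by positivity)
  linarith [le_abs_self X]

/-- Solutions that satisfy the energy inequality coincide with the regular solution. -/
theorem IsRegular.unique (P : Problem T s r C K a f) (hu0 : VSob s u0)
    (R : IsRegular T s (tcoeff a) f u0 u du) (V : IsEvolution T a f v dv) (hv0 : v 0 = u0) {B : ℝ}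
    (hB : ∀ᵐ t ∂(volume.restrict (Ioo 0 T)), vNormSq 0 (v t) ≤ B)
    (hv : ∀ t ∈ Icc 0 T, VSob 0 (v t))
    (hE : ∀ t, 0 ≤ t → t ≤ T → StandardEnergyInequality a f u0 v t) :
    ∀ t ∈ Icc 0 T, v t = u t := by
  have E := R.isEvolution P hu0
  have hs := P.hs
  have hn := P.hn'
  obtain ⟨Cb, hCb, hb⟩ := exists_bop_half P.hn
  have hu : L2S T ((n : ℝ) / 2) u := R.mem.mono (by linarith)
  have hut : ∀ t ∈ Icc 0 T, VSob 0 (u t) := fun t ht => (R.trace hu0 ht).1.mono P.s_nonneg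
  have hw1 : L2S T 1 (v - u) := (V.mem.sub E.mem).1
  have hw0 : L2S T 0 (v - u) := hw1.mono zero_le_one
  -- The Gronwall kernel; it is integrable exactly because u is square integrable with values in
  -- H^{n/2}. The factor 2 compensates the 1/2 in the energies.
  set k : ℝ → ℝ := fun t => 2 * C * Cb * vNormSq ((n : ℝ) / 2) (u t) with hk
  have hk0 : ∀ t, 0 ≤ k t := fun t =>
    mul_nonneg (by have := P.hC; positivity) (vNormSq_nonneg _ _)
  have hki : IntegrableOn k (Ioo 0 T) := hu.int.const_mul _
  obtain ⟨B', hB'⟩ : ∃ B', ∀ᵐ t ∂(volume.restrict (Ioo 0 T)), vNormSq 0 (v t - u t) ≤ B' := by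
    obtain ⟨Bu, hBu⟩ := (R.mem_LinftyV hu0 P.s_nonneg).2.2
    refine ⟨2 * (B + Bu), ?_⟩
    filter_upwards [hB, hBu, ae_restrict_mem measurableSet_Ioo] with t h1 h2 ht
    have ht' : t ∈ Icc 0 T := ⟨ht.1.le, ht.2.le⟩
    exact (vNormSq_sub_le (hv t ht') (hut t ht')).trans (by linarith)
  have hky : IntegrableOn (fun t => k t * vNormSq 0 (v t - u t)) (Ioo 0 T) := by
    refine Integrable.mono' (hki.mul_const B')
      (hki.aestronglyMeasurable.mul hw0.int.aestronglyMeasurable) ?_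
    filter_upwards [hB'] with t ht
    rw [Real.norm_of_nonneg (mul_nonneg (hk0 t) (vNormSq_nonneg _ _))]
    exact mul_le_mul_of_nonneg_left ht (hk0 t)
  have pv := P.power V.mem V.solenoidal
  have pu := P.power E.mem E.solenoidal
  have dvv := P.dissipation V.mem V.solenoidal V.mem V.solenoidal
  have duu := P.dissipation E.mem E.solenoidal E.mem E.solenoidal
  have hc := R.cross_isPrim P hu0 V
  -- Half the square of v - u is expanded: the inequality for v plus the equality for u minus the
  -- evolution of their scalar product. The initial terms cancel since both start at u⁰.
  have hmain := eq_zero_of_le_integral (y := fun t => vNormSq 0 (v t - u t)) P.hT.le hki hk0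
    (fun t => vNormSq_nonneg _ _) hB' fun t ht => by
      have i0 : (0 : ℝ) ∈ Icc 0 T := ⟨le_rfl, P.hT.le⟩
      have e1 := hE t ht.1 ht.2
      rw [StandardEnergyInequality, intervalIntegral_congr_of_Ioo pv.1 le_rfl ht.1 ht.2,
        ← integral_Ioo_eq _ ht.1, ← integral_Ioo_eq _ ht.1] at e1
      have e2 := R.energyEquality P hu0 le_rfl ht.1 ht.2
      rw [EnergyEquality, intervalIntegral_congr_of_Ioo pu.1 le_rfl ht.1 ht.2,
        ← integral_Ioo_eq _ ht.1, ← integral_Ioo_eq _ ht.1, R.initial] at e2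
      have e3 := hc.2 t ht
      beta_reduce at e3
      rw [hv0, R.initial, vin_self, ← integral_Ioo_eq _ ht.1] at e3
      rw [vNormSq_sub_eq (hv t ht) (hut t ht)]
      have hsub : Ioo (0 : ℝ) t ⊆ Ioo 0 T := Ioo_subset_Ioo_right ht.2
      have i1 := pv.2.mono_set hsub
      have i2 := pu.2.mono_set hsub
      have i3 := dvv.mono_set hsub
      have i4 := duu.mono_set hsub
      have i5 := hc.1.mono_set hsub
      have j1 : IntegrableOn (fun τ => vin 0 (f τ) (v τ) - aForm a τ (v τ) (v τ)) (Ioo 0 t) :=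
        i1.sub i3
      have j2 : IntegrableOn (fun τ => vin 0 (f τ) (u τ) - aForm a τ (u τ) (u τ)) (Ioo 0 t) :=
        i2.sub i4
      have j3 : IntegrableOn (fun τ => (vin 0 (f τ) (v τ) - aForm a τ (v τ) (v τ)) +
        (vin 0 (f τ) (u τ) - aForm a τ (u τ) (u τ))) (Ioo 0 t) := j1.add j2
      have h1 := integral_mono_ae (j3.sub i5) ((hky.mono_set hsub).const_mul (1 / 2)) (by
        refine ae_mono (Measure.restrict_mono hsub le_rfl) ?_
        filter_upwards [P.good, hu.mem, V.mem.mem, ae_restrict_mem measurableSet_Ioo]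
          with τ a1 a2 a3 hτ
        have hτ' : τ ∈ Icc 0 T := ⟨hτ.1.le, hτ.2.le⟩
        have b1 := R.solenoidal τ hτ'
        have b2 := V.solenoidal τ hτ'
        have a4 : VSob 1 (u τ) := a2.mono (by linarith)
        have hr0 : 0 ≤ r := by linarith [P.hr]
        have hw : VSob (1 / 2) (v τ - u τ) := (a3.sub a4).mono (by norm_num)
        have h := neg_dissipation_add_le a1 hr0 P.hC hCb.le (b2.sub b1) (a3.sub a4) a2
          (hb _ _ hw hw)
        rw [aForm_sub a1 hr0 b1 b2 a4 a3 P.hr] at h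
        simp only [Pi.sub_apply, hk]
        linarith)
      simp only [Pi.sub_apply] at h1
      rw [integral_sub j3 i5, integral_add j1 j2, integral_sub i1 i3, integral_sub i2 i4,
        integral_const_mul] at h1
      linarith
  intro t ht
  exact sub_eq_zero.mp (vNormSq_eq_zero ((hv t ht).sub (hut t ht)) (hmain t ht))

end

section

/-! ### The main theorem -/

lemma L2S_and_real_of_mem_L2V {T Tstar s : ℝ} (hT : Tstar ≤ T) {f : ℝ → VDistr n}
    (hf : f ∈ L2V T s (VHsDot n s)) : L2S Tstar s f ∧
      ∀ᵐ t ∂(volume.restrict (Ioo 0 Tstar)), ∀ i, IsReal (f t i) ∧ f t i 0 = 0 := by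
  have h := (mem_L2V_iff fun w hw i => (mem_Hs_iff.mp (hw i).1).2).mp hf
  refine ⟨h.1.mono_time hT, ?_⟩
  filter_upwards [ae_mono (Measure.restrict_mono (Ioo_subset_Ioo_right hT) le_rfl) h.2]
    with t ht i using ⟨(mem_Hs_iff.mp (ht i).1).1, (ht i).2⟩

lemma IsRegular.deriv_mem_L2V {T s r C K : ℝ} {a : Tensor n} {f u du : ℝ → VDistr n}
    {u0 : VDistr n} (P : Problem T s r C K a f) (R : IsRegular T s (tcoeff a) f u0 u du) :
    du ∈ L2V T (s - 1) (VHsDotSigma n (s - 1)) := by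
  rw [mem_L2V_iff fun v hv => (mem_VHsDotSigma_iff.mp hv).2]
  refine ⟨R.memDeriv, ?_⟩
  filter_upwards [R.memDeriv.mem, R.equation, P.dotf, P.bdd, ae_restrict_mem measurableSet_Ioo]
    with t h1 h2 h3 h4 ht
  have hu := (R.solenoidal t ⟨ht.1.le, ht.2.le⟩).real
  refine mem_VHsDotSigma_iff.mpr ⟨?_, h1⟩
  rw [h2]
  exact solenoidal_leray fun i => ((h3 i).1.sub (lop_real h4 hu i)).sub (bop_real hu hu i)

/-- Small data lead to regular solutions. -/
theorem exists_isRegular (n : ℕ) (hn : 2 ≤ n) {T σ CA s : ℝ}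
    (hσ : (n : ℝ) / 2 + |(n : ℝ) / 2 - 2| < σ) (hCA : 0 < CA) (M : ℝ)
    (hs : s = (n : ℝ) / 2 - 1) :
    ∃ r K A₃ : ℝ, 0 < A₃ ∧ ∀ a : Tensor n, TensorMemLinfty T (σ + 1) M a →
      RelaxedElliptic T CA a → ∀ f ∈ L2V T (s - 1) (VHsDot n (s - 1)), ∀ u0 : VDistr n,
      Solenoidal u0 → VSob s u0 → ∀ Tstar : ℝ, 0 < Tstar → Tstar ≤ T →
        Problem Tstar s r CA K a f ∧
        (en Tstar (s - 1) f + (vNormSq s u0 + 1) * en Tstar (s + 1) (heat u0) < A₃ →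
          ∃ u du, IsRegular Tstar s (tcoeff a) f u0 u du) := by
  have hn' : (2 : ℝ) ≤ n := by exact_mod_cast hn
  have hs0 : 0 ≤ s := by linarith
  have e : (n : ℝ) / 2 - 2 = s - 1 := by linarith
  rw [e] at hσ
  have hr : 1 ≤ 1 + |s - 1| := by linarith [abs_nonneg (s - 1)]
  have hsr : s ≤ 1 + |s - 1| := by linarith [le_abs_self (s - 1)]
  -- The commutator needs the coefficients in ℓ¹ with the weight of order 1 + |s-1|, and |s-1| =
  -- |n/2 - 2|; the assumption on σ is the embedding condition for this order.
  obtain ⟨B₀, -, hgood⟩ := exists_goodTensor (n := n) (by omega) (r := 1 + |s - 1|) (σ := σ + 1)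
    (by linarith) (by linarith)
  obtain ⟨c, m, B, E, hc, hm, hB, hE, hlin⟩ :=
    exists_linear_coercive n (r := 1 + |s - 1|) (K := B₀ * M) hCA hs0 le_rfl
  obtain ⟨Cb, hCb, hbop⟩ := exists_bop_L4 hn
  obtain ⟨A₃, hA₃, hsol⟩ := exists_small_solution n (T₀ := T) (B₀ * M) hc hm hB hE hCb
  refine ⟨1 + |s - 1|, B₀ * M, A₃, hA₃, fun a ha hell f hf u0 h0 hu0 Tstar hT0 hT => ?_⟩
  obtain ⟨hf1, hf2⟩ := L2S_and_real_of_mem_L2V hT hf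
  have hle : (volume : Measure ℝ).restrict (Ioo 0 Tstar) ≤ volume.restrict (Ioo 0 T) :=
    Measure.restrict_mono (Ioo_subset_Ioo_right hT) le_rfl
  have P : Problem Tstar s (1 + |s - 1|) CA (B₀ * M) a f :=
    ⟨hn, hT0, hs, hsr, hr, hCA, fun k j α β ξ => (measurable_tcoeff ha k j α β ξ).mono_measure hle,
      ae_mono hle (hgood T M CA a ha hell), hf1, hf2⟩
  refine ⟨P, fun hsmall => ?_⟩
  rw [e] at hbop
  have S : Setting Tstar s (((n : ℝ) - 1) / 2) (1 + |s - 1|) (B₀ * M) Cb (tcoeff a) f u0 :=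
    ⟨hT0.le, hs0, hsr, by linarith, hCb, P.measA, P.bdd, hf1,
      hf2.mono fun t ht i => (ht i).1, h0, hu0, hbop Tstar⟩
  obtain ⟨G, hG, hres⟩ := hsol Tstar s _ _ (tcoeff a) f u0 hT S
    (P.good.mono fun t ht => hlin a t ht) hsmall
  exact ⟨_, _, S.isRegular hm hG hres⟩

end

end PeriodicNS

theorem mainTheorem1 (n : ℕ) (hn : 2 ≤ n) (T : ℝ) (hT : 0 < T)
    (σ : ℝ) (hσ : (n : ℝ) / 2 + |(n : ℝ) / 2 - 2| < σ)
    (CA : ℝ) (hCA : 0 < CA) (M : ℝ) :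
    ∃ A₁ A₂ A₃ : ℝ, 0 ≤ A₁ ∧ 0 ≤ A₂ ∧ 0 < A₃ ∧
      ∀ a : PeriodicNS.Tensor n,
      PeriodicNS.TensorMemLinfty T (σ + 1) M a →
      PeriodicNS.TensorSymmetric T a →
      PeriodicNS.RelaxedElliptic T CA a →
      ∀ f ∈ PeriodicNS.L2V T ((n : ℝ) / 2 - 2) (PeriodicNS.VHsDot n ((n : ℝ) / 2 - 2)),
      ∀ u0 ∈ PeriodicNS.VHsDotSigma n ((n : ℝ) / 2 - 1),
      ∀ Tstar : ℝ, 0 < Tstar → Tstar ≤ T →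
      (∫ t in (0 : ℝ)..Tstar, PeriodicNS.vNormSq ((n : ℝ) / 2 - 2) (f t)) +
          (A₁ * PeriodicNS.vNormSq ((n : ℝ) / 2 - 1) u0 + A₂) *
            (∫ t in (0 : ℝ)..Tstar,
              PeriodicNS.vNormSq ((n : ℝ) / 2) (PeriodicNS.heat u0 t)) < A₃ →
      ∃ u : ℝ → PeriodicNS.VDistr n,
        -- (i) existence of a Serrin-type solution
        PeriodicNS.IsSerrinTypeSolution a f u0 Tstar u ∧
        u ∈ PeriodicNS.LinftyV Tstar ((n : ℝ) / 2 - 1)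
          (PeriodicNS.VHsDotSigma n ((n : ℝ) / 2 - 1)) ∧
        u ∈ PeriodicNS.L2V Tstar ((n : ℝ) / 2) (PeriodicNS.VHsDotSigma n ((n : ℝ) / 2)) ∧
        -- (ii) regularity of the time derivative, continuity, initial value, pressure
        (∃ du ∈ PeriodicNS.L2V Tstar ((n : ℝ) / 2 - 2)
            (PeriodicNS.VHsDotSigma n ((n : ℝ) / 2 - 2)),
          PeriodicNS.IsTimeDeriv Tstar u du) ∧
        u ∈ PeriodicNS.C0V Tstar ((n : ℝ) / 2 - 1)
          (PeriodicNS.VHsDotSigma n ((n : ℝ) / 2 - 1)) ∧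
        Filter.Tendsto (fun t => PeriodicNS.vNormSq ((n : ℝ) / 2 - 1) (u t - u0))
          (nhdsWithin 0 (Set.Ioi 0)) (nhds 0) ∧
        (∃ p ∈ PeriodicNS.L2Dot n Tstar ((n : ℝ) / 2 - 1),
          PeriodicNS.IsAssociatedPressure a f Tstar u p ∧
          ∀ q : ℝ → PeriodicNS.PDistr n,
            PeriodicNS.IsAssociatedPressure a f Tstar u q →
            (∀ᵐ t ∂(MeasureTheory.volume.restrict (Set.Ioo 0 Tstar)), q t 0 = 0) →
            ∀ᵐ t ∂(MeasureTheory.volume.restrict (Set.Ioo 0 Tstar)), q t = p t) ∧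
        -- (iii) energy equality
        (∀ t₀ t : ℝ, 0 ≤ t₀ → t₀ ≤ t → t ≤ Tstar → PeriodicNS.EnergyEquality a f u t₀ t) ∧
        (∀ t : ℝ, 0 ≤ t → t ≤ Tstar → PeriodicNS.StandardEnergyEquality a f u0 u t) ∧
        -- (iv) uniqueness among the weak solutions satisfying the energy inequality
        (∀ v : ℝ → PeriodicNS.VDistr n,
          PeriodicNS.IsWeakSolution a f u0 Tstar v →
          (∀ t : ℝ, 0 ≤ t → t ≤ Tstar → PeriodicNS.StandardEnergyInequality a f u0 v t) →
          ∀ t : ℝ, 0 ≤ t → t ≤ Tstar → v t = u t) := by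
  obtain ⟨s, hs⟩ : ∃ s : ℝ, s = (n : ℝ) / 2 - 1 := ⟨_, rfl⟩
  have e1 : (n : ℝ) / 2 - 2 = s - 1 := by linarith
  have e2 : (n : ℝ) / 2 - 1 = s := hs.symm
  have e3 : (n : ℝ) / 2 = s + 1 := by linarith
  obtain ⟨r, K, A₃, hA₃, hsol⟩ := PeriodicNS.exists_isRegular n hn (T := T) hσ hCA M hs
  -- All data terms share one constant in `Setting.en_residual_zero_le`, and it is absorbed by A₃.
  refine ⟨1, 1, A₃, zero_le_one, zero_le_one, hA₃, ?_⟩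
  intro a ha _ hell f hf u0 hu0 Tstar hT0 hTT hsmall
  rw [e1] at hf
  rw [e2] at hu0
  obtain ⟨h0, hu0s⟩ := PeriodicNS.mem_VHsDotSigma_iff.mp hu0
  obtain ⟨P, hex⟩ := hsol a ha hell f hf u0 h0 hu0s Tstar hT0 hTT
  rw [e1, e2, e3, ← PeriodicNS.integral_Ioo_eq _ hT0.le, ← PeriodicNS.integral_Ioo_eq _ hT0.le,
    one_mul] at hsmall
  obtain ⟨u, du, R⟩ := hex hsmall
  have hW := R.isWeakSolution P hu0s
  have hL2 := R.mem_L2V (σ := s + 1) le_rfl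
  have hdu : du ∈ PeriodicNS.L2V Tstar (s - 1) (PeriodicNS.VHsDotSigma n (s - 1)) :=
    R.deriv_mem_L2V P
  have hp := R.pressure_mem P
  have hpa := R.isAssociatedPressure P
  refine ⟨u, ⟨hW, ?_⟩, ?_, ?_, ⟨du, ?_, R.hasPrim.isTimeDeriv⟩, ?_, ?_,
    ⟨PeriodicNS.pressure a f u, ?_, hpa, fun q hq hq0 => hpa.unique hq ?_ hq0⟩,
    fun t₀ t h1 h2 h3 => R.energyEquality P hu0s h1 h2 h3, fun t h1 h2 => ?_, ?_⟩
  · rwa [e3]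
  · rw [e2]
    exact R.mem_LinftyV hu0s le_rfl
  · rwa [e3]
  · rwa [e1]
  · rw [e2]
    exact R.mem_C0V hu0s
  · rw [e2]
    exact R.tendsto_zero P hu0s
  · rwa [e2]
  · exact hp.2.1.mono fun t ht => ht.2
  · have h := R.energyEquality P hu0s le_rfl h1 h2
    rwa [PeriodicNS.EnergyEquality, R.initial] at h
  · intro v V hE t ht0 htT
    obtain ⟨dv, hV⟩ := V.exists_isEvolution P
    obtain ⟨B, hB⟩ := V.mem_Linfty.2.2
    exact R.unique P hu0s hV (V.initial_eq hT0.le h0 (hu0s.mono P.s_nonneg)) hB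
      (fun t ht => (PeriodicNS.mem_VHsDotSigma_iff.mp (V.mem t ht)).2) hE t ⟨ht0, htT⟩
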